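/- Notation. Let $N\ge 0$, $k\in\mathbb Z$, and let $L$ be a symmetric real $N\times N$ matrix with $L_{ii}\in\mathbb Z$, $L_{ij}\in\frac12\mathbb Z$; put $L[x]=x^{T}Lx$ and $\mathcal L=2\pi i L$. Write $\tau=x+iy$ with $y>0$, $z=u+iv\in\mathbb C^N$. Let $\pi_{\rm nd}$ be the Euclidean orthogonal projection onto $(\ker L)^{\perp}$, and let $L_{\rm nd}^{-1}$ be the matrix with $L_{\rm nd}^{-1}\pi_{\rm nd}=L_{\rm nd}^{-1}$ and $L L_{\rm nd}^{-1}=L_{\rm nd}^{-1}L=\pi_{\rm nd}$; put $\mathcal L^{-1}_{\rm nd}=(2\pi i)^{-1}L_{\rm nd}^{-1}$. The slash action of $(\gamma,\lambda,\mu)\in \mathrm{SL}_2(\mathbb Z)\ltimes(\mathbb Z^N\times\mathbb Z^N)$ with $\gamma=\left(\begin{smallmatrix}a&b\\c&d\end{smallmatrix}\right)$ is $$(\phi|_{k,L}(\gamma,\lambda,\mu))(\tau,z)=(c\tau+d)^{-k}\exp\Big(2\pi i\Big(\tfrac{-cL[z+\lambda\tau+\mu]}{c\tau+d}+2\lambda^{T}Lz+L[\lambda]\tau\Big)\Big)\,\phi\Big(\tfrac{a\tau+b}{c\tau+d},\tfrac{z+\lambda\tau+\mu}{c\tau+d}\Big).$$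 With $\Delta_\kappa=4y^2\partial_\tau\partial_{\bar\tau}-2\kappa iy\,\partial_{\bar\tau}$, the Casimir operator is (all coefficients standing to the left of the derivatives) $$\begin{aligned}\mathcal C_{k,L}={}&-2\Delta_{k-N/2}+2y^2\big(\partial_{\bar\tau}\mathcal L_{\rm nd}^{-1}[\partial_z]+\partial_\tau\mathcal L_{\rm nd}^{-1}[\partial_{\bar z}]\big)-8y\,\partial_\tau(\pi_{\rm nd}v)^{T}\partial_{\bar z}\\&-\tfrac12y^2\big(\mathcal L_{\rm nd}^{-1}[\partial_{\bar z}]\mathcal L_{\rm nd}^{-1}[\partial_z]-(\partial_{\bar z}^{T}\mathcal L_{\rm nd}^{-1}\partial_z)^2\big)+2y\big((\pi_{\rm nd}v)^{T}\partial_{\bar z}\big)\partial_z^{T}\mathcal L_{\rm nd}^{-1}\partial_u\\&-\tfrac12(2k-N+1)iy\,\partial_{\bar z}^{T}\mathcal L_{\rm nd}^{-1}\partial_u+2(\pi_{\rm nd}v)^{T}\big((\pi_{\rm nd}v)^{T}\partial_{\bar z}\big)\partial_{\bar z}+(2k-N-1)i(\pi_{\rm nd}v)^{T}\partial_{\bar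 z}.\end{aligned}$$ For $e\in\mathbb R^N$ let $\partial_{z_e},\partial_{\bar z_e}$ be the derivatives along $e$ and let $\Delta_L^{\mathrm H[e]}=y\,\partial_{z_e}\partial_{\bar z_e}+2(\pi_{\rm nd}v)^{T}\mathcal L e\,\partial_{\bar z_e}$ be the Heisenberg Laplace operator. Let $E$ be a partial frame, i.e. a finite family of linearly independent vectors of $\mathbb R^N$, such that $e^{T}Le'=0$ for distinct $e,e'\in E$, and let $W$ be a complement of $\mathrm{span}(E)$ in $\mathbb R^N$ (for example the Euclidean orthogonal complement $E^\perp$). Let $E_0,E_+,E_-$ be the sets of $e\in E$ with $L[e]=0$, $>0$, $<0$. Write $L_e=L[e]$, let $v_e$ be the coordinate of $v$ along $e$ with respect to $\mathbb R^N=\mathrm{span}(E)\oplus W$, and put $r_e=\langle r,e\rangle_{\rm eucl}$. (If $E$ is Euclidean orthonormal and $W=E^\perp$, then $v_e=\langle v,e\rangle_{\rm eucl}$.) A function $\phi$ on $\mathbb H\times\mathbb C^N$ is an $\mathrm H[E]$-harmonic Maass–Jacobi form of weight $k$ and index $L$ (holomorphic in $z_W$) if there is a set $S$, a finite union of sets $\{p(z)=\alpha+\beta\tau\}+\mathbb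 Z^N+\tau\mathbb Z^N$ with nonzero linear forms $p:\mathbb R^N\to\mathbb R$ and $\alpha,\beta\in\mathbb R$, such that $\phi$ is real-analytic outside $S$; near each point of $S$, off $S$, $\phi$ is the sum of a quotient of a real-analytic by a holomorphic function and of a real-analytic function; and, off $S$: (1) $\phi|_{k,L}(\gamma,\lambda,\mu)=\phi$ for all $(\gamma,\lambda,\mu)$; (2) $\mathcal C_{k,L}\phi=0$; (3) $\Delta^{\mathrm H[e]}_L\phi=0$ for all $e\in E$, and $\partial_{\bar z_w}\phi=0$ for all $w\in W$; (4) for all $\alpha,\beta\in\mathbb R^N$ such that $(\tau,\alpha\tau+\beta)\notin S$ for all $\tau$, there is $a>0$ with $\phi(\tau,\alpha\tau+\beta)=O(e^{ay})$ as $y\to\infty$, for each fixed $x$. Building blocks. Let $\kappa=k-N/2$. For $n\in\mathbb Z$, $r\in\mathbb Z^N$ let $D$ be the discriminant of $(n,r)$, so that $D/|L_{\rm nd}|=4n-L_{\rm nd}^{-1}[r]$. Put $$H(y;D)=\begin{cases}\Gamma\big(1-\kappa,-\pi Dy/|L_{\rm nd}|\big),&D\ne0,\\ y^{1-\kappa},&D=0,\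 \kappa\neq1,\\ \log y,&D=0,\ \kappa=1,\end{cases}$$ where $\Gamma(s,x)=\int_x^\infty e^{-t}t^{s-1}\,dt$ for real $x\ne0$, with principal powers and a path of integration that leaves $x$ into the upper half plane (which for $x<0$ gives the analytic continuation in $s$). For $L_e<0$ put $$H^{\mathrm H[e]}(y,v;r)=\mathrm{sgn}\Big(r_e+2L_e\frac{v_e}{y}\Big)\,\gamma\Big(\frac12,\frac{-\pi y}{L_e}\Big(r_e+2L_e\frac{v_e}{y}\Big)^2\Big),\qquad \gamma(s,x)=\int_0^xt^{s-1}e^{-t}\,dt .$$ Proposition. Let $\phi$ be an $\mathrm H[E]$-harmonic Maass–Jacobi form of weight $k$ and index $L$. Let $U\subset\mathbb R_{>0}\times\mathbb R^N$ be open and connected, such that $\phi$ is real-analytic at all $(\tau,z)$ with $(y,v)\in U$, and let $c(n,r;y,v)$, for $(y,v)\in U$, be the coefficients of the local Fourier expansion $\phi=\sum_{n\in\mathbb Z,\,r\in\mathbb Z^N}c(n,r;y,v)\,q^n\zeta^r$ there, where $q^n\zeta^r=\exp(2\pi i(n\tau+r^{T}z))$; that is, $c(n,r;y,v)=\int_{[0,1]\times[0,1]^N}\phi\,q^{-n}\zeta^{-r}\,dx\,du$.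 Then for all $n,r$ there are complex numbers $c^{\delta,\mathrm H[E']}(n,r)$ and $c^{\Delta,\mathrm H[E']}(n,r)$, for $E'\subseteq E_0\cup E_-$, such that for all $(y,v)\in U$ $$c(n,r;y,v)=\sum_{E'\subseteq E_0\cup E_-}\Big(c^{\delta,\mathrm H[E']}(n,r)+c^{\Delta,\mathrm H[E']}(n,r)\,H(y;D)\Big)\prod_{e\in E'\cap E_0}\exp(4\pi r_ev_e)\prod_{e\in E'\cap E_-}H^{\mathrm H[e]}(y,v;r).$$ In particular, no factor attached to a vector of $E_+$ occurs. -/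

import Mathlib

open scoped Matrix
open Complex (I)

noncomputable section

namespace MaassJacobi

/-! Points of the Jacobi upper half plane are pairs `(τ, z)` with `0 < Im τ`, inside the ambient
real vector space `JacobiSpace N`.  Only values of functions at points with `0 < Im τ` matter. -/

/-- The ambient space of the Jacobi upper half plane. -/
abbrev JacobiSpace (N : ℕ) : Type := ℂ × (Fin N → ℂ)

variable {N : ℕ}

/-! ### Lattices and quadratic forms -/

/-- Integral symmetric matrices: symmetric, entries in `½ ℤ`, diagonal entries in `ℤ`. -/
structure IsJacobiIndex (L : Matrix (Fin N) (Fin N) ℝ) : Prop where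
  symm : L.IsSymm
  diag : ∀ i, ∃ m : ℤ, L i i = m
  half : ∀ i j, ∃ m : ℤ, 2 * L i j = m

/-- `L[x] = xᵀ L x` for a real vector `x`. -/
def qf (L : Matrix (Fin N) (Fin N) ℝ) (x : Fin N → ℝ) : ℝ := x ⬝ᵥ (L *ᵥ x)

/-- The complex matrix with the same entries. -/
def toC (L : Matrix (Fin N) (Fin N) ℝ) : Matrix (Fin N) (Fin N) ℂ := L.map (fun a => (a : ℂ))

/-- `L[z] = zᵀ L z` for a complex vector `z` (complex bilinear, no conjugation). -/
def qfC (L : Matrix (Fin N) (Fin N) ℝ) (z : Fin N → ℂ) : ℂ := z ⬝ᵥ (toC L *ᵥ z)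

/-- The matrix of `π_nd`, the Euclidean orthogonal projection of `ℝ^N` onto the orthogonal
complement of the radical `L_0 = ker L`. -/
def projNd (L : Matrix (Fin N) (Fin N) ℝ) : Matrix (Fin N) (Fin N) ℝ :=
  Matrix.of fun i j =>
    ((LinearMap.ker (Matrix.toEuclideanLin L))ᗮ.starProjection (EuclideanSpace.single j 1)) i

/-- `L_nd⁻¹`, the inverse of `L` on the orthogonal complement of its radical, extended by zero to
the radical: `L * pinv L = pinv L * L = projNd L` for symmetric `L`, and `pinv L` vanishes on the
radical.  (On the radical, `L` is replaced by the identity before it is inverted.) -/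
def pinv (L : Matrix (Fin N) (Fin N) ℝ) : Matrix (Fin N) (Fin N) ℝ :=
  (L + (1 - projNd L))⁻¹ * projNd L

/-- The entries of `𝓛_nd⁻¹`, where `𝓛 = 2 π i L`. -/
def scrInv (L : Matrix (Fin N) (Fin N) ℝ) (i j : Fin N) : ℂ :=
  (2 * Real.pi * I)⁻¹ * (pinv L i j : ℂ)

/-- The imaginary part `(y, v)` of a point `(τ, z)`. -/
def imPart (P : JacobiSpace N) : ℝ × (Fin N → ℝ) := (P.1.im, fun j => (P.2 j).im)

/-- `π_nd v`, where `v = Im z`. -/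
def vNd (L : Matrix (Fin N) (Fin N) ℝ) (P : JacobiSpace N) : Fin N → ℝ :=
  projNd L *ᵥ (imPart P).2

/-! ### Wirtinger derivatives and differential operators -/

/-- The holomorphic derivative `½ (D_d - i D_{i d})` in the direction `d`. -/
def wirt (d : JacobiSpace N) (F : JacobiSpace N → ℂ) (P : JacobiSpace N) : ℂ :=
  (fderiv ℝ F P d - I * fderiv ℝ F P (I • d)) / 2

/-- The antiholomorphic derivative `½ (D_d + i D_{i d})` in the direction `d`. -/
def wirtBar (d : JacobiSpace N) (F : JacobiSpace N → ℂ) (P : JacobiSpace N) : ℂ :=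
  (fderiv ℝ F P d + I * fderiv ℝ F P (I • d)) / 2

/-- The direction of the modular variable `τ`. -/
def dirTau : JacobiSpace N := (1, 0)

/-- The direction in the elliptic variables given by a real vector. -/
def dirZ (e : Fin N → ℝ) : JacobiSpace N := (0, fun j => (e j : ℂ))

/-- `∂_τ` -/
def dTau (F : JacobiSpace N → ℂ) : JacobiSpace N → ℂ := wirt dirTau F
/-- `∂_{τ̄}` -/
def dTauBar (F : JacobiSpace N → ℂ) : JacobiSpace N → ℂ := wirtBar dirTau F
/-- The derivative `∂_{z_e}` along the vector `e`. -/
def dZ (e : Fin N → ℝ) (F : JacobiSpace N → ℂ) : JacobiSpace N → ℂ := wirt (dirZ e) F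
/-- The derivative `∂_{z̄_e}` along the vector `e`. -/
def dZBar (e : Fin N → ℝ) (F : JacobiSpace N → ℂ) : JacobiSpace N → ℂ := wirtBar (dirZ e) F

/-- Standard basis vectors of `ℝ^N`. -/
def stdVec (j : Fin N) : Fin N → ℝ := Pi.single j 1

/-- `𝓛_nd⁻¹[∂_z]` -/
def opP (L : Matrix (Fin N) (Fin N) ℝ) (F : JacobiSpace N → ℂ) : JacobiSpace N → ℂ :=
  fun P => ∑ i, ∑ j, scrInv L i j * dZ (stdVec i) (dZ (stdVec j) F) P

/-- `𝓛_nd⁻¹[∂_{z̄}]` -/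
def opQ (L : Matrix (Fin N) (Fin N) ℝ) (F : JacobiSpace N → ℂ) : JacobiSpace N → ℂ :=
  fun P => ∑ i, ∑ j, scrInv L i j * dZBar (stdVec i) (dZBar (stdVec j) F) P

/-- `∂_{z̄}ᵀ 𝓛_nd⁻¹ ∂_z` -/
def opR (L : Matrix (Fin N) (Fin N) ℝ) (F : JacobiSpace N → ℂ) : JacobiSpace N → ℂ :=
  fun P => ∑ i, ∑ j, scrInv L i j * dZBar (stdVec i) (dZ (stdVec j) F) P

/-- `∂_{u_j} = ∂_{z_j} + ∂_{z̄_j}`, where `u = Re z`. -/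
def dU (j : Fin N) (F : JacobiSpace N → ℂ) : JacobiSpace N → ℂ :=
  fun P => dZ (stdVec j) F P + dZBar (stdVec j) F P

/-- `∂_zᵀ 𝓛_nd⁻¹ ∂_u` -/
def opZU (L : Matrix (Fin N) (Fin N) ℝ) (F : JacobiSpace N → ℂ) : JacobiSpace N → ℂ :=
  fun P => ∑ i, ∑ j, scrInv L i j * dZ (stdVec i) (dU j F) P

/-- `∂_{z̄}ᵀ 𝓛_nd⁻¹ ∂_u` -/
def opZBarU (L : Matrix (Fin N) (Fin N) ℝ) (F : JacobiSpace N → ℂ) : JacobiSpace N → ℂ :=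
  fun P => ∑ i, ∑ j, scrInv L i j * dZBar (stdVec i) (dU j F) P

/-- `Δ_κ = 4 y² ∂_τ ∂_{τ̄} - 2 κ i y ∂_{τ̄}` -/
def laplace (κ : ℝ) (F : JacobiSpace N → ℂ) : JacobiSpace N → ℂ :=
  fun P => 4 * (P.1.im : ℂ) ^ 2 * dTau (dTauBar F) P - 2 * κ * I * P.1.im * dTauBar F P

/-- The parameter `k - N / 2`. -/
def kappa (k : ℤ) (N : ℕ) : ℝ := (k : ℝ) - (N : ℝ) / 2

/-- The real coordinates `(π_nd v)_j`, as complex numbers. -/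
def vNdC (L : Matrix (Fin N) (Fin N) ℝ) (P : JacobiSpace N) (j : Fin N) : ℂ := (vNd L P j : ℂ)

/-- The Casimir operator of weight `k` and index `L`. -/
def casimir (k : ℤ) (L : Matrix (Fin N) (Fin N) ℝ) (F : JacobiSpace N → ℂ) :
    JacobiSpace N → ℂ := fun P =>
  (-2) * laplace (kappa k N) F P
  + 2 * (P.1.im : ℂ) ^ 2 * (dTauBar (opP L F) P + dTau (opQ L F) P)
  - 8 * (P.1.im : ℂ) * (∑ j, vNdC L P j * dTau (dZBar (stdVec j) F) P)
  - (1 / 2) * (P.1.im : ℂ) ^ 2 * (opQ L (opP L F) P - opR L (opR L F) P)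
  + 2 * (P.1.im : ℂ) * (∑ j, vNdC L P j * dZBar (stdVec j) (opZU L F) P)
  - (1 / 2) * (2 * (k : ℂ) - (N : ℂ) + 1) * I * (P.1.im : ℂ) * opZBarU L F P
  + 2 * (∑ i, ∑ j, vNdC L P i * vNdC L P j * dZBar (stdVec i) (dZBar (stdVec j) F) P)
  + (2 * (k : ℂ) - (N : ℂ) - 1) * I * (∑ j, vNdC L P j * dZBar (stdVec j) F P)

/-- The Heisenberg Laplace operator in the direction `e`,
`y ∂_{z_e} ∂_{z̄_e} + 2 (π_nd v)ᵀ 𝓛 e ∂_{z̄_e}` with `𝓛 = 2 π i L`.  It is the composition of the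
raising operator `i ∂_{z_e} + 2 i y⁻¹ (π_nd v)ᵀ 𝓛 e` and the lowering operator
`- i y ∂_{z̄_e}`. -/
def heisLaplace (L : Matrix (Fin N) (Fin N) ℝ) (e : Fin N → ℝ) (F : JacobiSpace N → ℂ) :
    JacobiSpace N → ℂ := fun P =>
  (P.1.im : ℂ) * dZ e (dZBar e F) P
    + 2 * (2 * Real.pi * I * ((vNd L P ⬝ᵥ (L *ᵥ e) : ℝ) : ℂ)) * dZBar e F P

/-! ### The action of the full Jacobi group -/

/-- The denominator `c τ + d`. -/
def denomJ (γ : Matrix.SpecialLinearGroup (Fin 2) ℤ) (τ : ℂ) : ℂ :=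
  (γ.1 1 0 : ℂ) * τ + (γ.1 1 1 : ℂ)

/-- `z + λ τ + μ` -/
def shiftZ (lam mu : Fin N → ℤ) (P : JacobiSpace N) : Fin N → ℂ :=
  fun j => P.2 j + (lam j : ℂ) * P.1 + (mu j : ℂ)

/-- The action `(γ, λ, μ) (τ, z) = (γ τ, (z + λ τ + μ) / (c τ + d))`. -/
def jacobiAct (γ : Matrix.SpecialLinearGroup (Fin 2) ℤ) (lam mu : Fin N → ℤ)
    (P : JacobiSpace N) : JacobiSpace N :=
  (((γ.1 0 0 : ℂ) * P.1 + (γ.1 0 1 : ℂ)) / denomJ γ P.1,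
    fun j => shiftZ lam mu P j / denomJ γ P.1)

/-- The slash action `φ |_{k, L} (γ, λ, μ)`. -/
def slash (k : ℤ) (L : Matrix (Fin N) (Fin N) ℝ) (φ : JacobiSpace N → ℂ)
    (γ : Matrix.SpecialLinearGroup (Fin 2) ℤ) (lam mu : Fin N → ℤ) (P : JacobiSpace N) : ℂ :=
  denomJ γ P.1 ^ (-k)
    * Complex.exp (2 * Real.pi * I *
        (- (γ.1 1 0 : ℂ) * qfC L (shiftZ lam mu P) / denomJ γ P.1
          + 2 * ((fun j => (lam j : ℂ)) ⬝ᵥ (toC L *ᵥ P.2))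
          + qfC L (fun j => (lam j : ℂ)) * P.1))
    * φ (jacobiAct γ lam mu P)

/-! ### Singularities -/

/-- For data `(p, α, β)`, where `p : ℝ^N → ℝ` is the linear map `x ↦ ∑ p_j x_j`, the union of the
sets `{p(z) = α + β τ} + ℤ^N + τ ℤ^N` over the members of `s`. -/
def singularLocus (s : Finset ((Fin N → ℝ) × ℝ × ℝ)) : Set (JacobiSpace N) :=
  {P | ∃ q ∈ s, ∃ lam mu : Fin N → ℤ,
    ∑ j, (q.1 j : ℂ) * shiftZ lam mu P j = (q.2.1 : ℂ) + (q.2.2 : ℂ) * P.1}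

/-- The regular points of the Jacobi upper half plane: those outside the singular locus. -/
def regularPoints (s : Finset ((Fin N → ℝ) × ℝ × ℝ)) : Set (JacobiSpace N) :=
  {P | 0 < P.1.im ∧ P ∉ singularLocus s}

/-- `φ` is real-analytic on the Jacobi upper half plane except for non-moving singularities, located
at `singularLocus s`, of almost meromorphic type: near each point of the singular locus, `φ` is the
sum of a quotient of a real-analytic by a holomorphic function and of a real-analytic function. -/
structure HasAlmostMeromorphicSingularities (s : Finset ((Fin N → ℝ) × ℝ × ℝ))
    (φ : JacobiSpace N → ℂ) : Prop where
  nonzero : ∀ q ∈ s, q.1 ≠ 0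
  analytic : AnalyticOnNhd ℝ φ (regularPoints s)
  almostMeromorphic : ∀ P₀ ∈ singularLocus s, 0 < P₀.1.im →
    ∃ V : Set (JacobiSpace N), IsOpen V ∧ P₀ ∈ V ∧ (∀ P ∈ V, 0 < P.1.im) ∧
      ∃ f g h : JacobiSpace N → ℂ,
        AnalyticOnNhd ℝ f V ∧ AnalyticOnNhd ℝ g V ∧ AnalyticOnNhd ℂ h V ∧
        ∀ P ∈ V \ singularLocus s, h P ≠ 0 ∧ φ P = f P / h P + g P

/-! ### Heisenberg harmonic Maass-Jacobi forms -/

/-- The point `(τ, α τ + β)`. -/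
def sectionPt (α β : Fin N → ℝ) (τ : ℂ) : JacobiSpace N :=
  (τ, fun j => (α j : ℂ) * τ + (β j : ℂ))

/-- `φ` is an `H[E]`-harmonic Maass-Jacobi form of weight `k` and index `L`.  Here `E` is a partial
frame and `W` is the complement of its span in whose directions `φ` is holomorphic (that is, `φ` is
holomorphic in `z_W`). -/
def IsHHarmonic (k : ℤ) (L : Matrix (Fin N) (Fin N) ℝ) {m : ℕ} (E : Fin m → Fin N → ℝ)
    (W : Submodule ℝ (Fin N → ℝ)) (φ : JacobiSpace N → ℂ) : Prop :=
  ∃ s : Finset ((Fin N → ℝ) × ℝ × ℝ),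
    HasAlmostMeromorphicSingularities s φ ∧
    (∀ γ lam mu, ∀ P ∈ regularPoints s, jacobiAct γ lam mu P ∈ regularPoints s →
      slash k L φ γ lam mu P = φ P) ∧
    (∀ P ∈ regularPoints s, casimir k L φ P = 0) ∧
    (∀ P ∈ regularPoints s,
      (∀ i, heisLaplace L (E i) φ P = 0) ∧ ∀ w ∈ W, dZBar w φ P = 0) ∧
    (∀ α β : Fin N → ℝ, (∀ τ : ℂ, 0 < τ.im → sectionPt α β τ ∉ singularLocus s) →
      ∃ a > (0 : ℝ), ∀ x : ℝ,
        (fun y : ℝ => φ (sectionPt α β ((x : ℂ) + (y : ℂ) * I)))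
          =O[Filter.atTop] fun y : ℝ => Real.exp (a * y))

/-- The coordinate `v_e` of `v`, for `e = E i`, with respect to the decomposition
`ℝ^N = span E ⊕ W`. -/
def frameCoord {m : ℕ} {E : Fin m → Fin N → ℝ} {W : Submodule ℝ (Fin N → ℝ)}
    (hE : LinearIndependent ℝ E) (hW : IsCompl (Submodule.span ℝ (Set.range E)) W)
    (v : Fin N → ℝ) (i : Fin m) : ℝ :=
  hE.repr (Submodule.projectionOnto _ W hW v) i

/-! ### Fourier coefficients and their building blocks -/

/-- The coefficient `c(n, r; y, v)` of `q^n ζ^r = exp(2 π i (n τ + ∑ r_j z_j))` in the Fourier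
expansion of `φ` in `(x, u)` on the fibre of `Im` above `(y, v)`. -/
def fourierCoeff (φ : JacobiSpace N → ℂ) (n : ℤ) (r : Fin N → ℤ) (y : ℝ) (v : Fin N → ℝ) : ℂ :=
  ∫ p in Set.Icc (0 : ℝ × (Fin N → ℝ)) 1,
    φ ((p.1 : ℂ) + (y : ℂ) * I, fun j => (p.2 j : ℂ) + (v j : ℂ) * I)
      * Complex.exp (- (2 * Real.pi * I *
          ((n : ℂ) * ((p.1 : ℂ) + (y : ℂ) * I)
            + ∑ j, (r j : ℂ) * ((p.2 j : ℂ) + (v j : ℂ) * I))))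

/-- The lower incomplete gamma function `γ(s, x)`. -/
def lowerGamma (s x : ℝ) : ℝ := ∫ t in (0 : ℝ)..x, t ^ (s - 1) * Real.exp (-t)

/-- The upper incomplete gamma function `Γ(s, x) = ∫_x^∞ e^{-t} t^{s-1} dt` for real `x ≠ 0` (of
either sign) and arbitrary `s`.  The path of integration is the ray `x + (1 + i) t`, `t ≥ 0`, which
avoids the branch point `0`, and powers are principal ones.  This is the analytic continuation in
`s` of the integral along the real line. -/
def upperGamma (s x : ℝ) : ℂ :=
  ∫ t in Set.Ioi (0 : ℝ),
    (1 + I) * Complex.exp (-((x : ℂ) + (1 + I) * t)) * ((x : ℂ) + (1 + I) * t) ^ ((s : ℂ) - 1)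

/-- The number `D / |L_nd| = 4 n - L_nd⁻¹[r]`, where `D` is the discriminant of `(n, r)`. -/
def normDisc (L : Matrix (Fin N) (Fin N) ℝ) (n : ℤ) (r : Fin N → ℤ) : ℝ :=
  4 * (n : ℝ) - qf (pinv L) (fun j => (r j : ℝ))

/-- The function `H(y; D)`, in terms of `κ = k - N / 2` and `D' = D / |L_nd|`. -/
def HFun (κ D' y : ℝ) : ℂ :=
  if D' ≠ 0 then upperGamma (1 - κ) (-(Real.pi * D' * y))
  else if κ ≠ 1 then ((y ^ (1 - κ) : ℝ) : ℂ)
  else ((Real.log y : ℝ) : ℂ)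

/-- The function `H^{H[e]}(y, v; r)` in terms of `L_e < 0`, `r_e` and `v_e`. -/
def HHeis (Le re y ve : ℝ) : ℝ :=
  Real.sign (re + 2 * Le * (ve / y))
    * lowerGamma (1 / 2) (-(y * Real.pi) / Le * (re + 2 * Le * (ve / y)) ^ 2)

/-- `r_e`, the Euclidean scalar product of `r` and `e`. -/
def pairing (r : Fin N → ℤ) (e : Fin N → ℝ) : ℝ := ∑ j, (r j : ℝ) * e j

open Classical in
/-- `E_0 ∪ E_-`, as a set of indices. -/
def nonposFrame (L : Matrix (Fin N) (Fin N) ℝ) {m : ℕ} (E : Fin m → Fin N → ℝ) :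
    Finset (Fin m) := Finset.univ.filter fun i => qf L (E i) ≤ 0

open Classical in
/-- The building block attached to `E' ⊆ E_0 ∪ E_-`: the product of the `exp(4 π r_e v_e)` over the
isotropic `e ∈ E'` and of the `H^{H[e]}(y, v; r)` over the negative `e ∈ E'`. -/
def block (L : Matrix (Fin N) (Fin N) ℝ) {m : ℕ} {E : Fin m → Fin N → ℝ}
    {W : Submodule ℝ (Fin N → ℝ)} (hE : LinearIndependent ℝ E)
    (hW : IsCompl (Submodule.span ℝ (Set.range E)) W) (E' : Finset (Fin m)) (r : Fin N → ℤ)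
    (y : ℝ) (v : Fin N → ℝ) : ℝ :=
  (∏ i ∈ E'.filter (fun i => qf L (E i) = 0),
      Real.exp (4 * Real.pi * pairing r (E i) * frameCoord hE hW v i))
    * ∏ i ∈ E'.filter (fun i => qf L (E i) < 0),
      HHeis (qf L (E i)) (pairing r (E i)) y (frameCoord hE hW v i)

end MaassJacobi

end

open scoped Matrix
open Complex (I)

noncomputable section

namespace MaassJacobi

variable {N : ℕ}

/-! ### The projection and the pseudo-inverse -/

section PseudoInverse

variable (L : Matrix (Fin N) (Fin N) ℝ)

/-! Call a frame vector essential if it is negative and `L`-orthogonal to `W` (`starFrame`). The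
form turns out to satisfy `∂̄_x φ = 0` for every real `x` without essential coordinates
(`IsCasimirForm.dZBar_of_coord`). The dependence of a Fourier coefficient on the essential
coordinates and on `y` is then governed by ordinary differential equations that integrate to the
stated building blocks. Coefficients attached to sets that contain a nonessential vector are taken
to be zero, so the isotropic exponentials enter with coefficient zero.

The vanishing has three sources.

Positive vectors (`IsCasimirForm.dZBar_pos`). By the Heisenberg equation, `∂̄_e φ · exp(-4π L[v]/y)`
is antiholomorphic on complex lines in the direction `e`. Because the singularities of `φ` have a
holomorphic denominator, its conjugate extends to an entire function on generic lines. The quantity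
`|∂̄_e φ| exp(-2π L[v]/y)` is invariant under the lattice, and a linear flow on a torus is
recurrent. This bounds the function on a sequence of horizontal lines by a constant times `exp(-2π y
L[α + t e])`, and Phragmén–Lindelöf carries the bound into the strips between them (`norm_extG_le`).
For `L[e] > 0` the bound tends to zero, so the function vanishes. For `L e = 0` it stays finite, and
Liouville's theorem makes the function constant.

Vectors that are not `L`-orthogonal to `W` (`dZBar_eq_zero_of_transverse`). Differentiating the
Heisenberg equation by `∂̄_w` only sees the coefficient `vᵀ L e`, which leaves `(wᵀ L e) ∂̄_e φ =
0`.

The radical (`IsCasimirForm.dZBar_ker`). An isotropic frame vector that is `L`-orthogonal to `W`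
lies in `ker L`. Lattice translations along the radical act on `φ` without a factor of automorphy,
but they move the direction of `τ` in the Casimir operator. Comparing `λ` with `-λ` yields a second
order equation and an equation linear in `λ`. Together with Liouville's theorem and periodicity,
these give `radM (∂̄_λ φ) = 0`. The operator `radM` is not covariant under `τ ↦ -1/(τ+d)`. Its
transform is a quadratic expression in `τ+d` and its conjugate (`radM_invS`) which has to vanish for
all integers `d`, so its mixed coefficient vanishes. That coefficient is `((tr π_nd - N)/2 - 1) ∂̄_λ
φ`, with a negative scalar.

For the coefficients, `∂̄` becomes `i/2` times the derivative in `(y, v)`, and the Casimir and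
Heisenberg equations become `casimir_mode` and `heis_mode`. Together they give, for the linear field
`Y = 2y ∂_y + ∑ (v_e - r_e y/(2 L_e)) ∂_{v_e}` over the essential `e`, the equation `Y² c = (2(1-κ)
+ 2π D' y) Y c` with `D' = D/|L_nd|` (`IsCasimirForm.radial_mode`). If `r` does not annihilate the
radical, even `Y c = 0`.

The fields `Y`, `√y ∂_{v_e}` and the inessential directions commute and span. Divided by suitable
functions, `Y` and the `√y ∂_{v_e}` become commuting derivations whose squares kill `c`, and for
which `H(y; D)` and the functions `H^{H[e]}` are dual coordinates. Hence `c` has degree at most one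
in each of these coordinates (`exists_multilinear`), which is the assertion. The derivatives of the
two kinds of building blocks come from `hasDerivAt_upperGamma` and `lowerGamma_half_sq`. -/

/-- The radical of `L`, as a subspace of Euclidean space. -/
abbrev radE : Submodule ℝ (EuclideanSpace ℝ (Fin N)) := LinearMap.ker (Matrix.toEuclideanLin L)

theorem mem_radE (x : EuclideanSpace ℝ (Fin N)) : x ∈ radE L ↔ L *ᵥ (WithLp.ofLp x) = 0 := by
  rw [LinearMap.mem_ker]
  constructor
  · intro h
    have := congrArg WithLp.ofLp h
    simpa using this
  · intro h
    apply (WithLp.ofLp_injective 2)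
    simpa using h

theorem projNd_mulVec (x : Fin N → ℝ) :
    projNd L *ᵥ x = WithLp.ofLp ((radE L)ᗮ.starProjection (WithLp.toLp 2 x)) := by
  have hx : WithLp.toLp 2 x = ∑ j, x j • EuclideanSpace.single j (1 : ℝ) := by
    ext i
    simp [Pi.single_apply]
  ext i
  rw [hx, map_sum]
  simp only [Matrix.mulVec, dotProduct, projNd, Matrix.of_apply, map_smul, WithLp.ofLp_sum,
    WithLp.ofLp_smul, Finset.sum_apply, Pi.smul_apply, smul_eq_mul]
  exact Finset.sum_congr rfl fun j _ => mul_comm _ _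

theorem mulVec_projNd_mulVec (x : Fin N → ℝ) : L *ᵥ (projNd L *ᵥ x) = L *ᵥ x := by
  have h : (WithLp.toLp 2 x) - (radE L)ᗮ.starProjection (WithLp.toLp 2 x) ∈ radE L := by
    have := Submodule.sub_starProjection_mem_orthogonal (K := (radE L)ᗮ) (WithLp.toLp 2 x)
    rwa [Submodule.orthogonal_orthogonal] at this
  rw [mem_radE] at h
  rw [projNd_mulVec]
  simp only [WithLp.ofLp_sub, Matrix.mulVec_sub] at h
  exact (sub_eq_zero.mp h).symm

theorem mul_projNd : L * projNd L = L := by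
  apply Matrix.mulVec_injective
  ext1 x
  rw [← Matrix.mulVec_mulVec, mulVec_projNd_mulVec]

theorem projNd_mulVec_of_ker {x : Fin N → ℝ} (hx : L *ᵥ x = 0) : projNd L *ᵥ x = 0 := by
  rw [projNd_mulVec]
  have : WithLp.toLp 2 x ∈ (radE L)ᗮᗮ := by
    rw [Submodule.orthogonal_orthogonal, mem_radE]
    exact hx
  rw [(Submodule.starProjection_apply_eq_zero_iff (K := (radE L)ᗮ)).mpr this]
  rfl

theorem projNd_isSymm : (projNd L).IsSymm := by
  ext i j
  have h := Submodule.inner_starProjection_left_eq_right ((radE L)ᗮ)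
    (EuclideanSpace.single i (1 : ℝ)) (EuclideanSpace.single j (1 : ℝ))
  rw [EuclideanSpace.inner_single_right, EuclideanSpace.inner_single_left] at h
  simpa only [Matrix.transpose_apply, projNd, Matrix.of_apply, map_one, one_mul, conj_trivial] using h

theorem projNd_mul_projNd : projNd L * projNd L = projNd L := by
  apply Matrix.mulVec_injective
  ext1 x
  rw [← Matrix.mulVec_mulVec, projNd_mulVec L (projNd L *ᵥ x), projNd_mulVec]
  congr 1
  exact Submodule.starProjection_eq_self_iff.mpr (Submodule.starProjection_apply_mem _ _)

theorem mulVec_sub_projNd (x : Fin N → ℝ) : L *ᵥ (x - projNd L *ᵥ x) = 0 := by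
  rw [Matrix.mulVec_sub, mulVec_projNd_mulVec, sub_self]

/-- A diagonal entry of a symmetric idempotent matrix is the sum of the squares of its row, hence at
least its own square. The resulting bound on the trace fixes the sign of the decisive constant in
`IsCasimirForm.dZBar_ker`. -/
theorem projNd_diag_le_one (j : Fin N) : projNd L j j ≤ 1 := by
  have h1 : projNd L j j = ∑ i, projNd L j i ^ 2 := by
    conv_lhs => rw [← projNd_mul_projNd, Matrix.mul_apply]
    refine Finset.sum_congr rfl fun i _ => ?_
    rw [← (projNd_isSymm L).apply i j, sq]
  have h2 : projNd L j j ^ 2 ≤ projNd L j j := by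
    conv_rhs => rw [h1]
    exact Finset.single_le_sum (f := fun i => projNd L j i ^ 2) (fun i _ => sq_nonneg _)
      (Finset.mem_univ j)
  nlinarith

theorem trace_projNd_le : (projNd L).trace ≤ N := by
  calc (projNd L).trace ≤ ∑ _j : Fin N, (1 : ℝ) :=
        Finset.sum_le_sum fun j _ => projNd_diag_le_one L j
    _ = N := by simp

variable {L}

theorem projNd_mul (hL : L.IsSymm) : projNd L * L = L := by
  have h := congrArg Matrix.transpose (mul_projNd L)
  rwa [Matrix.transpose_mul, projNd_isSymm L, hL] at h

/-- Applying `projNd L` to `(L + (1 - projNd L)) u` gives `L u`. A vector `u` in the kernel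
therefore lies in the radical, where the matrix acts as the identity. -/
theorem isUnit_det_aux (hL : L.IsSymm) : IsUnit (L + (1 - projNd L)).det := by
  rw [← Matrix.isUnit_iff_isUnit_det]
  rw [← Matrix.mulVec_injective_iff_isUnit]
  intro x y hxy
  rw [← sub_eq_zero] at hxy ⊢
  rw [← Matrix.mulVec_sub] at hxy
  set u := x - y
  have hproj : projNd L *ᵥ ((L + (1 - projNd L)) *ᵥ u) = L *ᵥ u := by
    rw [Matrix.mulVec_mulVec, mul_add, mul_sub, mul_one, projNd_mul_projNd, sub_self, add_zero,
      projNd_mul hL]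
  have hLu : L *ᵥ u = 0 := by rw [← hproj, hxy, Matrix.mulVec_zero]
  have hpu := projNd_mulVec_of_ker L hLu
  rw [Matrix.add_mulVec, Matrix.sub_mulVec, Matrix.one_mulVec, hLu, hpu] at hxy
  simpa using hxy

theorem pinv_mul (hL : L.IsSymm) : pinv L * L = projNd L := by
  have h : (L + (1 - projNd L)) * projNd L = L := by
    rw [add_mul, sub_mul, one_mul, projNd_mul_projNd, sub_self, add_zero, mul_projNd]
  have h1 : (L + (1 - projNd L))⁻¹ * L = projNd L := by
    conv_lhs => enter [2]; rw [← h]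
    rw [← mul_assoc, Matrix.nonsing_inv_mul _ (isUnit_det_aux hL), one_mul]
  rw [pinv, mul_assoc, projNd_mul hL, h1]

theorem pinv_isSymm (hL : L.IsSymm) : (pinv L).IsSymm := by
  have hM : (L + (1 - projNd L)).IsSymm := by
    have h1 : (1 - projNd L).IsSymm := by
      rw [Matrix.IsSymm, Matrix.transpose_sub, Matrix.transpose_one, projNd_isSymm L]
    exact hL.add h1
  have hcomm : (L + (1 - projNd L)) * projNd L = projNd L * (L + (1 - projNd L)) := by
    rw [add_mul, sub_mul, mul_add, mul_sub, mul_projNd, projNd_mul hL]; simp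
  have hu := isUnit_det_aux hL
  have hcomm' : (L + (1 - projNd L))⁻¹ * projNd L = projNd L * (L + (1 - projNd L))⁻¹ := by
    calc (L + (1 - projNd L))⁻¹ * projNd L
        = (L + (1 - projNd L))⁻¹ * (projNd L * (L + (1 - projNd L))) *
            (L + (1 - projNd L))⁻¹ := by
          rw [mul_assoc, mul_assoc, Matrix.mul_nonsing_inv _ hu, mul_one]
      _ = _ := by
          rw [← hcomm, ← mul_assoc, Matrix.nonsing_inv_mul _ hu, one_mul]
  rw [Matrix.IsSymm, pinv, Matrix.transpose_mul, projNd_isSymm L, Matrix.transpose_nonsing_inv,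
    hM, hcomm']

end PseudoInverse

/-! ### The radical is spanned by integral vectors -/

theorem exists_int_smul (q : Fin N → ℚ) : ∃ D : ℕ, 0 < D ∧ ∃ l : Fin N → ℤ,
    ∀ j, (l j : ℝ) = D * (q j : ℝ) := by
  refine ⟨∏ j, (q j).den, Finset.prod_pos fun j _ => (q j).den_pos, ?_⟩
  have : ∀ j, ∃ l : ℤ, (l : ℝ) = ((∏ i, (q i).den : ℕ) : ℝ) * (q j : ℝ) := by
    intro j
    obtain ⟨k, hk⟩ := Finset.dvd_prod_of_mem (fun i => (q i).den) (Finset.mem_univ j)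
    refine ⟨k * (q j).num, ?_⟩
    rw [hk]
    have h : ((q j).den : ℝ) * (q j : ℝ) = (q j).num := by
      exact_mod_cast Rat.den_mul_eq_num (q j)
    push_cast
    rw [← h]; ring
  choose l hl using this
  exact ⟨l, hl⟩

/-- The equations `L x = 0` have rational coefficients. Expanding the entries of `x` in a basis of
`ℝ` over `ℚ`, the coordinates that belong to one basis element form a rational solution, and
clearing denominators makes it integral. Identities obtained from lattice translations, once linear
in the translation, thus extend to the whole radical. -/
theorem ker_le_span_int {L : Matrix (Fin N) (Fin N) ℝ} (hL : IsJacobiIndex L) {x : Fin N → ℝ}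
    (hx : L *ᵥ x = 0) :
    x ∈ Submodule.span ℝ {y : Fin N → ℝ | L *ᵥ y = 0 ∧ ∃ l : Fin N → ℤ, ∀ j, y j = l j} := by
  choose M hM using hL.half
  let b := Module.Basis.ofVectorSpace ℚ ℝ
  have hq : ∀ k, L *ᵥ (fun j => ((b.repr (x j) k : ℚ) : ℝ)) = 0 := by
    intro k
    ext i
    have h1 : ∑ j, (M i j : ℚ) • x j = 0 := by
      have h2 := congrFun hx i
      simp only [Matrix.mulVec, dotProduct, Pi.zero_apply] at h2
      have : ∑ j, (M i j : ℚ) • x j = 2 * ∑ j, L i j * x j := by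
        rw [Finset.mul_sum]
        refine Finset.sum_congr rfl fun j _ => ?_
        rw [← mul_assoc, hM, Rat.smul_def]; simp
      rw [this, h2, mul_zero]
    have h3 := congrArg (fun w => b.repr w k) h1
    simp only [map_sum, map_smul, map_zero, Finsupp.coe_finsetSum, Finset.sum_apply,
      Finsupp.smul_apply, Finsupp.coe_zero, Pi.zero_apply, smul_eq_mul] at h3
    have h4 : ∑ j, (M i j : ℝ) * ((b.repr (x j) k : ℚ) : ℝ) = 0 := by exact_mod_cast h3
    have h5 : (2 : ℝ) * ∑ j, L i j * ((b.repr (x j) k : ℚ) : ℝ) = 0 := by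
      rw [← h4, Finset.mul_sum]
      exact Finset.sum_congr rfl fun j _ => by rw [← mul_assoc, hM]
    simpa [Matrix.mulVec, dotProduct] using h5
  have hx' : x = ∑ k ∈ Finset.univ.biUnion (fun j => (b.repr (x j)).support),
      b k • (fun j => ((b.repr (x j) k : ℚ) : ℝ)) := by
    ext j
    rw [Finset.sum_apply]
    conv_lhs => rw [← b.linearCombination_repr (x j)]
    rw [Finsupp.linearCombination_apply, Finsupp.sum_of_support_subset _
      (Finset.subset_biUnion_of_mem (fun j => (b.repr (x j)).support) (Finset.mem_univ j))]
    · exact Finset.sum_congr rfl fun k _ => by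
        simp [Rat.smul_def, mul_comm]
    · simp
  rw [hx']
  refine Submodule.sum_mem _ fun k _ => Submodule.smul_mem _ _ ?_
  obtain ⟨D, hD, l, hl⟩ := exists_int_smul (fun j => b.repr (x j) k)
  have hD' : (D : ℝ) ≠ 0 := by positivity
  have : (fun j => ((b.repr (x j) k : ℚ) : ℝ)) = (D : ℝ)⁻¹ • (fun j => (l j : ℝ)) := by
    ext j; simp [hl, hD']
  rw [this]
  refine Submodule.smul_mem _ _ (Submodule.subset_span ⟨?_, l, fun j => rfl⟩)
  have h6 : (fun j => (l j : ℝ)) = (D : ℝ) • (fun j => ((b.repr (x j) k : ℚ) : ℝ)) := by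
    ext j; simp [hl]
  rw [h6, Matrix.mulVec_smul, hq, smul_zero]

/-! ### Calculus of Wirtinger derivatives -/

open scoped Topology ContDiff

/-- The first order operator `½ (D_d + s D_{i d})`; for `s = -i` and `s = i` it is `wirt d` and
`wirtBar d`. -/
def wirtG (s : ℂ) (d : JacobiSpace N) (F : JacobiSpace N → ℂ) (P : JacobiSpace N) : ℂ :=
  (fderiv ℝ F P d + s * fderiv ℝ F P (I • d)) / 2

theorem wirt_eq (d : JacobiSpace N) : wirt d = wirtG (-I) d := by
  funext F P; simp only [wirt, wirtG]; ring

theorem dTau_eq : (dTau : (JacobiSpace N → ℂ) → _) = wirtG (-I) dirTau := wirt_eq _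
theorem dTauBar_eq : (dTauBar : (JacobiSpace N → ℂ) → _) = wirtG I dirTau := rfl
theorem dZ_eq (e : Fin N → ℝ) : dZ e = wirtG (-I) (dirZ e) := wirt_eq _
theorem dZBar_eq (e : Fin N → ℝ) : dZBar e = wirtG I (dirZ e) := rfl

section Schwarz

variable {E : Type*} [NormedAddCommGroup E] [NormedSpace ℝ E]

theorem fderiv_fderiv_apply {F : E → ℂ} {p : E} (hF : ContDiffAt ℝ 2 F p) (a b : E) :
    fderiv ℝ (fun q => fderiv ℝ F q a) p b = fderiv ℝ (fderiv ℝ F) p b a := by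
  have h : DifferentiableAt ℝ (fderiv ℝ F) p :=
    (hF.fderiv_right (m := 1) (by norm_num)).differentiableAt (by norm_num)
  rw [fderiv_clm_apply h (differentiableAt_const a)]
  simp

theorem fderiv_fderiv_symm {F : E → ℂ} {p : E} (hF : ContDiffAt ℝ 2 F p) (a b : E) :
    fderiv ℝ (fderiv ℝ F) p b a = fderiv ℝ (fderiv ℝ F) p a b :=
  (hF.isSymmSndFDerivAt (by simp)) b a

theorem fderiv_fderiv_comm {F : E → ℂ} {p : E} (hF : ContDiffAt ℝ 2 F p) (a b : E) :
    fderiv ℝ (fun q => fderiv ℝ F q a) p b = fderiv ℝ (fun q => fderiv ℝ F q b) p a := by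
  rw [fderiv_fderiv_apply hF, fderiv_fderiv_apply hF, fderiv_fderiv_symm hF]

end Schwarz

section Rules

variable {F G : JacobiSpace N → ℂ} {P : JacobiSpace N} {s t : ℂ} {d d' : JacobiSpace N}

theorem analyticAt_fderiv_apply (hF : AnalyticAt ℝ F P) (d : JacobiSpace N) :
    AnalyticAt ℝ (fun q => fderiv ℝ F q d) P :=
  ((ContinuousLinearMap.apply ℝ ℂ d).analyticAt _).comp hF.fderiv

theorem analyticAt_wirtG (hF : AnalyticAt ℝ F P) (s : ℂ) (d : JacobiSpace N) :
    AnalyticAt ℝ (wirtG s d F) P := by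
  unfold wirtG
  exact ((analyticAt_fderiv_apply hF d).add
    (analyticAt_const.mul (analyticAt_fderiv_apply hF (I • d)))).div analyticAt_const (by norm_num)

theorem wirtG_congr (h : F =ᶠ[𝓝 P] G) (s : ℂ) (d : JacobiSpace N) :
    wirtG s d F P = wirtG s d G P := by
  rw [wirtG, wirtG, h.fderiv_eq]

theorem wirtG_congr' (h : F =ᶠ[𝓝 P] G) (s : ℂ) (d : JacobiSpace N) :
    wirtG s d F =ᶠ[𝓝 P] wirtG s d G := by
  filter_upwards [h.eventuallyEq_nhds] with Q hQ using wirtG_congr hQ s d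

theorem wirtG_add (hF : DifferentiableAt ℝ F P) (hG : DifferentiableAt ℝ G P) :
    wirtG s d (fun Q => F Q + G Q) P = wirtG s d F P + wirtG s d G P := by
  simp only [wirtG, fderiv_fun_add hF hG, add_apply]; ring

theorem wirtG_sub (hF : DifferentiableAt ℝ F P) (hG : DifferentiableAt ℝ G P) :
    wirtG s d (fun Q => F Q - G Q) P = wirtG s d F P - wirtG s d G P := by
  simp only [wirtG, fderiv_fun_sub hF hG, sub_apply]; ring

theorem wirtG_mul (hF : DifferentiableAt ℝ F P) (hG : DifferentiableAt ℝ G P) :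
    wirtG s d (fun Q => F Q * G Q) P = F P * wirtG s d G P + wirtG s d F P * G P := by
  simp only [wirtG, fderiv_fun_mul hF hG, add_apply,
    smul_apply, smul_eq_mul]; ring

theorem wirtG_const (c : ℂ) : wirtG s d (fun _ => c) P = 0 := by
  simp [wirtG]

theorem wirtG_const_mul (c : ℂ) (hF : DifferentiableAt ℝ F P) :
    wirtG s d (fun Q => c * F Q) P = c * wirtG s d F P := by
  simp only [wirtG, fderiv_const_mul hF, smul_apply, smul_eq_mul]; ring

theorem wirtG_sum {ι : Type*} {u : Finset ι} {A : ι → JacobiSpace N → ℂ}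
    (h : ∀ i ∈ u, DifferentiableAt ℝ (A i) P) :
    wirtG s d (fun Q => ∑ i ∈ u, A i Q) P = ∑ i ∈ u, wirtG s d (A i) P := by
  simp only [wirtG, fderiv_fun_sum h, sum_apply]
  rw [Finset.mul_sum, ← Finset.sum_add_distrib, Finset.sum_div]

theorem wirtG_dir_add : wirtG s (d + d') F P = wirtG s d F P + wirtG s d' F P := by
  simp only [wirtG, smul_add, map_add]; ring

theorem wirtG_dir_sub : wirtG s (d - d') F P = wirtG s d F P - wirtG s d' F P := by
  simp only [wirtG, smul_sub, map_sub]; ring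

theorem wirtG_dir_smul (r : ℝ) : wirtG s (r • d) F P = r * wirtG s d F P := by
  simp only [wirtG, smul_comm I r d, map_smul, Complex.real_smul]; ring

theorem wirtG_dir_zero : wirtG s (0 : JacobiSpace N) F P = 0 := by simp [wirtG]

theorem wirtG_comm (hF : AnalyticAt ℝ F P) (s t : ℂ) (d d' : JacobiSpace N) :
    wirtG s d (wirtG t d' F) P = wirtG t d' (wirtG s d F) P := by
  have h2 : ContDiffAt ℝ 2 F P := hF.contDiffAt
  have key : ∀ (s t : ℂ) (d d' : JacobiSpace N), wirtG s d (wirtG t d' F) P =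
      (fderiv ℝ (fun q => fderiv ℝ F q d') P d + t * fderiv ℝ (fun q => fderiv ℝ F q (I • d')) P d
      + s * fderiv ℝ (fun q => fderiv ℝ F q d') P (I • d)
      + s * t * fderiv ℝ (fun q => fderiv ℝ F q (I • d')) P (I • d)) / 4 := by
    intro s t d d'
    have h1 := (analyticAt_fderiv_apply hF d').differentiableAt
    have h3 := (analyticAt_fderiv_apply hF (I • d')).differentiableAt
    have : fderiv ℝ (wirtG t d' F) P = (2 : ℂ)⁻¹ • (fderiv ℝ (fun q => fderiv ℝ F q d') P
        + t • fderiv ℝ (fun q => fderiv ℝ F q (I • d')) P) := by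
      have : wirtG t d' F =
          fun q => (2 : ℂ)⁻¹ * (fderiv ℝ F q d' + t * fderiv ℝ F q (I • d')) := by
        funext q; simp only [wirtG]; ring
      rw [this, fderiv_const_mul (DifferentiableAt.fun_add h1 (h3.const_mul t)),
        fderiv_fun_add h1 (h3.const_mul t), fderiv_const_mul h3]
    simp only [wirtG] at this ⊢
    rw [this]
    simp only [smul_apply, add_apply, smul_eq_mul]
    ring
  rw [key, key, fderiv_fderiv_comm h2 d' d, fderiv_fderiv_comm h2 (I • d') d,
    fderiv_fderiv_comm h2 d' (I • d), fderiv_fderiv_comm h2 (I • d') (I • d)]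
  ring

theorem wirtBar_of_holomorphic (hF : DifferentiableAt ℂ F P) (d : JacobiSpace N) :
    wirtG I d F P = 0 := by
  rw [wirtG, hF.fderiv_restrictScalars ℝ]
  simp only [ContinuousLinearMap.coe_restrictScalars', map_smul, smul_eq_mul]
  rw [← mul_assoc, Complex.I_mul_I]; ring

theorem wirt_of_holomorphic (hF : DifferentiableAt ℂ F P) (d : JacobiSpace N) :
    wirtG (-I) d F P = fderiv ℂ F P d := by
  rw [wirtG, hF.fderiv_restrictScalars ℝ]
  simp only [ContinuousLinearMap.coe_restrictScalars', map_smul, smul_eq_mul]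
  rw [← mul_assoc, neg_mul, Complex.I_mul_I]; ring

/-- The holomorphic derivative is complex linear in the direction, the antiholomorphic one is
antilinear. -/
theorem wirt_dir_csmul (a : ℂ) : wirtG (-I) (a • d) F P = a * wirtG (-I) d F P := by
  have h1 : a • d = a.re • d + a.im • (I • d) := by
    conv_lhs => rw [← Complex.re_add_im a]
    rw [add_smul, mul_smul]; rfl
  have h2 : I • (a • d) = a.re • (I • d) - a.im • d := by
    rw [h1, smul_add, smul_comm I a.re, smul_comm I a.im, smul_smul I I, Complex.I_mul_I,
      neg_one_smul, smul_neg, sub_eq_add_neg]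
  rw [wirtG, h2, h1]
  simp only [map_add, map_sub, map_smul, Complex.real_smul, wirtG]
  conv_rhs => rw [← Complex.re_add_im a]
  linear_combination ((a.im : ℂ) * (fderiv ℝ F P (I • d)) / 2) * Complex.I_mul_I

theorem wirtBar_dir_csmul (a : ℂ) :
    wirtG I (a • d) F P = (starRingEnd ℂ) a * wirtG I d F P := by
  have h1 : a • d = a.re • d + a.im • (I • d) := by
    conv_lhs => rw [← Complex.re_add_im a]
    rw [add_smul, mul_smul]; rfl
  have h2 : I • (a • d) = a.re • (I • d) - a.im • d := by
    rw [h1, smul_add, smul_comm I a.re, smul_comm I a.im, smul_smul I I, Complex.I_mul_I,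
      neg_one_smul, smul_neg, sub_eq_add_neg]
  have h3 : (starRingEnd ℂ) a = a.re - a.im * I := by
    conv_lhs => rw [← Complex.re_add_im a]
    simp [sub_eq_add_neg, Complex.ext_iff]
  rw [wirtG, h2, h1, h3]
  simp only [map_add, map_sub, map_smul, Complex.real_smul, wirtG]
  linear_combination ((a.im : ℂ) * (fderiv ℝ F P (I • d)) / 2) * Complex.I_mul_I

/-- The chain rule for a holomorphic change of variables. -/
theorem wirtG_comp {T : JacobiSpace N → JacobiSpace N} (hT : DifferentiableAt ℂ T P)
    (hF : DifferentiableAt ℝ F (T P)) :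
    wirtG s d (fun Q => F (T Q)) P = wirtG s (fderiv ℂ T P d) F (T P) := by
  have h : fderiv ℝ (fun Q => F (T Q)) P = (fderiv ℝ F (T P)).comp
      ((fderiv ℂ T P).restrictScalars ℝ) := by
    have := fderiv_comp P hF (hT.restrictScalars ℝ)
    rw [hT.fderiv_restrictScalars ℝ] at this
    exact this
  simp only [wirtG, h, ContinuousLinearMap.comp_apply, ContinuousLinearMap.coe_restrictScalars',
    map_smul]

end Rules

/-! ### Directions and coefficients -/

/-- The embedding of real directions. -/
def emb : (ℝ × (Fin N → ℝ)) →ₗ[ℝ] JacobiSpace N where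
  toFun a := ((a.1 : ℂ), fun j => (a.2 j : ℂ))
  map_add' a b := by ext <;> simp
  map_smul' r a := by ext <;> simp

theorem dirTau_eq_emb : (dirTau : JacobiSpace N) = emb (1, 0) := by
  ext <;> simp [dirTau, emb]

theorem dirZ_eq_emb (e : Fin N → ℝ) : dirZ e = emb (0, e) := by
  ext <;> simp [dirZ, emb]

theorem dirZ_add (a b : Fin N → ℝ) : dirZ (a + b) = dirZ a + dirZ b := by
  simp only [dirZ_eq_emb, ← map_add]; simp

theorem dirZ_smul (r : ℝ) (a : Fin N → ℝ) : dirZ (r • a) = r • dirZ a := by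
  simp only [dirZ_eq_emb, ← map_smul]; simp

theorem dirZ_zero : dirZ (0 : Fin N → ℝ) = 0 := by
  rw [dirZ_eq_emb, show ((0 : ℝ), (0 : Fin N → ℝ)) = 0 from rfl, map_zero]

theorem dirZ_sum {ι : Type*} (u : Finset ι) (f : ι → Fin N → ℝ) :
    dirZ (∑ i ∈ u, f i) = ∑ i ∈ u, dirZ (f i) := by
  classical
  induction u using Finset.induction_on with
  | empty => simp [dirZ_zero]
  | insert a u ha ih => rw [Finset.sum_insert ha, dirZ_add, ih, Finset.sum_insert ha]

theorem wirtG_dir_sum {ι : Type*} {s : ℂ} {F : JacobiSpace N → ℂ} {P : JacobiSpace N}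
    (u : Finset ι) (f : ι → JacobiSpace N) :
    wirtG s (∑ i ∈ u, f i) F P = ∑ i ∈ u, wirtG s (f i) F P := by
  classical
  induction u using Finset.induction_on with
  | empty => simp [wirtG_dir_zero]
  | insert a u ha ih => rw [Finset.sum_insert ha, wirtG_dir_add, ih, Finset.sum_insert ha]

theorem wirtG_dirZ_eq_sum {s : ℂ} {F : JacobiSpace N → ℂ} {P : JacobiSpace N} (a : Fin N → ℝ) :
    wirtG s (dirZ a) F P = ∑ j, (a j : ℂ) * wirtG s (dirZ (stdVec j)) F P := by
  have : a = ∑ j, a j • (stdVec j : Fin N → ℝ) := by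
    ext i; simp [stdVec, Pi.single_apply]
  conv_lhs => rw [this, dirZ_sum, wirtG_dir_sum]
  exact Finset.sum_congr rfl fun j _ => by rw [dirZ_smul, wirtG_dir_smul]

/-- A real linear functional of the imaginary parts, as a complex valued function. -/
def imFun (ℓ : (ℝ × (Fin N → ℝ)) →L[ℝ] ℝ) (P : JacobiSpace N) : ℂ := (ℓ (imPart P) : ℝ)

/-- Imaginary parts, as a continuous linear map. -/
def imPartL : JacobiSpace N →L[ℝ] ℝ × (Fin N → ℝ) :=
  (Complex.imCLM.comp (ContinuousLinearMap.fst ℝ ℂ (Fin N → ℂ))).prod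
    (ContinuousLinearMap.pi fun j =>
      Complex.imCLM.comp ((ContinuousLinearMap.proj j).comp (ContinuousLinearMap.snd ℝ ℂ _)))

theorem imPartL_apply (P : JacobiSpace N) : imPartL P = imPart P := rfl

theorem imPart_emb (d : ℝ × (Fin N → ℝ)) : imPart (emb d) = 0 := by
  simp [imPart, emb]; rfl

theorem imPart_I_emb (d : ℝ × (Fin N → ℝ)) : imPart (I • emb d) = d := by
  simp [imPart, emb]

theorem imFun_eq (ℓ : (ℝ × (Fin N → ℝ)) →L[ℝ] ℝ) :
    imFun ℓ = fun P => (Complex.ofRealCLM.comp (ℓ.comp imPartL)) P := rfl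

theorem analyticAt_imFun (ℓ : (ℝ × (Fin N → ℝ)) →L[ℝ] ℝ) (P : JacobiSpace N) :
    AnalyticAt ℝ (imFun ℓ) P := by
  rw [imFun_eq]; exact ContinuousLinearMap.analyticAt _ _

theorem wirtG_imFun (s : ℂ) (ℓ : (ℝ × (Fin N → ℝ)) →L[ℝ] ℝ) (d : ℝ × (Fin N → ℝ))
    (P : JacobiSpace N) : wirtG s (emb d) (imFun ℓ) P = s * ℓ d / 2 := by
  rw [wirtG, imFun_eq, ContinuousLinearMap.fderiv]
  simp [imPartL_apply, imPart_emb, imPart_I_emb]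

/-- The functional `(y, v) ↦ y`. -/
abbrev fstL : (ℝ × (Fin N → ℝ)) →L[ℝ] ℝ := ContinuousLinearMap.fst ℝ ℝ _

/-- The functional `(y, v) ↦ wᵀ v`. -/
def sndL (w : Fin N → ℝ) : (ℝ × (Fin N → ℝ)) →L[ℝ] ℝ :=
  (∑ j, w j • ContinuousLinearMap.proj (R := ℝ) (φ := fun _ : Fin N => ℝ) j).comp
    (ContinuousLinearMap.snd ℝ ℝ _)

theorem sndL_apply (w : Fin N → ℝ) (p : ℝ × (Fin N → ℝ)) : sndL w p = w ⬝ᵥ p.2 := by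
  simp [sndL, dotProduct]

theorem vNdC_eq_imFun (L : Matrix (Fin N) (Fin N) ℝ) (j : Fin N) :
    (fun P => vNdC L P j) = imFun (sndL (projNd L j)) := by
  funext P
  simp [vNdC, vNd, imFun, sndL_apply, Matrix.mulVec]

open scoped Topology ContDiff

/-! ### Generic sections and regular points -/

/-- Directions `α` for which no section `(τ, α τ + β)` meets the singular locus. -/
def genericDir (s : Finset ((Fin N → ℝ) × ℝ × ℝ)) : Set (Fin N → ℝ) :=
  {α | ∀ q ∈ s, ∀ lam : Fin N → ℤ, ∑ j, q.1 j * (α j + lam j) ≠ q.2.2}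

/-- On the section `z = α τ + β` with real `α`, `β`, the imaginary part of a singular equation is
`y` times a condition on `α` alone. A single generic `α` therefore serves for all `β` and all `τ`.
-/
theorem sectionPt_mem_regularPoints {s : Finset ((Fin N → ℝ) × ℝ × ℝ)} {α : Fin N → ℝ}
    (hα : α ∈ genericDir s) (β : Fin N → ℝ) {τ : ℂ} (hτ : 0 < τ.im) :
    sectionPt α β τ ∈ regularPoints s := by
  refine ⟨hτ, ?_⟩
  rintro ⟨q, hq, lam, mu, h⟩
  refine hα q hq lam ?_
  have h1 := congrArg Complex.im h
  simp only [sectionPt, shiftZ, Complex.im_sum, Complex.add_im, Complex.mul_im,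
    Complex.ofReal_re, Complex.ofReal_im, Complex.add_re, Complex.mul_re, Complex.intCast_re,
    Complex.intCast_im, zero_mul, add_zero, zero_add, sub_zero] at h1
  have h2 : (∑ j, q.1 j * (α j + lam j)) * τ.im = q.2.2 * τ.im := by
    rw [← h1, Finset.sum_mul]
    exact Finset.sum_congr rfl fun j _ => by ring
  exact mul_right_cancel₀ hτ.ne' h2

/-- Baire's theorem: the excluded directions form countably many affine hyperplanes, whose
complements are open and dense. -/
theorem dense_genericDir {s : Finset ((Fin N → ℝ) × ℝ × ℝ)} (hs : ∀ q ∈ s, q.1 ≠ 0) :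
    Dense (genericDir s) := by
  have heq : genericDir s = ⋂ i : s × (Fin N → ℤ),
      {α : Fin N → ℝ | ∑ j, i.1.1.1 j * (α j + i.2 j) ≠ i.1.1.2.2} := by
    ext α
    simp only [genericDir, Set.mem_ofPred_eq, Set.mem_iInter, Prod.forall, Subtype.forall]
  rw [heq]
  refine dense_iInter_of_isOpen (fun i => ?_) (fun i => ?_)
  · refine isOpen_ne_fun ?_ continuous_const
    fun_prop
  · have hq := hs i.1.1 i.1.2
    set q := i.1.1
    obtain ⟨j, hj⟩ := Function.ne_iff.mp hq
    intro α
    rw [mem_closure_iff_seq_limit]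
    by_cases hα : ∑ j, q.1 j * (α j + i.2 j) = q.2.2
    -- A coordinate `j` with `q.1 j ≠ 0` is transverse to the hyperplane, so small shifts along it
    -- leave the hyperplane and converge back to `α`.
    · refine ⟨fun n => α + (1 / ((n : ℝ) + 1)) • Pi.single j (1 : ℝ), fun n => ?_, ?_⟩
      · have h1 : ∑ k, q.1 k * ((α + (1 / ((n : ℝ) + 1)) • (Pi.single j (1 : ℝ) : Fin N → ℝ)) k + i.2 k)
            = q.2.2 + q.1 j * (1 / ((n : ℝ) + 1)) := by
          rw [← hα]
          simp only [Pi.add_apply, Pi.smul_apply, smul_eq_mul]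
          have : ∀ k, q.1 k * (α k + 1 / ((n : ℝ) + 1) * (Pi.single j (1 : ℝ) : Fin N → ℝ) k
              + i.2 k) = q.1 k * (α k + i.2 k)
                + q.1 k * (1 / ((n : ℝ) + 1)) * (Pi.single j (1 : ℝ) : Fin N → ℝ) k :=
            fun k => by ring
          simp only [this, Finset.sum_add_distrib]
          simp [Pi.single_apply]
        change _ ≠ _
        rw [h1]
        have : q.1 j * (1 / ((n : ℝ) + 1)) ≠ 0 := mul_ne_zero hj (by positivity)
        simpa using this
      · have : Filter.Tendsto (fun n : ℕ => α + (1 / ((n : ℝ) + 1)) • Pi.single j (1 : ℝ))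
            Filter.atTop (𝓝 (α + (0 : ℝ) • Pi.single j (1 : ℝ))) :=
          tendsto_const_nhds.add (tendsto_one_div_add_atTop_nhds_zero_nat.smul_const _)
        simpa using this
    · exact ⟨fun _ => α, fun _ => hα, tendsto_const_nhds⟩

/-- The coordinates `α`, `β` of a point. -/
theorem exists_sectionPt {P : JacobiSpace N} (hP : 0 < P.1.im) :
    P = sectionPt (fun j => (P.2 j).im / P.1.im)
      (fun j => (P.2 j).re - (P.2 j).im / P.1.im * P.1.re) P.1 := by
  have h0 : P.1.im ≠ 0 := hP.ne'
  refine Prod.ext rfl ?_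
  ext j
  apply Complex.ext
  · simp [sectionPt]
  · simp [sectionPt]; field_simp

theorem continuous_sectionPt : Continuous fun a : (Fin N → ℝ) × (Fin N → ℝ) × ℂ =>
    sectionPt a.1 a.2.1 a.2.2 := by
  unfold sectionPt
  fun_prop

theorem mem_closure_regularPoints {s : Finset ((Fin N → ℝ) × ℝ × ℝ)} (hs : ∀ q ∈ s, q.1 ≠ 0)
    {P : JacobiSpace N} (hP : 0 < P.1.im) : P ∈ closure (regularPoints s) := by
  rw [exists_sectionPt hP]
  generalize (fun j => (P.2 j).im / P.1.im) = α
  generalize (fun j => (P.2 j).re - (P.2 j).im / P.1.im * P.1.re) = β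
  have hc : Continuous fun a : Fin N → ℝ => sectionPt a β P.1 :=
    continuous_sectionPt.comp (by fun_prop : Continuous fun a : Fin N → ℝ => (a, β, P.1))
  exact map_mem_closure (f := fun a : Fin N → ℝ => sectionPt a β P.1) hc (dense_genericDir hs α)
    fun a ha => sectionPt_mem_regularPoints ha β hP

/-- The open set of points of the Jacobi upper half plane at which `φ` is real-analytic. -/
def analyticDomain (φ : JacobiSpace N → ℂ) : Set (JacobiSpace N) :=
  {P | 0 < P.1.im ∧ AnalyticAt ℝ φ P}

theorem isOpen_im_pos : IsOpen {P : JacobiSpace N | 0 < P.1.im} :=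
  isOpen_lt continuous_const (Complex.continuous_im.comp continuous_fst)

theorem isOpen_analyticDomain (φ : JacobiSpace N → ℂ) : IsOpen (analyticDomain φ) :=
  isOpen_im_pos.inter (isOpen_analyticAt ℝ φ)

/-- Regular points are dense and both functions are continuous near `P`, so agreement at regular
points is agreement everywhere nearby. -/
theorem eventuallyEq_of_regular {s : Finset ((Fin N → ℝ) × ℝ × ℝ)} (hs : ∀ q ∈ s, q.1 ≠ 0)
    {P : JacobiSpace N} (hP : 0 < P.1.im) {F G : JacobiSpace N → ℂ} (hF : AnalyticAt ℝ F P)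
    (hG : AnalyticAt ℝ G P) (h : ∀ᶠ Q in 𝓝 P, Q ∈ regularPoints s → F Q = G Q) :
    F =ᶠ[𝓝 P] G := by
  filter_upwards [hF.eventually_analyticAt, hG.eventually_analyticAt, h.eventually_nhds,
    isOpen_im_pos.mem_nhds hP] with Q h1 h2 h3 h4
  have hcl : Q ∈ closure (regularPoints s) := mem_closure_regularPoints hs h4
  rw [mem_closure_iff_nhdsWithin_neBot] at hcl
  have t1 : Filter.Tendsto F (𝓝[regularPoints s] Q) (𝓝 (F Q)) :=
    h1.continuousAt.tendsto.mono_left nhdsWithin_le_nhds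
  have t2 : Filter.Tendsto G (𝓝[regularPoints s] Q) (𝓝 (G Q)) :=
    h2.continuousAt.tendsto.mono_left nhdsWithin_le_nhds
  refine tendsto_nhds_unique_of_eventuallyEq t1 t2 ?_
  rw [Filter.EventuallyEq, eventually_nhdsWithin_iff]
  exact h3

/-- The defining equations are given off the singular locus only, whereas `U` may lie over points of
the locus at which `φ` happens to be analytic. This lemma passes from the one to the other. -/
theorem eq_zero_of_regular {s : Finset ((Fin N → ℝ) × ℝ × ℝ)} (hs : ∀ q ∈ s, q.1 ≠ 0)
    {φ F : JacobiSpace N → ℂ} (hF : ∀ P ∈ analyticDomain φ, AnalyticAt ℝ F P)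
    (h : ∀ P ∈ regularPoints s, F P = 0) : ∀ P ∈ analyticDomain φ, F P = 0 := fun P hP =>
  (eventuallyEq_of_regular hs hP.1 (hF P hP) (analyticAt_const (v := (0 : ℂ)))
    (Filter.Eventually.of_forall h)).eq_of_nhds

/-! ### Elliptic translations -/

theorem shiftZ_jacobiAct_one (lam mu lam' mu' : Fin N → ℤ) (P : JacobiSpace N) :
    shiftZ lam' mu' (jacobiAct 1 lam mu P) = shiftZ (lam' + lam) (mu' + mu) P := by
  ext j
  simp only [jacobiAct, shiftZ, denomJ, Matrix.SpecialLinearGroup.coe_one]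
  simp
  ring

theorem jacobiAct_one_fst (lam mu : Fin N → ℤ) (P : JacobiSpace N) :
    (jacobiAct 1 lam mu P).1 = P.1 := by
  simp [jacobiAct, denomJ]

theorem jacobiAct_one_snd (lam mu : Fin N → ℤ) (P : JacobiSpace N) :
    (jacobiAct 1 lam mu P).2 = shiftZ lam mu P := by
  ext j
  simp [jacobiAct, denomJ]

theorem jacobiAct_one_mem_regularPoints {s : Finset ((Fin N → ℝ) × ℝ × ℝ)} (lam mu : Fin N → ℤ)
    {P : JacobiSpace N} (hP : P ∈ regularPoints s) : jacobiAct 1 lam mu P ∈ regularPoints s := by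
  refine ⟨by rw [jacobiAct_one_fst]; exact hP.1, ?_⟩
  rintro ⟨q, hq, lam', mu', h⟩
  refine hP.2 ⟨q, hq, lam' + lam, mu' + mu, ?_⟩
  rwa [shiftZ_jacobiAct_one, jacobiAct_one_fst] at h

/-- The elliptic factor of automorphy. -/
def ellFactor (L : Matrix (Fin N) (Fin N) ℝ) (lam : Fin N → ℤ) (P : JacobiSpace N) : ℂ :=
  Complex.exp (2 * Real.pi * I * (2 * ((fun j => (lam j : ℂ)) ⬝ᵥ (toC L *ᵥ P.2))
          + qfC L (fun j => (lam j : ℂ)) * P.1))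

theorem slash_one (k : ℤ) (L : Matrix (Fin N) (Fin N) ℝ) (φ : JacobiSpace N → ℂ)
    (lam mu : Fin N → ℤ) (P : JacobiSpace N) :
    slash k L φ 1 lam mu P = ellFactor L lam P * φ (jacobiAct 1 lam mu P) := by
  simp [slash, ellFactor, denomJ]

/-- The translation `(τ, z) ↦ (τ, z + λ τ)`. -/
def transL (lam : Fin N → ℝ) : JacobiSpace N →ₗ[ℂ] JacobiSpace N where
  toFun P := (P.1, fun j => P.2 j + (lam j : ℂ) * P.1)
  map_add' P Q := by ext j <;> simp; ring
  map_smul' a P := by ext j <;> simp; ring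

/-- The translation `(τ, z) ↦ (τ, z + λ τ)`, as an automorphism. -/
def transE (lam : Fin N → ℝ) : JacobiSpace N ≃L[ℂ] JacobiSpace N :=
  LinearEquiv.toContinuousLinearEquiv
    { transL lam with
      invFun := transL (-lam)
      left_inv := fun P => by ext j <;> simp [transL]
      right_inv := fun P => by ext j <;> simp [transL] }

theorem transE_apply (lam : Fin N → ℝ) (P : JacobiSpace N) :
    transE lam P = (P.1, fun j => P.2 j + (lam j : ℂ) * P.1) := rfl

theorem transE_dirZ (lam e : Fin N → ℝ) : transE lam (dirZ e) = dirZ e := by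
  simp [transE_apply, dirZ]

theorem transE_dirTau (lam : Fin N → ℝ) :
    transE lam (dirTau - dirZ lam) = dirTau := by
  simp only [transE_apply, dirZ, dirTau]
  ext j <;> simp

theorem wirtG_comp_transE (s : ℂ) (lam : Fin N → ℝ) (d : JacobiSpace N) (F : JacobiSpace N → ℂ) :
    wirtG s d (fun Q => F (transE lam Q)) = fun P => wirtG s (transE lam d) F (transE lam P) := by
  funext P
  have h : fderiv ℝ (fun Q => F (transE lam Q)) P = (fderiv ℝ F (transE lam P)).comp
      ((transE lam).restrictScalars ℝ : JacobiSpace N →L[ℝ] JacobiSpace N) :=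
    ContinuousLinearEquiv.comp_right_fderiv ((transE lam).restrictScalars ℝ)
  simp only [wirtG, h]
  simp

/-! ### The Casimir operator with a general modular direction -/

/-- The Casimir operator, with the direction of `τ` replaced by `δ`. -/
def casD (k : ℤ) (L : Matrix (Fin N) (Fin N) ℝ) (δ : JacobiSpace N) (F : JacobiSpace N → ℂ)
    (P : JacobiSpace N) : ℂ :=
  (-2) * (4 * (P.1.im : ℂ) ^ 2 * wirtG (-I) δ (wirtG I δ F) P
    - 2 * (kappa k N) * I * P.1.im * wirtG I δ F P)
  + 2 * (P.1.im : ℂ) ^ 2 * (wirtG I δ (opP L F) P + wirtG (-I) δ (opQ L F) P)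
  - 8 * (P.1.im : ℂ) * (∑ j, vNdC L P j * wirtG (-I) δ (dZBar (stdVec j) F) P)
  - (1 / 2) * (P.1.im : ℂ) ^ 2 * (opQ L (opP L F) P - opR L (opR L F) P)
  + 2 * (P.1.im : ℂ) * (∑ j, vNdC L P j * dZBar (stdVec j) (opZU L F) P)
  - (1 / 2) * (2 * (k : ℂ) - (N : ℂ) + 1) * I * (P.1.im : ℂ) * opZBarU L F P
  + 2 * (∑ i, ∑ j, vNdC L P i * vNdC L P j * dZBar (stdVec i) (dZBar (stdVec j) F) P)
  + (2 * (k : ℂ) - (N : ℂ) - 1) * I * (∑ j, vNdC L P j * dZBar (stdVec j) F P)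

theorem casimir_eq_casD (k : ℤ) (L : Matrix (Fin N) (Fin N) ℝ) (F : JacobiSpace N → ℂ) :
    casimir k L F = casD k L dirTau F := by
  funext P
  simp only [casimir, casD, laplace, dTau_eq, dTauBar_eq]

/-- The general second order operator `∑ S_ij ∂_i ∂_j` with constant coefficients. -/
def op2 (S : Fin N → Fin N → ℂ) (s t : ℂ) (F : JacobiSpace N → ℂ) (P : JacobiSpace N) : ℂ :=
  ∑ i, ∑ j, S i j * wirtG s (dirZ (stdVec i)) (wirtG t (dirZ (stdVec j)) F) P

theorem opP_eq (L : Matrix (Fin N) (Fin N) ℝ) : opP L = op2 (scrInv L) (-I) (-I) := by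
  funext F P; simp only [opP, op2, dZ_eq]

theorem opQ_eq (L : Matrix (Fin N) (Fin N) ℝ) : opQ L = op2 (scrInv L) I I := rfl

theorem opR_eq (L : Matrix (Fin N) (Fin N) ℝ) : opR L = op2 (scrInv L) I (-I) := by
  funext F P; simp only [opR, op2, dZ_eq, dZBar_eq]

theorem dU_eq (j : Fin N) : dU j = fun F P =>
    wirtG (-I) (dirZ (stdVec j)) F P + wirtG I (dirZ (stdVec j)) F P := by
  funext F P; simp only [dU, dZ_eq, dZBar_eq]

section Congr

variable {F G : JacobiSpace N → ℂ} {P : JacobiSpace N}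

theorem op2_congr (h : F =ᶠ[𝓝 P] G) (S : Fin N → Fin N → ℂ) (s t : ℂ) :
    op2 S s t F =ᶠ[𝓝 P] op2 S s t G := by
  filter_upwards [h.eventuallyEq_nhds] with Q hQ
  simp only [op2]
  exact Finset.sum_congr rfl fun i _ => Finset.sum_congr rfl fun j _ => by
    rw [wirtG_congr (wirtG_congr' hQ _ _)]

theorem analyticAt_op2 (hF : AnalyticAt ℝ F P) (S : Fin N → Fin N → ℂ) (s t : ℂ) :
    AnalyticAt ℝ (op2 S s t F) P := by
  unfold op2
  refine Finset.analyticAt_fun_sum _ fun i _ => Finset.analyticAt_fun_sum _ fun j _ => ?_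
  exact analyticAt_const.mul (analyticAt_wirtG (analyticAt_wirtG hF _ _) _ _)

theorem dU_congr (h : F =ᶠ[𝓝 P] G) (j : Fin N) : dU j F =ᶠ[𝓝 P] dU j G := by
  filter_upwards [h.eventuallyEq_nhds] with Q hQ
  simp only [dU_eq]
  rw [wirtG_congr hQ, wirtG_congr hQ]

theorem opZU_congr (h : F =ᶠ[𝓝 P] G) (L : Matrix (Fin N) (Fin N) ℝ) :
    opZU L F =ᶠ[𝓝 P] opZU L G := by
  filter_upwards [h.eventuallyEq_nhds] with Q hQ
  simp only [opZU, dZ_eq]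
  exact Finset.sum_congr rfl fun i _ => Finset.sum_congr rfl fun j _ => by
    rw [wirtG_congr (dU_congr hQ _)]

theorem opZBarU_congr (h : F =ᶠ[𝓝 P] G) (L : Matrix (Fin N) (Fin N) ℝ) :
    opZBarU L F =ᶠ[𝓝 P] opZBarU L G := by
  filter_upwards [h.eventuallyEq_nhds] with Q hQ
  simp only [opZBarU, dZBar_eq]
  exact Finset.sum_congr rfl fun i _ => Finset.sum_congr rfl fun j _ => by
    rw [wirtG_congr (dU_congr hQ _)]

theorem casD_congr (h : F =ᶠ[𝓝 P] G) (k : ℤ) (L : Matrix (Fin N) (Fin N) ℝ)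
    (δ : JacobiSpace N) : casD k L δ F P = casD k L δ G P := by
  simp only [casD, opP_eq, opQ_eq, opR_eq, dZBar_eq]
  rw [wirtG_congr (wirtG_congr' h _ _), wirtG_congr h, wirtG_congr (op2_congr h _ _ _),
    wirtG_congr (op2_congr h _ _ _), (op2_congr (op2_congr h _ _ _) _ _ _).eq_of_nhds,
    (op2_congr (op2_congr h _ _ _) _ _ _).eq_of_nhds, (opZBarU_congr h L).eq_of_nhds]
  have e1 : ∀ j, wirtG I (dirZ (stdVec j)) F P = wirtG I (dirZ (stdVec j)) G P :=
    fun j => wirtG_congr h _ _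
  have e2 : ∀ j, wirtG (-I) δ (wirtG I (dirZ (stdVec j)) F) P
      = wirtG (-I) δ (wirtG I (dirZ (stdVec j)) G) P :=
    fun j => wirtG_congr (wirtG_congr' h _ _) _ _
  have e3 : ∀ i j, wirtG I (dirZ (stdVec i)) (wirtG I (dirZ (stdVec j)) F) P
      = wirtG I (dirZ (stdVec i)) (wirtG I (dirZ (stdVec j)) G) P :=
    fun i j => wirtG_congr (wirtG_congr' h _ _) _ _
  have e4 : ∀ j, wirtG I (dirZ (stdVec j)) (opZU L F) P
      = wirtG I (dirZ (stdVec j)) (opZU L G) P := fun j => wirtG_congr (opZU_congr h L) _ _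
  simp only [e1, e2, e3, e4]

theorem analyticAt_dU (hF : AnalyticAt ℝ F P) (j : Fin N) : AnalyticAt ℝ (dU j F) P := by
  rw [dU_eq]; exact (analyticAt_wirtG hF _ _).add (analyticAt_wirtG hF _ _)

theorem analyticAt_opZU (hF : AnalyticAt ℝ F P) (L : Matrix (Fin N) (Fin N) ℝ) :
    AnalyticAt ℝ (opZU L F) P := by
  unfold opZU
  simp only [dZ_eq]
  exact Finset.analyticAt_fun_sum _ fun i _ => Finset.analyticAt_fun_sum _ fun j _ =>
    analyticAt_const.mul (analyticAt_wirtG (analyticAt_dU hF j) _ _)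

theorem analyticAt_opZBarU (hF : AnalyticAt ℝ F P) (L : Matrix (Fin N) (Fin N) ℝ) :
    AnalyticAt ℝ (opZBarU L F) P := by
  unfold opZBarU
  simp only [dZBar_eq]
  exact Finset.analyticAt_fun_sum _ fun i _ => Finset.analyticAt_fun_sum _ fun j _ =>
    analyticAt_const.mul (analyticAt_wirtG (analyticAt_dU hF j) _ _)

theorem analyticAt_im (P : JacobiSpace N) :
    AnalyticAt ℝ (fun P : JacobiSpace N => (P.1.im : ℂ)) P := analyticAt_imFun fstL P

theorem analyticAt_vNdC (L : Matrix (Fin N) (Fin N) ℝ) (j : Fin N) (P : JacobiSpace N) :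
    AnalyticAt ℝ (fun P => vNdC L P j) P := by
  rw [vNdC_eq_imFun]; exact analyticAt_imFun _ P

end Congr

/-- The part of the definition of a harmonic Maass-Jacobi form that does not involve a frame. -/
structure IsCasimirForm (k : ℤ) (L : Matrix (Fin N) (Fin N) ℝ)
    (s : Finset ((Fin N → ℝ) × ℝ × ℝ)) (φ : JacobiSpace N → ℂ) : Prop where
  index : IsJacobiIndex L
  sing : HasAlmostMeromorphicSingularities s φ
  inv : ∀ γ lam mu, ∀ P ∈ regularPoints s, jacobiAct γ lam mu P ∈ regularPoints s →
      slash k L φ γ lam mu P = φ P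
  cas : ∀ P ∈ regularPoints s, casimir k L φ P = 0

/-! ### Translations by lattice vectors in the radical of `L`. -/

section Translation

variable {k : ℤ} {L : Matrix (Fin N) (Fin N) ℝ} {s : Finset ((Fin N → ℝ) × ℝ × ℝ)}
  {φ : JacobiSpace N → ℂ}

theorem IsCasimirForm.mem_analyticDomain (h : IsCasimirForm k L s φ) {P : JacobiSpace N}
    (hP : P ∈ regularPoints s) : P ∈ analyticDomain φ := ⟨hP.1, h.sing.analytic P hP⟩

theorem IsCasimirForm.eq_zero (h : IsCasimirForm k L s φ) {F : JacobiSpace N → ℂ}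
    (hF : ∀ P ∈ analyticDomain φ, AnalyticAt ℝ F P)
    (h0 : ∀ P ∈ regularPoints s, F P = 0) : ∀ P ∈ analyticDomain φ, F P = 0 :=
  eq_zero_of_regular h.sing.nonzero hF h0

theorem IsCasimirForm.elliptic (h : IsCasimirForm k L s φ) (lam mu : Fin N → ℤ)
    {P : JacobiSpace N} (hP : P ∈ regularPoints s) :
    ellFactor L lam P * φ (jacobiAct 1 lam mu P) = φ P := by
  rw [← slash_one k]
  exact h.inv 1 lam mu P hP (jacobiAct_one_mem_regularPoints lam mu hP)

theorem toC_mulVec_intCast (L : Matrix (Fin N) (Fin N) ℝ) (v : Fin N → ℝ) :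
    toC L *ᵥ (fun j => (v j : ℂ)) = fun i => ((L *ᵥ v) i : ℂ) := by
  ext i
  simp [Matrix.mulVec, dotProduct, toC]

theorem ellFactor_of_ker (hL : L.IsSymm) {lam : Fin N → ℤ}
    (hlam : L *ᵥ (fun j => (lam j : ℝ)) = 0) (P : JacobiSpace N) : ellFactor L lam P = 1 := by
  have h1 : toC L *ᵥ (fun j => (lam j : ℂ)) = 0 := by
    have := toC_mulVec_intCast L (fun j => (lam j : ℝ))
    rw [hlam] at this
    simpa [funext_iff] using this
  have h2 : (fun j => (lam j : ℂ)) ⬝ᵥ (toC L *ᵥ P.2) = 0 := by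
    have hs : (toC L).IsSymm := by
      rw [Matrix.IsSymm, toC, ← Matrix.transpose_map, hL]
    rw [Matrix.dotProduct_mulVec, ← Matrix.mulVec_transpose, hs, h1, zero_dotProduct]
  rw [ellFactor, h2, qfC, h1]
  simp

theorem jacobiAct_one_eq_transE (lam : Fin N → ℤ) (P : JacobiSpace N) :
    jacobiAct 1 lam 0 P = transE (fun j => (lam j : ℝ)) P := by
  refine Prod.ext (jacobiAct_one_fst _ _ _) ?_
  rw [jacobiAct_one_snd, transE_apply]
  ext j
  simp [shiftZ]

theorem vNdC_transE {lam : Fin N → ℝ} (hlam : L *ᵥ lam = 0) (P : JacobiSpace N) (j : Fin N) :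
    vNdC L (transE lam P) j = vNdC L P j := by
  have h1 : (imPart (transE lam P)).2 = (imPart P).2 + P.1.im • lam := by
    ext i
    simp [imPart, transE_apply, mul_comm]
  rw [vNdC, vNd, h1, Matrix.mulVec_add, Matrix.mulVec_smul, projNd_mulVec_of_ker L hlam]
  simp [vNdC, vNd]

theorem op2_comp_transE (S : Fin N → Fin N → ℂ) (a b : ℂ) (lam : Fin N → ℝ)
    (F : JacobiSpace N → ℂ) :
    op2 S a b (fun Q => F (transE lam Q)) = fun Q => op2 S a b F (transE lam Q) := by
  funext Q
  simp only [op2, wirtG_comp_transE, transE_dirZ]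

/-- A radical translation fixes the elliptic directions and preserves both `y` and `π_nd v`. In the
Casimir operator only the direction that plays the role of `τ` changes. -/
theorem casD_comp_transE {lam : Fin N → ℝ} (hlam : L *ᵥ lam = 0) (δ : JacobiSpace N)
    (F : JacobiSpace N → ℂ) (P : JacobiSpace N) :
    casD k L δ (fun Q => F (transE lam Q)) P = casD k L (transE lam δ) F (transE lam P) := by
  have h1 : ∀ j, dU j (fun Q => F (transE lam Q)) = fun Q => dU j F (transE lam Q) := by
    intro j; funext Q
    simp only [dU_eq, wirtG_comp_transE, transE_dirZ]
  have h2 : opZU L (fun Q => F (transE lam Q)) = fun Q => opZU L F (transE lam Q) := by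
    funext Q
    simp only [opZU, dZ_eq, h1, wirtG_comp_transE, transE_dirZ]
  have h3 : opZBarU L (fun Q => F (transE lam Q)) = fun Q => opZBarU L F (transE lam Q) := by
    funext Q
    simp only [opZBarU, dZBar_eq, h1, wirtG_comp_transE, transE_dirZ]
  have h4 : (transE lam P).1 = P.1 := rfl
  simp only [casD, opP_eq, opQ_eq, opR_eq, dZBar_eq, h2, h3, op2_comp_transE, wirtG_comp_transE,
    transE_dirZ, vNdC_transE hlam, h4]

/-- For `λ` in the radical the factor of automorphy is `1`, so `φ` itself is invariant. The Casimir
equation at the translated point then reads as an equation at `P` with the direction `∂_τ - ∂_λ` in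
place of `∂_τ`. -/
theorem IsCasimirForm.casD_ker (h : IsCasimirForm k L s φ) {lam : Fin N → ℤ}
    (hlam : L *ᵥ (fun j => (lam j : ℝ)) = 0) {P : JacobiSpace N} (hP : P ∈ regularPoints s) :
    casD k L (dirTau - dirZ (fun j => (lam j : ℝ))) φ P = 0 := by
  set l : Fin N → ℝ := fun j => (lam j : ℝ) with hl
  have hT : ∀ Q ∈ regularPoints s, transE l Q ∈ regularPoints s := fun Q hQ => by
    rw [← jacobiAct_one_eq_transE]; exact jacobiAct_one_mem_regularPoints lam 0 hQ
  have hev : (fun Q => φ (transE l Q)) =ᶠ[𝓝 P] φ := by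
    refine eventuallyEq_of_regular h.sing.nonzero hP.1 ?_ (h.sing.analytic P hP)
      (Filter.Eventually.of_forall fun Q hQ => ?_)
    · have hT2 : AnalyticAt ℝ (fun Q => transE l Q) P :=
        ContinuousLinearMap.analyticAt
          ((transE l).restrictScalars ℝ : JacobiSpace N →L[ℝ] JacobiSpace N) P
      exact (h.sing.analytic _ (hT P hP)).comp hT2
    · have := h.elliptic lam 0 hQ
      rwa [ellFactor_of_ker h.index.symm hlam, one_mul, jacobiAct_one_eq_transE] at this
  rw [← casD_congr hev, casD_comp_transE hlam, transE_dirTau, ← casimir_eq_casD]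
  exact h.cas _ (hT P hP)

/-- The part of the translated Casimir operator that is linear in the translation. -/
def casLin (k : ℤ) (L : Matrix (Fin N) (Fin N) ℝ) (lam : Fin N → ℝ) (F : JacobiSpace N → ℂ)
    (P : JacobiSpace N) : ℂ :=
  8 * (P.1.im : ℂ) ^ 2 * (wirtG (-I) (dirZ lam) (wirtG I dirTau F) P
      + wirtG (-I) dirTau (wirtG I (dirZ lam) F) P)
  - 4 * (kappa k N) * I * P.1.im * wirtG I (dirZ lam) F P
  - 2 * (P.1.im : ℂ) ^ 2 * (wirtG I (dirZ lam) (opP L F) P + wirtG (-I) (dirZ lam) (opQ L F) P)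
  + 8 * (P.1.im : ℂ) * (∑ j, vNdC L P j * wirtG (-I) (dirZ lam) (wirtG I (dirZ (stdVec j)) F) P)

theorem wirtG_dir_sub_fun (a : ℂ) (d d' : JacobiSpace N) (F : JacobiSpace N → ℂ) :
    wirtG a (d - d') F = fun P => wirtG a d F P - wirtG a d' F P := by
  funext P; exact wirtG_dir_sub

theorem wirtG_dir_add_fun (a : ℂ) (d d' : JacobiSpace N) (F : JacobiSpace N → ℂ) :
    wirtG a (d + d') F = fun P => wirtG a d F P + wirtG a d' F P := by
  funext P; exact wirtG_dir_add

theorem wirtG_dir_smul_fun (a : ℂ) (r : ℝ) (d : JacobiSpace N) (F : JacobiSpace N → ℂ) :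
    wirtG a (r • d) F = fun P => (r : ℂ) * wirtG a d F P := by
  funext P; exact wirtG_dir_smul r

/-- The modular direction occurs twice in the term `∂_τ ∂_τ̄` and at most once elsewhere. The
operator is thus a polynomial of degree two in `λ`, with the quadratic part as displayed. -/
theorem casD_expand {F : JacobiSpace N → ℂ} {P : JacobiSpace N} (hF : AnalyticAt ℝ F P)
    (lam : Fin N → ℝ) : casD k L (dirTau - dirZ lam) F P = casD k L dirTau F P
      + casLin k L lam F P
      - 8 * (P.1.im : ℂ) ^ 2 * wirtG (-I) (dirZ lam) (wirtG I (dirZ lam) F) P := by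
  have d1 : ∀ d, DifferentiableAt ℝ (wirtG I d F) P :=
    fun d => (analyticAt_wirtG hF _ _).differentiableAt
  simp only [casD, casLin, dZBar_eq, wirtG_dir_sub, wirtG_dir_sub_fun I,
    wirtG_sub (d1 dirTau) (d1 (dirZ lam)), mul_sub, Finset.sum_sub_distrib]
  ring

theorem casLin_add {F : JacobiSpace N → ℂ} {P : JacobiSpace N} (hF : AnalyticAt ℝ F P)
    (a b : Fin N → ℝ) :
    casLin k L (a + b) F P = casLin k L a F P + casLin k L b F P := by
  have d1 : ∀ d, DifferentiableAt ℝ (wirtG I d F) P :=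
    fun d => (analyticAt_wirtG hF _ _).differentiableAt
  simp only [casLin, dirZ_add, wirtG_dir_add, wirtG_dir_add_fun,
    wirtG_add (d1 (dirZ a)) (d1 (dirZ b)), mul_add, Finset.sum_add_distrib]
  ring

theorem casLin_smul {F : JacobiSpace N → ℂ} {P : JacobiSpace N} (hF : AnalyticAt ℝ F P)
    (r : ℝ) (a : Fin N → ℝ) : casLin k L (r • a) F P = r * casLin k L a F P := by
  have d1 : ∀ d, DifferentiableAt ℝ (wirtG I d F) P :=
    fun d => (analyticAt_wirtG hF _ _).differentiableAt
  simp only [casLin, dirZ_smul, wirtG_dir_smul, wirtG_dir_smul_fun,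
    wirtG_const_mul _ (d1 (dirZ a)), mul_left_comm _ (r : ℂ), ← Finset.mul_sum]
  ring

/-- The polarised mixed second derivative. -/
def mixed (a b : Fin N → ℝ) (F : JacobiSpace N → ℂ) (P : JacobiSpace N) : ℂ :=
  wirtG (-I) (dirZ a) (wirtG I (dirZ b) F) P

theorem mixed_add_left (a a' b : Fin N → ℝ) (F : JacobiSpace N → ℂ) (P : JacobiSpace N) :
    mixed (a + a') b F P = mixed a b F P + mixed a' b F P := by
  simp only [mixed, dirZ_add, wirtG_dir_add]

theorem mixed_smul_left (r : ℝ) (a b : Fin N → ℝ) (F : JacobiSpace N → ℂ) (P : JacobiSpace N) :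
    mixed (r • a) b F P = r * mixed a b F P := by
  simp only [mixed, dirZ_smul, wirtG_dir_smul]

theorem mixed_add_right {F : JacobiSpace N → ℂ} {P : JacobiSpace N} (hF : AnalyticAt ℝ F P)
    (a b b' : Fin N → ℝ) : mixed a (b + b') F P = mixed a b F P + mixed a b' F P := by
  have d1 : ∀ d, DifferentiableAt ℝ (wirtG I d F) P :=
    fun d => (analyticAt_wirtG hF _ _).differentiableAt
  simp only [mixed, dirZ_add, wirtG_dir_add_fun, wirtG_add (d1 _) (d1 _)]

theorem mixed_smul_right {F : JacobiSpace N → ℂ} {P : JacobiSpace N} (hF : AnalyticAt ℝ F P)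
    (r : ℝ) (a b : Fin N → ℝ) : mixed a (r • b) F P = r * mixed a b F P := by
  have d1 : ∀ d, DifferentiableAt ℝ (wirtG I d F) P :=
    fun d => (analyticAt_wirtG hF _ _).differentiableAt
  simp only [mixed, dirZ_smul, wirtG_dir_smul_fun, wirtG_const_mul _ (d1 _)]

/-- Both `λ` and `-λ` are admissible; the odd part of the expansion is the linear term and the even
part is the mixed second derivative. -/
theorem IsCasimirForm.casD_ker_parts (h : IsCasimirForm k L s φ) {lam : Fin N → ℤ}
    (hlam : L *ᵥ (fun j => (lam j : ℝ)) = 0) {P : JacobiSpace N} (hP : P ∈ regularPoints s) :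
    casLin k L (fun j => (lam j : ℝ)) φ P = 0 ∧
      mixed (fun j => (lam j : ℝ)) (fun j => (lam j : ℝ)) φ P = 0 := by
  have hF := h.sing.analytic P hP
  set l : Fin N → ℝ := fun j => (lam j : ℝ) with hl
  have hneg : (fun j => (((-lam) j : ℤ) : ℝ)) = (-1 : ℝ) • l := by ext j; simp [hl]
  have hlam' : L *ᵥ (fun j => (((-lam) j : ℤ) : ℝ)) = 0 := by
    rw [hneg, Matrix.mulVec_smul, hlam, smul_zero]
  have e0 : casD k L dirTau φ P = 0 := by rw [← casimir_eq_casD]; exact h.cas P hP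
  have e1 := h.casD_ker hlam hP
  have e2 := h.casD_ker hlam' hP
  rw [casD_expand hF, e0, ← hl] at e1
  rw [casD_expand hF, e0, hneg, casLin_smul hF] at e2
  have m1 : mixed l l φ P = wirtG (-I) (dirZ l) (wirtG I (dirZ l) φ) P := rfl
  have m2 : wirtG (-I) (dirZ ((-1 : ℝ) • l)) (wirtG I (dirZ ((-1 : ℝ) • l)) φ) P
      = mixed l l φ P := by
    change mixed _ _ φ P = _
    rw [mixed_smul_left, mixed_smul_right hF]; push_cast; ring
  rw [← m1] at e1
  rw [m2] at e2
  push_cast at e2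
  have hy : (P.1.im : ℂ) ≠ 0 := by exact_mod_cast hP.1.ne'
  constructor
  · linear_combination (e1 - e2) / 2
  · have : (P.1.im : ℂ) ^ 2 * mixed l l φ P = 0 := by linear_combination (-1 / 16) * (e1 + e2)
    exact (mul_eq_zero.mp this).resolve_left (pow_ne_zero 2 hy)

theorem analyticAt_casLin {F : JacobiSpace N → ℂ} {P : JacobiSpace N} (hF : AnalyticAt ℝ F P)
    (lam : Fin N → ℝ) : AnalyticAt ℝ (casLin k L lam F) P := by
  unfold casLin
  simp only [opP_eq, opQ_eq]
  have hw := fun a d => analyticAt_wirtG hF a d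
  have hww := fun a d b e => analyticAt_wirtG (hw a d) b e
  have hop := fun S a b c d => analyticAt_wirtG (analyticAt_op2 hF S a b) c d
  have hy := analyticAt_im P
  refine (((analyticAt_const.mul (hy.pow 2)).mul ((hww _ _ _ _).add (hww _ _ _ _))).sub ?_
    |>.sub ?_).add ?_
  · exact (analyticAt_const.mul hy).mul (hw _ _)
  · exact (analyticAt_const.mul (hy.pow 2)).mul ((hop _ _ _ _ _).add (hop _ _ _ _ _))
  · exact (analyticAt_const.mul hy).mul (Finset.analyticAt_fun_sum _ fun j _ =>
      (analyticAt_vNdC L j P).mul (hww _ _ _ _))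

/-- The linear part of the translated Casimir operator annihilates the form, for all translations
in the radical. -/
theorem IsCasimirForm.casLin_eq_zero (h : IsCasimirForm k L s φ) {lam : Fin N → ℝ}
    (hlam : L *ᵥ lam = 0) : ∀ P ∈ analyticDomain φ, casLin k L lam φ P = 0 := by
  refine h.eq_zero (fun P hP => analyticAt_casLin hP.2 lam) fun P hP => ?_
  have hF := h.sing.analytic P hP
  -- The expression is linear in the translation, and the radical is spanned over `ℝ` by its lattice
  -- vectors.
  refine Submodule.span_induction (p := fun x _ => casLin k L x φ P = 0) ?_ ?_ ?_ ?_
    (ker_le_span_int h.index hlam)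
  · rintro x ⟨hx, l, hl⟩
    obtain rfl : x = fun j => (l j : ℝ) := funext hl
    exact (h.casD_ker_parts hx hP).1
  · have := casLin_smul (k := k) (L := L) hF 0 0
    simpa using this
  · intro x y _ _ hx hy
    rw [casLin_add hF, hx, hy, add_zero]
  · intro r x _ hx
    rw [casLin_smul hF, hx, mul_zero]

/-- The mixed derivatives along the radical. -/
theorem IsCasimirForm.mixed_add_mixed (h : IsCasimirForm k L s φ) {a b : Fin N → ℝ}
    (ha : L *ᵥ a = 0) (hb : L *ᵥ b = 0) :
    ∀ P ∈ analyticDomain φ, mixed a b φ P + mixed b a φ P = 0 := by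
  refine h.eq_zero (fun P hP => ?_) fun P hP => ?_
  · exact (analyticAt_wirtG (analyticAt_wirtG hP.2 _ _) _ _).add
      (analyticAt_wirtG (analyticAt_wirtG hP.2 _ _) _ _)
  have hF := h.sing.analytic P hP
  have add' : ∀ x y z : Fin N → ℝ, mixed (x + y) z φ P + mixed z (x + y) φ P
      = (mixed x z φ P + mixed z x φ P) + (mixed y z φ P + mixed z y φ P) := fun x y z => by
    rw [mixed_add_left, mixed_add_right hF]; ring
  have smul' : ∀ (r : ℝ) (x z : Fin N → ℝ), mixed (r • x) z φ P + mixed z (r • x) φ P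
      = r * (mixed x z φ P + mixed z x φ P) := fun r x z => by
    rw [mixed_smul_left, mixed_smul_right hF]; ring
  -- The symmetrised form is bilinear. It suffices to know it on pairs of lattice vectors, where it
  -- is the polarisation of the quadratic identity in `casD_ker_parts`.
  have step : ∀ y : Fin N → ℝ, (∀ l : Fin N → ℤ, L *ᵥ (fun j => (l j : ℝ)) = 0 →
      mixed (fun j => (l j : ℝ)) y φ P + mixed y (fun j => (l j : ℝ)) φ P = 0) →
      ∀ x : Fin N → ℝ, L *ᵥ x = 0 → mixed x y φ P + mixed y x φ P = 0 := by
    intro y hy x hx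
    refine Submodule.span_induction (p := fun x _ => mixed x y φ P + mixed y x φ P = 0)
      ?_ ?_ ?_ ?_ (ker_le_span_int h.index hx)
    · rintro x ⟨hx, l, hl⟩
      obtain rfl : x = fun j => (l j : ℝ) := funext hl
      exact hy l hx
    · have := smul' 0 0 y
      simpa using this
    · intro x x' _ _ hx hx'
      rw [add', hx, hx', add_zero]
    · intro r x _ hx
      rw [smul', hx, mul_zero]
  refine step b (fun l hl => ?_) a ha
  rw [add_comm]
  refine step _ (fun m hm => ?_) b hb
  have hsum : L *ᵥ (fun j => (((m + l) j : ℤ) : ℝ)) = 0 := by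
    have : (fun j => (((m + l) j : ℤ) : ℝ)) = (fun j => (m j : ℝ)) + fun j => (l j : ℝ) := by
      ext j; simp
    rw [this, Matrix.mulVec_add, hm, hl, add_zero]
  have e1 := (h.casD_ker_parts hm hP).2
  have e2 := (h.casD_ker_parts hl hP).2
  have e3 := (h.casD_ker_parts hsum hP).2
  have : (fun j => (((m + l) j : ℤ) : ℝ)) = (fun j => (m j : ℝ)) + fun j => (l j : ℝ) := by
    ext j; simp
  rw [this, mixed_add_left, mixed_add_right hF, mixed_add_right hF, e1, e2] at e3
  linear_combination e3

end Translation

/-! ### Removable singularities of antiholomorphic quotients -/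

section OneVariable

open Filter

/-- The holomorphic derivative in one variable. -/
def dOne (F : ℂ → ℂ) (s : ℂ) : ℂ := (fderiv ℝ F s 1 - I * fderiv ℝ F s I) / 2

theorem analyticAt_dOne {F : ℂ → ℂ} {s : ℂ} (hF : AnalyticAt ℝ F s) : AnalyticAt ℝ (dOne F) s := by
  unfold dOne
  exact ((((ContinuousLinearMap.apply ℝ ℂ (1 : ℂ)).analyticAt _).comp hF.fderiv).sub
    (analyticAt_const.mul (((ContinuousLinearMap.apply ℝ ℂ I).analyticAt _).comp hF.fderiv))).div
    analyticAt_const (by norm_num)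

theorem dOne_mul_conj {F H : ℂ → ℂ} {s : ℂ} (hF : DifferentiableAt ℂ F s)
    (hH : DifferentiableAt ℂ H s) :
    dOne (fun z => F z * (starRingEnd ℂ) (H z)) s = deriv F s * (starRingEnd ℂ) (H s) := by
  have h1 : HasFDerivAt F ((fderiv ℂ F s).restrictScalars ℝ) s :=
    hF.hasFDerivAt.restrictScalars ℝ
  have h2 : HasFDerivAt H ((fderiv ℂ H s).restrictScalars ℝ) s :=
    hH.hasFDerivAt.restrictScalars ℝ
  have h3 : HasFDerivAt (fun z => (starRingEnd ℂ) (H z))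
      ((Complex.conjCLE : ℂ →L[ℝ] ℂ).comp ((fderiv ℂ H s).restrictScalars ℝ)) s :=
    (Complex.conjCLE : ℂ →L[ℝ] ℂ).hasFDerivAt.comp s h2
  have h4 := h1.mul h3
  have e1 : fderiv ℂ F s I = I * fderiv ℂ F s 1 := by
    rw [← smul_eq_mul, ← map_smul]; simp
  have e2 : fderiv ℂ H s I = I * fderiv ℂ H s 1 := by
    rw [← smul_eq_mul, ← map_smul]; simp
  have e3 : fderiv ℂ F s 1 = deriv F s := by simp
  rw [dOne]
  have h5 : (fun z => F z * (starRingEnd ℂ) (H z)) = F * fun z => (starRingEnd ℂ) (H z) := rfl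
  rw [h5, h4.fderiv]
  simp only [add_apply, smul_apply, ContinuousLinearMap.comp_apply,
    ContinuousLinearMap.coe_restrictScalars', smul_eq_mul, e1, e2, e3]
  simp only [ContinuousLinearEquiv.coe_coe, Complex.conjCLE_apply, map_mul, Complex.conj_I]
  linear_combination (-(1 / 2) * (starRingEnd ℂ) (H s) * deriv F s
    + (1 / 2) * F s * (starRingEnd ℂ) (fderiv ℂ H s 1)) * Complex.I_mul_I

/-- The holomorphic derivative ignores the conjugate of `H` and lowers the power of `s - s₀` by one,
while the left hand side stays real-analytic. After `m` derivatives the conjugate of `H` itself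
agrees with a continuous function. -/
theorem bounded_of_pow_mul_conj {s₀ : ℂ} {H : ℂ → ℂ}
    (hH : ∀ᶠ s in 𝓝[≠] s₀, DifferentiableAt ℂ H s) (m : ℕ) :
    ∀ R : ℂ → ℂ, AnalyticAt ℝ R s₀ →
      (∀ᶠ s in 𝓝[≠] s₀, R s = (s - s₀) ^ m * (starRingEnd ℂ) (H s)) →
      ∃ C, ∀ᶠ s in 𝓝[≠] s₀, ‖H s‖ ≤ C := by
  induction m with
  | zero =>
    intro R hR hRH
    refine ⟨‖R s₀‖ + 1, ?_⟩
    have hc : ∀ᶠ s in 𝓝 s₀, ‖R s‖ < ‖R s₀‖ + 1 :=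
      hR.continuousAt.norm.eventually (gt_mem_nhds (by linarith))
    filter_upwards [hRH, hc.filter_mono nhdsWithin_le_nhds] with s h1 h2
    rw [pow_zero, one_mul] at h1
    rw [h1, RCLike.norm_conj] at h2
    exact h2.le
  | succ m ih =>
    intro R hR hRH
    refine ih (fun s => dOne R s / (m + 1)) ((analyticAt_dOne hR).div analyticAt_const
      (by exact_mod_cast Nat.succ_ne_zero m)) ?_
    have hRH' : ∀ᶠ s in 𝓝[≠] s₀, ∀ᶠ z in 𝓝 s, R z = (z - s₀) ^ (m + 1) * (starRingEnd ℂ) (H z) := by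
      have := eventually_eventually_nhdsWithin.mpr hRH
      rw [eventually_nhdsWithin_iff] at this ⊢
      filter_upwards [this] with s h1 h2
      have h3 := h1 h2
      rwa [(isOpen_compl_singleton).nhdsWithin_eq h2] at h3
    filter_upwards [hRH', hH] with s h1 h2
    have h3 : dOne R s = dOne (fun z => (z - s₀) ^ (m + 1) * (starRingEnd ℂ) (H z)) s := by
      rw [dOne, dOne, Filter.EventuallyEq.fderiv_eq h1]
    have h4 : HasDerivAt (fun z : ℂ => (z - s₀) ^ (m + 1)) (((m + 1 : ℕ) : ℂ) * (s - s₀) ^ m) s := by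
      simpa using ((hasDerivAt_id s).sub_const s₀).fun_pow (m + 1)
    rw [h3, dOne_mul_conj h4.differentiableAt h2, h4.deriv]
    have : ((m : ℂ) + 1) ≠ 0 := by exact_mod_cast Nat.succ_ne_zero m
    push_cast
    field_simp

/-- If a real-analytic function is the product of a holomorphic and an antiholomorphic function
around a point, then the antiholomorphic one is bounded there. -/
theorem bounded_of_mul_conj {s₀ : ℂ} {H R h : ℂ → ℂ}
    (hH : ∀ᶠ s in 𝓝[≠] s₀, DifferentiableAt ℂ H s) (hR : AnalyticAt ℝ R s₀)
    (hh : AnalyticAt ℂ h s₀) (hh0 : ¬ ∀ᶠ s in 𝓝 s₀, h s = 0)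
    (hRH : ∀ᶠ s in 𝓝[≠] s₀, R s = h s * (starRingEnd ℂ) (H s)) :
    ∃ C, ∀ᶠ s in 𝓝[≠] s₀, ‖H s‖ ≤ C := by
  -- Write `h` as a power of `s - s₀` times a nonvanishing holomorphic `u`; the quotient `R / u` is
  -- still real-analytic.
  obtain ⟨m, u, hu, hu0, hu1⟩ := hh.exists_eventuallyEq_pow_smul_nonzero_iff.mpr hh0
  have huR : AnalyticAt ℝ u s₀ := hu.restrictScalars
  refine bounded_of_pow_mul_conj hH m (fun s => R s / u s) (hR.div huR hu0) ?_
  filter_upwards [hRH, hu1.filter_mono nhdsWithin_le_nhds,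
    (hu.continuousAt.eventually_ne hu0).filter_mono nhdsWithin_le_nhds] with s h1 h2 h3
  rw [h1, h2, smul_eq_mul]
  field_simp

/-- The extension across isolated singularities. -/
theorem differentiableAt_limUnder {s₀ : ℂ} {H : ℂ → ℂ}
    (hH : ∀ᶠ s in 𝓝[≠] s₀, DifferentiableAt ℂ H s)
    (hb : ∃ C, ∀ᶠ s in 𝓝[≠] s₀, ‖H s‖ ≤ C) :
    DifferentiableAt ℂ (fun s => limUnder (𝓝[≠] s) H) s₀ := by
  obtain ⟨C, hC⟩ := hb
  obtain ⟨U, hU, hUo⟩ := (eventually_nhdsWithin_iff.mp (hH.and hC)).exists_mem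
  have hd : DifferentiableOn ℂ H (U \ {s₀}) := fun s hs =>
    (hUo s hs.1 hs.2).1.differentiableWithinAt
  have hbd : BddAbove (norm ∘ H '' (U \ {s₀})) := by
    refine ⟨C, ?_⟩
    rintro _ ⟨s, hs, rfl⟩
    exact (hUo s hs.1 hs.2).2
  have key := Complex.differentiableOn_update_limUnder_of_bddAbove hU hd hbd
  have key2 : DifferentiableAt ℂ (Function.update H s₀ (limUnder (𝓝[≠] s₀) H)) s₀ :=
    key.differentiableAt hU
  refine key2.congr_of_eventuallyEq ?_
  filter_upwards [hU] with s hs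
  by_cases h : s = s₀
  · subst h; simp
  · rw [Function.update_of_ne h]
    exact ((hUo s hs h).1.continuousAt.tendsto.mono_left nhdsWithin_le_nhds).limUnder_eq

theorem countable_zeros_dense {T : Set ℂ} (hT : T.Countable) (s : ℂ) : (𝓝[Tᶜ] s).NeBot := by
  rw [← mem_closure_iff_nhdsWithin_neBot]
  exact hT.dense_compl ℝ s

end OneVariable

/-! ### The weight -/

/-- The function `exp (-4 π L[v] / y)`. -/
def wFun (L : Matrix (Fin N) (Fin N) ℝ) (P : JacobiSpace N) : ℂ :=
  ((Real.exp (-(4 * Real.pi) * qf L (imPart P).2 / P.1.im) : ℝ) : ℂ)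

theorem wFun_eq (L : Matrix (Fin N) (Fin N) ℝ) (P : JacobiSpace N) :
    wFun L P = Complex.exp (-(4 * Real.pi) * (∑ i, ∑ j, (L i j : ℂ) * ((P.2 i).im * (P.2 j).im))
      / (P.1.im : ℂ)) := by
  rw [wFun, Complex.ofReal_exp]
  congr 1
  push_cast [qf, imPart, dotProduct, Matrix.mulVec]
  congr 2
  refine Finset.sum_congr rfl fun i _ => ?_
  rw [Finset.mul_sum]
  exact Finset.sum_congr rfl fun j _ => by ring

theorem analyticAt_im_snd (i : Fin N) (P : JacobiSpace N) :
    AnalyticAt ℝ (fun P : JacobiSpace N => ((P.2 i).im : ℂ)) P :=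
  ContinuousLinearMap.analyticAt (Complex.ofRealCLM.comp (Complex.imCLM.comp
    ((ContinuousLinearMap.proj (R := ℝ) (φ := fun _ : Fin N => ℂ) i).comp
      (ContinuousLinearMap.snd ℝ ℂ _)))) P

theorem analyticAt_wFun (L : Matrix (Fin N) (Fin N) ℝ) {P : JacobiSpace N} (hP : 0 < P.1.im) :
    AnalyticAt ℝ (wFun L) P := by
  have h : wFun L = fun P => Complex.exp (-(4 * Real.pi) *
      (∑ i, ∑ j, (L i j : ℂ) * ((P.2 i).im * (P.2 j).im)) / (P.1.im : ℂ)) :=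
    funext (wFun_eq L)
  rw [h]
  have hy : (P.1.im : ℂ) ≠ 0 := by exact_mod_cast hP.ne'
  have hexp : ∀ w : ℂ, AnalyticAt ℝ Complex.exp w := fun w => analyticAt_cexp.restrictScalars
  refine (hexp _).comp (((analyticAt_const.mul ?_)).div (analyticAt_im P) hy)
  exact Finset.analyticAt_fun_sum _ fun i _ => Finset.analyticAt_fun_sum _ fun j _ =>
    analyticAt_const.mul ((analyticAt_im_snd i P).mul (analyticAt_im_snd j P))

theorem qf_add_smul {L : Matrix (Fin N) (Fin N) ℝ} (hL : L.IsSymm) (v e : Fin N → ℝ) (t : ℝ) :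
    qf L (v + t • e) = qf L v + 2 * t * (v ⬝ᵥ (L *ᵥ e)) + t ^ 2 * qf L e := by
  have h : e ⬝ᵥ (L *ᵥ v) = v ⬝ᵥ (L *ᵥ e) := by
    rw [Matrix.dotProduct_mulVec, ← Matrix.mulVec_transpose, hL, dotProduct_comm]
  simp only [qf, Matrix.mulVec_add, Matrix.mulVec_smul, dotProduct_add, add_dotProduct,
    dotProduct_smul, smul_dotProduct, smul_eq_mul, h]
  ring

theorem imPart_add_I_smul_dirZ (P : JacobiSpace N) (t : ℝ) (e : Fin N → ℝ) :
    imPart (P + t • (I • dirZ e)) = ((imPart P).1, (imPart P).2 + t • e) := by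
  refine Prod.ext ?_ ?_
  · simp [imPart, dirZ]
  · ext j; simp [imPart, dirZ]

theorem imPart_add_smul_dirZ (P : JacobiSpace N) (t : ℝ) (e : Fin N → ℝ) :
    imPart (P + t • dirZ e) = imPart P := by
  refine Prod.ext ?_ ?_
  · simp [imPart, dirZ]
  · ext j; simp [imPart, dirZ]

theorem wirtG_wFun {L : Matrix (Fin N) (Fin N) ℝ} (hL : L.IsSymm) (e : Fin N → ℝ)
    {P : JacobiSpace N} (hP : 0 < P.1.im) :
    wirtG (-I) (dirZ e) (wFun L) P
      = 4 * Real.pi * I * (((imPart P).2 ⬝ᵥ (L *ᵥ e) : ℝ) : ℂ) / P.1.im * wFun L P := by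
  have hd := (analyticAt_wFun L hP).differentiableAt
  have h1 : fderiv ℝ (wFun L) P (dirZ e) = 0 := by
    rw [← hd.lineDeriv_eq_fderiv, lineDeriv]
    have : (fun t : ℝ => wFun L (P + t • dirZ e)) = fun _ => wFun L P := by
      funext t
      simp only [wFun, imPart_add_smul_dirZ]
      have : (P + t • dirZ e).1.im = P.1.im := congrArg Prod.fst (imPart_add_smul_dirZ P t e)
      rw [this]
    rw [this, deriv_const]
  have h2 : fderiv ℝ (wFun L) P (I • dirZ e)
      = ((-(8 * Real.pi) * ((imPart P).2 ⬝ᵥ (L *ᵥ e)) / P.1.im : ℝ) : ℂ) * wFun L P := by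
    rw [← hd.lineDeriv_eq_fderiv, lineDeriv]
    have : (fun t : ℝ => wFun L (P + t • (I • dirZ e))) = fun t : ℝ =>
        ((Real.exp (-(4 * Real.pi) * (qf L (imPart P).2 + 2 * t * ((imPart P).2 ⬝ᵥ (L *ᵥ e))
          + t ^ 2 * qf L e) / P.1.im) : ℝ) : ℂ) := by
      funext t
      have h3 := imPart_add_I_smul_dirZ P t e
      have h4 : (P + t • (I • dirZ e)).1.im = P.1.im := congrArg Prod.fst h3
      rw [wFun, h4, h3, qf_add_smul hL]
    rw [this]
    have h5 : HasDerivAt (fun t : ℝ => -(4 * Real.pi) * (qf L (imPart P).2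
        + 2 * t * ((imPart P).2 ⬝ᵥ (L *ᵥ e)) + t ^ 2 * qf L e) / P.1.im)
        (-(8 * Real.pi) * ((imPart P).2 ⬝ᵥ (L *ᵥ e)) / P.1.im) 0 := by
      have h6 : HasDerivAt (fun t : ℝ => qf L (imPart P).2
          + 2 * t * ((imPart P).2 ⬝ᵥ (L *ᵥ e)) + t ^ 2 * qf L e)
          (2 * ((imPart P).2 ⬝ᵥ (L *ᵥ e))) 0 := by
        have := (((hasDerivAt_id (0 : ℝ)).const_mul 2).mul_const
          ((imPart P).2 ⬝ᵥ (L *ᵥ e))).const_add (qf L (imPart P).2) |>.add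
            (((hasDerivAt_id (0 : ℝ)).pow 2).mul_const (qf L e))
        refine this.congr_deriv ?_
        simp
      have := (h6.const_mul (-(4 * Real.pi))).div_const P.1.im
      refine this.congr_deriv ?_
      ring
    have h7 := (h5.exp).ofReal_comp
    rw [h7.deriv, wFun]
    simp
    ring
  rw [wirtG, h1, h2]
  push_cast
  ring

open Filter

/-! ### Extension along complex lines -/

theorem heisLaplace_eq {L : Matrix (Fin N) (Fin N) ℝ} (hL : L.IsSymm) (e : Fin N → ℝ)
    (F : JacobiSpace N → ℂ) (P : JacobiSpace N) : heisLaplace L e F P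
      = (P.1.im : ℂ) * wirtG (-I) (dirZ e) (wirtG I (dirZ e) F) P
        + 4 * Real.pi * I * (((imPart P).2 ⬝ᵥ (L *ᵥ e) : ℝ) : ℂ) * wirtG I (dirZ e) F P := by
  have h : vNd L P ⬝ᵥ (L *ᵥ e) = (imPart P).2 ⬝ᵥ (L *ᵥ e) := by
    rw [vNd, dotProduct_comm, Matrix.dotProduct_mulVec, ← Matrix.mulVec_transpose,
      projNd_isSymm L, Matrix.mulVec_mulVec, projNd_mul hL, dotProduct_comm]
  rw [heisLaplace, h, dZ_eq, dZBar_eq]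
  ring

theorem analyticAt_heisLaplace {L : Matrix (Fin N) (Fin N) ℝ} {F : JacobiSpace N → ℂ}
    {P : JacobiSpace N} (hF : AnalyticAt ℝ F P) (hL : L.IsSymm) (e : Fin N → ℝ) :
    AnalyticAt ℝ (heisLaplace L e F) P := by
  have h : heisLaplace L e F = fun P => (P.1.im : ℂ) * wirtG (-I) (dirZ e) (wirtG I (dirZ e) F) P
        + 4 * Real.pi * I * imFun (sndL (L *ᵥ e)) P * wirtG I (dirZ e) F P := by
    funext Q
    rw [heisLaplace_eq hL, imFun, sndL_apply, dotProduct_comm]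
  rw [h]
  have h1 := analyticAt_wirtG hF I (dirZ e)
  exact ((analyticAt_im P).mul (analyticAt_wirtG h1 _ _)).add
    ((analyticAt_const.mul (analyticAt_imFun _ P)).mul h1)

theorem heisLaplace_congr {L : Matrix (Fin N) (Fin N) ℝ} {F G : JacobiSpace N → ℂ}
    {P : JacobiSpace N} (h : F =ᶠ[𝓝 P] G) (e : Fin N → ℝ) :
    heisLaplace L e F P = heisLaplace L e G P := by
  simp only [heisLaplace, dZ_eq, dZBar_eq]
  rw [wirtG_congr (wirtG_congr' h _ _), wirtG_congr h]

/-- The antiholomorphic derivative in the direction `e`, multiplied by the weight. -/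
def xiW (L : Matrix (Fin N) (Fin N) ℝ) (e : Fin N → ℝ) (φ : JacobiSpace N → ℂ)
    (P : JacobiSpace N) : ℂ := wirtG I (dirZ e) φ P * wFun L P

/-- Points whose complex line in the direction `e` is not contained in the singular locus. -/
def GoodLine (s : Finset ((Fin N → ℝ) × ℝ × ℝ)) (e : Fin N → ℝ) (Q : JacobiSpace N) : Prop :=
  {z : ℂ | Q + z • dirZ e ∈ singularLocus s}.Countable

/-- Local presentation of an almost meromorphic function. -/
structure LocalPres (s : Finset ((Fin N → ℝ) × ℝ × ℝ)) (φ : JacobiSpace N → ℂ)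
    (V : Set (JacobiSpace N)) (f g h : JacobiSpace N → ℂ) : Prop where
  isOpen : IsOpen V
  pos : ∀ P ∈ V, 0 < P.1.im
  f_an : AnalyticOnNhd ℝ f V
  g_an : AnalyticOnNhd ℝ g V
  h_an : AnalyticOnNhd ℂ h V
  eq : ∀ P ∈ V \ singularLocus s, h P ≠ 0 ∧ φ P = f P / h P + g P

theorem exists_localPres {s : Finset ((Fin N → ℝ) × ℝ × ℝ)} {φ : JacobiSpace N → ℂ}
    (hs : HasAlmostMeromorphicSingularities s φ) {P : JacobiSpace N} (hP : 0 < P.1.im) :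
    ∃ V f g h, P ∈ V ∧ LocalPres s φ V f g h := by
  by_cases hS : P ∈ singularLocus s
  · obtain ⟨V, hV, hPV, hpos, f, g, h, hf, hg, hh, heq⟩ := hs.almostMeromorphic P hS hP
    exact ⟨V, f, g, h, hPV, hV, hpos, hf, hg, hh, heq⟩
  · refine ⟨analyticDomain φ, φ, fun _ => 0, fun _ => 1, ⟨hP, hs.analytic P ⟨hP, hS⟩⟩,
      isOpen_analyticDomain φ, fun Q hQ => hQ.1, fun Q hQ => hQ.2, fun Q _ => analyticAt_const,
      fun Q _ => analyticAt_const, fun Q _ => ⟨one_ne_zero, by simp⟩⟩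

section Local

variable {L : Matrix (Fin N) (Fin N) ℝ} {s : Finset ((Fin N → ℝ) × ℝ × ℝ)}
  {φ : JacobiSpace N → ℂ} {e : Fin N → ℝ} {V : Set (JacobiSpace N)}
  {f g h : JacobiSpace N → ℂ} {P : JacobiSpace N}

theorem LocalPres.analyticAt (hp : LocalPres s φ V f g h) (hP : P ∈ V) (hh : h P ≠ 0) :
    AnalyticAt ℝ (fun Q => f Q / h Q + g Q) P :=
  ((hp.f_an P hP).div (hp.h_an P hP).restrictScalars hh).add (hp.g_an P hP)

theorem LocalPres.eventuallyEq (hs : HasAlmostMeromorphicSingularities s φ)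
    (hp : LocalPres s φ V f g h) (hP : P ∈ V) (hreg : P ∈ regularPoints s) :
    φ =ᶠ[𝓝 P] fun Q => f Q / h Q + g Q := by
  refine eventuallyEq_of_regular hs.nonzero hreg.1 (hs.analytic P hreg)
    (hp.analyticAt hP (hp.eq P ⟨hP, hreg.2⟩).1) ?_
  filter_upwards [hp.isOpen.mem_nhds hP] with Q hQ hQr
  exact (hp.eq Q ⟨hQ, hQr.2⟩).2

theorem LocalPres.heis (hs : HasAlmostMeromorphicSingularities s φ)
    (hp : LocalPres s φ V f g h) (hL : L.IsSymm)
    (hH : ∀ P ∈ regularPoints s, heisLaplace L e φ P = 0) (hP : P ∈ V) (hh : h P ≠ 0) :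
    heisLaplace L e (fun Q => f Q / h Q + g Q) P = 0 := by
  have := eventuallyEq_of_regular hs.nonzero (hp.pos P hP)
    (analyticAt_heisLaplace (hp.analyticAt hP hh) hL e) (analyticAt_const (v := (0 : ℂ))) ?_
  · exact this.eq_of_nhds
  filter_upwards [hp.isOpen.mem_nhds hP] with Q hQ hQr
  rw [← heisLaplace_congr (hp.eventuallyEq hs hQ hQr)]
  exact hH Q hQr

/-- The weight is an integrating factor. Its holomorphic logarithmic derivative along `e` is `y⁻¹`
times the coefficient of the first order term of the Heisenberg operator, so `y ∂_e` of the product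
is the weight times the Heisenberg Laplacian of `F`. -/
theorem wirtG_xiW {F : JacobiSpace N → ℂ} (hL : L.IsSymm) (hP : 0 < P.1.im)
    (hF : AnalyticAt ℝ F P) (hH : heisLaplace L e F P = 0) :
    wirtG (-I) (dirZ e) (xiW L e F) P = 0 := by
  have hy : (P.1.im : ℂ) ≠ 0 := by exact_mod_cast hP.ne'
  rw [heisLaplace_eq hL] at hH
  have h1 : wirtG (-I) (dirZ e) (xiW L e F) P = _ :=
    wirtG_mul (analyticAt_wirtG hF I (dirZ e)).differentiableAt
      (analyticAt_wFun L hP).differentiableAt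
  rw [h1, wirtG_wFun hL e hP]
  field_simp
  linear_combination wFun L P * hH

theorem analyticAt_xiW {F : JacobiSpace N → ℂ} (hP : 0 < P.1.im) (hF : AnalyticAt ℝ F P) :
    AnalyticAt ℝ (xiW L e F) P := (analyticAt_wirtG hF _ _).mul (analyticAt_wFun L hP)

theorem xiW_congr {F G : JacobiSpace N → ℂ} (h : F =ᶠ[𝓝 P] G) :
    xiW L e F P = xiW L e G P := by rw [xiW, xiW, wirtG_congr h]

/-- A function annihilated by the holomorphic derivative is antiholomorphic on lines. -/
theorem differentiableAt_conj_line {F : JacobiSpace N → ℂ} {Q : JacobiSpace N} {z : ℂ}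
    {d : JacobiSpace N} (hF : DifferentiableAt ℝ F (Q + z • d))
    (h0 : wirtG (-I) d F (Q + z • d) = 0) :
    DifferentiableAt ℂ (fun w : ℂ => (starRingEnd ℂ) (F (Q + w • d))) z := by
  have hl : HasFDerivAt (fun w : ℂ => Q + w • d)
      ((ContinuousLinearMap.toSpanSingleton ℂ d).restrictScalars ℝ) z := by
    have : HasFDerivAt (fun w : ℂ => Q + w • d) (ContinuousLinearMap.toSpanSingleton ℂ d) z := by
      simpa using ((ContinuousLinearMap.toSpanSingleton ℂ d).hasFDerivAt (x := z)).const_add Q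
    exact this.restrictScalars ℝ
  have h1 : HasFDerivAt (fun w : ℂ => (starRingEnd ℂ) (F (Q + w • d)))
      ((Complex.conjCLE : ℂ →L[ℝ] ℂ).comp ((fderiv ℝ F (Q + z • d)).comp
        ((ContinuousLinearMap.toSpanSingleton ℂ d).restrictScalars ℝ))) z :=
    (Complex.conjCLE : ℂ →L[ℝ] ℂ).hasFDerivAt.comp z (hF.hasFDerivAt.comp z hl)
  have h2 : fderiv ℝ F (Q + z • d) (I • d) = -I * fderiv ℝ F (Q + z • d) d := by
    have h3 : fderiv ℝ F (Q + z • d) d + -I * fderiv ℝ F (Q + z • d) (I • d) = 0 := by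
      rw [wirtG, div_eq_zero_iff] at h0
      exact h0.resolve_right two_ne_zero
    linear_combination I * h3 + fderiv ℝ F (Q + z • d) (I • d) * Complex.I_mul_I
  set a : ℂ := (starRingEnd ℂ) (fderiv ℝ F (Q + z • d) d) with ha
  refine (hasFDerivAt_of_restrictScalars ℝ h1
    (f' := ContinuousLinearMap.toSpanSingleton ℂ a) ?_).differentiableAt
  ext w
  simp only [ContinuousLinearMap.coe_restrictScalars', ContinuousLinearMap.toSpanSingleton_apply,
    ContinuousLinearMap.comp_apply, smul_eq_mul, ContinuousLinearEquiv.coe_coe,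
    Complex.conjCLE_apply]
  have h4 : w • d = w.re • d + w.im • (I • d) := by
    conv_lhs => rw [← Complex.re_add_im w]
    rw [add_smul, mul_smul]; rfl
  rw [h4, map_add, map_smul, map_smul, h2]
  simp only [Complex.real_smul, map_add, map_mul, Complex.conj_ofReal, map_neg, Complex.conj_I,
    neg_neg, ← ha]
  conv_lhs => rw [← Complex.re_add_im w]
  ring

/-- Since `h` is holomorphic, `∂̄` does not raise the order of the pole: a single factor `h` makes
the derivative real-analytic across the zeros of `h`. This is the product required by
`bounded_of_mul_conj`. -/
theorem LocalPres.mul_xiW (hp : LocalPres s φ V f g h) (hP : P ∈ V) (hh : h P ≠ 0) :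
    (wirtG I (dirZ e) f P + h P * wirtG I (dirZ e) g P) * wFun L P
      = h P * xiW L e (fun Q => f Q / h Q + g Q) P := by
  have hhC := (hp.h_an P hP).differentiableAt
  have hinv : DifferentiableAt ℂ (fun Q => (h Q)⁻¹) P := hhC.inv hh
  have h1 : wirtG I (dirZ e) (fun Q => f Q / h Q + g Q) P
      = (h P)⁻¹ * wirtG I (dirZ e) f P + wirtG I (dirZ e) g P := by
    have hf := (hp.f_an P hP).differentiableAt
    simp only [div_eq_mul_inv]
    rw [wirtG_add (hf.fun_mul (hinv.restrictScalars ℝ)) (hp.g_an P hP).differentiableAt,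
      wirtG_mul hf (hinv.restrictScalars ℝ), wirtBar_of_holomorphic hinv]
    ring
  rw [xiW, h1]
  field_simp

end Local

theorem line_add (Q : JacobiSpace N) (e : Fin N → ℝ) (z w : ℂ) :
    Q + (z + w) • dirZ e = (Q + z • dirZ e) + w • dirZ e := by rw [add_smul, add_assoc]

theorem line_fst (Q : JacobiSpace N) (e : Fin N → ℝ) (z : ℂ) : (Q + z • dirZ e).1 = Q.1 := by
  simp [dirZ]

theorem GoodLine.translate {s : Finset ((Fin N → ℝ) × ℝ × ℝ)} {e : Fin N → ℝ}
    {Q : JacobiSpace N} (h : GoodLine s e Q) (z : ℂ) : GoodLine s e (Q + z • dirZ e) := by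
  have : {w : ℂ | (Q + z • dirZ e) + w • dirZ e ∈ singularLocus s}
      = (fun w => z + w) ⁻¹' {w : ℂ | Q + w • dirZ e ∈ singularLocus s} := by
    ext w
    simp only [Set.mem_ofPred_eq, Set.mem_preimage, line_add]
  rw [GoodLine, this]
  exact h.preimage_of_injOn (add_right_injective z).injOn

theorem GoodLine.frequently {s : Finset ((Fin N → ℝ) × ℝ × ℝ)} {e : Fin N → ℝ}
    {Q : JacobiSpace N} (h : GoodLine s e Q) (z : ℂ) :
    ∃ᶠ w in 𝓝 z, Q + w • dirZ e ∉ singularLocus s := by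
  have := countable_zeros_dense h z
  have h1 : ∃ᶠ w in 𝓝[{w : ℂ | Q + w • dirZ e ∈ singularLocus s}ᶜ] z,
      Q + w • dirZ e ∉ singularLocus s :=
    (eventually_mem_nhdsWithin (s := {w : ℂ | Q + w • dirZ e ∈ singularLocus s}ᶜ)).frequently
  exact h1.filter_mono nhdsWithin_le_nhds

theorem continuous_line (e : Fin N → ℝ) :
    Continuous fun a : JacobiSpace N × ℂ => a.1 + a.2 • dirZ e := by fun_prop

section LocalExtension

variable {L : Matrix (Fin N) (Fin N) ℝ} {s : Finset ((Fin N → ℝ) × ℝ × ℝ)}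
  {φ : JacobiSpace N → ℂ} {e : Fin N → ℝ}

/-- Uniform local extension of the antiholomorphic derivative across the singular locus. -/
theorem exists_local_extension (hL : L.IsSymm) (hs : HasAlmostMeromorphicSingularities s φ)
    (hH : ∀ P ∈ regularPoints s, heisLaplace L e φ P = 0) {Q₀ : JacobiSpace N}
    (hQ₀ : 0 < Q₀.1.im) (hgood : GoodLine s e Q₀) :
    ∃ ρ > (0 : ℝ), ∃ M : ℝ, ∀ᶠ Q in 𝓝 Q₀, GoodLine s e Q → ∃ F : ℂ → ℂ,
      DifferentiableOn ℂ F (Metric.ball 0 ρ) ∧ (∀ z ∈ Metric.ball (0 : ℂ) ρ, ‖F z‖ ≤ M) ∧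
      ∀ z ∈ Metric.ball (0 : ℂ) ρ, Q + z • dirZ e ∉ singularLocus s →
        F z = (starRingEnd ℂ) (xiW L e φ (Q + z • dirZ e)) := by
  obtain ⟨V, f, g, h, hQV, hp⟩ := exists_localPres hs hQ₀
  have hline : ∀ (Q : JacobiSpace N) (z : ℂ), Q + z • dirZ e ∈ V →
      AnalyticAt ℂ (fun w : ℂ => h (Q + w • dirZ e)) z := fun Q z hz => by
    have h1 : AnalyticAt ℂ (fun w : ℂ => Q + w • dirZ e) z := by fun_prop
    exact AnalyticAt.comp (g := h) (f := fun w : ℂ => Q + w • dirZ e) (hp.h_an _ hz) h1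
  -- Near every point of a good line there are parameters off the singular locus, where the
  -- denominator is nonzero. Hence `h` does not vanish identically along the line, and its zeros
  -- there are isolated.
  have hne : ∀ (Q : JacobiSpace N), GoodLine s e Q → ∀ z : ℂ, Q + z • dirZ e ∈ V →
      ∀ᶠ w in 𝓝[≠] z, h (Q + w • dirZ e) ≠ 0 := fun Q hQ z hz => by
    refine (hline Q z hz).eventually_eq_zero_or_eventually_ne_zero.resolve_left fun h0 => ?_
    have hV : ∀ᶠ w in 𝓝 z, Q + w • dirZ e ∈ V :=
      (continuous_line e).comp (Continuous.prodMk_right Q) |>.continuousAt.eventually_mem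
        (hp.isOpen.mem_nhds hz)
    obtain ⟨w, hw1, hw2, hw3⟩ := ((hQ.frequently z).and_eventually (h0.and hV)).exists
    exact (hp.eq _ ⟨hw3, hw1⟩).1 hw2
  have hV0 : ∀ᶠ w in 𝓝 (0 : ℂ), Q₀ + w • dirZ e ∈ V :=
    ((continuous_line e).comp (Continuous.prodMk_right Q₀)).continuousAt.eventually_mem
        (hp.isOpen.mem_nhds (by simpa using hQV))
  -- The disc is chosen so small that the centre is the only possible zero of `h` on the line
  -- through `Q₀`; the boundary circle is then free of zeros.
  obtain ⟨ρ, hρ, hball⟩ : ∃ ρ > (0 : ℝ), ∀ z ∈ Metric.closedBall (0 : ℂ) ρ,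
      Q₀ + z • dirZ e ∈ V ∧ (z ≠ 0 → h (Q₀ + z • dirZ e) ≠ 0) := by
    have := (hV0.and (eventually_nhdsWithin_iff.mp (hne Q₀ hgood 0 (by simpa using hQV))))
    obtain ⟨ρ, hρ, hb⟩ := Metric.nhds_basis_closedBall.eventually_iff.mp this
    exact ⟨ρ, hρ, fun z hz => hb hz⟩
  set G : JacobiSpace N → ℂ := xiW L e (fun Q => f Q / h Q + g Q) with hG
  have hGcont : ∀ P ∈ V, h P ≠ 0 → ContinuousAt G P := fun P hP hh =>
    (analyticAt_xiW (hp.pos P hP) (hp.analyticAt hP hh)).continuousAt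
  have hsph : ∀ z ∈ Metric.sphere (0 : ℂ) ρ, Q₀ + z • dirZ e ∈ V ∧ h (Q₀ + z • dirZ e) ≠ 0 := by
    intro z hz
    have h1 := hball z (Metric.sphere_subset_closedBall hz)
    refine ⟨h1.1, h1.2 ?_⟩
    rintro rfl
    simp at hz
    exact hρ.ne hz
  obtain ⟨M, hM⟩ : ∃ M, ∀ z ∈ Metric.sphere (0 : ℂ) ρ, ‖G (Q₀ + z • dirZ e)‖ ≤ M := by
    refine (isCompact_sphere (0 : ℂ) ρ).exists_bound_of_continuousOn (f := fun z : ℂ => G (Q₀ + z • dirZ e)) fun z hz => ?_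
    refine ContinuousAt.continuousWithinAt ?_
    have h1 : ContinuousAt (fun z : ℂ => Q₀ + z • dirZ e) z := by fun_prop
    exact ContinuousAt.comp (f := fun z : ℂ => Q₀ + z • dirZ e) (g := G)
      (hGcont _ (hsph z hz).1 (hsph z hz).2) h1
  refine ⟨ρ, hρ, M + 1, ?_⟩
  have hQV' : ∀ᶠ Q in 𝓝 Q₀, ∀ z ∈ Metric.closedBall (0 : ℂ) ρ, Q + z • dirZ e ∈ V := by
    refine (isCompact_closedBall (0 : ℂ) ρ).eventually_forall_of_forall_eventually fun z hz => ?_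
    exact (continuous_line e).continuousAt.eventually_mem (hp.isOpen.mem_nhds (hball z hz).1)
  -- The circle is compact, so nonvanishing of `h` and the bound on `G` survive for all neighbouring
  -- lines. This is what makes the extension uniform in `Q`.
  have hQh : ∀ᶠ Q in 𝓝 Q₀, ∀ z ∈ Metric.sphere (0 : ℂ) ρ,
      h (Q + z • dirZ e) ≠ 0 ∧ ‖G (Q + z • dirZ e)‖ ≤ M + 1 := by
    refine (isCompact_sphere (0 : ℂ) ρ).eventually_forall_of_forall_eventually fun z hz => ?_
    have hV := hsph z hz
    have h1 : Tendsto (fun a : JacobiSpace N × ℂ => a.1 + a.2 • dirZ e) (𝓝 (Q₀, z))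
        (𝓝 (Q₀ + z • dirZ e)) := (continuous_line e).continuousAt
    have h2 : ∀ᶠ P in 𝓝 (Q₀ + z • dirZ e), h P ≠ 0 :=
      (hp.h_an _ hV.1).continuousAt.eventually_ne hV.2
    have h3 : ∀ᶠ P in 𝓝 (Q₀ + z • dirZ e), ‖G P‖ < M + 1 :=
      (hGcont _ hV.1 hV.2).norm.eventually (gt_mem_nhds ((hM z hz).trans_lt (by linarith)))
    filter_upwards [h1.eventually h2, h1.eventually h3] with a ha hb using ⟨ha, hb.le⟩
  filter_upwards [hQV', hQh] with Q hQ1 hQ2 hQg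
  set H : ℂ → ℂ := fun w => (starRingEnd ℂ) (G (Q + w • dirZ e)) with hHdef
  have hHdiff : ∀ z, Q + z • dirZ e ∈ V → h (Q + z • dirZ e) ≠ 0 → DifferentiableAt ℂ H z :=
    fun z hz hz' => differentiableAt_conj_line
      (analyticAt_xiW (hp.pos _ hz) (hp.analyticAt hz hz')).differentiableAt
      (wirtG_xiW hL (hp.pos _ hz) (hp.analyticAt hz hz') (hp.heis hs hL hH hz hz'))
  have hVev : ∀ z, Q + z • dirZ e ∈ V → ∀ᶠ w in 𝓝 z, Q + w • dirZ e ∈ V := fun z hz =>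
    ((continuous_line e).comp (Continuous.prodMk_right Q)).continuousAt.eventually_mem
        (hp.isOpen.mem_nhds hz)
  have hev : ∀ z, Q + z • dirZ e ∈ V → ∀ᶠ w in 𝓝[≠] z, DifferentiableAt ℂ H w := fun z hz => by
    filter_upwards [hne Q hQg z hz, (hVev z hz).filter_mono nhdsWithin_le_nhds] with w h1 h2
    exact hHdiff w h2 h1
  set F : ℂ → ℂ := fun z => limUnder (𝓝[≠] z) H with hF
  have hFH : ∀ z, Q + z • dirZ e ∈ V → h (Q + z • dirZ e) ≠ 0 → F z = H z := fun z hz hz' =>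
    ((hHdiff z hz hz').continuousAt.tendsto.mono_left nhdsWithin_le_nhds).limUnder_eq
  have hFdiff : ∀ z ∈ Metric.closedBall (0 : ℂ) ρ, DifferentiableAt ℂ F z := by
    intro z hz
    have hzV := hQ1 z hz
    -- Riemann's theorem on removable singularities; boundedness follows because `h` times the
    -- conjugate of `H` is real-analytic.
    refine differentiableAt_limUnder (hev z hzV) (bounded_of_mul_conj (hev z hzV)
      (R := fun w => (wirtG I (dirZ e) f (Q + w • dirZ e)
        + h (Q + w • dirZ e) * wirtG I (dirZ e) g (Q + w • dirZ e)) * wFun L (Q + w • dirZ e))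
      (h := fun w => h (Q + w • dirZ e)) ?_ (hline Q z hzV) ?_ ?_)
    · have hl : AnalyticAt ℝ (fun w : ℂ => Q + w • dirZ e) z := by fun_prop
      have h1 : AnalyticAt ℝ (fun P => (wirtG I (dirZ e) f P + h P * wirtG I (dirZ e) g P)
          * wFun L P) (Q + z • dirZ e) :=
        ((analyticAt_wirtG (hp.f_an _ hzV) _ _).add ((hp.h_an _ hzV).restrictScalars.mul
          (analyticAt_wirtG (hp.g_an _ hzV) _ _))).mul (analyticAt_wFun L (hp.pos _ hzV))
      exact AnalyticAt.comp (f := fun w : ℂ => Q + w • dirZ e) h1 hl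
    · intro h0
      obtain ⟨w, hw1, hw2⟩ := ((hne Q hQg z hzV).and (h0.filter_mono nhdsWithin_le_nhds)).exists
      exact hw1 hw2
    · filter_upwards [hne Q hQg z hzV, (hVev z hzV).filter_mono nhdsWithin_le_nhds] with w h1 h2
      rw [hHdef]
      simp only [Complex.conj_conj]
      exact hp.mul_xiW h2 h1
  refine ⟨F, fun z hz => (hFdiff z (Metric.ball_subset_closedBall hz)).differentiableWithinAt,
    ?_, ?_⟩
  · intro z hz
    -- The maximum principle transfers the bound from the circle, which avoids the zeros of `h`, to
    -- the disc.
    have hdc : DiffContOnCl ℂ F (Metric.ball 0 ρ) := by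
      refine DifferentiableOn.diffContOnCl fun w hw => ?_
      rw [closure_ball _ hρ.ne'] at hw
      exact (hFdiff w hw).differentiableWithinAt
    refine Complex.norm_le_of_forall_mem_frontier_norm_le Metric.isBounded_ball hdc
      (fun w hw => ?_) (subset_closure hz)
    rw [frontier_ball _ hρ.ne'] at hw
    rw [hFH w (hQ1 w (Metric.sphere_subset_closedBall hw)) (hQ2 w hw).1, hHdef]
    simp only [RCLike.norm_conj]
    exact (hQ2 w hw).2
  · intro z hz hzS
    have hzV := hQ1 z (Metric.ball_subset_closedBall hz)
    have h1 := (hp.eq _ ⟨hzV, hzS⟩).1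
    rw [hFH z hzV h1, hHdef]
    simp only
    rw [xiW_congr (hp.eventuallyEq hs hzV ⟨hp.pos _ hzV, hzS⟩)]

end LocalExtension

section Global

variable {L : Matrix (Fin N) (Fin N) ℝ} {s : Finset ((Fin N → ℝ) × ℝ × ℝ)}
  {φ : JacobiSpace N → ℂ} {e : Fin N → ℝ}

/-- On the line each singular equation is affine in `z`. It is either a constant equation, false
because it fails at `Q`, or has at most one root, and there are countably many equations. -/
theorem goodLine_of_notMem {Q : JacobiSpace N} (hQ : Q ∉ singularLocus s) : GoodLine s e Q := by
  have hsub : {z : ℂ | Q + z • dirZ e ∈ singularLocus s} ⊆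
      ⋃ i : s × (Fin N → ℤ) × (Fin N → ℤ), {z : ℂ | ∑ j, (i.1.1.1 j : ℂ) *
        shiftZ i.2.1 i.2.2 (Q + z • dirZ e) j = (i.1.1.2.1 : ℂ) + (i.1.1.2.2 : ℂ) * Q.1} := by
    rintro z ⟨q, hq, lam, mu, h⟩
    rw [line_fst] at h
    exact Set.mem_iUnion.mpr ⟨⟨⟨q, hq⟩, lam, mu⟩, h⟩
  refine (Set.countable_iUnion fun i => Set.Subsingleton.countable ?_).mono hsub
  intro z hz w hw
  obtain ⟨⟨q, hq⟩, lam, mu⟩ := i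
  have hexp : ∀ x : ℂ, ∑ j, (q.1 j : ℂ) * shiftZ lam mu (Q + x • dirZ e) j
      = ∑ j, (q.1 j : ℂ) * shiftZ lam mu Q j + x * ∑ j, (q.1 j : ℂ) * e j := by
    intro x
    rw [Finset.mul_sum, ← Finset.sum_add_distrib]
    refine Finset.sum_congr rfl fun j _ => ?_
    simp [shiftZ, dirZ]
    ring
  simp only [Set.mem_ofPred_eq, hexp] at hz hw
  by_contra hne
  have h1 : (z - w) * ∑ j, (q.1 j : ℂ) * e j = 0 := by linear_combination hz - hw
  have h2 := (mul_eq_zero.mp h1).resolve_left (sub_ne_zero.mpr hne)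
  rw [h2, mul_zero, add_zero] at hz
  exact hQ ⟨q, hq, lam, mu, hz⟩

/-- The extension of the conjugate of `xiW` along complex lines in the direction `e`. -/
def extG (L : Matrix (Fin N) (Fin N) ℝ) (s : Finset ((Fin N → ℝ) × ℝ × ℝ)) (e : Fin N → ℝ)
    (φ : JacobiSpace N → ℂ) (P : JacobiSpace N) : ℂ :=
  limUnder (𝓝[{z : ℂ | P + z • dirZ e ∉ singularLocus s}] 0)
    fun z => (starRingEnd ℂ) (xiW L e φ (P + z • dirZ e))

theorem GoodLine.neBot {Q : JacobiSpace N} (h : GoodLine s e Q) :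
    (𝓝[{z : ℂ | Q + z • dirZ e ∉ singularLocus s}] 0).NeBot :=
  countable_zeros_dense h 0

theorem extG_of_regular {P : JacobiSpace N} (hs : HasAlmostMeromorphicSingularities s φ)
    (hP : P ∈ regularPoints s) : extG L s e φ P = (starRingEnd ℂ) (xiW L e φ P) := by
  have := (goodLine_of_notMem (e := e) hP.2).neBot
  refine Tendsto.limUnder_eq ?_
  have h1 : ContinuousAt (xiW L e φ) P :=
    (analyticAt_xiW hP.1 (hs.analytic P hP)).continuousAt
  have h2 : ContinuousAt (fun z : ℂ => P + z • dirZ e) 0 := by fun_prop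
  have h3 : ContinuousAt (fun z : ℂ => (starRingEnd ℂ) (xiW L e φ (P + z • dirZ e))) 0 :=
    Complex.continuous_conj.continuousAt.comp
      (ContinuousAt.comp (f := fun z : ℂ => P + z • dirZ e) (g := xiW L e φ)
        (by simpa using h1) h2)
  have h4 := h3.tendsto.mono_left
    (nhdsWithin_le_nhds (s := {z : ℂ | P + z • dirZ e ∉ singularLocus s}))
  simpa using h4

/-- The bound is uniform for good lines near `Q₀`, not only along a single line; `extG_bounded` uses
this for a compactness argument in which `β` varies. -/
theorem extG_local (hL : L.IsSymm) (hs : HasAlmostMeromorphicSingularities s φ)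
    (hH : ∀ P ∈ regularPoints s, heisLaplace L e φ P = 0) {Q₀ : JacobiSpace N}
    (hQ₀ : 0 < Q₀.1.im) (hgood : GoodLine s e Q₀) :
    ∃ M : ℝ, ∀ᶠ Q in 𝓝 Q₀, GoodLine s e Q → ‖extG L s e φ Q‖ ≤ M ∧
      DifferentiableAt ℂ (fun z : ℂ => extG L s e φ (Q + z • dirZ e)) 0 := by
  obtain ⟨ρ, hρ, M, hM⟩ := exists_local_extension hL hs hH hQ₀ hgood
  refine ⟨M, ?_⟩
  filter_upwards [hM] with Q hQ hQg
  obtain ⟨F, hF1, hF2, hF3⟩ := hQ hQg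
  have hext : ∀ z ∈ Metric.ball (0 : ℂ) ρ, extG L s e φ (Q + z • dirZ e) = F z := by
    intro z hz
    have := (hQg.translate z).neBot
    refine Tendsto.limUnder_eq ?_
    have h1 : ContinuousAt F z := (hF1.differentiableAt (Metric.isOpen_ball.mem_nhds hz)).continuousAt
    have h2 : Tendsto (fun w : ℂ => F (z + w)) (𝓝 0) (𝓝 (F z)) := by
      have h5 : ContinuousAt (fun w : ℂ => z + w) 0 := by fun_prop
      have h3 : ContinuousAt (fun w : ℂ => F (z + w)) 0 :=
        ContinuousAt.comp (f := fun w : ℂ => z + w) (by simpa using h1) h5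
      simpa using h3.tendsto
    refine (h2.mono_left nhdsWithin_le_nhds).congr' ?_
    have h6 : ∀ᶠ w in 𝓝 (0 : ℂ), z + w ∈ Metric.ball (0 : ℂ) ρ := by
      have h5 : ContinuousAt (fun w : ℂ => z + w) 0 := by fun_prop
      exact h5.eventually_mem (Metric.isOpen_ball.mem_nhds (by simpa using hz))
    filter_upwards [h6.filter_mono nhdsWithin_le_nhds, self_mem_nhdsWithin] with w hw1 hw2
    rw [← line_add]
    refine hF3 _ hw1 ?_
    rw [line_add]; exact hw2
  have h0 : (0 : ℂ) ∈ Metric.ball (0 : ℂ) ρ := Metric.mem_ball_self hρ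
  constructor
  · have := hext 0 h0
    rw [zero_smul, add_zero] at this
    rw [this]; exact hF2 0 h0
  · refine (hF1.differentiableAt (Metric.isOpen_ball.mem_nhds h0)).congr_of_eventuallyEq ?_
    filter_upwards [Metric.isOpen_ball.mem_nhds h0] with z hz using hext z hz

theorem differentiable_extG (hL : L.IsSymm) (hs : HasAlmostMeromorphicSingularities s φ)
    (hH : ∀ P ∈ regularPoints s, heisLaplace L e φ P = 0) {Q : JacobiSpace N}
    (hQ : 0 < Q.1.im) (hgood : GoodLine s e Q) :
    Differentiable ℂ fun z : ℂ => extG L s e φ (Q + z • dirZ e) := by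
  intro z
  obtain ⟨M, hM⟩ := extG_local hL hs hH (Q₀ := Q + z • dirZ e) (by rwa [line_fst])
    (hgood.translate z)
  have h1 := (hM.self_of_nhds (hgood.translate z)).2
  have h2 : (fun w : ℂ => extG L s e φ (Q + w • dirZ e))
      = (fun w : ℂ => extG L s e φ (Q + z • dirZ e + w • dirZ e)) ∘ fun w => w - z := by
    funext w
    simp only [Function.comp_apply, ← line_add]
    congr 3; ring
  rw [h2]
  refine DifferentiableAt.comp z ?_ (by fun_prop)
  simpa using h1

theorem sectionPt_add_smul (α β : Fin N → ℝ) (τ : ℂ) (t σ : ℝ) :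
    sectionPt (α + t • e) (β + σ • e) τ = sectionPt α β τ + ((t : ℂ) * τ + σ) • dirZ e := by
  refine Prod.ext ?_ ?_
  · simp [sectionPt, dirZ]
  · ext j
    simp [sectionPt, dirZ]
    ring

theorem jacobiAct_one_sectionPt (α β : Fin N → ℝ) (τ : ℂ) (lam mu : Fin N → ℤ) :
    jacobiAct 1 lam mu (sectionPt α β τ)
      = sectionPt (α + fun j => (lam j : ℝ)) (β + fun j => (mu j : ℝ)) τ := by
  refine Prod.ext (jacobiAct_one_fst _ _ _) ?_
  rw [jacobiAct_one_snd]
  ext j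
  simp [sectionPt, shiftZ]
  ring

theorem imPart_sectionPt (α β : Fin N → ℝ) (τ : ℂ) :
    imPart (sectionPt α β τ) = (τ.im, τ.im • α) := by
  refine Prod.ext rfl ?_
  ext j
  simp [sectionPt, imPart, mul_comm]

/-- The lattice invariant norm of the antiholomorphic derivative. -/
def xiNorm (L : Matrix (Fin N) (Fin N) ℝ) (e : Fin N → ℝ) (φ : JacobiSpace N → ℂ)
    (P : JacobiSpace N) : ℝ :=
  ‖wirtG I (dirZ e) φ P‖ * Real.exp (-(2 * Real.pi) * qf L (imPart P).2 / P.1.im)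

/-- The weight `exp(-4π L[v]/y)` splits into two equal factors. One makes the derivative lattice
invariant, the other supplies the decay in positive directions. -/
theorem norm_xiW (P : JacobiSpace N) : ‖xiW L e φ P‖
    = xiNorm L e φ P * Real.exp (-(2 * Real.pi) * qf L (imPart P).2 / P.1.im) := by
  rw [xiW, xiNorm, norm_mul, wFun, Complex.norm_real, Real.norm_eq_abs, abs_of_pos (Real.exp_pos _),
    mul_assoc, ← Real.exp_add]
  congr 2
  ring

theorem ellFactor_differentiable (lam : Fin N → ℤ) : Differentiable ℂ (ellFactor L lam) := by
  unfold ellFactor qfC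
  simp only [dotProduct, Matrix.mulVec]
  fun_prop

theorem analyticAt_snd_apply (j : Fin N) (P : JacobiSpace N) :
    AnalyticAt ℂ (fun P : JacobiSpace N => P.2 j) P :=
  ContinuousLinearMap.analyticAt ((ContinuousLinearMap.proj (R := ℂ) (φ := fun _ : Fin N => ℂ) j).comp
    (ContinuousLinearMap.snd ℂ ℂ _)) P

theorem analyticAt_ellFactor (lam : Fin N → ℤ) (P : JacobiSpace N) :
    AnalyticAt ℂ (ellFactor L lam) P := by
  unfold ellFactor qfC
  simp only [dotProduct, Matrix.mulVec]
  refine analyticAt_cexp.comp (analyticAt_const.mul ((analyticAt_const.mul ?_).add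
    (analyticAt_const.mul analyticAt_fst)))
  exact Finset.analyticAt_fun_sum _ fun i _ => analyticAt_const.mul
    (Finset.analyticAt_fun_sum _ fun j _ => analyticAt_const.mul (analyticAt_snd_apply j P))

theorem norm_ellFactor (hL : L.IsSymm) (lam : Fin N → ℤ) (P : JacobiSpace N) :
    ‖ellFactor L lam P‖ = Real.exp (-(2 * Real.pi) *
      (2 * ((imPart P).2 ⬝ᵥ (L *ᵥ fun j => (lam j : ℝ))) + qf L (fun j => (lam j : ℝ)) * P.1.im)) := by
  rw [ellFactor, Complex.norm_exp]
  congr 1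
  have h1 : ((fun j => (lam j : ℂ)) ⬝ᵥ (toC L *ᵥ P.2)).im
      = (imPart P).2 ⬝ᵥ (L *ᵥ fun j => (lam j : ℝ)) := by
    have : (imPart P).2 ⬝ᵥ (L *ᵥ fun j => (lam j : ℝ))
        = (fun j => (lam j : ℝ)) ⬝ᵥ (L *ᵥ (imPart P).2) := by
      rw [Matrix.dotProduct_mulVec, ← Matrix.mulVec_transpose, hL, dotProduct_comm]
    rw [this]
    simp [dotProduct, Matrix.mulVec, toC, imPart]
  have h2 : qfC L (fun j => (lam j : ℂ)) = (qf L (fun j => (lam j : ℝ)) : ℝ) := by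
    have := toC_mulVec_intCast L (fun j => (lam j : ℝ))
    simp only [Complex.ofReal_intCast] at this
    rw [qfC, this, qf]
    simp [dotProduct]
  rw [h2]
  have h3 : (2 * (Real.pi : ℂ) * I * (2 * ((fun j => (lam j : ℂ)) ⬝ᵥ (toC L *ᵥ P.2))
      + ((qf L (fun j => (lam j : ℝ)) : ℝ) : ℂ) * P.1)).re
      = -(2 * Real.pi) * (2 * ((fun j => (lam j : ℂ)) ⬝ᵥ (toC L *ᵥ P.2)).im
        + qf L (fun j => (lam j : ℝ)) * P.1.im) := by
    have : (2 * (Real.pi : ℂ) * I) = ((2 * Real.pi : ℝ) : ℂ) * I := by push_cast; ring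
    rw [this, mul_assoc, Complex.re_ofReal_mul, Complex.I_mul_re, Complex.add_im,
      Complex.im_ofReal_mul]
    have h4 : (2 * ((fun j => (lam j : ℂ)) ⬝ᵥ (toC L *ᵥ P.2))).im
        = 2 * ((fun j => (lam j : ℂ)) ⬝ᵥ (toC L *ᵥ P.2)).im := by
      simp
    rw [h4]; ring
  rw [h3, h1]

theorem jacobiAct_one_eq (lam mu : Fin N → ℤ) (P : JacobiSpace N) :
    jacobiAct 1 lam mu P = transE (fun j => (lam j : ℝ)) P + emb (0, fun j => (mu j : ℝ)) := by
  refine Prod.ext ?_ ?_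
  · rw [jacobiAct_one_fst]; simp [transE_apply, emb]
  · rw [jacobiAct_one_snd]
    ext j
    simp [transE_apply, emb, shiftZ]

theorem wirtG_comp_jacobiAct_one (a : ℂ) (lam mu : Fin N → ℤ) (e : Fin N → ℝ)
    (F : JacobiSpace N → ℂ) (P : JacobiSpace N) :
    wirtG a (dirZ e) (fun Q => F (jacobiAct 1 lam mu Q)) P
      = wirtG a (dirZ e) F (jacobiAct 1 lam mu P) := by
  have h := wirtG_comp_transE a (fun j => (lam j : ℝ)) (dirZ e)
    (fun Q => F (Q + emb (0, fun j => (mu j : ℝ))))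
  rw [transE_dirZ] at h
  simp only [jacobiAct_one_eq]
  rw [h]
  simp only [wirtG, fderiv_comp_add_right]

variable {k : ℤ}

theorem wirtBar_jacobiAct_one (h : IsCasimirForm k L s φ) {P : JacobiSpace N}
    (hP : P ∈ regularPoints s) (lam mu : Fin N → ℤ) (e : Fin N → ℝ) :
    wirtG I (dirZ e) φ P = ellFactor L lam P * wirtG I (dirZ e) φ (jacobiAct 1 lam mu P) := by
  have hP' := jacobiAct_one_mem_regularPoints lam mu hP
  have hmapA : AnalyticAt ℝ (jacobiAct 1 lam mu : JacobiSpace N → _) P := by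
    have : (jacobiAct 1 lam mu : JacobiSpace N → _)
        = fun Q => transE (fun j => (lam j : ℝ)) Q + emb (0, fun j => (mu j : ℝ)) :=
      funext (jacobiAct_one_eq lam mu)
    rw [this]
    exact (ContinuousLinearMap.analyticAt
      ((transE fun j => (lam j : ℝ)).restrictScalars ℝ : JacobiSpace N →L[ℝ] JacobiSpace N) P).add
      analyticAt_const
  have hcomp : AnalyticAt ℝ (fun Q => φ (jacobiAct 1 lam mu Q)) P :=
    (h.sing.analytic _ hP').comp hmapA
  have hell : AnalyticAt ℝ (ellFactor L lam) P :=
    (analyticAt_ellFactor lam P).restrictScalars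
  have hev : (fun Q => ellFactor L lam Q * φ (jacobiAct 1 lam mu Q)) =ᶠ[𝓝 P] φ :=
    eventuallyEq_of_regular h.sing.nonzero hP.1 (hell.mul hcomp) (h.sing.analytic P hP)
      (Eventually.of_forall fun Q hQ => h.elliptic lam mu hQ)
  rw [← wirtG_congr hev, wirtG_mul hell.differentiableAt hcomp.differentiableAt,
    wirtBar_of_holomorphic (ellFactor_differentiable lam P), zero_mul, add_zero,
    wirtG_comp_jacobiAct_one]

/-- The absolute value of the elliptic factor of automorphy is exactly compensated by the change of
`exp(-2π L[v]/y)` under `v ↦ v + y λ`. -/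
theorem xiNorm_jacobiAct (h : IsCasimirForm k L s φ) {P : JacobiSpace N}
    (hP : P ∈ regularPoints s) (lam mu : Fin N → ℤ) :
    xiNorm L e φ (jacobiAct 1 lam mu P) = xiNorm L e φ P := by
  have hy : P.1.im ≠ 0 := hP.1.ne'
  have h1 := wirtBar_jacobiAct_one h hP lam mu e
  have h2 : (imPart (jacobiAct 1 lam mu P)).2 = (imPart P).2 + P.1.im • fun j => (lam j : ℝ) := by
    rw [jacobiAct_one_eq]
    ext j
    simp [imPart, transE_apply, emb, mul_comm]
  have h3 : (jacobiAct 1 lam mu P).1.im = P.1.im := by rw [jacobiAct_one_fst]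
  rw [xiNorm, xiNorm, h1, norm_mul, norm_ellFactor h.index.symm, h2, h3,
    qf_add_smul h.index.symm, mul_comm (Real.exp _) ‖_‖,
    mul_assoc ‖wirtG I (dirZ e) φ (jacobiAct 1 lam mu P)‖, ← Real.exp_add]
  congr 2
  field_simp
  ring

/-- Continuity and compactness of the unit cube bound `xiNorm` for directions near `α` and `β` in
the cube. Lattice invariance extends this bound to all `β` and to directions near every translate `α
+ λ`. -/
theorem xiNorm_bound (h : IsCasimirForm k L s φ) {α : Fin N → ℝ} (hα : α ∈ genericDir s) {τ : ℂ}
    (hτ : 0 < τ.im) : ∃ M, ∃ ε > (0 : ℝ), ∀ α' ∈ genericDir s, ∀ lam : Fin N → ℤ,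
      dist α' (α + fun j => (lam j : ℝ)) < ε → ∀ β, xiNorm L e φ (sectionPt α' β τ) ≤ M := by
  have hcont : ∀ β, ContinuousAt (xiNorm L e φ) (sectionPt α β τ) := by
    intro β
    have hr := sectionPt_mem_regularPoints hα β hτ
    have h1 : ContinuousAt (wirtG I (dirZ e) φ) (sectionPt α β τ) :=
      (analyticAt_wirtG (h.sing.analytic _ hr) _ _).continuousAt
    have h2 : ContinuousAt (fun P : JacobiSpace N =>
        Real.exp (-(2 * Real.pi) * qf L (imPart P).2 / P.1.im)) (sectionPt α β τ) := by
      have h3 : Continuous fun P : JacobiSpace N => qf L (imPart P).2 := by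
        unfold qf imPart; simp only [dotProduct, Matrix.mulVec]; fun_prop
      refine Real.continuous_exp.continuousAt.comp (ContinuousAt.div ?_ ?_ hr.1.ne')
      · exact (continuous_const.mul h3).continuousAt
      · exact (Complex.continuous_im.comp continuous_fst).continuousAt
    exact h1.norm.mul h2
  have hK : IsCompact (Set.Icc (0 : Fin N → ℝ) 1) := isCompact_Icc
  have hsc : ∀ β : Fin N → ℝ, Tendsto (fun a : (Fin N → ℝ) × (Fin N → ℝ) => sectionPt a.1 a.2 τ)
      (𝓝 (α, β)) (𝓝 (sectionPt α β τ)) := fun β =>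
    (continuous_sectionPt.comp (by fun_prop : Continuous fun a : (Fin N → ℝ) × (Fin N → ℝ) =>
      (a.1, a.2, τ))).continuousAt
  obtain ⟨M, hM⟩ : ∃ M, ∀ β ∈ Set.Icc (0 : Fin N → ℝ) 1, xiNorm L e φ (sectionPt α β τ) ≤ M := by
    obtain ⟨M, hM⟩ := hK.exists_bound_of_continuousOn
      (f := fun β => xiNorm L e φ (sectionPt α β τ)) fun β _ =>
        (ContinuousAt.comp (f := fun β => sectionPt α β τ) (hcont β)
          (continuous_sectionPt.comp (by fun_prop : Continuous fun b : Fin N → ℝ =>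
            (α, b, τ))).continuousAt).continuousWithinAt
    exact ⟨M, fun β hβ => (le_abs_self _).trans (hM β hβ)⟩
  have hev : ∀ᶠ α' in 𝓝 α, ∀ β ∈ Set.Icc (0 : Fin N → ℝ) 1,
      xiNorm L e φ (sectionPt α' β τ) ≤ M + 1 := by
    refine hK.eventually_forall_of_forall_eventually fun β hβ => ?_
    have h3 : ∀ᶠ P in 𝓝 (sectionPt α β τ), xiNorm L e φ P < M + 1 :=
      (hcont β).eventually (gt_mem_nhds ((hM β hβ).trans_lt (by linarith)))
    filter_upwards [(hsc β).eventually h3] with a ha using ha.le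
  obtain ⟨ε, hε, hball⟩ := Metric.eventually_nhds_iff.mp hev
  refine ⟨M + 1, ε, hε, fun α' hα' lam hd β => ?_⟩
  have hr := sectionPt_mem_regularPoints hα' β hτ
  rw [← xiNorm_jacobiAct h hr (-lam) (fun j => -⌊β j⌋), jacobiAct_one_sectionPt]
  refine hball ?_ _ ?_
  · have h4 : dist (α' + fun j => (((-lam) j : ℤ) : ℝ)) α
        = dist α' (α + fun j => (lam j : ℝ)) := by
      rw [dist_eq_norm, dist_eq_norm]
      congr 1
      ext j
      simp
      ring
    rw [h4]; exact hd
  · constructor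
    · intro j
      have := Int.fract_nonneg (β j)
      simp only [Pi.zero_apply, Pi.add_apply, Int.cast_neg]
      rw [Int.fract] at this
      linarith
    · intro j
      have := (Int.fract_lt_one (β j)).le
      simp only [Pi.one_apply, Pi.add_apply, Int.cast_neg]
      rw [Int.fract] at this
      linarith

/-- Recurrence of linear flows on tori. -/
theorem exists_recurrence (e : Fin N → ℝ) {ε : ℝ} (hε : 0 < ε) {T : ℝ} (hT : 0 < T) :
    ∃ t ≥ T, ∃ lam : Fin N → ℤ, dist (t • e) (fun j => (lam j : ℝ)) < ε := by
  let x : ℕ → Fin N → ℝ := fun n j => Int.fract ((n * T) * e j)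
  have hx : ∀ n, x n ∈ Set.Icc (0 : Fin N → ℝ) 1 := fun n =>
    ⟨fun j => Int.fract_nonneg _, fun j => (Int.fract_lt_one _).le⟩
  -- Among the multiples of `T e`, reduced modulo `ℤ^N`, two consecutive terms of a convergent
  -- subsequence lie within `ε`. Their difference is a return of the flow after a time that is a
  -- positive multiple of `T`.
  obtain ⟨a, -, ψ, hψ, hlim⟩ := isCompact_Icc.tendsto_subseq hx
  obtain ⟨M, hM⟩ := Metric.cauchySeq_iff'.mp hlim.cauchySeq ε hε
  have h1 := hM (M + 1) (Nat.le_succ M)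
  have hlt : ψ M < ψ (M + 1) := hψ (Nat.lt_succ_self M)
  refine ⟨((ψ (M + 1) : ℝ) - ψ M) * T, ?_, fun j =>
    ⌊((ψ (M + 1) : ℝ) * T) * e j⌋ - ⌊((ψ M : ℝ) * T) * e j⌋, ?_⟩
  · have : (ψ M : ℝ) + 1 ≤ ψ (M + 1) := by exact_mod_cast hlt
    nlinarith
  · refine lt_of_eq_of_lt ?_ h1
    rw [dist_eq_norm, dist_eq_norm]
    congr 1
    ext j
    simp only [Pi.sub_apply, Pi.smul_apply, smul_eq_mul, Function.comp_apply, x, Int.fract]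
    push_cast
    ring

theorem countable_nongeneric {α : Fin N → ℝ} (hα : α ∈ genericDir s) (e : Fin N → ℝ) :
    {t : ℝ | α + t • e ∉ genericDir s}.Countable := by
  have hsub : {t : ℝ | α + t • e ∉ genericDir s} ⊆ ⋃ i : s × (Fin N → ℤ),
      {t : ℝ | ∑ j, i.1.1.1 j * ((α + t • e) j + i.2 j) = i.1.1.2.2} := by
    intro t ht
    simp only [genericDir, Set.mem_ofPred_eq, not_forall, not_not] at ht
    obtain ⟨q, hq, lam, h⟩ := ht
    exact Set.mem_iUnion.mpr ⟨⟨⟨q, hq⟩, lam⟩, h⟩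
  refine (Set.countable_iUnion fun i => Set.Subsingleton.countable ?_).mono hsub
  intro t ht t' ht'
  obtain ⟨⟨q, hq⟩, lam⟩ := i
  have hexp : ∀ x : ℝ, ∑ j, q.1 j * ((α + x • e) j + lam j)
      = ∑ j, q.1 j * (α j + lam j) + x * ∑ j, q.1 j * e j := by
    intro x
    rw [Finset.mul_sum, ← Finset.sum_add_distrib]
    refine Finset.sum_congr rfl fun j _ => ?_
    simp
    ring
  simp only [Set.mem_ofPred_eq, hexp] at ht ht'
  by_contra hne
  have h1 : (t - t') * ∑ j, q.1 j * e j = 0 := by linear_combination ht - ht'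
  have h2 := (mul_eq_zero.mp h1).resolve_left (sub_ne_zero.mpr hne)
  rw [h2, mul_zero, add_zero] at ht
  exact hα q hq lam ht

/-- Recurrence through generic directions. -/
theorem exists_generic_recurrence {α : Fin N → ℝ} (hα : α ∈ genericDir s) (e : Fin N → ℝ) {ε : ℝ}
    (hε : 0 < ε) {T : ℝ} (hT : 0 < T) (σ : ℝ) :
    ∃ t > T, α + (σ * t) • e ∈ genericDir s ∧
      ∃ lam : Fin N → ℤ, dist (α + (σ * t) • e) (α + fun j => (lam j : ℝ)) < ε := by
  obtain ⟨t, ht, lam, hd⟩ := exists_recurrence (σ • e) hε (T := T + 1) (by linarith)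
  have hcount : {x : ℝ | α + x • (σ • e) ∉ genericDir s}.Countable := countable_nongeneric hα _
  have hcont : Continuous fun x : ℝ => dist (x • (σ • e)) (fun j => (lam j : ℝ)) := by fun_prop
  have hopen : IsOpen {x : ℝ | T < x ∧ dist (x • (σ • e)) (fun j => (lam j : ℝ)) < ε} :=
    (isOpen_lt continuous_const continuous_id).inter (isOpen_lt hcont continuous_const)
  -- Being a good return time is an open condition and only countably many times are nongeneric, so
  -- a return time can be moved to a generic one.
  obtain ⟨x, hx, hx'⟩ := (hcount.dense_compl ℝ).exists_mem_open hopen ⟨t, by linarith, hd⟩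
  have hxe : x • (σ • e) = (σ * x) • e := by rw [smul_smul, mul_comm]
  refine ⟨x, hx'.1, ?_, lam, ?_⟩
  · have : ¬ (α + x • (σ • e) ∉ genericDir s) := hx
    rw [hxe, not_not] at this
    exact this
  · rw [dist_add_left, ← hxe]
    exact hx'.2

end Global

/-! ### Bounds along complex lines, and what they imply for positive and radical directions. -/

section Global

variable {L : Matrix (Fin N) (Fin N) ℝ} {s : Finset ((Fin N → ℝ) × ℝ × ℝ)}
  {φ : JacobiSpace N → ℂ} {e : Fin N → ℝ} {k : ℤ}

theorem eq_zero_of_generic (hs : ∀ q ∈ s, q.1 ≠ 0) {F : JacobiSpace N → ℂ} {P : JacobiSpace N}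
    (hP : 0 < P.1.im) (hF : ContinuousAt F P)
    (h : ∀ α ∈ genericDir s, ∀ β, ∀ τ : ℂ, 0 < τ.im → F (sectionPt α β τ) = 0) : F P = 0 := by
  rw [exists_sectionPt hP] at hF ⊢
  generalize (fun j => (P.2 j).im / P.1.im) = α at hF ⊢
  generalize (fun j => (P.2 j).re - (P.2 j).im / P.1.im * P.1.re) = β at hF ⊢
  by_contra hne
  have hc : Continuous fun a : Fin N → ℝ => sectionPt a β P.1 :=
    continuous_sectionPt.comp (by fun_prop : Continuous fun a : Fin N → ℝ => (a, β, P.1))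
  have h1 : ∀ᶠ a in 𝓝 α, F (sectionPt a β P.1) ≠ 0 :=
    (ContinuousAt.comp (f := fun a : Fin N → ℝ => sectionPt a β P.1) hF
      hc.continuousAt).eventually_ne hne
  obtain ⟨a, ha1, ha2⟩ := ((mem_closure_iff_frequently.mp (dense_genericDir hs α)).and_eventually
    h1).exists
  exact ha2 (h a ha1 β P.1 hP)

theorem jacobiAct_one_zero_line (mu : Fin N → ℤ) (P : JacobiSpace N) (z : ℂ) :
    jacobiAct 1 0 mu P + z • dirZ e = jacobiAct 1 0 mu (P + z • dirZ e) := by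
  rw [jacobiAct_one_eq, jacobiAct_one_eq]
  have h0 : (fun j => (((0 : Fin N → ℤ) j : ℤ) : ℝ)) = 0 := by ext j; simp
  have h1 : ∀ Q : JacobiSpace N, transE (0 : Fin N → ℝ) Q = Q := by
    intro Q; refine Prod.ext ?_ ?_ <;> simp [transE_apply]
  rw [h0, h1, h1, add_right_comm]

theorem jacobiAct_one_zero_mem (mu : Fin N → ℤ) {P : JacobiSpace N} :
    jacobiAct 1 0 mu P ∈ regularPoints s ↔ P ∈ regularPoints s := by
  refine ⟨fun h => ?_, jacobiAct_one_mem_regularPoints 0 mu⟩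
  have h1 := jacobiAct_one_mem_regularPoints 0 (-mu) h
  have h2 : jacobiAct 1 0 (-mu) (jacobiAct 1 0 mu P) = P := by
    refine Prod.ext (by rw [jacobiAct_one_fst, jacobiAct_one_fst]) ?_
    rw [jacobiAct_one_snd]
    ext j
    simp [shiftZ, jacobiAct_one_snd]
  rwa [h2] at h1

theorem xiW_jacobiAct_one_zero (h : IsCasimirForm k L s φ) (mu : Fin N → ℤ) {P : JacobiSpace N}
    (hP : P ∈ regularPoints s) : xiW L e φ (jacobiAct 1 0 mu P) = xiW L e φ P := by
  have h1 := wirtBar_jacobiAct_one h hP 0 mu e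
  have h2 : ellFactor L (0 : Fin N → ℤ) P = 1 := by simp [ellFactor, qfC]
  rw [h2, one_mul] at h1
  have h3 : imPart (jacobiAct 1 0 mu P) = imPart P := by
    refine Prod.ext ?_ ?_
    · simp [imPart, jacobiAct_one_fst]
    · ext j; simp [imPart, jacobiAct_one_snd, shiftZ]
  have h4 : (jacobiAct 1 0 mu P).1 = P.1 := jacobiAct_one_fst _ _ _
  rw [xiW, xiW, wFun, wFun, h1, h3, h4]

theorem extG_jacobiAct_one_zero (h : IsCasimirForm k L s φ) (mu : Fin N → ℤ) {P : JacobiSpace N}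
    (hP : 0 < P.1.im) : extG L s e φ (jacobiAct 1 0 mu P) = extG L s e φ P := by
  have hset : {z : ℂ | jacobiAct 1 0 mu P + z • dirZ e ∉ singularLocus s}
      = {z : ℂ | P + z • dirZ e ∉ singularLocus s} := by
    ext z
    have h1 := jacobiAct_one_zero_mem (s := s) mu (P := P + z • dirZ e)
    have h2 : (jacobiAct 1 0 mu (P + z • dirZ e)).1 = P.1 := by
      rw [jacobiAct_one_fst, line_fst]
    have h3 : (P + z • dirZ e).1 = P.1 := line_fst _ _ _
    simp only [regularPoints, Set.mem_ofPred_eq, h2, h3, hP, true_and] at h1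
    rw [Set.mem_ofPred_eq, Set.mem_ofPred_eq, jacobiAct_one_zero_line, h1]
  rw [extG, extG, hset, limUnder, limUnder]
  congr 1
  refine Filter.map_congr ?_
  filter_upwards [self_mem_nhdsWithin] with z hz
  rw [jacobiAct_one_zero_line, xiW_jacobiAct_one_zero h mu ⟨by rw [line_fst]; exact hP, hz⟩]

/-- This is the a priori bound that Phragmén–Lindelöf needs on a strip. Invariance under real
lattice translations reduces `β` to the unit cube, and local bounds patch over the compact set of
parameters. -/
theorem extG_bounded (h : IsCasimirForm k L s φ)
    (hH : ∀ P ∈ regularPoints s, heisLaplace L e φ P = 0) {α : Fin N → ℝ} (hα : α ∈ genericDir s)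
    {τ : ℂ} (hτ : 0 < τ.im) (T : ℝ) :
    ∃ M, ∀ t ∈ Set.Icc (-T) T, ∀ β, ‖extG L s e φ (sectionPt (α + t • e) β τ)‖ ≤ M := by
  have hgood : ∀ (t : ℝ) β, GoodLine s e (sectionPt (α + t • e) β τ) := by
    intro t β
    have := sectionPt_add_smul (e := e) α β τ t 0
    rw [zero_smul, add_zero] at this
    rw [this]
    exact (goodLine_of_notMem (sectionPt_mem_regularPoints hα β hτ).2).translate _
  have hc : Continuous fun x : ℝ × (Fin N → ℝ) => sectionPt (α + x.1 • e) x.2 τ :=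
    continuous_sectionPt.comp (by fun_prop : Continuous fun x : ℝ × (Fin N → ℝ) =>
      (α + x.1 • e, x.2, τ))
  have hK : IsCompact (Set.Icc (-T) T ×ˢ Set.Icc (0 : Fin N → ℝ) 1) := isCompact_Icc.prod isCompact_Icc
  obtain ⟨M, hM⟩ : ∃ M, ∀ x ∈ Set.Icc (-T) T ×ˢ Set.Icc (0 : Fin N → ℝ) 1,
      ‖extG L s e φ (sectionPt (α + x.1 • e) x.2 τ)‖ ≤ M := by
    refine hK.induction_on (p := fun S => ∃ M, ∀ x ∈ S,
      ‖extG L s e φ (sectionPt (α + x.1 • e) x.2 τ)‖ ≤ M) ⟨0, by simp⟩ ?_ ?_ ?_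
    · rintro S S' hS ⟨M, hM⟩
      exact ⟨M, fun x hx => hM x (hS hx)⟩
    · rintro S S' ⟨M, hM⟩ ⟨M', hM'⟩
      refine ⟨max M M', ?_⟩
      rintro x (hx | hx)
      · exact (hM x hx).trans (le_max_left _ _)
      · exact (hM' x hx).trans (le_max_right _ _)
    · rintro x -
      obtain ⟨M, hM⟩ := extG_local h.index.symm h.sing hH
        (Q₀ := sectionPt (α + x.1 • e) x.2 τ) hτ (hgood _ _)
      refine ⟨_, mem_nhdsWithin_of_mem_nhds (hc.continuousAt.eventually hM), M, fun y hy => ?_⟩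
      exact (hy (hgood _ _)).1
  refine ⟨M, fun t ht β => ?_⟩
  have h1 := extG_jacobiAct_one_zero (e := e) h (fun j => -⌊β j⌋)
    (P := sectionPt (α + t • e) β τ) hτ
  have h0 : (fun j => (((0 : Fin N → ℤ) j : ℤ) : ℝ)) = 0 := by ext j; simp
  rw [jacobiAct_one_sectionPt, h0, add_zero] at h1
  rw [← h1]
  refine hM (t, _) ⟨ht, ?_, ?_⟩
  · intro j
    have := Int.fract_nonneg (β j)
    rw [Int.fract] at this
    simp only [Pi.zero_apply, Pi.add_apply, Int.cast_neg]
    linarith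
  · intro j
    have := (Int.fract_lt_one (β j)).le
    rw [Int.fract] at this
    simp only [Pi.one_apply, Pi.add_apply, Int.cast_neg]
    linarith

theorem sectionPt_line {τ : ℂ} (hτ : 0 < τ.im) (α β : Fin N → ℝ) (z : ℂ) :
    sectionPt α β τ + z • dirZ e
      = sectionPt (α + (z.im / τ.im) • e) (β + (z.re - z.im / τ.im * τ.re) • e) τ := by
  rw [sectionPt_add_smul]
  congr 2
  have h0 : τ.im ≠ 0 := hτ.ne'
  apply Complex.ext
  · simp
  · simp [h0]

/-- Phragmén–Lindelöf estimate along complex lines. -/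
theorem norm_extG_le (h : IsCasimirForm k L s φ)
    (hH : ∀ P ∈ regularPoints s, heisLaplace L e φ P = 0) {α : Fin N → ℝ} (hα : α ∈ genericDir s)
    {τ : ℂ} (hτ : 0 < τ.im) :
    ∃ M ≥ 0, ∀ C T₀ : ℝ, (∀ t : ℝ, T₀ ≤ |t| →
      Real.exp (-(2 * Real.pi) * τ.im * qf L (α + t • e)) ≤ C) →
      ∀ β, ∀ z : ℂ, ‖extG L s e φ (sectionPt α β τ + z • dirZ e)‖ ≤ M * C := by
  obtain ⟨M, ε, hε, hM⟩ := xiNorm_bound (e := e) h hα hτ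
  have hM0 : 0 ≤ M := by
    have h0 : (fun j => (((0 : Fin N → ℤ) j : ℤ) : ℝ)) = 0 := by ext j; simp
    have := hM α hα 0 (by rw [h0, add_zero, dist_self]; exact hε) 0
    exact le_trans (mul_nonneg (norm_nonneg _) (Real.exp_pos _).le) this
  refine ⟨M, hM0, fun C T₀ hC β z => ?_⟩
  -- At a return time the first factor of `norm_xiW` is at most `M` by recurrence. The second is
  -- `exp(-2π y L[α + t e])`, because the imaginary part of the section is `y (α + t e)`.
  have hedge : ∀ t : ℝ, T₀ ≤ |t| → α + t • e ∈ genericDir s →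
      (∃ lam : Fin N → ℤ, dist (α + t • e) (α + fun j => (lam j : ℝ)) < ε) →
      ∀ w : ℂ, w.im = t * τ.im → ‖extG L s e φ (sectionPt α β τ + w • dirZ e)‖ ≤ M * C := by
    rintro t ht hg ⟨lam, hlam⟩ w hw
    have hwt : w.im / τ.im = t := by rw [hw]; field_simp
    rw [sectionPt_line hτ, hwt, extG_of_regular h.sing (sectionPt_mem_regularPoints hg _ hτ),
      RCLike.norm_conj, norm_xiW, imPart_sectionPt]
    refine mul_le_mul (hM _ hg lam hlam _) ((Real.exp_le_exp.mpr (le_of_eq ?_)).trans (hC t ht))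
      (Real.exp_pos _).le hM0
    have h1 : qf L (τ.im • (α + t • e)) = τ.im ^ 2 * qf L (α + t • e) := by
      simp only [qf, Matrix.mulVec_smul, dotProduct_smul, smul_dotProduct, smul_eq_mul]; ring
    have h2 : (sectionPt (α + t • e) (β + (w.re - t * τ.re) • e) τ).1.im = τ.im := rfl
    rw [h1, h2]
    have := hτ.ne'
    field_simp
  -- The two return times are taken beyond `T₀`, so that `hC` applies to them, and beyond `|Im z| /
  -- Im τ`, so that the strip contains `z`.
  have hT : 0 < max T₀ (|z.im| / τ.im) + 1 := by
    have : 0 ≤ |z.im| / τ.im := by positivity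
    have := le_max_right T₀ (|z.im| / τ.im)
    linarith
  obtain ⟨t₁, ht₁, hg₁, hl₁⟩ := exists_generic_recurrence hα e hε hT 1
  obtain ⟨t₂, ht₂, hg₂, hl₂⟩ := exists_generic_recurrence hα e hε hT (-1)
  have hbd : ∀ t, max T₀ (|z.im| / τ.im) + 1 < t → 0 < t ∧ T₀ ≤ t ∧ |z.im| ≤ t * τ.im := by
    intro t ht
    have h1 := le_max_left T₀ (|z.im| / τ.im)
    have h2 := le_max_right T₀ (|z.im| / τ.im)
    exact ⟨hT.trans ht, by linarith, (div_le_iff₀ hτ).mp (by linarith)⟩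
  obtain ⟨p1, q1, r1⟩ := hbd t₁ ht₁
  obtain ⟨p2, q2, r2⟩ := hbd t₂ ht₂
  have hgood := goodLine_of_notMem (e := e) (sectionPt_mem_regularPoints hα β hτ).2
  have hdiff := differentiable_extG h.index.symm h.sing hH (Q := sectionPt α β τ) hτ hgood
  obtain ⟨B, hB⟩ := extG_bounded h hH hα hτ (max t₁ t₂)
  refine PhragmenLindelof.horizontal_strip (a := -t₂ * τ.im) (b := t₁ * τ.im)
    (f := fun z => extG L s e φ (sectionPt α β τ + z • dirZ e)) hdiff.diffContOnCl ?_ ?_ ?_ ?_ ?_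
  -- The function is bounded on the strip, so the growth exponents in Phragmén–Lindelöf can be taken
  -- to be zero.
  · refine ⟨0, div_pos Real.pi_pos ?_, 0, ?_⟩
    · nlinarith
    · refine Asymptotics.IsBigO.of_bound B ?_
      refine Filter.Eventually.filter_mono inf_le_right ?_
      rw [eventually_principal]
      rintro w ⟨hw1, hw2⟩
      rw [sectionPt_line hτ]
      simp only [zero_mul, Real.exp_zero, norm_one, mul_one]
      refine hB _ ⟨?_, ?_⟩ _
      · rw [le_div_iff₀ hτ]
        have := le_max_right t₁ t₂
        nlinarith
      · rw [div_le_iff₀ hτ]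
        have := le_max_left t₁ t₂
        nlinarith
  · intro w hw
    refine hedge (-t₂) ?_ ?_ ?_ w hw
    · rw [abs_neg, abs_of_pos p2]; exact q2
    · simpa using hg₂
    · simpa using hl₂
  · intro w hw
    refine hedge t₁ ?_ ?_ ?_ w hw
    · rw [abs_of_pos p1]; exact q1
    · simpa using hg₁
    · simpa using hl₁
  · have := neg_abs_le z.im
    linarith
  · exact (le_abs_self _).trans r1

/-- As a polynomial in `t`, `L[α + t e]` has leading coefficient `L[e] > 0`. The explicit threshold
absorbs its lower terms and `log C`. -/
theorem tendsto_qf_line (hL : L.IsSymm) (he : 0 < qf L e) (α : Fin N → ℝ) {y C : ℝ} (hy : 0 < y)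
    (hC : 0 < C) : ∃ T₀ : ℝ, ∀ t : ℝ, T₀ ≤ |t| →
      Real.exp (-(2 * Real.pi) * y * qf L (α + t • e)) ≤ C := by
  set a := qf L α
  set b := α ⬝ᵥ (L *ᵥ e)
  set c := qf L e
  set K := -Real.log C / (2 * Real.pi * y)
  refine ⟨(|K| + |a| + 2 * |b|) / c + 1, fun t ht => ?_⟩
  rw [← Real.le_log_iff_exp_le hC, qf_add_smul hL]
  have h1 : K ≤ a + 2 * t * b + t ^ 2 * c := by
    have hx : 0 ≤ (|K| + |a| + 2 * |b|) / c := by positivity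
    have h2 : 1 ≤ |t| := by linarith
    have h3 : |K| + |a| + 2 * |b| ≤ c * |t| := by
      have : (|K| + |a| + 2 * |b|) / c ≤ |t| := by linarith
      rw [div_le_iff₀ he] at this; linarith
    have h4 : t ^ 2 = |t| * |t| := by rw [abs_mul_abs_self]; ring
    have h5 : -(|t| * |b|) ≤ t * b := by rw [← abs_mul]; exact neg_abs_le _
    have h6 := neg_abs_le a
    have h7 := le_abs_self K
    have h8 := abs_nonneg K
    have h9 := abs_nonneg a
    have h10 : (|K| + |a|) * 1 ≤ (|K| + |a|) * |t| := by gcongr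
    have h11 : (|K| + |a| + 2 * |b|) * |t| ≤ c * |t| * |t| := by gcongr
    rw [h4]
    nlinarith
  have hp : 0 < 2 * Real.pi * y := by positivity
  have h2 : K * (2 * Real.pi * y) = -Real.log C := div_mul_cancel₀ _ hp.ne'
  nlinarith

/-- Antiholomorphic derivatives in positive directions vanish. -/
theorem IsCasimirForm.dZBar_pos (h : IsCasimirForm k L s φ)
    (hH : ∀ P ∈ regularPoints s, heisLaplace L e φ P = 0) (he : 0 < qf L e) :
    ∀ P ∈ analyticDomain φ, wirtG I (dirZ e) φ P = 0 := by
  intro P hP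
  refine eq_zero_of_generic h.sing.nonzero hP.1 (analyticAt_wirtG hP.2 _ _).continuousAt
    fun α hα β τ hτ => ?_
  obtain ⟨M, hM0, hM⟩ := norm_extG_le h hH hα hτ
  have h0 : ‖extG L s e φ (sectionPt α β τ)‖ ≤ 0 := by
    refine le_of_forall_pos_le_add fun η hη => ?_
    -- The constant `M` does not depend on `C`, which can be made arbitrarily small in a positive
    -- direction.
    obtain ⟨T₀, hT₀⟩ := tendsto_qf_line h.index.symm he α hτ (C := η / (M + 1)) (by positivity)
    have h1 := hM _ T₀ hT₀ β 0
    rw [zero_smul, add_zero] at h1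
    rw [zero_add]
    refine h1.trans ?_
    rw [mul_div_assoc', div_le_iff₀ (by positivity)]
    nlinarith
  have hr := sectionPt_mem_regularPoints hα β hτ
  rw [extG_of_regular h.sing hr, RCLike.norm_conj, norm_xiW] at h0
  have h1 : xiNorm L e φ (sectionPt α β τ) = 0 := by
    refine le_antisymm ?_ (mul_nonneg (norm_nonneg _) (Real.exp_pos _).le)
    exact nonpos_of_mul_nonpos_left h0 (Real.exp_pos _)
  rw [xiNorm, mul_eq_zero, norm_eq_zero] at h1
  exact h1.resolve_right (Real.exp_pos _).ne'

/-- Along radical directions the antiholomorphic derivative is constant on complex lines. -/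
theorem IsCasimirForm.wirtG_dZBar_ker (h : IsCasimirForm k L s φ)
    (hH : ∀ P ∈ regularPoints s, heisLaplace L e φ P = 0) (he : L *ᵥ e = 0) (a : ℂ) :
    ∀ P ∈ analyticDomain φ, wirtG a (dirZ e) (wirtG I (dirZ e) φ) P = 0 := by
  intro P hP
  refine eq_zero_of_generic h.sing.nonzero hP.1
    (analyticAt_wirtG (analyticAt_wirtG hP.2 _ _) _ _).continuousAt fun α hα β τ hτ => ?_
  set P₀ := sectionPt α β τ with hP₀
  have hr : P₀ ∈ regularPoints s := sectionPt_mem_regularPoints hα β hτ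
  have hq : ∀ v : Fin N → ℝ, ∀ t : ℝ, qf L (v + t • e) = qf L v := by
    intro v t
    rw [qf_add_smul h.index.symm, qf, qf, he]; simp
  obtain ⟨M, hM0, hM⟩ := norm_extG_le h hH hα hτ
  have hbd := hM (Real.exp (-(2 * Real.pi) * τ.im * qf L α)) 0 (fun t _ => by rw [hq]) β
  have hdiff := differentiable_extG h.index.symm h.sing hH (Q := P₀) hτ
    (goodLine_of_notMem hr.2)
  -- In a radical direction `L[α + t e]` does not depend on `t`, so the entire function is bounded
  -- and Liouville's theorem applies.
  have hconst : ∀ z : ℂ, extG L s e φ (P₀ + z • dirZ e) = extG L s e φ P₀ := by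
    intro z
    have := hdiff.apply_eq_apply_of_bounded
      ((Metric.isBounded_closedBall (x := (0 : ℂ))
        (r := M * Real.exp (-(2 * Real.pi) * τ.im * qf L α))).subset (by
        rintro _ ⟨w, rfl⟩
        simpa using hbd w)) z 0
    simpa using this
  have hw : ∀ z : ℂ, wFun L (P₀ + z • dirZ e) = wFun L P₀ := by
    intro z
    rw [wFun, wFun, line_fst]
    have : (imPart (P₀ + z • dirZ e)).2 = (imPart P₀).2 + z.im • e := by
      ext j; simp [imPart, dirZ]
    rw [this, hq]
  -- The weight is constant along `e` as well and can be cancelled. Parameters on the singular locus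
  -- are then reached by continuity.
  have hlc : ∀ᶠ z in 𝓝 (0 : ℂ), wirtG I (dirZ e) φ (P₀ + z • dirZ e) = wirtG I (dirZ e) φ P₀ := by
    have hc : ContinuousAt (fun z : ℂ => P₀ + z • dirZ e) 0 := by fun_prop
    have h1 : ∀ᶠ z in 𝓝 (0 : ℂ), P₀ + z • dirZ e ∈ analyticDomain φ := by
      refine hc.eventually_mem ((isOpen_analyticDomain φ).mem_nhds ?_)
      simpa using h.mem_analyticDomain hr
    obtain ⟨δ, hδ, hball⟩ := Metric.eventually_nhds_iff_ball.mp h1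
    have hreg : ∀ z : ℂ, P₀ + z • dirZ e ∉ singularLocus s →
        wirtG I (dirZ e) φ (P₀ + z • dirZ e) = wirtG I (dirZ e) φ P₀ := by
      intro z hz
      have h2 := hconst z
      rw [extG_of_regular h.sing ⟨by rw [line_fst]; exact hτ, hz⟩, extG_of_regular h.sing hr] at h2
      have h3 := (starRingEnd ℂ).injective h2
      rw [xiW, xiW, hw] at h3
      refine mul_right_cancel₀ ?_ h3
      rw [wFun]
      exact_mod_cast (Real.exp_pos _).ne'
    filter_upwards [Metric.ball_mem_nhds (0 : ℂ) hδ] with z hz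
    by_contra hne
    have hcz : ContinuousAt (fun w : ℂ => wirtG I (dirZ e) φ (P₀ + w • dirZ e)) z := by
      have h4 := (analyticAt_wirtG (hball z hz).2 I (dirZ e)).continuousAt
      exact ContinuousAt.comp (f := fun w : ℂ => P₀ + w • dirZ e) h4 (by fun_prop)
    obtain ⟨w, hw1, hw2⟩ := (((goodLine_of_notMem (e := e) hr.2).frequently z).and_eventually
      (hcz.eventually_ne hne)).exists
    exact hw2 (hreg w hw1)
  have hda : DifferentiableAt ℝ (wirtG I (dirZ e) φ) P₀ :=
    (analyticAt_wirtG (h.sing.analytic _ hr) _ _).differentiableAt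
  have hdir : ∀ c : ℂ, fderiv ℝ (wirtG I (dirZ e) φ) P₀ (c • dirZ e) = 0 := by
    intro c
    have h1 : HasDerivAt (fun t : ℝ => P₀ + ((t : ℂ) * c) • dirZ e) (c • dirZ e) (0 : ℝ) := by
      have h2 : HasDerivAt (fun t : ℝ => P₀ + t • (c • dirZ e)) ((1 : ℝ) • (c • dirZ e)) (0 : ℝ) :=
        ((hasDerivAt_id (0 : ℝ)).smul_const (c • dirZ e)).const_add P₀
      rw [one_smul] at h2
      refine h2.congr_of_eventuallyEq (Eventually.of_forall fun t => ?_)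
      simp only [mul_smul]
      rfl
    have h3 := HasFDerivAt.comp_hasDerivAt (f := fun t : ℝ => P₀ + ((t : ℂ) * c) • dirZ e)
      (l := wirtG I (dirZ e) φ) (0 : ℝ) (by simpa using hda.hasFDerivAt) h1
    have h4 : (wirtG I (dirZ e) φ ∘ fun t : ℝ => P₀ + ((t : ℂ) * c) • dirZ e)
        =ᶠ[𝓝 0] fun _ => wirtG I (dirZ e) φ P₀ := by
      have hc : Tendsto (fun t : ℝ => (t : ℂ) * c) (𝓝 0) (𝓝 0) := by
        have : Continuous fun t : ℝ => (t : ℂ) * c := by fun_prop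
        simpa using this.tendsto 0
      exact hc.eventually hlc
    have h5 := (hasDerivAt_const (0 : ℝ) (wirtG I (dirZ e) φ P₀)).congr_of_eventuallyEq h4
    have h6 := h3.unique h5
    simpa using h6
  have e1 := hdir 1
  rw [one_smul] at e1
  rw [wirtG, e1, hdir I]; simp

end Global

/-! ### Equations for antiholomorphic derivatives along the radical. -/

section Radical

variable {L : Matrix (Fin N) (Fin N) ℝ} {s : Finset ((Fin N → ℝ) × ℝ × ℝ)}
  {φ : JacobiSpace N → ℂ} {e : Fin N → ℝ} {k : ℤ}

theorem wirtG_analyticDomain_congr {F G : JacobiSpace N → ℂ}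
    (h : ∀ P ∈ analyticDomain φ, F P = G P) (a : ℂ) (d : JacobiSpace N) :
    ∀ P ∈ analyticDomain φ, wirtG a d F P = wirtG a d G P := fun _ hP =>
  wirtG_congr (Filter.eventuallyEq_of_mem ((isOpen_analyticDomain φ).mem_nhds hP) h) a d

theorem wirtG_eq_zero_of_eq_zero {F : JacobiSpace N → ℂ} (h : ∀ P ∈ analyticDomain φ, F P = 0)
    (a : ℂ) (d : JacobiSpace N) : ∀ P ∈ analyticDomain φ, wirtG a d F P = 0 := fun P hP => by
  rw [wirtG_analyticDomain_congr (G := fun _ => 0) h a d P hP, wirtG_const]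

/-- Antiholomorphy in a direction that is not `L`-orthogonal to `e` forces antiholomorphic
derivatives along `e` to vanish. -/
theorem dZBar_eq_zero_of_transverse (hL : L.IsSymm) {w : Fin N → ℝ}
    (hH : ∀ P ∈ analyticDomain φ, heisLaplace L e φ P = 0)
    (hw : ∀ P ∈ analyticDomain φ, wirtG I (dirZ w) φ P = 0) (hwe : w ⬝ᵥ (L *ᵥ e) ≠ 0) :
    ∀ P ∈ analyticDomain φ, wirtG I (dirZ e) φ P = 0 := by
  intro P hP
  have hxi := analyticAt_wirtG hP.2 I (dirZ e)
  have hww : ∀ Q ∈ analyticDomain φ, wirtG I (dirZ w) (wirtG I (dirZ e) φ) Q = 0 := by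
    intro Q hQ
    rw [wirtG_comm hQ.2]
    exact wirtG_eq_zero_of_eq_zero hw _ _ Q hQ
  -- When `∂̄_w` is applied to the Heisenberg equation, every term that contains `∂̄_w φ` vanishes.
  -- Only the derivative of the coefficient `vᵀ L e`, a multiple of `wᵀ L e`, is left in front of
  -- `∂̄_e φ`.
  have h1 := wirtG_eq_zero_of_eq_zero hH I (dirZ w) P hP
  have hfun : heisLaplace L e φ = fun Q => imFun fstL Q *
      wirtG (-I) (dirZ e) (wirtG I (dirZ e) φ) Q
        + 4 * Real.pi * I * (imFun (sndL (L *ᵥ e)) Q * wirtG I (dirZ e) φ Q) := by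
    funext Q
    rw [heisLaplace_eq hL, imFun, imFun, sndL_apply, dotProduct_comm]
    simp only [imPart, ContinuousLinearMap.coe_fst']
    ring
  have hd2 := analyticAt_wirtG hxi (-I) (dirZ e)
  rw [hfun, wirtG_add ((analyticAt_imFun _ P).fun_mul hd2).differentiableAt
      (analyticAt_const.fun_mul ((analyticAt_imFun _ P).fun_mul hxi)).differentiableAt,
    wirtG_const_mul _ ((analyticAt_imFun _ P).fun_mul hxi).differentiableAt,
    wirtG_mul (analyticAt_imFun _ P).differentiableAt hd2.differentiableAt,
    wirtG_mul (analyticAt_imFun _ P).differentiableAt hxi.differentiableAt, hww P hP,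
    wirtG_comm hxi, wirtG_eq_zero_of_eq_zero hww _ _ P hP, dirZ_eq_emb w, wirtG_imFun, wirtG_imFun,
    sndL_apply] at h1
  have h2 : ((L *ᵥ e) ⬝ᵥ w : ℝ) ≠ 0 := by rwa [dotProduct_comm]
  have h3 : (((L *ᵥ e) ⬝ᵥ w : ℝ) : ℂ) ≠ 0 := by exact_mod_cast h2
  have hpi : (Real.pi : ℂ) ≠ 0 := by exact_mod_cast Real.pi_ne_zero
  simp only [ContinuousLinearMap.coe_fst', mul_zero, zero_add, Complex.ofReal_zero, zero_div,
    zero_mul, add_zero, mul_eq_zero, div_eq_zero_iff, Complex.I_ne_zero, hpi, h3, or_self,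
    OfNat.ofNat_ne_zero, false_or] at h1
  exact h1

/-- With `s = 0` the operator is half the real derivative, so this is `∂ = ∂_u - ∂̄`. It separates
periodic directions from antiholomorphic derivatives. -/
theorem wirtG_neg_I (d : JacobiSpace N) (F : JacobiSpace N → ℂ) (P : JacobiSpace N) :
    wirtG (-I) d F P = 2 * wirtG 0 d F P - wirtG I d F P := by
  simp only [wirtG]; ring

theorem wirtG_op2 {F : JacobiSpace N → ℂ} {P : JacobiSpace N} (hF : AnalyticAt ℝ F P)
    (S : Fin N → Fin N → ℂ) (a b c : ℂ) (d : JacobiSpace N) :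
    wirtG c d (op2 S a b F) P = op2 S a b (wirtG c d F) P := by
  have hw := fun i j => (analyticAt_wirtG (analyticAt_wirtG hF b (dirZ (stdVec j))) a
    (dirZ (stdVec i)))
  have h1 : op2 S a b F = fun Q => ∑ i, ∑ j, S i j *
      wirtG a (dirZ (stdVec i)) (wirtG b (dirZ (stdVec j)) F) Q := rfl
  rw [h1, wirtG_sum fun i _ => (Finset.analyticAt_fun_sum _ fun j _ =>
    analyticAt_const.fun_mul (hw i j)).differentiableAt, op2]
  refine Finset.sum_congr rfl fun i _ => ?_
  rw [wirtG_sum fun j _ => (analyticAt_const.fun_mul (hw i j)).differentiableAt]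
  refine Finset.sum_congr rfl fun j _ => ?_
  rw [wirtG_const_mul _ (hw i j).differentiableAt, wirtG_comm (analyticAt_wirtG hF _ _)]
  congr 1
  refine wirtG_congr ?_ _ _
  filter_upwards [hF.eventually_analyticAt] with Q hQ using wirtG_comm hQ _ _ _ _

/-- The operator by which the radical part of the Casimir operator acts on antiholomorphic
derivatives. -/
def radM (k : ℤ) (L : Matrix (Fin N) (Fin N) ℝ) (F : JacobiSpace N → ℂ) (P : JacobiSpace N) : ℂ :=
  2 * I * (imFun fstL P * (wirtG (-I) dirTau F P - wirtG I dirTau F P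
    - (1 / 4) * (op2 (scrInv L) (-I) (-I) F P - op2 (scrInv L) I I F P)))
  + (kappa k N) * F P
  - 2 * I * ∑ j, imFun (sndL (projNd L j)) P * wirtG I (dirZ (stdVec j)) F P

/-- The remaining part of the radical part of the Casimir operator. -/
def radZ (L : Matrix (Fin N) (Fin N) ℝ) (F : JacobiSpace N → ℂ) (P : JacobiSpace N) : ℂ :=
  2 * I * (imFun fstL P * (wirtG I dirTau F P - (1 / 4) * op2 (scrInv L) I I F P))
  + 2 * I * ∑ j, imFun (sndL (projNd L j)) P * wirtG I (dirZ (stdVec j)) F P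

theorem wirtG_zero_imFun_mul {F : JacobiSpace N → ℂ} {P : JacobiSpace N} (hF : AnalyticAt ℝ F P)
    (ℓ : (ℝ × (Fin N → ℝ)) →L[ℝ] ℝ) (lam : Fin N → ℝ) :
    wirtG 0 (dirZ lam) (fun Q => imFun ℓ Q * F Q) P = imFun ℓ P * wirtG 0 (dirZ lam) F P := by
  rw [wirtG_mul (analyticAt_imFun ℓ P).differentiableAt hF.differentiableAt, dirZ_eq_emb,
    wirtG_imFun]
  simp

theorem wirtG_zero_sum_imFun {F : Fin N → JacobiSpace N → ℂ} {P : JacobiSpace N}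
    (hF : ∀ j, AnalyticAt ℝ (F j) P) (ℓ : Fin N → (ℝ × (Fin N → ℝ)) →L[ℝ] ℝ) (lam : Fin N → ℝ) :
    wirtG 0 (dirZ lam) (fun Q => ∑ j, imFun (ℓ j) Q * F j Q) P
      = ∑ j, imFun (ℓ j) P * wirtG 0 (dirZ lam) (F j) P := by
  rw [wirtG_sum fun j _ => ((analyticAt_imFun (ℓ j) P).fun_mul (hF j)).differentiableAt]
  exact Finset.sum_congr rfl fun j _ => wirtG_zero_imFun_mul (hF j) _ _

theorem analyticAt_radZ {F : JacobiSpace N → ℂ} {P : JacobiSpace N} (hF : AnalyticAt ℝ F P) :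
    AnalyticAt ℝ (radZ L F) P := by
  unfold radZ
  exact (analyticAt_const.fun_mul ((analyticAt_imFun _ P).fun_mul ((analyticAt_wirtG hF _ _).fun_sub
    (analyticAt_const.fun_mul (analyticAt_op2 hF _ _ _))))).fun_add (analyticAt_const.fun_mul
      (Finset.analyticAt_fun_sum _ fun j _ => (analyticAt_imFun _ P).fun_mul (analyticAt_wirtG hF _ _)))

theorem analyticAt_radM {F : JacobiSpace N → ℂ} {P : JacobiSpace N} (hF : AnalyticAt ℝ F P) :
    AnalyticAt ℝ (radM k L F) P := by
  unfold radM
  exact ((analyticAt_const.fun_mul ((analyticAt_imFun _ P).fun_mul (((analyticAt_wirtG hF _ _).fun_sub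
    (analyticAt_wirtG hF _ _)).fun_sub (analyticAt_const.fun_mul ((analyticAt_op2 hF _ _ _).fun_sub
      (analyticAt_op2 hF _ _ _)))))).fun_add (analyticAt_const.fun_mul hF)).fun_sub (analyticAt_const.fun_mul
      (Finset.analyticAt_fun_sum _ fun j _ => (analyticAt_imFun _ P).fun_mul (analyticAt_wirtG hF _ _)))

theorem radM_congr {F G : JacobiSpace N → ℂ} {P : JacobiSpace N} (h : F =ᶠ[𝓝 P] G) :
    radM k L F P = radM k L G P := by
  simp only [radM, wirtG_congr h, (op2_congr h _ _ _).eq_of_nhds, h.eq_of_nhds]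

theorem radM_zero (P : JacobiSpace N) : radM k L (fun _ => 0) P = 0 := by
  have h : ∀ a (d : JacobiSpace N), wirtG a d (fun _ : JacobiSpace N => (0 : ℂ)) = fun _ => 0 :=
    fun a d => funext fun Q => wirtG_const 0
  simp [radM, op2, h]

theorem wirtG_zero_radM {F : JacobiSpace N → ℂ} {P : JacobiSpace N} (hF : AnalyticAt ℝ F P)
    (lam : Fin N → ℝ) :
    wirtG 0 (dirZ lam) (radM k L F) P = radM k L (wirtG 0 (dirZ lam) F) P := by
  have hw := fun a d => analyticAt_wirtG hF a d
  have ho := fun S a b => analyticAt_op2 hF S a b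
  have hA := ((hw (-I) dirTau).fun_sub (hw I dirTau)).fun_sub ((analyticAt_const (v := (1 / 4 : ℂ))).fun_mul
    ((ho (scrInv L) (-I) (-I)).fun_sub (ho (scrInv L) I I)))
  have hyA := (analyticAt_const (v := 2 * I)).fun_mul ((analyticAt_imFun fstL P).fun_mul hA)
  have hk := (analyticAt_const (v := (kappa k N : ℂ))).fun_mul hF
  have hS := Finset.analyticAt_fun_sum Finset.univ fun j _ =>
    (analyticAt_imFun (sndL (projNd L j)) P).fun_mul (hw I (dirZ (stdVec j)))
  have h1 : radM k L F = fun Q => 2 * I * (imFun fstL Q * (wirtG (-I) dirTau F Q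
      - wirtG I dirTau F Q - (1 / 4) * (op2 (scrInv L) (-I) (-I) F Q - op2 (scrInv L) I I F Q)))
      + (kappa k N) * F Q
      - 2 * I * ∑ j, imFun (sndL (projNd L j)) Q * wirtG I (dirZ (stdVec j)) F Q := rfl
  rw [h1, wirtG_sub (hyA.fun_add hk).differentiableAt (analyticAt_const.fun_mul hS).differentiableAt,
    wirtG_add hyA.differentiableAt hk.differentiableAt,
    wirtG_const_mul _ ((analyticAt_imFun fstL P).fun_mul hA).differentiableAt,
    wirtG_const_mul _ hF.differentiableAt, wirtG_const_mul _ hS.differentiableAt,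
    wirtG_zero_imFun_mul hA, wirtG_zero_sum_imFun fun j => hw I (dirZ (stdVec j)),
    wirtG_sub ((hw _ _).fun_sub (hw _ _)).differentiableAt
      (analyticAt_const.fun_mul ((ho _ _ _).fun_sub (ho _ _ _))).differentiableAt,
    wirtG_sub (hw _ _).differentiableAt (hw _ _).differentiableAt,
    wirtG_const_mul _ ((ho _ _ _).fun_sub (ho _ _ _)).differentiableAt,
    wirtG_sub (ho _ _ _).differentiableAt (ho _ _ _).differentiableAt, wirtG_op2 hF, wirtG_op2 hF,
    wirtG_comm hF, wirtG_comm hF 0 I, radM]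
  simp only [wirtG_comm hF 0 I]

/-- Each `∂_λ` is replaced by `∂_u - ∂̄` along `λ`. The terms with `∂̄_λ` collect into `radM` of
`∂̄_λ F`, and the others are a real derivative along `λ`, whose coefficients depend on imaginary
parts only and hence can be pulled inside. -/
theorem casLin_eq {F : JacobiSpace N → ℂ} {P : JacobiSpace N} (hF : AnalyticAt ℝ F P)
    (lam : Fin N → ℝ) : casLin k L lam F P * I
      = 4 * P.1.im * (radM k L (wirtG I (dirZ lam) F) P
        + 2 * wirtG 0 (dirZ lam) (radZ L F) P) := by
  have hw := fun a d => analyticAt_wirtG hF a d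
  have ho := fun S a b => analyticAt_op2 hF S a b
  have hA := (hw I dirTau).fun_sub ((analyticAt_const (v := (1 / 4 : ℂ))).fun_mul (ho (scrInv L) I I))
  have hyA := (analyticAt_const (v := 2 * I)).fun_mul ((analyticAt_imFun fstL P).fun_mul hA)
  have hS := Finset.analyticAt_fun_sum Finset.univ fun j _ =>
    (analyticAt_imFun (sndL (projNd L j)) P).fun_mul (hw I (dirZ (stdVec j)))
  have h1 : radZ L F = fun Q => 2 * I * (imFun fstL Q * (wirtG I dirTau F Q
      - (1 / 4) * op2 (scrInv L) I I F Q))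
      + 2 * I * ∑ j, imFun (sndL (projNd L j)) Q * wirtG I (dirZ (stdVec j)) F Q := rfl
  have h2 : wirtG 0 (dirZ lam) (radZ L F) P = 2 * I * (imFun fstL P *
      (wirtG 0 (dirZ lam) (wirtG I dirTau F) P
        - (1 / 4) * wirtG 0 (dirZ lam) (op2 (scrInv L) I I F) P))
      + 2 * I * ∑ j, imFun (sndL (projNd L j)) P *
        wirtG 0 (dirZ lam) (wirtG I (dirZ (stdVec j)) F) P := by
    rw [h1, wirtG_add hyA.differentiableAt (analyticAt_const.fun_mul hS).differentiableAt,
      wirtG_const_mul _ ((analyticAt_imFun fstL P).fun_mul hA).differentiableAt,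
      wirtG_const_mul _ hS.differentiableAt, wirtG_zero_imFun_mul hA,
      wirtG_zero_sum_imFun fun j => hw I (dirZ (stdVec j)),
      wirtG_sub (hw _ _).differentiableAt (analyticAt_const.fun_mul (ho _ _ _)).differentiableAt,
      wirtG_const_mul _ (ho _ _ _).differentiableAt]
  have hsum : ∑ j, vNdC L P j * wirtG (-I) (dirZ lam) (wirtG I (dirZ (stdVec j)) F) P
      = 2 * ∑ j, imFun (sndL (projNd L j)) P *
          wirtG 0 (dirZ lam) (wirtG I (dirZ (stdVec j)) F) P
        - ∑ j, imFun (sndL (projNd L j)) P *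
          wirtG I (dirZ (stdVec j)) (wirtG I (dirZ lam) F) P := by
    rw [Finset.mul_sum, ← Finset.sum_sub_distrib]
    refine Finset.sum_congr rfl fun j _ => ?_
    rw [wirtG_neg_I, wirtG_comm hF I I, ← congrFun (vNdC_eq_imFun L j) P]
    ring
  have hy : imFun fstL P = (P.1.im : ℂ) := rfl
  rw [casLin, hsum, h2, radM, opP_eq, opQ_eq, wirtG_op2 hF _ _ _ I, wirtG_neg_I (dirZ lam),
    wirtG_neg_I (dirZ lam), wirtG_op2 hF _ _ _ I, wirtG_comm hF I I (dirZ lam) dirTau, hy]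
  ring_nf
  simp only [Complex.I_sq]
  ring

theorem sectionPt_add_real_smul (α β : Fin N → ℝ) (τ : ℂ) (lam : Fin N → ℝ) (t : ℝ) :
    sectionPt α (β + t • lam) τ = sectionPt α β τ + t • dirZ lam := by
  have h := sectionPt_add_smul (e := lam) α β τ 0 t
  rw [zero_smul, add_zero] at h
  rw [h]
  refine Prod.ext ?_ ?_
  · simp [dirZ]
  · ext j; simp [dirZ]

theorem slope_eq_zero_of_bounded {f f' : ℝ → ℂ} (h1 : ∀ t, HasDerivAt f (f' t) t)
    (h2 : ∀ t, HasDerivAt f' 0 t) {M : ℝ} (hM : ∀ t, ‖f t‖ ≤ M) : f' 0 = 0 := by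
  have h3 : ∀ t, f' t = f' 0 := fun t =>
    is_const_of_deriv_eq_zero (fun t => (h2 t).differentiableAt) (fun t => (h2 t).deriv) t 0
  have h4 : ∀ t : ℝ, f t = f 0 + t * f' 0 := by
    intro t
    have h5 : ∀ t : ℝ, HasDerivAt (fun t : ℝ => f t - t * f' 0) 0 t := by
      intro t
      have := (h1 t).fun_sub ((Complex.ofRealCLM.hasDerivAt (x := t)).mul_const (f' 0))
      rw [h3 t] at this
      simpa using this
    have h6 := is_const_of_deriv_eq_zero (fun t => (h5 t).differentiableAt)
      (fun t => (h5 t).deriv) t 0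
    simp only [Complex.ofReal_zero, zero_mul, sub_zero] at h6
    linear_combination h6
  by_contra hne
  have hpos : 0 < ‖f' 0‖ := norm_pos_iff.mpr hne
  have h7 := hM ((2 * M + 1) / ‖f' 0‖)
  have h8 := hM 0
  rw [h4] at h7
  have hM0 : 0 ≤ M := (norm_nonneg _).trans h8
  have h9 : ‖(((2 * M + 1) / ‖f' 0‖ : ℝ) : ℂ) * f' 0‖ = 2 * M + 1 := by
    rw [norm_mul, Complex.norm_real, Real.norm_of_nonneg (by positivity), div_mul_cancel₀ _ hpos.ne']
  have h11 := norm_add_le (f 0 + (((2 * M + 1) / ‖f' 0‖ : ℝ) : ℂ) * f' 0) (-f 0)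
  rw [norm_neg, add_neg_cancel_comm, h9] at h11
  linarith

/-- Periodic functions that are affine in a real direction are constant in that direction. -/
theorem wirtG_zero_of_periodic {F : JacobiSpace N → ℂ}
    (hF : ∀ P ∈ regularPoints s, AnalyticAt ℝ F P)
    (hper : ∀ P ∈ regularPoints s, ∀ mu : Fin N → ℤ, F (jacobiAct 1 0 mu P) = F P)
    {lam : Fin N → ℝ}
    (h2 : ∀ P ∈ regularPoints s, wirtG 0 (dirZ lam) (wirtG 0 (dirZ lam) F) P = 0)
    {α : Fin N → ℝ} (hα : α ∈ genericDir s) (β : Fin N → ℝ) {τ : ℂ} (hτ : 0 < τ.im) :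
    wirtG 0 (dirZ lam) F (sectionPt α β τ) = 0 := by
  have hr : ∀ β, sectionPt α β τ ∈ regularPoints s := fun β => sectionPt_mem_regularPoints hα β hτ
  have hc : Continuous fun b : Fin N → ℝ => sectionPt α b τ :=
    continuous_sectionPt.comp (by fun_prop : Continuous fun b : Fin N → ℝ => (α, b, τ))
  obtain ⟨M, hM⟩ : ∃ M, ∀ β, ‖F (sectionPt α β τ)‖ ≤ M := by
    obtain ⟨M, hM⟩ := (isCompact_Icc (a := (0 : Fin N → ℝ)) (b := 1)).exists_bound_of_continuousOn
      (f := fun β => F (sectionPt α β τ)) fun β _ =>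
        (ContinuousAt.comp (f := fun β => sectionPt α β τ) (hF _ (hr β)).continuousAt
          hc.continuousAt).continuousWithinAt
    refine ⟨M, fun β => ?_⟩
    have h0 : (fun j => (((0 : Fin N → ℤ) j : ℤ) : ℝ)) = 0 := by ext j; simp
    rw [← hper _ (hr β) (fun j => -⌊β j⌋), jacobiAct_one_sectionPt, h0, add_zero]
    refine hM _ ⟨fun j => ?_, fun j => ?_⟩
    · have := Int.fract_nonneg (β j)
      rw [Int.fract] at this
      simp only [Pi.zero_apply, Pi.add_apply, Int.cast_neg]
      linarith
    · have := (Int.fract_lt_one (β j)).le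
      rw [Int.fract] at this
      simp only [Pi.one_apply, Pi.add_apply, Int.cast_neg]
      linarith
  have hder : ∀ G : JacobiSpace N → ℂ, (∀ P ∈ regularPoints s, AnalyticAt ℝ G P) → ∀ t : ℝ,
      HasDerivAt (fun t : ℝ => G (sectionPt α (β + t • lam) τ))
        (2 * wirtG 0 (dirZ lam) G (sectionPt α (β + t • lam) τ)) t := by
    intro G hG t
    have h3 : HasDerivAt (fun t : ℝ => sectionPt α (β + t • lam) τ) (dirZ lam) t := by
      have h4 : HasDerivAt (fun t : ℝ => sectionPt α β τ + t • (dirZ lam : JacobiSpace N))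
          ((1 : ℝ) • dirZ lam) t := ((hasDerivAt_id t).smul_const _).const_add _
      rw [one_smul] at h4
      exact h4.congr_of_eventuallyEq (Eventually.of_forall fun t =>
        sectionPt_add_real_smul α β τ lam t)
    have h5 := HasFDerivAt.comp_hasDerivAt (f := fun t : ℝ => sectionPt α (β + t • lam) τ)
      (l := G) t (hG _ (hr _)).differentiableAt.hasFDerivAt h3
    have h6 : 2 * wirtG 0 (dirZ lam) G (sectionPt α (β + t • lam) τ)
        = fderiv ℝ G (sectionPt α (β + t • lam) τ) (dirZ lam) := by
      simp only [wirtG]; ring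
    rw [h6]; exact h5
  have h7 := slope_eq_zero_of_bounded (hder F hF)
    (f' := fun t => 2 * wirtG 0 (dirZ lam) F (sectionPt α (β + t • lam) τ)) (fun t => by
      have := (hder (wirtG 0 (dirZ lam) F) (fun P hP => analyticAt_wirtG (hF P hP) _ _) t).const_mul 2
      rw [h2 _ (hr _)] at this
      simpa using this) (fun t => hM _)
  simpa using h7

theorem IsCasimirForm.wirtG_zero_of_periodic (h : IsCasimirForm k L s φ) {F : JacobiSpace N → ℂ}
    (hF : ∀ P ∈ analyticDomain φ, AnalyticAt ℝ F P)
    (hper : ∀ P ∈ regularPoints s, ∀ mu : Fin N → ℤ, F (jacobiAct 1 0 mu P) = F P)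
    {lam : Fin N → ℝ}
    (h2 : ∀ P ∈ regularPoints s, wirtG 0 (dirZ lam) (wirtG 0 (dirZ lam) F) P = 0) :
    ∀ P ∈ analyticDomain φ, wirtG 0 (dirZ lam) F P = 0 := fun P hP =>
  eq_zero_of_generic h.sing.nonzero hP.1 (analyticAt_wirtG (hF P hP) _ _).continuousAt
    fun _ hα β _ hτ => MaassJacobi.wirtG_zero_of_periodic
      (fun P hP => hF P (h.mem_analyticDomain hP)) hper h2 hα β hτ

/-- For every radical vector, in the frame or not, the Heisenberg equation reduces to the vanishing
of its mixed derivative, which is known from translations. Liouville's argument therefore applies to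
`lam`, `mu` and their sum, and the result is polarised. -/
theorem IsCasimirForm.wirtG_dZBar_polar (h : IsCasimirForm k L s φ) {lam mu : Fin N → ℝ}
    (hl : L *ᵥ lam = 0) (hm : L *ᵥ mu = 0) (a : ℂ) : ∀ P ∈ analyticDomain φ,
      wirtG a (dirZ lam) (wirtG I (dirZ mu) φ) P + wirtG a (dirZ mu) (wirtG I (dirZ lam) φ) P = 0 := by
  have hH : ∀ x : Fin N → ℝ, L *ᵥ x = 0 → ∀ P ∈ regularPoints s, heisLaplace L x φ P = 0 := by
    intro x hx P hP
    have h1 := h.mixed_add_mixed hx hx P (h.mem_analyticDomain hP)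
    rw [mixed] at h1
    rw [heisLaplace_eq h.index.symm, hx, dotProduct_zero]
    simp only [Complex.ofReal_zero]
    linear_combination (P.1.im : ℂ) / 2 * h1
  intro P hP
  have e1 := h.wirtG_dZBar_ker (hH lam hl) hl a P hP
  have e2 := h.wirtG_dZBar_ker (hH mu hm) hm a P hP
  have hlm : L *ᵥ (lam + mu) = 0 := by rw [Matrix.mulVec_add, hl, hm, add_zero]
  have e3 := h.wirtG_dZBar_ker (hH (lam + mu) hlm) hlm a P hP
  have hd := fun d => (analyticAt_wirtG hP.2 I d).differentiableAt
  rw [dirZ_add, wirtG_dir_add, wirtG_dir_add_fun, wirtG_add (hd _) (hd _), wirtG_add (hd _) (hd _)] at e3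
  linear_combination e3 - e1 - e2

/-- The expression is antisymmetric by polarisation and symmetric because derivatives commute. -/
theorem IsCasimirForm.dZBar_dZBar_ker (h : IsCasimirForm k L s φ) {lam mu : Fin N → ℝ}
    (hl : L *ᵥ lam = 0) (hm : L *ᵥ mu = 0) :
    ∀ P ∈ analyticDomain φ, wirtG I (dirZ lam) (wirtG I (dirZ mu) φ) P = 0 := by
  intro P hP
  have h1 := h.wirtG_dZBar_polar hl hm I P hP
  rw [wirtG_comm hP.2 I I (dirZ mu)] at h1
  linear_combination h1 / 2

/-- Polarisation turns the second real derivative of `∂̄_mu φ` along `lam` into a derivative of `∂_u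
∂̄ φ` with both directions equal to `lam`, which vanishes. A periodic function that is affine along
a direction is constant along it. -/
theorem IsCasimirForm.dU_dZBar_ker (h : IsCasimirForm k L s φ) {lam mu : Fin N → ℝ}
    (hl : L *ᵥ lam = 0) (hm : L *ᵥ mu = 0) :
    ∀ P ∈ analyticDomain φ, wirtG 0 (dirZ lam) (wirtG I (dirZ mu) φ) P = 0 := by
  refine h.wirtG_zero_of_periodic (fun P hP => analyticAt_wirtG hP.2 _ _) (fun P hP nu => ?_)
    fun P hP => ?_
  · have h1 := wirtBar_jacobiAct_one h hP 0 nu mu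
    have h2 : ellFactor L (0 : Fin N → ℤ) P = 1 := by simp [ellFactor, qfC]
    rw [h2, one_mul] at h1
    exact h1.symm
  · have hO := h.mem_analyticDomain hP
    have hxi := fun d => analyticAt_wirtG hO.2 I d
    have e1 : ∀ Q ∈ analyticDomain φ, wirtG 0 (dirZ lam) (wirtG I (dirZ mu) φ) Q
        = -wirtG 0 (dirZ mu) (wirtG I (dirZ lam) φ) Q := fun Q hQ =>
      eq_neg_of_add_eq_zero_left (h.wirtG_dZBar_polar hl hm 0 Q hQ)
    have e2 : ∀ Q ∈ analyticDomain φ, wirtG 0 (dirZ lam) (wirtG I (dirZ lam) φ) Q = 0 := by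
      intro Q hQ
      have := h.wirtG_dZBar_polar hl hl 0 Q hQ
      linear_combination this / 2
    rw [wirtG_analyticDomain_congr e1 _ _ P hO]
    have e3 := wirtG_const_mul (s := 0) (d := dirZ lam) (-1 : ℂ)
      (analyticAt_wirtG (hxi (dirZ lam)) 0 (dirZ mu)).differentiableAt
    simp only [neg_one_mul] at e3
    rw [e3, wirtG_comm (hxi _), wirtG_eq_zero_of_eq_zero e2 _ _ P hO, neg_zero]

theorem wirtG_comp_add (a : ℂ) (d v : JacobiSpace N) (F : JacobiSpace N → ℂ) :
    wirtG a d (fun Q => F (Q + v)) = fun Q => wirtG a d F (Q + v) := by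
  funext Q
  simp only [wirtG, fderiv_comp_add_right]

theorem radZ_congr {F G : JacobiSpace N → ℂ} {P : JacobiSpace N} (h : F =ᶠ[𝓝 P] G) :
    radZ L F P = radZ L G P := by
  simp only [radZ, wirtG_congr h, (op2_congr h _ _ _).eq_of_nhds]

theorem IsCasimirForm.radZ_periodic (h : IsCasimirForm k L s φ) {P : JacobiSpace N}
    (hP : P ∈ regularPoints s) (mu : Fin N → ℤ) : radZ L φ (jacobiAct 1 0 mu P) = radZ L φ P := by
  set v : JacobiSpace N := emb (0, fun j => (mu j : ℝ)) with hv
  have hact : ∀ Q : JacobiSpace N, jacobiAct 1 0 mu Q = Q + v := by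
    intro Q
    have h0 : (fun j => (((0 : Fin N → ℤ) j : ℤ) : ℝ)) = 0 := by ext j; simp
    rw [jacobiAct_one_eq, h0]
    congr 1
    refine Prod.ext ?_ ?_ <;> simp [transE_apply]
  have hP' := jacobiAct_one_mem_regularPoints 0 mu hP
  rw [hact] at hP' ⊢
  have hcomp : AnalyticAt ℝ (fun Q => φ (Q + v)) P :=
    AnalyticAt.comp (g := φ) (f := fun Q => Q + v) (h.sing.analytic _ hP')
      (analyticAt_id.fun_add analyticAt_const)
  have hev : (fun Q => φ (Q + v)) =ᶠ[𝓝 P] φ :=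
    eventuallyEq_of_regular h.sing.nonzero hP.1 hcomp (h.sing.analytic P hP)
      (Eventually.of_forall fun Q hQ => by
        have h1 := h.elliptic 0 mu hQ
        have h2 : ellFactor L (0 : Fin N → ℤ) Q = 1 := by simp [ellFactor, qfC]
        rwa [h2, one_mul, hact] at h1)
  have him : ∀ ℓ : (ℝ × (Fin N → ℝ)) →L[ℝ] ℝ, imFun ℓ (P + v) = imFun ℓ P := by
    intro ℓ
    have : imPart (P + v) = imPart P := by
      rw [← imPartL_apply, map_add, imPartL_apply, imPartL_apply, hv, imPart_emb, add_zero]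
    rw [imFun, imFun, this]
  rw [← radZ_congr hev]
  simp only [radZ, op2, wirtG_comp_add, him]

/-- The radical part of the Casimir operator splits. -/
theorem IsCasimirForm.radM_eq_zero (h : IsCasimirForm k L s φ) {lam : Fin N → ℝ}
    (hl : L *ᵥ lam = 0) : ∀ P ∈ analyticDomain φ, radM k L (wirtG I (dirZ lam) φ) P = 0 := by
  have h1 : ∀ P ∈ analyticDomain φ, radM k L (wirtG I (dirZ lam) φ) P
      + 2 * wirtG 0 (dirZ lam) (radZ L φ) P = 0 := by
    intro P hP
    have h2 := casLin_eq (k := k) (L := L) hP.2 lam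
    rw [h.casLin_eq_zero hl P hP, zero_mul] at h2
    have hy : (P.1.im : ℂ) ≠ 0 := by exact_mod_cast hP.1.ne'
    have h4 : (4 : ℂ) ≠ 0 := by norm_num
    exact (mul_eq_zero.mp h2.symm).resolve_left (mul_ne_zero h4 hy)
  have h3 : ∀ P ∈ analyticDomain φ, wirtG 0 (dirZ lam) (radZ L φ) P = 0 := by
    refine h.wirtG_zero_of_periodic (fun P hP => analyticAt_radZ hP.2)
      (fun P hP mu => h.radZ_periodic hP mu) fun P hP => ?_
    have hO := h.mem_analyticDomain hP
    -- The derivative of `radZ L φ` along `lam` is a multiple of `radM` of `∂̄_lam φ`. This is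
    -- itself constant along `lam`, so `radZ L φ` is affine and periodic.
    have h4 : ∀ Q ∈ analyticDomain φ, wirtG 0 (dirZ lam) (radZ L φ) Q
        = (-1 / 2) * radM k L (wirtG I (dirZ lam) φ) Q := fun Q hQ => by
      linear_combination (1 / 2 : ℂ) * h1 Q hQ
    have hxi := analyticAt_wirtG hO.2 I (dirZ lam)
    rw [wirtG_analyticDomain_congr h4 _ _ P hO, wirtG_const_mul _ (analyticAt_radM hxi).differentiableAt,
      wirtG_zero_radM hxi, radM_congr (G := fun _ => 0), radM_zero, mul_zero]
    exact Filter.eventuallyEq_of_mem ((isOpen_analyticDomain φ).mem_nhds hO) (h.dU_dZBar_ker hl hl)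
  intro P hP
  have := h1 P hP
  rwa [h3 P hP, mul_zero, add_zero] at this

end Radical

/-! ### The transformations `τ ↦ -1/(τ+d)` and their effect on derivatives. -/

section Modular

variable {L : Matrix (Fin N) (Fin N) ℝ} {s : Finset ((Fin N → ℝ) × ℝ × ℝ)}
  {φ : JacobiSpace N → ℂ} {k : ℤ} {d : ℤ}

/-- The modular transformation `(τ, z) ↦ (-1 / (τ + d), z / (τ + d))`. -/
def invS (d : ℤ) (P : JacobiSpace N) : JacobiSpace N :=
  (-(P.1 + d)⁻¹, (P.1 + d)⁻¹ • P.2)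

/-- The automorphy factor of `invS`. -/
def autS (k : ℤ) (L : Matrix (Fin N) (Fin N) ℝ) (d : ℤ) (P : JacobiSpace N) : ℂ :=
  (P.1 + d) ^ k * Complex.exp (2 * Real.pi * I * (qfC L P.2 / (P.1 + d)))

theorem denom_ne_zero {τ : ℂ} (hτ : 0 < τ.im) (d : ℤ) : τ + d ≠ 0 := by
  intro h
  have := congrArg Complex.im h
  simp at this
  exact hτ.ne' this

theorem invS_im {P : JacobiSpace N} :
    ((invS d P).1.im : ℂ) = P.1.im * ((P.1 + d)⁻¹ * (starRingEnd ℂ) (P.1 + d)⁻¹) := by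
  rw [Complex.mul_conj]
  norm_cast
  simp only [invS, Complex.neg_im, Complex.inv_im, Complex.normSq_inv]
  have : (P.1 + (d : ℂ)).im = P.1.im := by simp
  rw [this]
  ring

theorem invS_im_pos {P : JacobiSpace N} (hP : 0 < P.1.im) : 0 < (invS d P).1.im := by
  have h := invS_im (d := d) (P := P)
  rw [Complex.mul_conj] at h
  have h' : (invS d P).1.im = P.1.im * Complex.normSq (P.1 + d)⁻¹ := by exact_mod_cast h
  rw [h']
  exact mul_pos hP (Complex.normSq_pos.mpr (inv_ne_zero (denom_ne_zero hP d)))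

/-- The element of the modular group that acts as `invS`. -/
def gammaS (d : ℤ) : Matrix.SpecialLinearGroup (Fin 2) ℤ :=
  ⟨!![0, -1; 1, d], by simp [Matrix.det_fin_two]⟩

theorem jacobiAct_gammaS (P : JacobiSpace N) : jacobiAct (gammaS d) 0 0 P = invS d P := by
  refine Prod.ext ?_ ?_
  · simp [jacobiAct, gammaS, denomJ, invS, neg_div]
  · ext j
    simp [jacobiAct, gammaS, denomJ, invS, shiftZ, div_eq_inv_mul]

theorem IsCasimirForm.invS_of_regular (h : IsCasimirForm k L s φ) {P : JacobiSpace N}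
    (hP : P ∈ regularPoints s) (hP' : invS d P ∈ regularPoints s) :
    φ (invS d P) = autS k L d P * φ P := by
  have h1 := h.inv (gammaS d) 0 0 P hP (by rwa [jacobiAct_gammaS])
  have hj := denom_ne_zero hP.1 d
  have h2 : shiftZ (0 : Fin N → ℤ) 0 P = P.2 := by ext j; simp [shiftZ]
  have h3 : denomJ (gammaS d) P.1 = P.1 + d := by simp [denomJ, gammaS]
  have h4 : ((gammaS d).1 1 0 : ℂ) = 1 := by simp [gammaS]
  rw [slash, jacobiAct_gammaS, h2, h3, h4] at h1
  have h5 : (fun j => (((0 : Fin N → ℤ) j : ℤ) : ℂ)) = 0 := by ext j; simp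
  have h0 : qfC L (0 : Fin N → ℂ) = 0 := by simp [qfC]
  rw [h5, zero_dotProduct, h0, zero_mul, mul_zero, add_zero, add_zero] at h1
  have h6 : (2 * (Real.pi : ℂ) * I * (-1 * qfC L P.2 / (P.1 + d)))
      = -(2 * Real.pi * I * (qfC L P.2 / (P.1 + d))) := by ring
  rw [h6, Complex.exp_neg, zpow_neg] at h1
  rw [autS, ← h1]
  have h7 := zpow_ne_zero k hj
  have h8 := Complex.exp_ne_zero (2 * Real.pi * I * (qfC L P.2 / (P.1 + d)))
  field_simp

theorem invS_sectionPt (α β : Fin N → ℝ) {τ : ℂ} (hτ : 0 < τ.im) :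
    invS d (sectionPt α β τ) = sectionPt ((d : ℝ) • α - β) α (-(τ + d)⁻¹) := by
  have hj := denom_ne_zero hτ d
  refine Prod.ext rfl ?_
  ext j
  simp only [invS, sectionPt, Pi.smul_apply, smul_eq_mul, Pi.sub_apply, Complex.ofReal_sub,
    Complex.ofReal_mul, Complex.ofReal_intCast]
  field_simp
  ring

/-- By `invS_sectionPt` the coordinates `(α, β)` of a section become `(d α - β, α)`. The point and
its image are both regular as soon as `α` and `d α - β` are generic, and these two vectors can be
chosen independently of each other. -/
theorem mem_closure_regular_invS (hs : ∀ q ∈ s, q.1 ≠ 0) {P : JacobiSpace N} (hP : 0 < P.1.im) :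
    P ∈ closure {Q | Q ∈ regularPoints s ∧ invS d Q ∈ regularPoints s} := by
  rw [exists_sectionPt hP]
  generalize (fun j => (P.2 j).im / P.1.im) = α
  generalize (fun j => (P.2 j).re - (P.2 j).im / P.1.im * P.1.re) = β
  have hc : Continuous fun x : (Fin N → ℝ) × (Fin N → ℝ) =>
      sectionPt x.1 ((d : ℝ) • x.1 - x.2) P.1 :=
    continuous_sectionPt.comp (by fun_prop : Continuous fun x : (Fin N → ℝ) × (Fin N → ℝ) =>
      (x.1, (d : ℝ) • x.1 - x.2, P.1))
  have h1 := map_mem_closure (f := fun x : (Fin N → ℝ) × (Fin N → ℝ) =>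
      sectionPt x.1 ((d : ℝ) • x.1 - x.2) P.1)
    (t := {Q | Q ∈ regularPoints s ∧ invS d Q ∈ regularPoints s}) hc
    (((dense_genericDir hs).prod (dense_genericDir hs)) (α, (d : ℝ) • α - β)) (by
      rintro ⟨a, c⟩ ⟨ha, hc⟩
      refine ⟨sectionPt_mem_regularPoints ha _ hP, ?_⟩
      rw [invS_sectionPt _ _ hP, sub_sub_cancel]
      exact sectionPt_mem_regularPoints hc _ (invS_im_pos (P := sectionPt a 0 P.1) hP))
  simpa using h1

theorem eq_zero_of_regular_invS (hs : ∀ q ∈ s, q.1 ≠ 0) {P : JacobiSpace N} (hP : 0 < P.1.im)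
    {F : JacobiSpace N → ℂ} (hF : ContinuousAt F P)
    (h : ∀ᶠ Q in 𝓝 P, Q ∈ regularPoints s → invS d Q ∈ regularPoints s → F Q = 0) : F P = 0 := by
  by_contra hne
  obtain ⟨Q, hQ, h1, h2⟩ := ((mem_closure_iff_frequently.mp
    (mem_closure_regular_invS (d := d) hs hP)).and_eventually ((hF.eventually_ne hne).and h)).exists
  exact h1 (h2 hQ.1 hQ.2)

theorem differentiableAt_invS {P : JacobiSpace N} (hP : 0 < P.1.im) :
    DifferentiableAt ℂ (invS d) P := by
  have hj := denom_ne_zero hP d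
  have h1 : DifferentiableAt ℂ (fun Q : JacobiSpace N => (Q.1 + d)⁻¹) P :=
    (differentiableAt_fst.add_const _).inv hj
  exact h1.neg.prodMk (h1.smul differentiableAt_snd)

theorem fderiv_invS {P : JacobiSpace N} (hP : 0 < P.1.im) (v : JacobiSpace N) :
    fderiv ℂ (invS d) P v = ((P.1 + d)⁻¹ ^ 2 * v.1,
      (P.1 + d)⁻¹ • v.2 - ((P.1 + d)⁻¹ ^ 2 * v.1) • P.2) := by
  have hj := denom_ne_zero hP d
  have h0 : HasFDerivAt (fun Q : JacobiSpace N => Q.1 + d) (ContinuousLinearMap.fst ℂ ℂ _) P :=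
    hasFDerivAt_fst.add_const _
  have h1 := (hasDerivAt_inv hj).comp_hasFDerivAt P h0
  have h2 := h1.neg.prodMk (h1.smul (hasFDerivAt_snd (𝕜 := ℂ) (p := P)))
  have h3 := h2.fderiv
  have h4 : fderiv ℂ (invS d) P = _ := h3
  rw [h4]
  refine Prod.ext ?_ ?_
  · simp
  · ext j
    simp
    ring

theorem analyticAt_invS {P : JacobiSpace N} (hP : 0 < P.1.im) : AnalyticAt ℝ (invS d) P := by
  have hj := denom_ne_zero hP d
  have h1 : AnalyticAt ℂ (fun Q : JacobiSpace N => (Q.1 + d)⁻¹) P :=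
    (analyticAt_fst.add analyticAt_const).inv hj
  exact (h1.neg.prod (h1.smul analyticAt_snd)).restrictScalars

theorem analyticAt_qfC (P : JacobiSpace N) : AnalyticAt ℂ (fun Q : JacobiSpace N => qfC L Q.2) P := by
  unfold qfC
  simp only [dotProduct, Matrix.mulVec]
  exact Finset.analyticAt_fun_sum _ fun i _ => (analyticAt_snd_apply i P).mul
    (Finset.analyticAt_fun_sum _ fun j _ => analyticAt_const.mul (analyticAt_snd_apply j P))

theorem analyticAt_autS {P : JacobiSpace N} (hP : 0 < P.1.im) : AnalyticAt ℂ (autS k L d) P := by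
  have hj := denom_ne_zero hP d
  have h1 : AnalyticAt ℂ (fun Q : JacobiSpace N => Q.1 + d) P := analyticAt_fst.add analyticAt_const
  exact (h1.zpow hj).mul (analyticAt_cexp.comp (analyticAt_const.mul ((analyticAt_qfC P).div h1 hj)))

theorem autS_ne_zero {P : JacobiSpace N} (hP : 0 < P.1.im) : autS k L d P ≠ 0 :=
  mul_ne_zero (zpow_ne_zero _ (denom_ne_zero hP d)) (Complex.exp_ne_zero _)

theorem IsCasimirForm.invS_eq (h : IsCasimirForm k L s φ) {P : JacobiSpace N}
    (hP : P ∈ analyticDomain φ) (hP' : invS d P ∈ analyticDomain φ) :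
    φ (invS d P) = autS k L d P * φ P := by
  rw [← sub_eq_zero]
  refine eq_zero_of_regular_invS (d := d) (F := fun P => φ (invS d P) - autS k L d P * φ P)
    h.sing.nonzero hP.1 ?_ (Eventually.of_forall fun Q hQ hQ' => ?_)
  · exact (ContinuousAt.comp (f := invS d) hP'.2.continuousAt
      (differentiableAt_invS hP.1).continuousAt).sub
        ((analyticAt_autS hP.1).continuousAt.mul hP.2.continuousAt)
  · rw [h.invS_of_regular hQ hQ', sub_self]

theorem wirt_invS_dirZ {F : JacobiSpace N → ℂ} {P : JacobiSpace N} (hP : 0 < P.1.im)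
    (hF : AnalyticAt ℝ F (invS d P)) (e : Fin N → ℝ) :
    wirtG (-I) (dirZ e) (fun Q => F (invS d Q)) P
      = (P.1 + d)⁻¹ * wirtG (-I) (dirZ e) F (invS d P) := by
  have h1 : fderiv ℂ (invS d) P (dirZ e) = (P.1 + d)⁻¹ • dirZ e := by
    rw [fderiv_invS hP]
    refine Prod.ext ?_ ?_ <;> simp [dirZ]
  rw [wirtG_comp (differentiableAt_invS hP) hF.differentiableAt, h1, wirt_dir_csmul]

theorem wirtBar_invS_dirZ {F : JacobiSpace N → ℂ} {P : JacobiSpace N} (hP : 0 < P.1.im)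
    (hF : AnalyticAt ℝ F (invS d P)) (e : Fin N → ℝ) :
    wirtG I (dirZ e) (fun Q => F (invS d Q)) P
      = (starRingEnd ℂ) (P.1 + d)⁻¹ * wirtG I (dirZ e) F (invS d P) := by
  have h1 : fderiv ℂ (invS d) P (dirZ e) = (P.1 + d)⁻¹ • dirZ e := by
    rw [fderiv_invS hP]
    refine Prod.ext ?_ ?_ <;> simp [dirZ]
  rw [wirtG_comp (differentiableAt_invS hP) hF.differentiableAt, h1, wirtBar_dir_csmul]

theorem fderiv_invS_dirTau {P : JacobiSpace N} (hP : 0 < P.1.im) :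
    fderiv ℂ (invS d) P dirTau = (P.1 + d)⁻¹ ^ 2 • (dirTau - ∑ i, P.2 i • dirZ (stdVec i)) := by
  rw [fderiv_invS hP]
  refine Prod.ext ?_ ?_
  · simp [dirTau, dirZ, Prod.fst_sum]
  · ext j
    simp [dirTau, dirZ, stdVec, Prod.snd_sum, Pi.single_apply, apply_ite Complex.ofReal]

theorem wirt_invS_dirTau {F : JacobiSpace N → ℂ} {P : JacobiSpace N} (hP : 0 < P.1.im)
    (hF : AnalyticAt ℝ F (invS d P)) :
    wirtG (-I) dirTau (fun Q => F (invS d Q)) P = (P.1 + d)⁻¹ ^ 2 * (wirtG (-I) dirTau F (invS d P)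
      - ∑ i, P.2 i * wirtG (-I) (dirZ (stdVec i)) F (invS d P)) := by
  rw [wirtG_comp (differentiableAt_invS hP) hF.differentiableAt, fderiv_invS_dirTau hP,
    wirt_dir_csmul, wirtG_dir_sub, wirtG_dir_sum]
  simp only [wirt_dir_csmul]

theorem wirtBar_invS_dirTau {F : JacobiSpace N → ℂ} {P : JacobiSpace N} (hP : 0 < P.1.im)
    (hF : AnalyticAt ℝ F (invS d P)) :
    wirtG I dirTau (fun Q => F (invS d Q)) P
      = (starRingEnd ℂ) (P.1 + d)⁻¹ ^ 2 * (wirtG I dirTau F (invS d P)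
        - ∑ i, (starRingEnd ℂ) (P.2 i) * wirtG I (dirZ (stdVec i)) F (invS d P)) := by
  rw [wirtG_comp (differentiableAt_invS hP) hF.differentiableAt, fderiv_invS_dirTau hP,
    wirtBar_dir_csmul, wirtG_dir_sub, wirtG_dir_sum, map_pow]
  simp only [wirtBar_dir_csmul]

theorem wirtG_dirZ_comp_fst {f : ℂ → ℂ} {P : JacobiSpace N} (hf : DifferentiableAt ℝ f P.1) (a : ℂ)
    (e : Fin N → ℝ) : wirtG a (dirZ e) (fun Q => f Q.1) P = 0 := by
  have h1 : fderiv ℝ (fun Q : JacobiSpace N => f Q.1) P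
      = (fderiv ℝ f P.1).comp (ContinuousLinearMap.fst ℝ ℂ _) :=
    (hf.hasFDerivAt.comp P (hasFDerivAt_fst (𝕜 := ℝ) (p := P))).fderiv
  rw [wirtG, h1]
  simp [dirZ]

theorem eventually_invS {P : JacobiSpace N} (hP : 0 < P.1.im) {U : Set (JacobiSpace N)}
    (hU : IsOpen U) (hPU : invS d P ∈ U) : ∀ᶠ Q in 𝓝 P, 0 < Q.1.im ∧ invS d Q ∈ U :=
  (isOpen_im_pos.eventually_mem hP).and ((differentiableAt_invS hP).continuousAt.eventually_mem
    (hU.mem_nhds hPU))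

/-- The factor `c` depends on `τ` only, so elliptic derivatives pass through it and each of them
contributes one factor. -/
theorem op2_invS {F : JacobiSpace N → ℂ} {P : JacobiSpace N} (hP : 0 < P.1.im)
    (hF : AnalyticAt ℝ F (invS d P)) (S : Fin N → Fin N → ℂ) (a : ℂ) (c : ℂ → ℂ)
    (hc : DifferentiableAt ℝ c P.1)
    (h : ∀ (G : JacobiSpace N → ℂ) (Q : JacobiSpace N), 0 < Q.1.im → AnalyticAt ℝ G (invS d Q) →
      ∀ e, wirtG a (dirZ e) (fun Q => G (invS d Q)) Q = c Q.1 * wirtG a (dirZ e) G (invS d Q)) :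
    op2 S a a (fun Q => F (invS d Q)) P = c P.1 ^ 2 * op2 S a a F (invS d P) := by
  have hev := eventually_invS hP (isOpen_analyticAt ℝ F) hF
  simp only [op2, Finset.mul_sum]
  refine Finset.sum_congr rfl fun i _ => Finset.sum_congr rfl fun j _ => ?_
  have h1 : wirtG a (dirZ (stdVec j)) (fun Q => F (invS d Q))
      =ᶠ[𝓝 P] fun Q => c Q.1 * wirtG a (dirZ (stdVec j)) F (invS d Q) := by
    filter_upwards [hev] with Q hQ using h F Q hQ.1 hQ.2 _
  have hG := analyticAt_wirtG hF a (dirZ (stdVec j))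
  have hG' : AnalyticAt ℝ (fun Q => wirtG a (dirZ (stdVec j)) F (invS d Q)) P :=
    AnalyticAt.comp (f := invS d) hG (analyticAt_invS hP)
  have hc' : DifferentiableAt ℝ (fun Q : JacobiSpace N => c Q.1) P :=
    DifferentiableAt.comp P (f := fun Q : JacobiSpace N => Q.1) hc differentiableAt_fst
  rw [wirtG_congr h1, wirtG_mul hc' hG'.differentiableAt, wirtG_dirZ_comp_fst hc,
    h _ P hP hG]
  ring

end Modular

section ModularProduct

variable {L : Matrix (Fin N) (Fin N) ℝ} {s : Finset ((Fin N → ℝ) × ℝ × ℝ)}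
  {φ : JacobiSpace N → ℂ} {k : ℤ} {d : ℤ}

theorem wirt_eq_deriv_line {F : JacobiSpace N → ℂ} {P : JacobiSpace N} (hF : DifferentiableAt ℂ F P)
    (v : JacobiSpace N) {c : ℂ} (h : HasDerivAt (fun t : ℂ => F (P + t • v)) c 0) :
    wirtG (-I) v F P = c := by
  rw [wirt_of_holomorphic hF, ← hF.lineDeriv_eq_fderiv, lineDeriv, h.deriv]

theorem toC_isSymm (hL : L.IsSymm) : (toC L).IsSymm := by
  rw [Matrix.IsSymm, toC, ← Matrix.transpose_map, hL]

theorem qfC_add_smul (hL : L.IsSymm) (z e : Fin N → ℂ) (t : ℂ) :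
    qfC L (z + t • e) = qfC L z + t * (2 * (e ⬝ᵥ (toC L *ᵥ z))) + t ^ 2 * qfC L e := by
  have h : z ⬝ᵥ (toC L *ᵥ e) = e ⬝ᵥ (toC L *ᵥ z) := by
    rw [Matrix.dotProduct_mulVec, ← Matrix.mulVec_transpose, toC_isSymm hL, dotProduct_comm]
  simp only [qfC, Matrix.mulVec_add, Matrix.mulVec_smul, dotProduct_add, add_dotProduct,
    dotProduct_smul, smul_dotProduct, smul_eq_mul, h]
  ring

theorem wirt_autS_dirZ (hL : L.IsSymm) {P : JacobiSpace N} (hP : 0 < P.1.im) (e : Fin N → ℝ) :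
    wirtG (-I) (dirZ e) (autS k L d) P = autS k L d P *
      (4 * Real.pi * I / (P.1 + d) * ((fun i => (e i : ℂ)) ⬝ᵥ (toC L *ᵥ P.2))) := by
  refine wirt_eq_deriv_line (analyticAt_autS hP).differentiableAt _ ?_
  set c : ℂ := (fun i => (e i : ℂ)) ⬝ᵥ (toC L *ᵥ P.2) with hc
  set q : ℂ := qfC L (fun i => (e i : ℂ))
  have h1 : (fun t : ℂ => autS k L d (P + t • dirZ e)) = fun t : ℂ => (P.1 + d) ^ k *
      Complex.exp (2 * Real.pi * I * ((qfC L P.2 + t * (2 * c) + t ^ 2 * q) / (P.1 + d))) := by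
    funext t
    have h2 : (P + t • dirZ e).2 = P.2 + t • fun i => (e i : ℂ) := by
      ext i; simp [dirZ]
    rw [autS, line_fst, h2, qfC_add_smul hL]
  rw [h1]
  have h3 : HasDerivAt (fun t : ℂ => qfC L P.2 + t * (2 * c) + t ^ 2 * q) (2 * c) 0 := by
    have h4 := (((hasDerivAt_id (0 : ℂ)).mul_const (2 * c)).const_add (qfC L P.2)).add
      (((hasDerivAt_id (0 : ℂ)).pow 2).mul_const q)
    refine (h4.congr_deriv ?_)
    simp
  have h5 := (((h3.div_const (P.1 + d)).const_mul (2 * Real.pi * I)).cexp).const_mul ((P.1 + d) ^ k)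
  refine h5.congr_deriv ?_
  simp only [zero_mul, add_zero, autS, ne_eq, OfNat.ofNat_ne_zero, not_false_eq_true, zero_pow]
  ring

theorem wirt_autS_dirTau {P : JacobiSpace N} (hP : 0 < P.1.im) :
    wirtG (-I) dirTau (autS k L d) P = autS k L d P *
      (k / (P.1 + d) - 2 * Real.pi * I * qfC L P.2 / (P.1 + d) ^ 2) := by
  have hj := denom_ne_zero hP d
  refine wirt_eq_deriv_line (analyticAt_autS hP).differentiableAt _ ?_
  have h1 : (fun t : ℂ => autS k L d (P + t • dirTau)) = fun t : ℂ => (P.1 + d + t) ^ k *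
      Complex.exp (2 * Real.pi * I * (qfC L P.2 / (P.1 + d + t))) := by
    funext t
    simp [autS, dirTau, add_right_comm]
  rw [h1]
  have h2 : HasDerivAt (fun t : ℂ => P.1 + d + t) 1 0 := (hasDerivAt_id (0 : ℂ)).const_add _
  have hj' : P.1 + d + 0 ≠ 0 := by rwa [add_zero]
  have h3 := (hasDerivAt_zpow k (P.1 + d + 0) (Or.inl hj')).comp (0 : ℂ) h2
  have h4 := (((hasDerivAt_const (0 : ℂ) (qfC L P.2)).div h2 hj').const_mul (2 * Real.pi * I)).cexp
  refine (h3.mul h4).congr_deriv ?_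
  simp only [add_zero, autS, mul_one, zero_mul, zero_sub]
  rw [zpow_sub_one₀ hj]
  simp only [Function.comp_apply, add_zero, Pi.div_apply]
  field_simp
  ring

/-- The function by which antiholomorphic elliptic derivatives are multiplied under `invS`. -/
def autE (k : ℤ) (L : Matrix (Fin N) (Fin N) ℝ) (d : ℤ) (P : JacobiSpace N) : ℂ :=
  (starRingEnd ℂ) (P.1 + d) * autS k L d P

theorem hasFDerivAt_conj_denom (P : JacobiSpace N) :
    HasFDerivAt (fun Q : JacobiSpace N => (starRingEnd ℂ) (Q.1 + d))
      ((Complex.conjCLE : ℂ →L[ℝ] ℂ).comp (ContinuousLinearMap.fst ℝ ℂ _)) P :=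
  (Complex.conjCLE : ℂ →L[ℝ] ℂ).hasFDerivAt.comp P (hasFDerivAt_fst.add_const _)

theorem wirtG_conj_denom (a : ℂ) (v P : JacobiSpace N) :
    wirtG a v (fun Q : JacobiSpace N => (starRingEnd ℂ) (Q.1 + d)) P
      = (starRingEnd ℂ) v.1 * (1 - a * I) / 2 := by
  rw [wirtG, (hasFDerivAt_conj_denom P).fderiv]
  simp
  ring

theorem analyticAt_conj_denom (P : JacobiSpace N) :
    AnalyticAt ℝ (fun Q : JacobiSpace N => (starRingEnd ℂ) (Q.1 + d)) P := by
  have h : (fun Q : JacobiSpace N => (starRingEnd ℂ) (Q.1 + d))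
      = fun Q => ((Complex.conjCLE : ℂ →L[ℝ] ℂ).comp (ContinuousLinearMap.fst ℝ ℂ _)) Q
        + (starRingEnd ℂ) d := by
    funext Q; simp
  rw [h]
  exact (ContinuousLinearMap.analyticAt _ P).fun_add analyticAt_const

theorem analyticAt_autE {P : JacobiSpace N} (hP : 0 < P.1.im) : AnalyticAt ℝ (autE k L d) P :=
  (analyticAt_conj_denom P).fun_mul (analyticAt_autS hP).restrictScalars

theorem wirtG_autE (a : ℂ) (v : JacobiSpace N) {P : JacobiSpace N} (hP : 0 < P.1.im) :
    wirtG a v (autE k L d) P = (starRingEnd ℂ) (P.1 + d) * wirtG a v (autS k L d) P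
      + (starRingEnd ℂ) v.1 * (1 - a * I) / 2 * autS k L d P := by
  have h : autE k L d = fun Q : JacobiSpace N => (starRingEnd ℂ) (Q.1 + d) * autS k L d Q := rfl
  have hS : AnalyticAt ℝ (autS k L d) P := (analyticAt_autS hP).restrictScalars
  rw [h, wirtG_mul (analyticAt_conj_denom P).differentiableAt hS.differentiableAt, wirtG_conj_denom]

variable {F : JacobiSpace N → ℂ} {P : JacobiSpace N}

theorem wirtG_autE_mul (hP : 0 < P.1.im) (hF : AnalyticAt ℝ F P) (a : ℂ) (v : JacobiSpace N) :
    wirtG a v (fun Q => autE k L d Q * F Q) P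
      = autE k L d P * wirtG a v F P + wirtG a v (autE k L d) P * F P :=
  wirtG_mul (analyticAt_autE hP).differentiableAt hF.differentiableAt

theorem wirt_autE_dirTau (hP : 0 < P.1.im) (hF : AnalyticAt ℝ F P) :
    wirtG (-I) dirTau (fun Q => autE k L d Q * F Q) P = autE k L d P * (wirtG (-I) dirTau F P
      + (k / (P.1 + d) - 2 * Real.pi * I * qfC L P.2 / (P.1 + d) ^ 2) * F P) := by
  rw [wirtG_autE_mul hP hF, wirtG_autE _ _ hP, wirt_autS_dirTau hP, autE]
  have : (1 : ℂ) - -I * I = 0 := by rw [neg_mul, Complex.I_mul_I]; ring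
  rw [this]
  ring

theorem wirtBar_autE_dirTau (hP : 0 < P.1.im) (hF : AnalyticAt ℝ F P) :
    wirtG I dirTau (fun Q => autE k L d Q * F Q) P = autE k L d P * wirtG I dirTau F P
      + autS k L d P * F P := by
  rw [wirtG_autE_mul hP hF, wirtG_autE _ _ hP,
    wirtBar_of_holomorphic (analyticAt_autS hP).differentiableAt]
  have h1 : (1 : ℂ) - I * I = 2 := by rw [Complex.I_mul_I]; ring
  rw [h1, dirTau, map_one]
  ring

theorem wirtBar_autE_dirZ (hP : 0 < P.1.im) (hF : AnalyticAt ℝ F P) (e : Fin N → ℝ) :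
    wirtG I (dirZ e) (fun Q => autE k L d Q * F Q) P = autE k L d P * wirtG I (dirZ e) F P := by
  rw [wirtG_autE_mul hP hF, wirtG_autE _ _ hP,
    wirtBar_of_holomorphic (analyticAt_autS hP).differentiableAt]
  simp [dirZ]

theorem wirt_autE_dirZ (hL : L.IsSymm) (hP : 0 < P.1.im) (hF : AnalyticAt ℝ F P) (e : Fin N → ℝ) :
    wirtG (-I) (dirZ e) (fun Q => autE k L d Q * F Q) P = autE k L d P *
      (wirtG (-I) (dirZ e) F P
        + (4 * Real.pi * I / (P.1 + d) * ((fun i => (e i : ℂ)) ⬝ᵥ (toC L *ᵥ P.2))) * F P) := by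
  rw [wirtG_autE_mul hP hF, wirtG_autE _ _ hP, wirt_autS_dirZ hL hP, autE]
  simp [dirZ]
  ring

theorem eventually_im_analyticAt (hP : 0 < P.1.im) (hF : AnalyticAt ℝ F P) :
    ∀ᶠ Q in 𝓝 P, 0 < Q.1.im ∧ AnalyticAt ℝ F Q :=
  (isOpen_im_pos.eventually_mem hP).and hF.eventually_analyticAt

theorem op2_bar_autE (hP : 0 < P.1.im) (hF : AnalyticAt ℝ F P) (S : Fin N → Fin N → ℂ) :
    op2 S I I (fun Q => autE k L d Q * F Q) P = autE k L d P * op2 S I I F P := by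
  simp only [op2, Finset.mul_sum]
  refine Finset.sum_congr rfl fun i _ => Finset.sum_congr rfl fun j _ => ?_
  have h1 : wirtG I (dirZ (stdVec j)) (fun Q => autE k L d Q * F Q)
      =ᶠ[𝓝 P] fun Q => autE k L d Q * wirtG I (dirZ (stdVec j)) F Q := by
    filter_upwards [eventually_im_analyticAt hP hF] with Q hQ using wirtBar_autE_dirZ hQ.1 hQ.2 _
  rw [wirtG_congr h1, wirtBar_autE_dirZ hP (analyticAt_wirtG hF _ _)]
  ring

/-- The logarithmic derivative of `autE` in the `j`-th elliptic variable. -/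
def autEll (L : Matrix (Fin N) (Fin N) ℝ) (d : ℤ) (j : Fin N) (P : JacobiSpace N) : ℂ :=
  4 * Real.pi * I / (P.1 + d) * (toC L *ᵥ P.2) j

theorem stdVec_dotProduct (j : Fin N) (w : Fin N → ℂ) :
    (fun i => ((stdVec j : Fin N → ℝ) i : ℂ)) ⬝ᵥ w = w j := by
  simp [dotProduct, stdVec, Pi.single_apply, apply_ite Complex.ofReal]

theorem analyticAt_autEll (hP : 0 < P.1.im) (j : Fin N) : AnalyticAt ℂ (autEll L d j) P := by
  have h1 : AnalyticAt ℂ (fun Q : JacobiSpace N => Q.1 + d) P := analyticAt_fst.add analyticAt_const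
  unfold autEll
  simp only [Matrix.mulVec, dotProduct]
  exact (analyticAt_const.div h1 (denom_ne_zero hP d)).mul
    (Finset.analyticAt_fun_sum _ fun i _ => analyticAt_const.mul (analyticAt_snd_apply i P))

theorem wirt_autEll (hP : 0 < P.1.im) (i j : Fin N) :
    wirtG (-I) (dirZ (stdVec i)) (autEll L d j) P = 4 * Real.pi * I / (P.1 + d) * (L j i : ℂ) := by
  refine wirt_eq_deriv_line (analyticAt_autEll hP j).differentiableAt _ ?_
  have h1 : (fun t : ℂ => autEll L d j (P + t • dirZ (stdVec i))) = fun t : ℂ =>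
      4 * Real.pi * I / (P.1 + d) * ((toC L *ᵥ P.2) j + t * (L j i : ℂ)) := by
    funext t
    have h2 : (P + t • dirZ (stdVec i)).2 = P.2 + t • fun a => ((stdVec i : Fin N → ℝ) a : ℂ) := by
      ext a; simp [dirZ]
    rw [autEll, line_fst, h2, Matrix.mulVec_add, Matrix.mulVec_smul]
    simp [Matrix.mulVec, dotProduct, stdVec, Pi.single_apply, apply_ite Complex.ofReal, toC]
  rw [h1]
  have := (((hasDerivAt_id (0 : ℂ)).mul_const (L j i : ℂ)).const_add
    ((toC L *ᵥ P.2) j)).const_mul (4 * Real.pi * I / (P.1 + d))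
  simpa using this

theorem op2_autE (hL : L.IsSymm) (hP : 0 < P.1.im) (hF : AnalyticAt ℝ F P)
    (S : Fin N → Fin N → ℂ) :
    op2 S (-I) (-I) (fun Q => autE k L d Q * F Q) P = autE k L d P * (op2 S (-I) (-I) F P
      + (∑ i, ∑ j, S i j * (autEll L d j P * wirtG (-I) (dirZ (stdVec i)) F P
          + autEll L d i P * wirtG (-I) (dirZ (stdVec j)) F P))
      + (∑ i, ∑ j, S i j * (4 * Real.pi * I / (P.1 + d) * (L j i : ℂ)
          + autEll L d i P * autEll L d j P)) * F P) := by
  simp only [op2, Finset.sum_mul, ← Finset.sum_add_distrib, Finset.mul_sum]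
  refine Finset.sum_congr rfl fun i _ => Finset.sum_congr rfl fun j _ => ?_
  have h1 : wirtG (-I) (dirZ (stdVec j)) (fun Q => autE k L d Q * F Q)
      =ᶠ[𝓝 P] fun Q => autE k L d Q * (wirtG (-I) (dirZ (stdVec j)) F Q
        + autEll L d j Q * F Q) := by
    filter_upwards [eventually_im_analyticAt hP hF] with Q hQ
    rw [wirt_autE_dirZ hL hQ.1 hQ.2, stdVec_dotProduct, autEll]
  have hd := analyticAt_wirtG hF (-I) (dirZ (stdVec j))
  have hl : AnalyticAt ℝ (autEll L d j) P := (analyticAt_autEll hP j).restrictScalars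
  rw [wirtG_congr h1, wirt_autE_dirZ hL hP (hd.fun_add (hl.fun_mul hF)),
    wirtG_add hd.differentiableAt (hl.fun_mul hF).differentiableAt,
    wirtG_mul hl.differentiableAt hF.differentiableAt, wirt_autEll hP, stdVec_dotProduct]
  simp only [autEll]
  ring

end ModularProduct

/-! ### Vanishing of antiholomorphic derivatives along the radical. -/

section ModularRadical

variable {L : Matrix (Fin N) (Fin N) ℝ} {s : Finset ((Fin N → ℝ) × ℝ × ℝ)}
  {φ : JacobiSpace N → ℂ} {k : ℤ} {d : ℤ}

theorem toC_mul (A B : Matrix (Fin N) (Fin N) ℝ) : toC (A * B) = toC A * toC B :=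
  Matrix.map_mul (f := Complex.ofRealHom)

theorem sum_pinv_mul (hL : L.IsSymm) (z : Fin N → ℂ) (i : Fin N) :
    ∑ j, (pinv L i j : ℂ) * (toC L *ᵥ z) j = (toC (projNd L) *ᵥ z) i := by
  rw [← pinv_mul hL, toC_mul, ← Matrix.mulVec_mulVec]
  simp [Matrix.mulVec, dotProduct, toC]

theorem pinv_comm (hL : L.IsSymm) (i j : Fin N) : pinv L i j = pinv L j i :=
  congrFun (congrFun (pinv_isSymm hL) j) i

theorem dotProduct_projNd_qfC (hL : L.IsSymm) (z : Fin N → ℂ) :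
    ∑ i, (toC L *ᵥ z) i * (toC (projNd L) *ᵥ z) i = qfC L z := by
  have h : (toC L *ᵥ z) ⬝ᵥ (toC (projNd L) *ᵥ z) = qfC L z := by
    rw [Matrix.dotProduct_mulVec, ← Matrix.mulVec_transpose, toC_isSymm (projNd_isSymm L),
      Matrix.mulVec_mulVec, ← toC_mul, projNd_mul hL, dotProduct_comm, qfC]
  exact h

theorem two_pi_I_ne_zero : (2 * (Real.pi : ℂ) * I) ≠ 0 := by
  have hpi : (Real.pi : ℂ) ≠ 0 := by exact_mod_cast Real.pi_ne_zero
  simp [hpi]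

/-- Second derivatives of the automorphy factor bring down the entries of `L`, and their contraction
with `L_nd⁻¹` is `π_nd`. The resulting trace shifts the effective weight by half the rank of `L`,
instead of by `N/2` as in `kappa`. -/
theorem op2_autE_scrInv (hL : L.IsSymm) {F : JacobiSpace N → ℂ} {P : JacobiSpace N}
    (hP : 0 < P.1.im) (hF : AnalyticAt ℝ F P) :
    op2 (scrInv L) (-I) (-I) (fun Q => autE k L d Q * F Q) P
      = autE k L d P * (op2 (scrInv L) (-I) (-I) F P
        + 4 / (P.1 + d) * (∑ i, (toC (projNd L) *ᵥ P.2) i * wirtG (-I) (dirZ (stdVec i)) F P)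
        + (2 * ((projNd L).trace : ℂ) / (P.1 + d)
          + 8 * Real.pi * I * qfC L P.2 / (P.1 + d) ^ 2) * F P) := by
  have hj := denom_ne_zero hP d
  have h2 := two_pi_I_ne_zero
  have hpi : (Real.pi : ℂ) ≠ 0 := by exact_mod_cast Real.pi_ne_zero
  have hI := Complex.I_ne_zero
  have hS : ∀ i, ∑ j, scrInv L i j * autEll L d j P
      = 2 / (P.1 + d) * (toC (projNd L) *ᵥ P.2) i := by
    intro i
    rw [← sum_pinv_mul hL, Finset.mul_sum]
    refine Finset.sum_congr rfl fun j _ => ?_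
    rw [scrInv, autEll]
    field_simp
    ring
  have hS' : ∀ j, ∑ i, scrInv L i j * autEll L d i P
      = 2 / (P.1 + d) * (toC (projNd L) *ᵥ P.2) j := by
    intro j
    rw [← hS j]
    refine Finset.sum_congr rfl fun i _ => ?_
    rw [scrInv, scrInv, pinv_comm hL]
  have e1 : ∑ i, ∑ j, scrInv L i j * (autEll L d j P * wirtG (-I) (dirZ (stdVec i)) F P
      + autEll L d i P * wirtG (-I) (dirZ (stdVec j)) F P)
      = 4 / (P.1 + d) * ∑ i, (toC (projNd L) *ᵥ P.2) i * wirtG (-I) (dirZ (stdVec i)) F P := by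
    simp only [mul_add, Finset.sum_add_distrib]
    have a1 : ∑ i, ∑ j, scrInv L i j * (autEll L d j P * wirtG (-I) (dirZ (stdVec i)) F P)
        = 2 / (P.1 + d) * ∑ i, (toC (projNd L) *ᵥ P.2) i * wirtG (-I) (dirZ (stdVec i)) F P := by
      rw [Finset.mul_sum]
      refine Finset.sum_congr rfl fun i _ => ?_
      rw [← mul_assoc, ← hS, Finset.sum_mul]
      exact Finset.sum_congr rfl fun j _ => by ring
    have a2 : ∑ i, ∑ j, scrInv L i j * (autEll L d i P * wirtG (-I) (dirZ (stdVec j)) F P)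
        = 2 / (P.1 + d) * ∑ i, (toC (projNd L) *ᵥ P.2) i * wirtG (-I) (dirZ (stdVec i)) F P := by
      rw [Finset.sum_comm, Finset.mul_sum]
      refine Finset.sum_congr rfl fun i _ => ?_
      rw [← mul_assoc, ← hS', Finset.sum_mul]
      exact Finset.sum_congr rfl fun j _ => by ring
    rw [a1, a2]; ring
  have e2 : ∑ i, ∑ j, scrInv L i j * (4 * Real.pi * I / (P.1 + d) * (L j i : ℂ)
      + autEll L d i P * autEll L d j P) = 2 * ((projNd L).trace : ℂ) / (P.1 + d)
        + 8 * Real.pi * I * qfC L P.2 / (P.1 + d) ^ 2 := by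
    simp only [mul_add, Finset.sum_add_distrib]
    congr 1
    · rw [← pinv_mul hL, Matrix.trace]
      simp only [Matrix.diag, Matrix.mul_apply]
      push_cast
      rw [Finset.mul_sum, Finset.sum_div]
      refine Finset.sum_congr rfl fun i _ => ?_
      rw [Finset.mul_sum, Finset.sum_div]
      refine Finset.sum_congr rfl fun j _ => ?_
      rw [scrInv]
      field_simp
      ring
    · have : ∀ i, ∑ j, scrInv L i j * (autEll L d i P * autEll L d j P)
          = 8 * Real.pi * I / (P.1 + d) ^ 2 *
            ((toC L *ᵥ P.2) i * (toC (projNd L) *ᵥ P.2) i) := by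
        intro i
        have b : ∑ j, scrInv L i j * (autEll L d i P * autEll L d j P)
            = autEll L d i P * ∑ j, scrInv L i j * autEll L d j P := by
          rw [Finset.mul_sum]
          exact Finset.sum_congr rfl fun j _ => by ring
        rw [b, hS, autEll]
        field_simp
        ring
      simp only [this]
      rw [← Finset.mul_sum, dotProduct_projNd_qfC hL]
      ring
  rw [op2_autE hL hP hF, e1, e2]

/-- Only the projection of a complex vector matters when radical directions are annihilated. -/
theorem sum_projNd_mul {c : Fin N → ℂ} (hc : ∀ x : Fin N → ℝ, L *ᵥ x = 0 → ∑ i, (x i : ℂ) * c i = 0)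
    (z : Fin N → ℂ) : ∑ i, z i * c i = ∑ i, (toC (projNd L) *ᵥ z) i * c i := by
  have hreal : ∀ x : Fin N → ℝ, ∑ i, (x i : ℂ) * c i
      = ∑ i, (toC (projNd L) *ᵥ fun a => (x a : ℂ)) i * c i := by
    intro x
    have h1 := hc (x - projNd L *ᵥ x) (mulVec_sub_projNd L x)
    rw [toC_mulVec_intCast]
    simp only [Pi.sub_apply, Complex.ofReal_sub, sub_mul, Finset.sum_sub_distrib] at h1
    exact sub_eq_zero.mp h1
  have hz : z = (fun a => ((z a).re : ℂ)) + I • fun a => ((z a).im : ℂ) := by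
    ext a
    simp only [Pi.add_apply, Pi.smul_apply, smul_eq_mul]
    conv_lhs => rw [← Complex.re_add_im (z a)]
    ring
  have h1 := hreal fun a => (z a).re
  have h2 := hreal fun a => (z a).im
  rw [hz, Matrix.mulVec_add, Matrix.mulVec_smul]
  simp only [Pi.add_apply, Pi.smul_apply, smul_eq_mul, add_mul, mul_assoc, Finset.sum_add_distrib,
    ← Finset.mul_sum]
  rw [h1, h2]

theorem two_I_vNdC (P : JacobiSpace N) (j : Fin N) : 2 * I * imFun (sndL (projNd L j)) P
    = (toC (projNd L) *ᵥ P.2) j - (toC (projNd L) *ᵥ fun i => (starRingEnd ℂ) (P.2 i)) j := by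
  rw [imFun, sndL_apply]
  simp only [dotProduct, Matrix.mulVec, toC, Matrix.map_apply, imPart]
  push_cast
  rw [Finset.mul_sum, ← Finset.sum_sub_distrib]
  refine Finset.sum_congr rfl fun i _ => ?_
  have h : 2 * I * ((P.2 i).im : ℂ) = P.2 i - (starRingEnd ℂ) (P.2 i) := by
    rw [Complex.sub_conj]; push_cast; ring
  linear_combination (projNd L j i : ℂ) * h

theorem two_I_im (τ : ℂ) (d : ℤ) : 2 * I * (τ.im : ℂ) = (τ + d) - (starRingEnd ℂ) (τ + d) := by
  rw [Complex.sub_conj]; push_cast; simp; ring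

/-- The transformation behaviour of `radM`. -/
theorem radM_invS (hL : L.IsSymm) {F : JacobiSpace N → ℂ} {P : JacobiSpace N}
    (hP : 0 < P.1.im) (hF : AnalyticAt ℝ F P) (hF' : AnalyticAt ℝ F (invS d P))
    (hE : (fun Q => F (invS d Q)) =ᶠ[𝓝 P] fun Q => autE k L d Q * F Q)
    (hk : ∀ a, ∀ x : Fin N → ℝ, L *ᵥ x = 0 → wirtG a (dirZ x) F P = 0) :
    autS k L d P * ((P.1 + d) ^ 2 * (2 * I * P.1.im * (wirtG (-I) dirTau F P
        - 1 / 4 * op2 (scrInv L) (-I) (-I) F P) + (k - ((projNd L).trace : ℂ) / 2) * F P)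
      + (P.1 + d) * (starRingEnd ℂ) (P.1 + d) *
          ((kappa k N - (k - ((projNd L).trace : ℂ) / 2) - 1) * F P)
      + (starRingEnd ℂ) (P.1 + d) ^ 2 * (F P - 2 * I * P.1.im * (wirtG I dirTau F P
        - 1 / 4 * op2 (scrInv L) I I F P)
        - 2 * I * ∑ j, imFun (sndL (projNd L j)) P * wirtG I (dirZ (stdVec j)) F P))
    = (P.1 + d) * radM k L F (invS d P) := by
  have hj := denom_ne_zero hP d
  have hjb : (starRingEnd ℂ) (P.1 + d) ≠ 0 := (map_ne_zero _).mpr hj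
  have hS := autS_ne_zero (k := k) (L := L) (d := d) hP
  have hEval : F (invS d P) = autE k L d P * F P := hE.eq_of_nhds
  -- The chain rule for `∂_τ` produces derivatives along `z`. Because `F` is constant along the
  -- radical, `z` may be replaced by its projection, as it occurs in the other terms.
  have kill : ∀ a, ∀ z : Fin N → ℂ, ∑ i, z i * wirtG a (dirZ (stdVec i)) F P
      = ∑ i, (toC (projNd L) *ᵥ z) i * wirtG a (dirZ (stdVec i)) F P := fun a z =>
    sum_projNd_mul (fun x hx => by rw [← wirtG_dirZ_eq_sum, hk a x hx]) z
  have z1 : ∀ i, wirtG (-I) (dirZ (stdVec i)) F (invS d P) = (P.1 + d) * autE k L d P *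
      (wirtG (-I) (dirZ (stdVec i)) F P + 4 * Real.pi * I / (P.1 + d) * (toC L *ᵥ P.2) i * F P) := by
    intro i
    have h1 := wirt_invS_dirZ hP hF' (stdVec i)
    rw [wirtG_congr hE, wirt_autE_dirZ hL hP hF, stdVec_dotProduct] at h1
    rw [mul_assoc, h1, ← mul_assoc, mul_inv_cancel₀ hj, one_mul]
  have z2 : ∀ i, wirtG I (dirZ (stdVec i)) F (invS d P) = (starRingEnd ℂ) (P.1 + d) *
      autE k L d P * wirtG I (dirZ (stdVec i)) F P := by
    intro i
    have h1 := wirtBar_invS_dirZ hP hF' (stdVec i)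
    rw [wirtG_congr hE, wirtBar_autE_dirZ hP hF, map_inv₀] at h1
    rw [mul_assoc, h1, ← mul_assoc, mul_inv_cancel₀ hjb, one_mul]
  have t1 : wirtG (-I) dirTau F (invS d P) = (P.1 + d) ^ 2 * (autE k L d P * (wirtG (-I) dirTau F P
      + (k / (P.1 + d) - 2 * Real.pi * I * qfC L P.2 / (P.1 + d) ^ 2) * F P))
      + (P.1 + d) * autE k L d P * ((∑ i, (toC (projNd L) *ᵥ P.2) i *
          wirtG (-I) (dirZ (stdVec i)) F P) + 4 * Real.pi * I / (P.1 + d) * qfC L P.2 * F P) := by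
    have h1 := wirt_invS_dirTau hP hF'
    rw [wirtG_congr hE, wirt_autE_dirTau hP hF] at h1
    have h2 : ∑ i, P.2 i * wirtG (-I) (dirZ (stdVec i)) F (invS d P)
        = (P.1 + d) * autE k L d P * ((∑ i, (toC (projNd L) *ᵥ P.2) i *
          wirtG (-I) (dirZ (stdVec i)) F P) + 4 * Real.pi * I / (P.1 + d) * qfC L P.2 * F P) := by
      simp only [z1]
      rw [← kill, qfC, dotProduct, Finset.mul_sum, Finset.sum_mul, ← Finset.sum_add_distrib,
        Finset.mul_sum]
      exact Finset.sum_congr rfl fun i _ => by ring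
    rw [h1, h2]
    field_simp
    ring
  have t2 : wirtG I dirTau F (invS d P) = (starRingEnd ℂ) (P.1 + d) ^ 2 * (autE k L d P *
      wirtG I dirTau F P + autS k L d P * F P) + (starRingEnd ℂ) (P.1 + d) * autE k L d P *
      ∑ i, (toC (projNd L) *ᵥ fun i => (starRingEnd ℂ) (P.2 i)) i *
        wirtG I (dirZ (stdVec i)) F P := by
    have h1 := wirtBar_invS_dirTau hP hF'
    rw [wirtG_congr hE, wirtBar_autE_dirTau hP hF, map_inv₀] at h1
    have h2 : ∑ i, (starRingEnd ℂ) (P.2 i) * wirtG I (dirZ (stdVec i)) F (invS d P)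
        = (starRingEnd ℂ) (P.1 + d) * autE k L d P *
          ∑ i, (toC (projNd L) *ᵥ fun i => (starRingEnd ℂ) (P.2 i)) i *
            wirtG I (dirZ (stdVec i)) F P := by
      simp only [z2]
      rw [← kill, Finset.mul_sum]
      exact Finset.sum_congr rfl fun i _ => by ring
    rw [h1, h2]
    field_simp
    ring
  have p1 : op2 (scrInv L) (-I) (-I) F (invS d P) = (P.1 + d) ^ 2 * (autE k L d P *
      (op2 (scrInv L) (-I) (-I) F P
        + 4 / (P.1 + d) * (∑ i, (toC (projNd L) *ᵥ P.2) i * wirtG (-I) (dirZ (stdVec i)) F P)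
        + (2 * ((projNd L).trace : ℂ) / (P.1 + d)
          + 8 * Real.pi * I * qfC L P.2 / (P.1 + d) ^ 2) * F P)) := by
    have h1 := op2_invS hP hF' (scrInv L) (-I) (fun τ => (τ + d)⁻¹)
      ((((differentiableAt_id.add_const (d : ℂ)).inv hj : DifferentiableAt ℂ _ P.1)).restrictScalars ℝ)
      (fun G Q hQ hG e => wirt_invS_dirZ hQ hG e)
    rw [(op2_congr hE _ _ _).eq_of_nhds, op2_autE_scrInv hL hP hF] at h1
    rw [h1]
    field_simp
  have p2 : op2 (scrInv L) I I F (invS d P) = (starRingEnd ℂ) (P.1 + d) ^ 2 * (autE k L d P *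
      op2 (scrInv L) I I F P) := by
    have h1 := op2_invS hP hF' (scrInv L) I (fun τ => (starRingEnd ℂ) (τ + d)⁻¹)
      ((Complex.conjCLE : ℂ →L[ℝ] ℂ).differentiableAt.comp P.1
        ((((differentiableAt_id.add_const (d : ℂ)).inv hj : DifferentiableAt ℂ _ P.1)).restrictScalars ℝ))
      (fun G Q hQ hG e => wirtBar_invS_dirZ hQ hG e)
    rw [(op2_congr hE _ _ _).eq_of_nhds, op2_bar_autE hP hF, map_inv₀] at h1
    rw [h1]
    field_simp
  have v1 : 2 * I * ∑ j, imFun (sndL (projNd L j)) (invS d P) *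
      wirtG I (dirZ (stdVec j)) F (invS d P) = (starRingEnd ℂ) (P.1 + d) * autE k L d P *
      ((P.1 + d)⁻¹ * (∑ i, (toC (projNd L) *ᵥ P.2) i * wirtG I (dirZ (stdVec i)) F P)
      - ((starRingEnd ℂ) (P.1 + d))⁻¹ * ∑ i, (toC (projNd L) *ᵥ fun i => (starRingEnd ℂ) (P.2 i)) i *
        wirtG I (dirZ (stdVec i)) F P) := by
    have h1 : (invS d P).2 = (P.1 + d)⁻¹ • P.2 := rfl
    have h2 : (fun i => (starRingEnd ℂ) ((invS d P).2 i))
        = ((starRingEnd ℂ) (P.1 + d))⁻¹ • fun i => (starRingEnd ℂ) (P.2 i) := by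
      ext i
      simp [h1]
    rw [Finset.mul_sum, Finset.mul_sum, Finset.mul_sum, ← Finset.sum_sub_distrib, Finset.mul_sum]
    refine Finset.sum_congr rfl fun j _ => ?_
    rw [← mul_assoc, two_I_vNdC, h2, h1, Matrix.mulVec_smul, Matrix.mulVec_smul, z2]
    simp only [Pi.smul_apply, smul_eq_mul]
    ring
  have v2 : 2 * I * ∑ j, imFun (sndL (projNd L j)) P * wirtG I (dirZ (stdVec j)) F P
      = (∑ i, (toC (projNd L) *ᵥ P.2) i * wirtG I (dirZ (stdVec i)) F P)
      - ∑ i, (toC (projNd L) *ᵥ fun i => (starRingEnd ℂ) (P.2 i)) i *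
        wirtG I (dirZ (stdVec i)) F P := by
    rw [Finset.mul_sum, ← Finset.sum_sub_distrib]
    refine Finset.sum_congr rfl fun j _ => ?_
    rw [← mul_assoc, two_I_vNdC]
    ring
  have y1 : imFun fstL (invS d P) = (P.1.im : ℂ) * ((P.1 + d)⁻¹ * ((starRingEnd ℂ) (P.1 + d))⁻¹) := by
    rw [← map_inv₀, ← invS_im]
    rfl
  have y2 := two_I_im P.1 d
  rw [radM, v1, v2, t1, t2, p1, p2, hEval, y1]
  have hEdef : autE k L d P = (starRingEnd ℂ) (P.1 + d) * autS k L d P := rfl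
  rw [hEdef]
  -- Expressing `y` by `τ + d` and its conjugate turns the claim into a rational identity in these
  -- two quantities.
  have y3 : (P.1.im : ℂ) = ((P.1 + d) - (starRingEnd ℂ) (P.1 + d)) / (2 * I) := by
    rw [← y2]; field_simp
  rw [y3]
  have hI := Complex.I_ne_zero
  generalize (starRingEnd ℂ) (P.1 + d) = jb at *
  generalize P.1 + (d : ℂ) = j at *
  generalize autS k L d P = S at *
  field_simp
  ring

theorem IsCasimirForm.dZBar_invS (h : IsCasimirForm k L s φ) {P : JacobiSpace N}
    (hP : P ∈ analyticDomain φ) (hP' : invS d P ∈ analyticDomain φ) (lam : Fin N → ℝ) :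
    wirtG I (dirZ lam) φ (invS d P) = autE k L d P * wirtG I (dirZ lam) φ P := by
  have hjb : (starRingEnd ℂ) (P.1 + d) ≠ 0 := (map_ne_zero _).mpr (denom_ne_zero hP.1 d)
  have hev : (fun Q => φ (invS d Q)) =ᶠ[𝓝 P] fun Q => autS k L d Q * φ Q := by
    filter_upwards [eventually_invS hP.1 (isOpen_analyticDomain φ) hP',
      (isOpen_analyticDomain φ).eventually_mem hP] with Q h1 h2 using h.invS_eq h2 h1.2
  have h1 := wirtBar_invS_dirZ hP.1 hP'.2 lam
  have hS : AnalyticAt ℝ (autS k L d) P := (analyticAt_autS hP.1).restrictScalars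
  rw [wirtG_congr hev, wirtG_mul hS.differentiableAt hP.2.differentiableAt,
    wirtBar_of_holomorphic (analyticAt_autS hP.1).differentiableAt, zero_mul, add_zero,
    map_inv₀] at h1
  rw [autE, mul_assoc, h1, ← mul_assoc, mul_inv_cancel₀ hjb, one_mul]

/-- The left hand side is a quadratic polynomial in `d`; the values at `0`, `1`, `-1` force its
coefficients to vanish. For `j ≠ jb` the three products that occur are linearly independent. -/
theorem eq_zero_of_quadratic {X Y Z j jb : ℂ} (hj : j ≠ jb)
    (h : ∀ d : ℤ, (j + d) ^ 2 * X + (j + d) * (jb + d) * Y + (jb + d) ^ 2 * Z = 0) : Y = 0 := by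
  have h0 := h 0
  have h1 := h 1
  have h2 := h (-1)
  push_cast at h0 h1 h2
  have hne : (j - jb) ^ 2 ≠ 0 := pow_ne_zero 2 (sub_ne_zero.mpr hj)
  have c2 : X + Y + Z = 0 := by linear_combination (h1 + h2 - 2 * h0) / 2
  have c1 : 2 * j * X + (j + jb) * Y + 2 * jb * Z = 0 := by linear_combination (h1 - h2) / 2
  have hZ : (j - jb) ^ 2 * Z = 0 := by linear_combination h0 - j * c1 + j ^ 2 * c2
  have hX : (j - jb) ^ 2 * X = 0 := by linear_combination h0 - jb * c1 + jb ^ 2 * c2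
  have hY : (j - jb) ^ 2 * Y = 0 := by linear_combination (j - jb) ^ 2 * c2 - hZ - hX
  exact (mul_eq_zero.mp hY).resolve_left hne

/-- Antiholomorphic derivatives in radical directions vanish. -/
theorem IsCasimirForm.dZBar_ker (h : IsCasimirForm k L s φ) {lam : Fin N → ℝ}
    (hl : L *ᵥ lam = 0) : ∀ P ∈ analyticDomain φ, wirtG I (dirZ lam) φ P = 0 := by
  intro P hP
  set F := wirtG I (dirZ lam) φ with hFdef
  have hFa : ∀ Q ∈ analyticDomain φ, AnalyticAt ℝ F Q := fun Q hQ => analyticAt_wirtG hQ.2 _ _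
  have hk : ∀ Q ∈ analyticDomain φ, ∀ a, ∀ x : Fin N → ℝ, L *ᵥ x = 0 → wirtG a (dirZ x) F Q = 0 := by
    intro Q hQ a x hx
    have e1 := h.dZBar_dZBar_ker hx hl Q hQ
    have e2 := h.dU_dZBar_ker hx hl Q hQ
    have e3 : wirtG a (dirZ x) F Q
        = (1 + a * I) * wirtG 0 (dirZ x) F Q - a * I * wirtG I (dirZ x) F Q := by
      simp only [wirtG]
      linear_combination (a * fderiv ℝ F Q (I • dirZ x) / 2) * Complex.I_mul_I
    rw [e3, e1, e2]; ring
  -- The transformed operator vanishes wherever both the point and its image are regular. The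
  -- resulting relation no longer mentions the image, so it extends by continuity to `P` for every
  -- `d`.
  have hA : ∀ d : ℤ, ((P.1 + d) ^ 2 * (2 * I * P.1.im * (wirtG (-I) dirTau F P
        - 1 / 4 * op2 (scrInv L) (-I) (-I) F P) + (k - ((projNd L).trace : ℂ) / 2) * F P)
      + (P.1 + d) * (starRingEnd ℂ) (P.1 + d) *
          ((kappa k N - (k - ((projNd L).trace : ℂ) / 2) - 1) * F P)
      + (starRingEnd ℂ) (P.1 + d) ^ 2 * (F P - 2 * I * P.1.im * (wirtG I dirTau F P
        - 1 / 4 * op2 (scrInv L) I I F P)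
        - 2 * I * ∑ j, imFun (sndL (projNd L j)) P * wirtG I (dirZ (stdVec j)) F P)) = 0 := by
    intro d
    refine eq_zero_of_regular_invS (d := d) (F := fun P : JacobiSpace N =>
      ((P.1 + d) ^ 2 * (2 * I * P.1.im * (wirtG (-I) dirTau F P
        - 1 / 4 * op2 (scrInv L) (-I) (-I) F P) + (k - ((projNd L).trace : ℂ) / 2) * F P)
      + (P.1 + d) * (starRingEnd ℂ) (P.1 + d) *
          ((kappa k N - (k - ((projNd L).trace : ℂ) / 2) - 1) * F P)
      + (starRingEnd ℂ) (P.1 + d) ^ 2 * (F P - 2 * I * P.1.im * (wirtG I dirTau F P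
        - 1 / 4 * op2 (scrInv L) I I F P)
        - 2 * I * ∑ j, imFun (sndL (projNd L j)) P * wirtG I (dirZ (stdVec j)) F P)))
      h.sing.nonzero hP.1 ?_ (Eventually.of_forall fun Q hQ hQ' => ?_)
    · have c0 := (hFa P hP).continuousAt
      have cw := fun a v => (analyticAt_wirtG (hFa P hP) a v).continuousAt
      have co := fun a => (analyticAt_op2 (hFa P hP) (scrInv L) a a).continuousAt
      have ci := fun ℓ => (analyticAt_imFun (N := N) ℓ P).continuousAt
      have cy : ContinuousAt (fun P : JacobiSpace N => (P.1.im : ℂ)) P :=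
        (Complex.continuous_ofReal.comp (Complex.continuous_im.comp continuous_fst)).continuousAt
      have cj : ContinuousAt (fun P : JacobiSpace N => P.1 + (d : ℂ)) P := by fun_prop
      have cjb : ContinuousAt (fun P : JacobiSpace N => (starRingEnd ℂ) (P.1 + (d : ℂ))) P :=
        (analyticAt_conj_denom P).continuousAt
      have cs : ContinuousAt (fun P => ∑ j, imFun (sndL (projNd L j)) P *
          wirtG I (dirZ (stdVec j)) F P) P :=
        tendsto_finsetSum _ fun j _ => (ci (sndL (projNd L j))).mul (cw _ _)
      exact (((cj.pow 2).mul (((continuousAt_const.mul cy).mul ((cw _ _).sub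
        (continuousAt_const.mul (co _)))).add (continuousAt_const.mul c0))).add
        ((cj.mul cjb).mul (continuousAt_const.mul c0))).add ((cjb.pow 2).mul
        ((c0.sub ((continuousAt_const.mul cy).mul ((cw _ _).sub
          (continuousAt_const.mul (co _))))).sub (continuousAt_const.mul cs)))
    · have hO := h.mem_analyticDomain hQ
      have hO' := h.mem_analyticDomain hQ'
      have hE : (fun R => F (invS d R)) =ᶠ[𝓝 Q] fun R => autE k L d R * F R := by
        filter_upwards [eventually_invS hO.1 (isOpen_analyticDomain φ) hO',
          (isOpen_analyticDomain φ).eventually_mem hO] with R h1 h2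
          using h.dZBar_invS h2 h1.2 lam
      have h1 := radM_invS h.index.symm hO.1 (hFa Q hO) (hFa _ hO') hE (hk Q hO)
      rw [h.radM_eq_zero hl _ hO', mul_zero] at h1
      exact (mul_eq_zero.mp h1).resolve_left (autS_ne_zero hO.1)
  have hne : P.1 ≠ (starRingEnd ℂ) P.1 := by
    intro hc
    have := congrArg Complex.im hc
    rw [Complex.conj_im] at this
    have := hP.1
    linarith
  have h1 := eq_zero_of_quadratic hne (fun d => by
    have := hA d
    simpa only [map_add, Complex.conj_ofReal, map_intCast] using this)
  refine (mul_eq_zero.mp h1).resolve_left ?_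
  -- The mixed coefficient is `(tr π_nd - N)/2 - 1`, which is at most `-1` since the trace is at
  -- most `N`.
  have h2 : (((-(N : ℝ) + (projNd L).trace) / 2 - 1 : ℝ) : ℂ) ≠ 0 := by
    have := trace_projNd_le L
    have h3 : (-(N : ℝ) + (projNd L).trace) / 2 - 1 < 0 := by linarith
    exact_mod_cast h3.ne
  have h4 : (kappa k N - (k - ((projNd L).trace : ℂ) / 2) - 1 : ℂ)
      = (((-(N : ℝ) + (projNd L).trace) / 2 - 1 : ℝ) : ℂ) := by
    rw [kappa]; push_cast; ring
  rw [h4]; exact h2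

end ModularRadical

/-! ### Integrals of periodic functions over the unit cube. -/

section PeriodicIntegral

open MeasureTheory
open scoped Pointwise

/-- The standard basis of `ℝ × ℝ^N`. -/
def cubeBasis (N : ℕ) : Module.Basis (Unit ⊕ Fin N) ℝ (ℝ × (Fin N → ℝ)) :=
  (Module.Basis.singleton Unit ℝ).prod (Pi.basisFun ℝ (Fin N))

theorem fundamentalDomain_cubeBasis : ZSpan.fundamentalDomain (cubeBasis N)
    = Set.Ico (0 : ℝ) 1 ×ˢ Set.univ.pi fun _ : Fin N => Set.Ico (0 : ℝ) 1 := by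
  ext m
  simp [ZSpan.mem_fundamentalDomain, cubeBasis, Module.Basis.prod_repr_inl,
    Module.Basis.prod_repr_inr]

theorem fundamentalDomain_ae_eq :
    (Set.Icc (0 : ℝ × (Fin N → ℝ)) 1 : Set _) =ᵐ[volume] ZSpan.fundamentalDomain (cubeBasis N) := by
  have h1 : (Set.Icc (0 : ℝ × (Fin N → ℝ)) 1 : Set _)
      = Set.Icc (0 : ℝ) 1 ×ˢ Set.Icc (0 : Fin N → ℝ) 1 := by
    rw [Set.Icc_prod_Icc]; rfl
  rw [h1, fundamentalDomain_cubeBasis]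
  refine (Measure.set_prod_ae_eq Ico_ae_eq_Icc ?_).symm
  exact Measure.univ_pi_Ico_ae_eq_Icc

/-- Up to null sets, the cube and its translate are both fundamental domains for the same lattice,
and a periodic function has equal integrals over them. -/
theorem integral_periodic {g : ℝ × (Fin N → ℝ) → ℂ}
    (hg : ∀ q, ∀ m : ℤ, ∀ mu : Fin N → ℤ, g (q + ((m : ℝ), fun j => (mu j : ℝ))) = g q)
    (t : ℝ × (Fin N → ℝ)) :
    ∫ q in Set.Icc (0 : ℝ × (Fin N → ℝ)) 1, g (q + t) = ∫ q in Set.Icc (0 : ℝ × (Fin N → ℝ)) 1, g q := by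
  set D := ZSpan.fundamentalDomain (cubeBasis N) with hD
  have : (volume : Measure (ℝ × (Fin N → ℝ))).IsAddHaarMeasure := by
    rw [Measure.volume_eq_prod]; infer_instance
  have : VAddInvariantMeasure (Submodule.span ℤ (Set.range (cubeBasis N)))
      (ℝ × (Fin N → ℝ)) volume :=
    inferInstanceAs (VAddInvariantMeasure (Submodule.span ℤ (Set.range (cubeBasis N))).toAddSubgroup
      (ℝ × (Fin N → ℝ)) volume)
  have hfd := ZSpan.isAddFundamentalDomain (cubeBasis N) (volume : Measure (ℝ × (Fin N → ℝ)))
  have hspan : ∀ x ∈ Submodule.span ℤ (Set.range (cubeBasis N)), ∀ q, g (q + x) = g q := by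
    intro x hx
    induction hx using Submodule.span_induction with
    | mem x hx =>
      obtain ⟨i, rfl⟩ := hx
      intro q
      rcases i with i | i
      · have : cubeBasis N (Sum.inl i) = (((1 : ℤ) : ℝ), fun j => (((0 : Fin N → ℤ) j : ℤ) : ℝ)) := by
          ext <;> simp [cubeBasis]
        rw [this, hg]
      · have : cubeBasis N (Sum.inr i)
            = (((0 : ℤ) : ℝ), fun j => (((Pi.single i 1 : Fin N → ℤ) j : ℤ) : ℝ)) := by
          ext j
          · simp [cubeBasis]
          · by_cases h : j = i
            · subst h; simp [cubeBasis]
            · simp [cubeBasis, h]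
        rw [this, hg]
    | zero => intro q; rw [add_zero]
    | add x y _ _ hx hy => intro q; rw [← add_assoc, hy, hx]
    | smul a x _ hx =>
      intro q
      have hnat : ∀ n : ℕ, ∀ q, g (q + (n : ℤ) • x) = g q := by
        intro n
        induction n with
        | zero => intro q; simp
        | succ n ih => intro q; rw [Nat.cast_succ, add_smul, one_smul, ← add_assoc, hx, ih]
      obtain ⟨n, rfl | rfl⟩ := a.eq_nat_or_neg
      · exact hnat n q
      · rw [← hnat n (q + -(n : ℤ) • x), add_assoc, ← add_smul]; simp
  have h1 := hfd.vadd_of_comm (-t)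
  rw [setIntegral_congr_set fundamentalDomain_ae_eq, setIntegral_congr_set fundamentalDomain_ae_eq]
  have h2 := hfd.setIntegral_eq h1 (f := fun q => g (q + t)) (fun x q => by
    have := hspan x x.2 (q + t)
    rw [← this]
    congr 1
    change (x : ℝ × (Fin N → ℝ)) + q + t = _
    abel)
  rw [h2, ← integral_indicator, ← integral_indicator]
  · rw [← integral_add_right_eq_self (Set.indicator D g) t]
    refine integral_congr_ae (Eventually.of_forall fun q => ?_)
    have : q ∈ -t +ᵥ D ↔ q + t ∈ D := by rw [Set.mem_neg_vadd_set_iff, vadd_eq_add, add_comm]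
    change _ = D.indicator g (q + t)
    by_cases h : q + t ∈ D
    · rw [Set.indicator_of_mem (this.mpr h), Set.indicator_of_mem h]
    · rw [Set.indicator_of_notMem (mt this.mp h), Set.indicator_of_notMem h]
  · exact ZSpan.fundamentalDomain_measurableSet _
  · exact (ZSpan.fundamentalDomain_measurableSet _).const_vadd _

end PeriodicIntegral

section CubeIntegral

open MeasureTheory

variable {U : Set (ℝ × (Fin N → ℝ))} {Ψ : JacobiSpace N → ℂ}

/-- The embedding of real directions, as a continuous linear map. -/
def embL : (ℝ × (Fin N → ℝ)) →L[ℝ] JacobiSpace N := LinearMap.toContinuousLinearMap emb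

theorem embL_apply (p : ℝ × (Fin N → ℝ)) : embL p = emb p := rfl

theorem continuous_emb : Continuous (emb : (ℝ × (Fin N → ℝ)) → JacobiSpace N) :=
  (embL (N := N)).continuous

theorem imPart_emb_add (q : ℝ × (Fin N → ℝ)) (x : JacobiSpace N) : imPart (emb q + x) = imPart x := by
  rw [← imPartL_apply, map_add, imPartL_apply, imPartL_apply, imPart_emb, zero_add]

/-- The integral over the unit cube in the real directions. -/
def cubeInt (Ψ : JacobiSpace N → ℂ) (x : JacobiSpace N) : ℂ :=
  ∫ q in Set.Icc (0 : ℝ × (Fin N → ℝ)) 1, Ψ (emb q + x)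

theorem isOpen_preimage_imPart (hU : IsOpen U) : IsOpen (imPart ⁻¹' U : Set (JacobiSpace N)) :=
  hU.preimage (imPartL (N := N)).continuous

theorem continuous_slice {E : Type*} [NormedAddCommGroup E] {G : JacobiSpace N → E}
    (hG : ContinuousOn G (imPart ⁻¹' U)) {x : JacobiSpace N} (hx : imPart x ∈ U) :
    Continuous fun q : ℝ × (Fin N → ℝ) => G (emb q + x) :=
  hG.comp_continuous (continuous_emb.add continuous_const) fun q => by
    rw [Set.mem_preimage, imPart_emb_add]; exact hx

theorem integrableOn_slice {E : Type*} [NormedAddCommGroup E] {G : JacobiSpace N → E}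
    (hG : ContinuousOn G (imPart ⁻¹' U)) {x : JacobiSpace N} (hx : imPart x ∈ U) :
    IntegrableOn (fun q : ℝ × (Fin N → ℝ) => G (emb q + x)) (Set.Icc 0 1) :=
  (continuous_slice hG hx).continuousOn.integrableOn_compact isCompact_Icc

theorem hasFDerivAt_cubeInt (hU : IsOpen U) (hΨ : AnalyticOnNhd ℝ Ψ (imPart ⁻¹' U))
    {x : JacobiSpace N} (hx : imPart x ∈ U) : HasFDerivAt (cubeInt Ψ)
      (∫ q in Set.Icc (0 : ℝ × (Fin N → ℝ)) 1, fderiv ℝ Ψ (emb q + x)) x := by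
  have hU' := isOpen_preimage_imPart hU
  have hc : ContinuousOn Ψ (imPart ⁻¹' U) := fun P hP => (hΨ P hP).continuousAt.continuousWithinAt
  have hc' : ContinuousOn (fderiv ℝ Ψ) (imPart ⁻¹' U) := fun P hP =>
    (hΨ P hP).fderiv.continuousAt.continuousWithinAt
  obtain ⟨C, hC⟩ := (isCompact_Icc (a := (0 : ℝ × (Fin N → ℝ))) (b := 1)).exists_bound_of_continuousOn
    (continuous_slice hc' hx).continuousOn
  have hev : ∀ᶠ x' in 𝓝 x, ∀ q ∈ Set.Icc (0 : ℝ × (Fin N → ℝ)) 1,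
      imPart x' ∈ U ∧ ‖fderiv ℝ Ψ (emb q + x')‖ ≤ C + 1 := by
    refine isCompact_Icc.eventually_forall_of_forall_eventually fun q hq => ?_
    have hq' : emb q + x ∈ imPart ⁻¹' U := by rw [Set.mem_preimage, imPart_emb_add]; exact hx
    have h1 : ContinuousAt (fun z : JacobiSpace N × (ℝ × (Fin N → ℝ)) => ‖fderiv ℝ Ψ (emb z.2 + z.1)‖)
        (x, q) := by
      have h2 : ContinuousAt (fun z : JacobiSpace N × (ℝ × (Fin N → ℝ)) => emb z.2 + z.1) (x, q) :=
        ((continuous_emb.comp continuous_snd).add continuous_fst).continuousAt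
      exact (ContinuousAt.comp (f := fun z : JacobiSpace N × (ℝ × (Fin N → ℝ)) => emb z.2 + z.1)
        (g := fderiv ℝ Ψ) (hΨ _ hq').fderiv.continuousAt h2).norm
    have h3 : ∀ᶠ z : JacobiSpace N × (ℝ × (Fin N → ℝ)) in 𝓝 (x, q), imPart z.1 ∈ U :=
      continuous_fst.continuousAt.eventually (hU'.mem_nhds (show x ∈ imPart ⁻¹' U from hx))
    filter_upwards [h1.eventually (gt_mem_nhds ((hC q hq).trans_lt (by linarith : C < C + 1))), h3]
      with z hz1 hz2 using ⟨hz2, hz1.le⟩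
  change HasFDerivAt (fun x => ∫ q in Set.Icc (0 : ℝ × (Fin N → ℝ)) 1, Ψ (emb q + x)) _ x
  refine hasFDerivAt_integral_of_dominated_of_fderiv_le (F := fun x q => Ψ (emb q + x))
    (F' := fun x q => fderiv ℝ Ψ (emb q + x)) (bound := fun _ => C + 1) hev ?_ ?_ ?_ ?_ ?_ ?_
  · filter_upwards [hU'.mem_nhds hx] with x' hx'
    exact (integrableOn_slice hc hx').aestronglyMeasurable
  · exact integrableOn_slice hc hx
  · exact (integrableOn_slice hc' hx).aestronglyMeasurable
  · exact (ae_restrict_iff' measurableSet_Icc).mpr (Eventually.of_forall fun q hq x' hx' =>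
      (hx' q hq).2)
  · exact integrableOn_const (by exact isCompact_Icc.measure_lt_top.ne)
  · refine (ae_restrict_iff' measurableSet_Icc).mpr (Eventually.of_forall fun q hq x' hx' => ?_)
    have hq' : emb q + x' ∈ imPart ⁻¹' U := by
      rw [Set.mem_preimage, imPart_emb_add]; exact (hx' q hq).1
    exact (hΨ _ hq').differentiableAt.hasFDerivAt.comp x' ((hasFDerivAt_id x').const_add (emb q))

theorem fderiv_cubeInt (hU : IsOpen U) (hΨ : AnalyticOnNhd ℝ Ψ (imPart ⁻¹' U))
    {x : JacobiSpace N} (hx : imPart x ∈ U) (v : JacobiSpace N) :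
    fderiv ℝ (cubeInt Ψ) x v
      = ∫ q in Set.Icc (0 : ℝ × (Fin N → ℝ)) 1, fderiv ℝ Ψ (emb q + x) v := by
  have hc' : ContinuousOn (fderiv ℝ Ψ) (imPart ⁻¹' U) := fun P hP =>
    (hΨ P hP).fderiv.continuousAt.continuousWithinAt
  rw [(hasFDerivAt_cubeInt hU hΨ hx).fderiv,
    ContinuousLinearMap.integral_apply (integrableOn_slice hc' hx)]

theorem cubeInt_wirtG (hU : IsOpen U) (hΨ : AnalyticOnNhd ℝ Ψ (imPart ⁻¹' U))
    {x : JacobiSpace N} (hx : imPart x ∈ U) (a : ℂ) (v : JacobiSpace N) :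
    cubeInt (wirtG a v Ψ) x = wirtG a v (cubeInt Ψ) x := by
  have hc' : ∀ w, ContinuousOn (fun P => fderiv ℝ Ψ P w) (imPart ⁻¹' U) := fun w P hP =>
    (analyticAt_fderiv_apply (hΨ P hP) w).continuousAt.continuousWithinAt
  rw [wirtG, fderiv_cubeInt hU hΨ hx, fderiv_cubeInt hU hΨ hx, cubeInt]
  simp only [wirtG]
  rw [integral_div, integral_add (integrableOn_slice (hc' v) hx)
    ((integrableOn_slice (hc' (I • v)) hx).const_mul a), integral_const_mul]

/-- Real-analyticity and periodicity over a set of imaginary parts. -/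
structure PeriodicOn (U : Set (ℝ × (Fin N → ℝ))) (F : JacobiSpace N → ℂ) : Prop where
  analytic : AnalyticOnNhd ℝ F (imPart ⁻¹' U)
  periodic : ∀ P ∈ imPart ⁻¹' U, ∀ m : ℤ, ∀ mu : Fin N → ℤ,
    F (P + emb ((m : ℝ), fun j => (mu j : ℝ))) = F P

theorem cubeInt_add_emb (hΨ : PeriodicOn U Ψ) {x : JacobiSpace N} (hx : imPart x ∈ U)
    (t : ℝ × (Fin N → ℝ)) : cubeInt Ψ (x + emb t) = cubeInt Ψ x := by
  have h := integral_periodic (g := fun q => Ψ (emb q + x)) (fun q m mu => by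
    rw [map_add, add_right_comm]
    exact hΨ.periodic _ (by rw [Set.mem_preimage, imPart_emb_add]; exact hx) m mu) t
  rw [cubeInt, cubeInt, ← h]
  congr 1
  funext q
  rw [map_add]
  congr 1
  abel

theorem fderiv_cubeInt_emb (hU : IsOpen U) (hΨ : PeriodicOn U Ψ) {x : JacobiSpace N}
    (hx : imPart x ∈ U) (d : ℝ × (Fin N → ℝ)) : fderiv ℝ (cubeInt Ψ) x (emb d) = 0 := by
  have h1 := (hasFDerivAt_cubeInt hU hΨ.analytic hx).differentiableAt
  rw [← h1.lineDeriv_eq_fderiv, lineDeriv]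
  have : (fun t : ℝ => cubeInt Ψ (x + t • emb d)) = fun _ => cubeInt Ψ x := by
    funext t
    rw [← map_smul, cubeInt_add_emb hΨ hx]
  rw [this, deriv_const]

end CubeIntegral

/-! ### Fourier coefficients as functions of `(y, v)`. -/

section Coefficients

open MeasureTheory

variable {U : Set (ℝ × (Fin N → ℝ))} {F G : JacobiSpace N → ℂ} {n : ℤ} {r : Fin N → ℤ}

/-- The character `q^{-n} ζ^{-r}`. -/
def chi (n : ℤ) (r : Fin N → ℤ) (P : JacobiSpace N) : ℂ :=
  Complex.exp (-(2 * Real.pi * I * ((n : ℂ) * P.1 + ∑ j, (r j : ℂ) * P.2 j)))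

theorem analyticAt_chi (P : JacobiSpace N) : AnalyticAt ℂ (chi n r) P := by
  unfold chi
  exact analyticAt_cexp.comp ((analyticAt_const.mul ((analyticAt_const.mul analyticAt_fst).add
    (Finset.analyticAt_fun_sum _ fun j _ => analyticAt_const.mul (analyticAt_snd_apply j P)))).neg)

/-- The exponent of the character in a real direction. -/
def chiDir (n : ℤ) (r : Fin N → ℤ) (d : ℝ × (Fin N → ℝ)) : ℂ :=
  2 * Real.pi * I * ((n : ℂ) * d.1 + ∑ j, (r j : ℂ) * d.2 j)

theorem chi_add_smul_emb (P : JacobiSpace N) (t : ℂ) (d : ℝ × (Fin N → ℝ)) :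
    chi n r (P + t • emb d) = chi n r P * Complex.exp (-(t * chiDir n r d)) := by
  rw [chi, chi, ← Complex.exp_add, chiDir]
  congr 1
  have : ∑ j, (r j : ℂ) * (P + t • emb d).2 j
      = ∑ j, (r j : ℂ) * P.2 j + t * ∑ j, (r j : ℂ) * d.2 j := by
    rw [Finset.mul_sum, ← Finset.sum_add_distrib]
    refine Finset.sum_congr rfl fun j _ => ?_
    simp [emb]; ring
  rw [this]
  simp [emb]
  ring

theorem wirt_chi (P : JacobiSpace N) (d : ℝ × (Fin N → ℝ)) :
    wirtG (-I) (emb d) (chi n r) P = -chiDir n r d * chi n r P := by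
  refine wirt_eq_deriv_line (analyticAt_chi P).differentiableAt _ ?_
  simp only [chi_add_smul_emb]
  have h1 := (((hasDerivAt_id (0 : ℂ)).mul_const (chiDir n r d)).neg.cexp).const_mul (chi n r P)
  refine h1.congr_deriv ?_
  simp
  ring

theorem chi_periodic (P : JacobiSpace N) (m : ℤ) (mu : Fin N → ℤ) :
    chi n r (P + emb ((m : ℝ), fun j => (mu j : ℝ))) = chi n r P := by
  have h := chi_add_smul_emb (n := n) (r := r) P 1 ((m : ℝ), fun j => (mu j : ℝ))
  rw [one_smul] at h
  rw [h, one_mul, chiDir]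
  have : -(2 * (Real.pi : ℂ) * I * ((n : ℂ) * ((m : ℝ) : ℂ) + ∑ j, (r j : ℂ) * ((mu j : ℝ) : ℂ)))
      = ((-(n * m + ∑ j, r j * mu j) : ℤ) : ℂ) * (2 * Real.pi * I) := by
    push_cast; ring
  rw [this, Complex.exp_int_mul_two_pi_mul_I, mul_one]

theorem PeriodicOn.mul_chi (hF : PeriodicOn U F) : PeriodicOn U fun P => F P * chi n r P :=
  ⟨fun P hP => (hF.analytic P hP).fun_mul (analyticAt_chi P).restrictScalars,
    fun P hP m mu => by rw [hF.periodic P hP, chi_periodic]⟩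

theorem PeriodicOn.wirtG (hU : IsOpen U) (hF : PeriodicOn U F) (a : ℂ) (v : JacobiSpace N) :
    PeriodicOn U (wirtG a v F) := by
  refine ⟨fun P hP => analyticAt_wirtG (hF.analytic P hP) a v, fun P hP m mu => ?_⟩
  have h := congrFun (wirtG_comp_add a v (emb ((m : ℝ), fun j => (mu j : ℝ))) F) P
  rw [← h]
  exact wirtG_congr (Filter.eventuallyEq_of_mem ((isOpen_preimage_imPart hU).mem_nhds hP)
    fun Q hQ => hF.periodic Q hQ m mu) a v

theorem PeriodicOn.op2 (hU : IsOpen U) (hF : PeriodicOn U F) (S : Fin N → Fin N → ℂ) (a b : ℂ) :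
    PeriodicOn U (op2 S a b F) := by
  refine ⟨fun P hP => analyticAt_op2 (hF.analytic P hP) S a b, fun P hP m mu => ?_⟩
  simp only [MaassJacobi.op2]
  refine Finset.sum_congr rfl fun i _ => Finset.sum_congr rfl fun j _ => ?_
  rw [((hF.wirtG hU _ _).wirtG hU _ _).periodic P hP]

/-- The Fourier coefficient, as a function on imaginary parts. -/
def fcoef (n : ℤ) (r : Fin N → ℤ) (F : JacobiSpace N → ℂ) (p : ℝ × (Fin N → ℝ)) : ℂ :=
  cubeInt (fun P => F P * chi n r P) (I • emb p)

theorem fourierCoeff_eq_fcoef (p : ℝ × (Fin N → ℝ)) :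
    fourierCoeff F n r p.1 p.2 = fcoef n r F p := by
  rw [fourierCoeff, fcoef, cubeInt]
  congr 1
  funext q
  have h : (emb q + I • emb p : JacobiSpace N)
      = ((q.1 : ℂ) + (p.1 : ℂ) * I, fun j => (q.2 j : ℂ) + (p.2 j : ℂ) * I) := by
    refine Prod.ext ?_ ?_
    · simp [emb, mul_comm]
    · ext j; simp [emb, mul_comm]
  rw [h, chi]

theorem imPart_I_emb_mem {p : ℝ × (Fin N → ℝ)} (hp : p ∈ U) : imPart (I • emb p) ∈ U := by
  rw [imPart_I_emb]; exact hp

theorem hasFDerivAt_fcoef (hU : IsOpen U) (hF : PeriodicOn U F) {p : ℝ × (Fin N → ℝ)} (hp : p ∈ U) :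
    HasFDerivAt (fcoef n r F) ((fderiv ℝ (cubeInt fun P => F P * chi n r P) (I • emb p)).comp
      (I • embL)) p := by
  have h1 := (hasFDerivAt_cubeInt hU (hF.mul_chi (n := n) (r := r)).analytic
    (imPart_I_emb_mem hp)).differentiableAt.hasFDerivAt
  have h2 : HasFDerivAt (fun p : ℝ × (Fin N → ℝ) => I • (embL p : JacobiSpace N)) (I • embL) p :=
    (I • embL : (ℝ × (Fin N → ℝ)) →L[ℝ] JacobiSpace N).hasFDerivAt
  exact HasFDerivAt.comp (f := fun p : ℝ × (Fin N → ℝ) => I • (embL p : JacobiSpace N)) p h1 h2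

/-- The character is holomorphic, so `∂̄` passes through it. The integral over the cube is constant
in real directions, which leaves `i/2` times the derivative in the imaginary direction. -/
theorem fcoef_wirtBar (hU : IsOpen U) (hF : PeriodicOn U F) {p : ℝ × (Fin N → ℝ)} (hp : p ∈ U)
    (d : ℝ × (Fin N → ℝ)) :
    fcoef n r (wirtG I (emb d) F) p = I / 2 * fderiv ℝ (fcoef n r F) p d := by
  have hx := imPart_I_emb_mem hp
  have hFχ := hF.mul_chi (n := n) (r := r)
  rw [(hasFDerivAt_fcoef hU hF hp).fderiv]
  have h1 : fcoef n r (wirtG I (emb d) F) p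
      = cubeInt (wirtG I (emb d) fun P => F P * chi n r P) (I • emb p) := by
    rw [fcoef, cubeInt, cubeInt]
    congr 1
    funext q
    have hq : emb q + I • emb p ∈ imPart ⁻¹' U := by
      rw [Set.mem_preimage, imPart_emb_add]; exact hx
    rw [wirtG_mul (hF.analytic _ hq).differentiableAt
      (analyticAt_chi _).restrictScalars.differentiableAt,
      wirtBar_of_holomorphic (analyticAt_chi _).differentiableAt, mul_zero, zero_add]
  rw [h1, cubeInt_wirtG hU hFχ.analytic hx, wirtG, fderiv_cubeInt_emb hU hFχ hx]
  simp only [ContinuousLinearMap.comp_apply, smul_apply, embL_apply]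
  ring

/-- The sum `∂ + ∂̄` is a real derivative, which acts on the mode `(n, r)` by the scalar `chiDir`.
-/
theorem fcoef_wirt (hU : IsOpen U) (hF : PeriodicOn U F) {p : ℝ × (Fin N → ℝ)} (hp : p ∈ U)
    (d : ℝ × (Fin N → ℝ)) :
    fcoef n r (wirtG (-I) (emb d) F) p
      = chiDir n r d * fcoef n r F p - fcoef n r (wirtG I (emb d) F) p := by
  have hx := imPart_I_emb_mem hp
  have hFχ := hF.mul_chi (n := n) (r := r)
  rw [fcoef_wirtBar hU hF hp, (hasFDerivAt_fcoef hU hF hp).fderiv]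
  have h1 : fcoef n r (wirtG (-I) (emb d) F) p - chiDir n r d * fcoef n r F p
      = cubeInt (wirtG (-I) (emb d) fun P => F P * chi n r P) (I • emb p) := by
    have hcont : ∀ {K : JacobiSpace N → ℂ}, PeriodicOn U K → ContinuousOn K (imPart ⁻¹' U) :=
      fun hK P hP => (hK.analytic P hP).continuousAt.continuousWithinAt
    rw [fcoef, fcoef, cubeInt, cubeInt, cubeInt, ← integral_const_mul, ← integral_sub
      (integrableOn_slice (hcont (hF.wirtG hU _ _).mul_chi) hx)
      ((integrableOn_slice (hcont hFχ) hx).const_mul _)]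
    congr 1
    funext q
    have hq : emb q + I • emb p ∈ imPart ⁻¹' U := by
      rw [Set.mem_preimage, imPart_emb_add]; exact hx
    rw [wirtG_mul (hF.analytic _ hq).differentiableAt
      (analyticAt_chi _).restrictScalars.differentiableAt, wirt_chi]
    ring
  rw [cubeInt_wirtG hU hFχ.analytic hx, wirtG, fderiv_cubeInt_emb hU hFχ hx] at h1
  simp only [ContinuousLinearMap.comp_apply, smul_apply, embL_apply]
  linear_combination h1

theorem fcoef_congr {F G : JacobiSpace N → ℂ} {p : ℝ × (Fin N → ℝ)} (hp : p ∈ U)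
    (h : ∀ P ∈ imPart ⁻¹' U, F P = G P) : fcoef n r F p = fcoef n r G p := by
  rw [fcoef, fcoef, cubeInt, cubeInt]
  congr 1
  funext q
  rw [h _ (by rw [Set.mem_preimage, imPart_emb_add]; exact imPart_I_emb_mem hp)]

theorem fcoef_zero (p : ℝ × (Fin N → ℝ)) : fcoef n r (fun _ => (0 : ℂ)) p = 0 := by
  simp [fcoef, cubeInt]

theorem integrableOn_fcoef (hF : AnalyticOnNhd ℝ F (imPart ⁻¹' U)) {p : ℝ × (Fin N → ℝ)}
    (hp : p ∈ U) : IntegrableOn (fun q => F (emb q + I • emb p) * chi n r (emb q + I • emb p))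
      (Set.Icc 0 1) :=
  integrableOn_slice (G := fun P => F P * chi n r P) (fun P hP =>
    ((hF P hP).fun_mul (analyticAt_chi P).restrictScalars).continuousAt.continuousWithinAt)
    (imPart_I_emb_mem hp)

theorem fcoef_add (hF : AnalyticOnNhd ℝ F (imPart ⁻¹' U)) (hG : AnalyticOnNhd ℝ G (imPart ⁻¹' U))
    {p : ℝ × (Fin N → ℝ)} (hp : p ∈ U) :
    fcoef n r (fun P => F P + G P) p = fcoef n r F p + fcoef n r G p := by
  rw [fcoef, fcoef, fcoef, cubeInt, cubeInt, cubeInt,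
    ← integral_add (integrableOn_fcoef hF hp) (integrableOn_fcoef hG hp)]
  simp only [add_mul]

theorem fcoef_const_mul (c : ℂ) (p : ℝ × (Fin N → ℝ)) :
    fcoef n r (fun P => c * F P) p = c * fcoef n r F p := by
  rw [fcoef, fcoef, cubeInt, cubeInt, ← integral_const_mul]
  simp only [mul_assoc]

theorem fcoef_sum {ι : Type*} (u : Finset ι) {K : ι → JacobiSpace N → ℂ}
    (hK : ∀ i ∈ u, AnalyticOnNhd ℝ (K i) (imPart ⁻¹' U)) {p : ℝ × (Fin N → ℝ)} (hp : p ∈ U) :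
    fcoef n r (fun P => ∑ i ∈ u, K i P) p = ∑ i ∈ u, fcoef n r (K i) p := by
  simp only [fcoef, cubeInt, Finset.sum_mul]
  exact integral_finsetSum _ fun i hi => integrableOn_fcoef (hK i hi) hp

theorem fcoef_imFun_mul (ℓ : (ℝ × (Fin N → ℝ)) →L[ℝ] ℝ) (p : ℝ × (Fin N → ℝ)) :
    fcoef n r (fun P => imFun ℓ P * F P) p = (ℓ p : ℂ) * fcoef n r F p := by
  rw [fcoef, fcoef, cubeInt, cubeInt, ← integral_const_mul]
  congr 1
  funext q
  rw [imFun, imPart_emb_add, imPart_I_emb, mul_assoc]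

/-- Every partial derivative of a coefficient is `-2i` times the coefficient of `∂̄ F`, and `∂̄ F`
is again periodic and analytic. The induction runs over all such `F` at once. -/
theorem contDiffOn_fcoef (hU : IsOpen U) (hF : PeriodicOn U F) :
    ContDiffOn ℝ ∞ (fcoef n r F) U := by
  rw [contDiffOn_infty]
  intro k
  induction k generalizing F with
  | zero =>
    exact contDiffOn_zero.mpr fun p hp =>
      (hasFDerivAt_fcoef hU hF hp).continuousAt.continuousWithinAt
  | succ k ih =>
    rw [Nat.cast_succ, contDiffOn_succ_iff_fderiv_of_isOpen hU]
    refine ⟨fun p hp => (hasFDerivAt_fcoef hU hF hp).differentiableAt.differentiableWithinAt,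
      by simp, ?_⟩
    rw [contDiffOn_clm_apply]
    intro d
    refine (contDiffOn_const (c := (-2 * I : ℂ))).mul (ih (hF.wirtG hU I (emb d))) |>.congr ?_
    intro p hp
    rw [fcoef_wirtBar hU hF hp]
    linear_combination (fderiv ℝ (fcoef n r F) p d) * Complex.I_mul_I

end Coefficients

section Commutation

variable {F : JacobiSpace N → ℂ} {P : JacobiSpace N}

theorem wirtG_comm_eventually (hF : AnalyticAt ℝ F P) (a b : ℂ) (d d' : JacobiSpace N) :
    wirtG a d (wirtG b d' F) =ᶠ[𝓝 P] wirtG b d' (wirtG a d F) := by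
  filter_upwards [hF.eventually_analyticAt] with Q hQ using wirtG_comm hQ _ _ _ _

theorem wirtG_op2_eventually (hF : AnalyticAt ℝ F P) (S : Fin N → Fin N → ℂ) (a b c : ℂ)
    (d : JacobiSpace N) : wirtG c d (op2 S a b F) =ᶠ[𝓝 P] op2 S a b (wirtG c d F) := by
  filter_upwards [hF.eventually_analyticAt] with Q hQ using wirtG_op2 hQ _ _ _ _ _

theorem wirtG_wirtG_wirtG_comm (hF : AnalyticAt ℝ F P) (a b c : ℂ) (d d' d'' : JacobiSpace N) :
    wirtG a d (wirtG b d' (wirtG c d'' F)) P = wirtG c d'' (wirtG a d (wirtG b d' F)) P := by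
  rw [wirtG_congr (wirtG_comm_eventually hF b c d' d''), wirtG_comm (analyticAt_wirtG hF _ _)]

theorem op2_op2_comm (hF : AnalyticAt ℝ F P) (S T : Fin N → Fin N → ℂ) (a b c d : ℂ) :
    op2 S a b (op2 T c d F) P = op2 T c d (op2 S a b F) P := by
  have key : ∀ (S T : Fin N → Fin N → ℂ) (a b c d : ℂ), op2 S a b (op2 T c d F) P
      = ∑ i, ∑ j, ∑ x, ∑ y, S i j * T x y * wirtG c (dirZ (stdVec x)) (wirtG d (dirZ (stdVec y))
        (wirtG a (dirZ (stdVec i)) (wirtG b (dirZ (stdVec j)) F))) P := by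
    intro S T a b c d
    rw [op2]
    refine Finset.sum_congr rfl fun i _ => Finset.sum_congr rfl fun j _ => ?_
    rw [wirtG_congr (wirtG_op2_eventually hF T c d b _), wirtG_op2 (analyticAt_wirtG hF _ _), op2,
      Finset.mul_sum]
    refine Finset.sum_congr rfl fun x _ => ?_
    rw [Finset.mul_sum]
    refine Finset.sum_congr rfl fun y _ => ?_
    rw [mul_assoc]
  rw [key, key]
  have hswap : ∀ f : Fin N → Fin N → Fin N → Fin N → ℂ,
      ∑ i, ∑ j, ∑ x, ∑ y, f i j x y = ∑ x, ∑ y, ∑ i, ∑ j, f i j x y := by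
    intro f
    have h1 : ∀ i, ∑ j, ∑ x, ∑ y, f i j x y = ∑ x, ∑ y, ∑ j, f i j x y := by
      intro i
      rw [Finset.sum_comm]
      exact Finset.sum_congr rfl fun x _ => Finset.sum_comm
    simp only [h1]
    rw [Finset.sum_comm]
    exact Finset.sum_congr rfl fun x _ => Finset.sum_comm
  rw [hswap]
  refine Finset.sum_congr rfl fun x _ => Finset.sum_congr rfl fun y _ =>
    Finset.sum_congr rfl fun i _ => Finset.sum_congr rfl fun j _ => ?_
  rw [mul_comm (S i j)]
  congr 1
  rw [wirtG_wirtG_wirtG_comm (analyticAt_wirtG hF _ _), wirtG_congr]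
  filter_upwards [hF.eventually_analyticAt] with Q hQ using wirtG_wirtG_wirtG_comm hQ _ _ _ _ _ _

end Commutation

/-! ### Bookkeeping for coefficients of differential operators. -/

section HasCoef

variable {U : Set (ℝ × (Fin N → ℝ))} {F G : JacobiSpace N → ℂ} {n : ℤ} {r : Fin N → ℤ}
  {p : ℝ × (Fin N → ℝ)} {a b : ℂ} {L : Matrix (Fin N) (Fin N) ℝ}

/-- `F` is real-analytic over `U`, with Fourier coefficient `a` at `p`. -/
def HasCoef (U : Set (ℝ × (Fin N → ℝ))) (n : ℤ) (r : Fin N → ℤ) (p : ℝ × (Fin N → ℝ))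
    (F : JacobiSpace N → ℂ) (a : ℂ) : Prop :=
  AnalyticOnNhd ℝ F (imPart ⁻¹' U) ∧ fcoef n r F p = a

theorem HasCoef.add (hp : p ∈ U) (hF : HasCoef U n r p F a) (hG : HasCoef U n r p G b) :
    HasCoef U n r p (fun P => F P + G P) (a + b) :=
  ⟨fun P hP => (hF.1 P hP).fun_add (hG.1 P hP), by rw [fcoef_add hF.1 hG.1 hp, hF.2, hG.2]⟩

theorem HasCoef.const_mul (hF : HasCoef U n r p F a) (c : ℂ) :
    HasCoef U n r p (fun P => c * F P) (c * a) :=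
  ⟨fun P hP => analyticAt_const.fun_mul (hF.1 P hP), by rw [fcoef_const_mul, hF.2]⟩

theorem HasCoef.sub (hp : p ∈ U) (hF : HasCoef U n r p F a) (hG : HasCoef U n r p G b) :
    HasCoef U n r p (fun P => F P - G P) (a - b) := by
  have h := hF.add hp (hG.const_mul (-1))
  simpa only [neg_mul, one_mul, ← sub_eq_add_neg] using h

theorem HasCoef.imFun_mul (hF : HasCoef U n r p F a) (ℓ : (ℝ × (Fin N → ℝ)) →L[ℝ] ℝ) :
    HasCoef U n r p (fun P => imFun ℓ P * F P) ((ℓ p : ℂ) * a) :=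
  ⟨fun P hP => (analyticAt_imFun ℓ P).fun_mul (hF.1 P hP), by rw [fcoef_imFun_mul, hF.2]⟩

theorem HasCoef.im_mul (hF : HasCoef U n r p F a) :
    HasCoef U n r p (fun P => (P.1.im : ℂ) * F P) ((p.1 : ℂ) * a) := hF.imFun_mul fstL

theorem HasCoef.sum {ι : Type*} (hp : p ∈ U) {K : ι → JacobiSpace N → ℂ} {c : ι → ℂ} (u : Finset ι)
    (hK : ∀ i, HasCoef U n r p (K i) (c i)) :
    HasCoef U n r p (fun P => ∑ i ∈ u, K i P) (∑ i ∈ u, c i) :=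
  ⟨fun P hP => Finset.analyticAt_fun_sum _ fun i _ => (hK i).1 P hP, by
    rw [fcoef_sum u (fun i _ => (hK i).1) hp]; exact Finset.sum_congr rfl fun i _ => (hK i).2⟩

theorem HasCoef.vNdC_mul (hF : HasCoef U n r p F a) (j : Fin N) :
    HasCoef U n r p (fun P => vNdC L P j * F P) (((projNd L *ᵥ p.2) j : ℂ) * a) := by
  have h := hF.imFun_mul (sndL (projNd L j))
  rw [sndL_apply] at h
  have h2 : (fun P => vNdC L P j * F P) = fun P => imFun (sndL (projNd L j)) P * F P := by
    funext P; rw [← vNdC_eq_imFun]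
  rw [h2]; exact h

theorem HasCoef.eq_zero (h : HasCoef U n r p F a) (hp : p ∈ U) (h0 : ∀ P ∈ imPart ⁻¹' U, F P = 0) :
    a = 0 := by
  rw [← h.2, fcoef_congr hp h0, fcoef_zero]

theorem HasCoef.congr (h : HasCoef U n r p F a) (hU : IsOpen U) (hp : p ∈ U)
    (h0 : ∀ P ∈ imPart ⁻¹' U, G P = F P) : HasCoef U n r p G a :=
  ⟨h.1.congr (isOpen_preimage_imPart hU) fun P hP => (h0 P hP).symm, by rw [fcoef_congr hp h0, h.2]⟩

theorem PeriodicOn.hasCoef (hF : PeriodicOn U F) : HasCoef U n r p F (fcoef n r F p) :=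
  ⟨hF.analytic, rfl⟩

theorem PeriodicOn.hasCoef_wirt (hF : PeriodicOn U F) (hU : IsOpen U) (hp : p ∈ U)
    (d : ℝ × (Fin N → ℝ)) : HasCoef U n r p (MaassJacobi.wirtG (-I) (emb d) F)
      (chiDir n r d * fcoef n r F p - fcoef n r (MaassJacobi.wirtG I (emb d) F) p) :=
  ⟨(hF.wirtG hU _ _).analytic, fcoef_wirt hU hF hp d⟩

/-- The gradient of the character, as a vector: `L_nd⁻¹ r`. -/
def pinvVec (L : Matrix (Fin N) (Fin N) ℝ) (r : Fin N → ℤ) : Fin N → ℝ :=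
  pinv L *ᵥ fun j => (r j : ℝ)

theorem chiDir_stdVec (i : Fin N) : chiDir n r (0, stdVec i) = 2 * Real.pi * I * r i := by
  rw [chiDir, Finset.sum_eq_single i (fun j _ hj => by simp [stdVec, hj]) (by simp)]
  simp [stdVec]

theorem sum_scrInv_chi (hL : L.IsSymm) (c : Fin N → ℂ) :
    ∑ i, ∑ j, scrInv L i j * (chiDir n r (0, stdVec i) * c j) = ∑ j, (pinvVec L r j : ℂ) * c j := by
  rw [Finset.sum_comm]
  refine Finset.sum_congr rfl fun j _ => ?_
  have h2 : (pinvVec L r j : ℂ) = ∑ i, (pinv L i j : ℂ) * r i := by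
    simp only [pinvVec, Matrix.mulVec, dotProduct, pinv_comm hL j]
    push_cast
    rfl
  rw [h2, Finset.sum_mul]
  refine Finset.sum_congr rfl fun i _ => ?_
  rw [chiDir_stdVec, scrInv]
  field_simp [two_pi_I_ne_zero]

theorem sum_scrInv_chi' (hL : L.IsSymm) (c : Fin N → ℂ) :
    ∑ i, ∑ j, scrInv L i j * (chiDir n r (0, stdVec j) * c i) = ∑ j, (pinvVec L r j : ℂ) * c j := by
  rw [← sum_scrInv_chi (n := n) hL, Finset.sum_comm]
  refine Finset.sum_congr rfl fun i _ => Finset.sum_congr rfl fun j _ => ?_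
  rw [scrInv, scrInv, pinv_comm hL]

theorem sum_pinvVec_chi : ∑ j, (pinvVec L r j : ℂ) * chiDir n r (0, stdVec j)
    = 2 * Real.pi * I * qf (pinv L) fun j => (r j : ℝ) := by
  simp only [chiDir_stdVec, qf, dotProduct]
  push_cast
  rw [Finset.mul_sum]
  exact Finset.sum_congr rfl fun j _ => by rw [pinvVec]; ring

variable (L) in
/-- The coefficient of the antiholomorphic derivative along `L_nd⁻¹ r`. -/
theorem PeriodicOn.fcoef_pinvVec (hF : PeriodicOn U F) (hU : IsOpen U) (hp : p ∈ U) (a : ℂ) :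
    fcoef n r (MaassJacobi.wirtG a (emb (0, pinvVec L r)) F) p
      = ∑ j, (pinvVec L r j : ℂ) * fcoef n r (MaassJacobi.wirtG a (emb (0, stdVec j)) F) p := by
  have h := HasCoef.sum hp Finset.univ fun j => ((hF.wirtG hU a (emb (0, stdVec j))).hasCoef
    (n := n) (r := r) (p := p)).const_mul (pinvVec L r j : ℂ)
  rw [← h.2]
  refine fcoef_congr hp fun P _ => ?_
  simp only [← dirZ_eq_emb]
  exact wirtG_dirZ_eq_sum _

/-- On the mode `(n, r)` the operator `∂_j` is the scalar `2π i r_j` minus `∂̄_j`. Contracting the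
scalar part with `𝓛_nd⁻¹` yields the single derivative `∂̄` along `L_nd⁻¹ r`. -/
theorem PeriodicOn.hasCoef_opR (hF : PeriodicOn U F) (hU : IsOpen U) (hp : p ∈ U) (hL : L.IsSymm) :
    HasCoef U n r p (MaassJacobi.op2 (scrInv L) I (-I) F)
      (fcoef n r (MaassJacobi.wirtG I (emb (0, pinvVec L r)) F) p
        - fcoef n r (MaassJacobi.op2 (scrInv L) I I F) p) := by
  refine ⟨(hF.op2 hU _ _ _).analytic, ?_⟩
  have h1 : ∀ i j, HasCoef U n r p (fun P => MaassJacobi.wirtG I (dirZ (stdVec i))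
      (MaassJacobi.wirtG (-I) (dirZ (stdVec j)) F) P) (chiDir n r (0, stdVec j) *
        fcoef n r (MaassJacobi.wirtG I (emb (0, stdVec i)) F) p
        - fcoef n r (MaassJacobi.wirtG I (emb (0, stdVec i)) (MaassJacobi.wirtG I (emb (0, stdVec j)) F)) p) := by
    intro i j
    have h := (hF.wirtG hU I (emb (0, stdVec i))).hasCoef_wirt (n := n) (r := r) hU hp (0, stdVec j)
    have h2 : fcoef n r (MaassJacobi.wirtG I (emb (0, stdVec j)) (MaassJacobi.wirtG I (emb (0, stdVec i)) F)) p
        = fcoef n r (MaassJacobi.wirtG I (emb (0, stdVec i)) (MaassJacobi.wirtG I (emb (0, stdVec j)) F)) p :=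
      fcoef_congr hp fun P hP => wirtG_comm (hF.analytic P hP) _ _ _ _
    rw [h2] at h
    refine h.congr hU hp fun P hP => ?_
    rw [dirZ_eq_emb, dirZ_eq_emb, wirtG_comm (hF.analytic P hP)]
  have h2 : ∀ i j, HasCoef U n r p (fun P => MaassJacobi.wirtG I (dirZ (stdVec i))
      (MaassJacobi.wirtG I (dirZ (stdVec j)) F) P)
      (fcoef n r (MaassJacobi.wirtG I (emb (0, stdVec i)) (MaassJacobi.wirtG I (emb (0, stdVec j)) F)) p) := by
    intro i j
    rw [dirZ_eq_emb, dirZ_eq_emb]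
    exact ((hF.wirtG hU _ _).wirtG hU _ _).hasCoef
  have h3 := HasCoef.sum hp Finset.univ fun i => HasCoef.sum hp Finset.univ fun j =>
    (h1 i j).const_mul (scrInv L i j)
  have h4 := HasCoef.sum hp Finset.univ fun i => HasCoef.sum hp Finset.univ fun j =>
    (h2 i j).const_mul (scrInv L i j)
  refine h3.2.trans ?_
  rw [show fcoef n r (MaassJacobi.op2 (scrInv L) I I F) p = _ from h4.2, hF.fcoef_pinvVec L hU hp,
    ← sum_scrInv_chi' (n := n) hL, ← Finset.sum_sub_distrib]
  refine Finset.sum_congr rfl fun i _ => ?_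
  rw [← Finset.sum_sub_distrib]
  exact Finset.sum_congr rfl fun j _ => by ring

theorem PeriodicOn.hasCoef_opR' (hF : PeriodicOn U F) (hU : IsOpen U) (hp : p ∈ U) (hL : L.IsSymm) :
    HasCoef U n r p (MaassJacobi.op2 (scrInv L) (-I) I F)
      (fcoef n r (MaassJacobi.wirtG I (emb (0, pinvVec L r)) F) p
        - fcoef n r (MaassJacobi.op2 (scrInv L) I I F) p) := by
  refine (hF.hasCoef_opR hU hp hL).congr hU hp fun P hP => ?_
  rw [MaassJacobi.op2, MaassJacobi.op2, Finset.sum_comm]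
  refine Finset.sum_congr rfl fun i _ => Finset.sum_congr rfl fun j _ => ?_
  rw [wirtG_comm (hF.analytic P hP), scrInv, scrInv, pinv_comm hL]

theorem PeriodicOn.hasCoef_opP (hF : PeriodicOn U F) (hU : IsOpen U) (hp : p ∈ U) (hL : L.IsSymm) :
    HasCoef U n r p (MaassJacobi.op2 (scrInv L) (-I) (-I) F)
      (2 * Real.pi * I * (qf (pinv L) fun j => (r j : ℝ)) * fcoef n r F p
        - 2 * fcoef n r (MaassJacobi.wirtG I (emb (0, pinvVec L r)) F) p
        + fcoef n r (MaassJacobi.op2 (scrInv L) I I F) p) := by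
  refine ⟨(hF.op2 hU _ _ _).analytic, ?_⟩
  have h1 : ∀ i j, HasCoef U n r p (fun P => MaassJacobi.wirtG (-I) (dirZ (stdVec i))
      (MaassJacobi.wirtG (-I) (dirZ (stdVec j)) F) P) (chiDir n r (0, stdVec i) *
        fcoef n r (MaassJacobi.wirtG (-I) (emb (0, stdVec j)) F) p
        - fcoef n r (MaassJacobi.wirtG I (dirZ (stdVec i)) (MaassJacobi.wirtG (-I) (dirZ (stdVec j)) F)) p) := by
    intro i j
    have h := (hF.wirtG hU (-I) (emb (0, stdVec j))).hasCoef_wirt (n := n) (r := r) hU hp (0, stdVec i)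
    simpa only [dirZ_eq_emb] using h
  have h2 : ∀ i j, HasCoef U n r p (fun P => MaassJacobi.wirtG I (dirZ (stdVec i))
      (MaassJacobi.wirtG (-I) (dirZ (stdVec j)) F) P)
      (fcoef n r (MaassJacobi.wirtG I (dirZ (stdVec i)) (MaassJacobi.wirtG (-I) (dirZ (stdVec j)) F)) p) :=
    fun i j => ((hF.wirtG hU _ _).wirtG hU _ _).hasCoef
  have h3 := HasCoef.sum hp Finset.univ fun i => HasCoef.sum hp Finset.univ fun j =>
    (h1 i j).const_mul (scrInv L i j)
  have h4 := HasCoef.sum hp Finset.univ fun i => HasCoef.sum hp Finset.univ fun j =>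
    (h2 i j).const_mul (scrInv L i j)
  have h5 := (hF.hasCoef_opR (n := n) (r := r) hU hp hL).2
  rw [show fcoef n r (MaassJacobi.op2 (scrInv L) I (-I) F) p = _ from h4.2] at h5
  have h6 : ∑ i, ∑ j, scrInv L i j * (chiDir n r (0, stdVec i) *
        fcoef n r (MaassJacobi.wirtG (-I) (emb (0, stdVec j)) F) p)
      = 2 * Real.pi * I * (qf (pinv L) fun j => (r j : ℝ)) * fcoef n r F p
        - fcoef n r (MaassJacobi.wirtG I (emb (0, pinvVec L r)) F) p := by
    rw [sum_scrInv_chi hL, hF.fcoef_pinvVec L hU hp, ← sum_pinvVec_chi (n := n), Finset.sum_mul,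
      ← Finset.sum_sub_distrib]
    refine Finset.sum_congr rfl fun j _ => ?_
    rw [fcoef_wirt hU hF hp]
    ring
  refine h3.2.trans ?_
  simp only [mul_sub, Finset.sum_sub_distrib]
  rw [h5, h6]
  ring

end HasCoef

/-! ### Differential equations for a single Fourier coefficient. -/

section ModeEquations

variable {U : Set (ℝ × (Fin N → ℝ))} {φ F : JacobiSpace N → ℂ} {n : ℤ} {r : Fin N → ℤ}
  {p : ℝ × (Fin N → ℝ)} {L : Matrix (Fin N) (Fin N) ℝ} {k : ℤ}

theorem contDiffAt_fcoef (hU : IsOpen U) (hF : PeriodicOn U F) (hp : p ∈ U) :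
    ContDiffAt ℝ 2 (fcoef n r F) p := by
  have h := (contDiffOn_infty.mp (contDiffOn_fcoef (n := n) (r := r) hU hF) 2).contDiffAt
    (hU.mem_nhds hp)
  exact_mod_cast h

theorem fcoef_wirtBar_wirtBar (hU : IsOpen U) (hF : PeriodicOn U F) (hp : p ∈ U)
    (d d' : ℝ × (Fin N → ℝ)) :
    fcoef n r (wirtG I (emb d) (wirtG I (emb d') F)) p
      = -(1 / 4) * fderiv ℝ (fderiv ℝ (fcoef n r F)) p d d' := by
  rw [fcoef_wirtBar hU (hF.wirtG hU _ _) hp]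
  have hev : fcoef n r (wirtG I (emb d') F) =ᶠ[𝓝 p] fun x => I / 2 * fderiv ℝ (fcoef n r F) x d' :=
    Filter.eventuallyEq_of_mem (hU.mem_nhds hp) fun x hx => fcoef_wirtBar hU hF hx d'
  have hc : ContDiffAt ℝ 2 (fcoef n r F) p := contDiffAt_fcoef hU hF hp
  have hd : DifferentiableAt ℝ (fderiv ℝ (fcoef n r F)) p :=
    (hc.fderiv_right (m := 1) le_rfl).differentiableAt one_ne_zero
  rw [hev.fderiv_eq, fderiv_const_mul (hd.clm_apply (differentiableAt_const d')),
    smul_apply, fderiv_fderiv_apply hc, smul_eq_mul]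
  linear_combination (1 / 4 * fderiv ℝ (fderiv ℝ (fcoef n r F)) p d d') * Complex.I_mul_I

theorem sum_coord_apply (T : (ℝ × (Fin N → ℝ)) →L[ℝ] ℂ) (a : Fin N → ℝ) :
    ∑ j, (a j : ℂ) * T (0, stdVec j) = T (0, a) := by
  have : ((0 : ℝ), a) = ∑ j, a j • ((0 : ℝ), (stdVec j : Fin N → ℝ)) := by
    refine Prod.ext ?_ ?_
    · simp [Prod.fst_sum]
    · ext i; simp [Prod.snd_sum, stdVec, Pi.single_apply]
  conv_rhs => rw [this, map_sum]
  exact Finset.sum_congr rfl fun j _ => by rw [map_smul, Complex.real_smul]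

/-- The equation for Fourier coefficients that results from the Casimir operator. -/
theorem casimir_mode (hU : IsOpen U) (hφ : PeriodicOn U φ) (hp : p ∈ U) (hL : L.IsSymm)
    (hcas : ∀ P ∈ imPart ⁻¹' U, casimir k L φ P = 0) (D1 : (ℝ × (Fin N → ℝ)) →L[ℝ] ℂ)
    (D2 : (ℝ × (Fin N → ℝ)) →L[ℝ] (ℝ × (Fin N → ℝ)) →L[ℝ] ℂ) (hD1 : D1 = fderiv ℝ (fcoef n r φ) p)
    (hD2 : D2 = fderiv ℝ (fderiv ℝ (fcoef n r φ)) p) (vv w θ : ℝ × (Fin N → ℝ))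
    (hv : vv = (0, projNd L *ᵥ p.2)) (hw : w = (0, pinvVec L r))
    (hθ : θ = (2 * p.1) • ((1 : ℝ), (0 : Fin N → ℝ)) + vv - (p.1 / 2) • w) :
    -(1 / 2) * D2 θ θ - kappa k N * D1 θ + 1 / 2 * D1 vv + 1 / 4 * p.1 * D1 w
      + Real.pi * normDisc L n r * p.1 * (2 * p.1 * D1 (1, 0) + 2 * D1 vv)
      - normDisc L n r * p.1 ^ 2 / 8 * ∑ i, ∑ j, (pinv L i j : ℂ) * D2 (0, stdVec i) (0, stdVec j)
      = 0 := by
  have hsymm : ∀ a b, D2 a b = D2 b a := by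
    intro a b
    rw [hD2]
    exact fderiv_fderiv_symm (contDiffAt_fcoef hU hφ hp) b a
  have c1 : ∀ d, fcoef n r (wirtG I (emb d) φ) p = I / 2 * D1 d := by
    intro d; rw [hD1]; exact fcoef_wirtBar hU hφ hp d
  have c2 : ∀ d d', fcoef n r (wirtG I (emb d) (wirtG I (emb d') φ)) p = -(1 / 4) * D2 d d' := by
    intro d d'; rw [hD2]; exact fcoef_wirtBar_wirtBar hU hφ hp d d'
  have hA := fun d => hφ.wirtG hU I (emb d)
  have hcc : ∀ d d', HasCoef U n r p (wirtG I (emb d) (wirtG I (emb d') φ)) (-(1 / 4) * D2 d d') :=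
    fun d d' => ⟨((hA d').wirtG hU _ _).analytic, c2 d d'⟩
  have hc : ∀ d, HasCoef U n r p (wirtG I (emb d) φ) (I / 2 * D1 d) :=
    fun d => ⟨(hA d).analytic, c1 d⟩
  set q := fcoef n r (op2 (scrInv L) I I φ) p with hq
  have hq1 : q = (2 * Real.pi * I)⁻¹ * (-(1 / 4) *
      ∑ i, ∑ j, (pinv L i j : ℂ) * D2 (0, stdVec i) (0, stdVec j)) := by
    have h := HasCoef.sum hp Finset.univ fun i => HasCoef.sum hp Finset.univ fun j =>
      (hcc (0, stdVec i) (0, stdVec j)).const_mul (scrInv L i j)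
    simp only [← dirZ_eq_emb] at h
    rw [show q = _ from h.2, Finset.mul_sum, Finset.mul_sum]
    refine Finset.sum_congr rfl fun i _ => ?_
    rw [Finset.mul_sum, Finset.mul_sum]
    refine Finset.sum_congr rfl fun j _ => ?_
    rw [scrInv]; ring
  set ρ : ℂ := ((qf (pinv L) fun j => (r j : ℝ) : ℝ) : ℂ) with hρ
  have hχ : chiDir n r ((1 : ℝ), (0 : Fin N → ℝ)) = 2 * Real.pi * I * n := by simp [chiDir]
  -- A third order contribution; it occurs with opposite signs in `t2` and `t3`.
  set x := fcoef n r (op2 (scrInv L) I I (wirtG I (emb (1, 0)) φ)) p with hx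
  -- the terms of the Casimir operator
  have t1 : HasCoef U n r p (wirtG (-I) dirTau (wirtG I dirTau φ))
      (2 * Real.pi * I * n * (I / 2 * D1 (1, 0)) - -(1 / 4) * D2 (1, 0) (1, 0)) := by
    have := (hA (1, 0)).hasCoef_wirt (n := n) (r := r) hU hp (1, 0)
    rwa [hχ, c1, c2, ← dirTau_eq_emb] at this
  have t1' : HasCoef U n r p (wirtG I dirTau φ) (I / 2 * D1 (1, 0)) := by
    rw [dirTau_eq_emb]; exact hc _
  have t2 : HasCoef U n r p (wirtG I dirTau (op2 (scrInv L) (-I) (-I) φ))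
      (2 * Real.pi * I * ρ * (I / 2 * D1 (1, 0)) - 2 * (-(1 / 4) * D2 w (1, 0)) + x) := by
    have := (hA (1, 0)).hasCoef_opP (n := n) (r := r) hU hp hL
    rw [c1, c2, ← hw] at this
    refine this.congr hU hp fun P hP => ?_
    rw [dirTau_eq_emb, wirtG_op2 (hφ.analytic P hP)]
  have t3 : HasCoef U n r p (wirtG (-I) dirTau (op2 (scrInv L) I I φ))
      (2 * Real.pi * I * n * q - x) := by
    have := (hφ.op2 hU (scrInv L) I I).hasCoef_wirt (n := n) (r := r) hU hp (1, 0)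
    rw [hχ, ← dirTau_eq_emb, ← hq] at this
    have h2 : fcoef n r (wirtG I dirTau (op2 (scrInv L) I I φ)) p = x := by
      rw [hx, ← dirTau_eq_emb]
      exact fcoef_congr hp fun P hP => wirtG_op2 (hφ.analytic P hP) _ _ _ _ _
    rwa [h2] at this
  have t4 : HasCoef U n r p (fun P => ∑ j, vNdC L P j * wirtG (-I) dirTau (dZBar (stdVec j) φ) P)
      (2 * Real.pi * I * n * (I / 2 * D1 vv) - -(1 / 4) * D2 (1, 0) vv) := by
    have h := HasCoef.sum hp Finset.univ fun j => ((hA (0, stdVec j)).hasCoef_wirt (n := n) (r := r)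
      hU hp (1, 0)).vNdC_mul (L := L) j
    simp only [hχ, c1, c2] at h
    have h2 : ∑ j, ((projNd L *ᵥ p.2) j : ℂ) * (2 * Real.pi * I * n * (I / 2 * D1 (0, stdVec j))
        - -(1 / 4) * D2 (1, 0) (0, stdVec j))
        = 2 * Real.pi * I * n * (I / 2 * D1 vv) - -(1 / 4) * D2 (1, 0) vv := by
      rw [hv, ← sum_coord_apply D1, ← sum_coord_apply (D2 (1, 0))]
      simp only [Finset.mul_sum, ← Finset.sum_sub_distrib]
      exact Finset.sum_congr rfl fun j _ => by ring
    rw [h2] at h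
    simpa only [dZBar_eq, dirTau_eq_emb, dirZ_eq_emb] using h
  have hQ := hφ.op2 hU (scrInv L) I I
  have hR := hφ.op2 hU (scrInv L) I (-I)
  have hAQ : fcoef n r (wirtG I (emb w) (op2 (scrInv L) I I φ)) p
      = fcoef n r (op2 (scrInv L) I I (wirtG I (emb w) φ)) p :=
    fcoef_congr hp fun P hP => wirtG_op2 (hφ.analytic P hP) _ _ _ _ _
  -- The terms of order four and three cancel between the two products of second order operators, so
  -- the Casimir equation is of second order on Fourier coefficients.
  have t5 : HasCoef U n r p (fun P => op2 (scrInv L) I I (op2 (scrInv L) (-I) (-I) φ) P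
      - op2 (scrInv L) I (-I) (op2 (scrInv L) I (-I) φ) P)
      (2 * Real.pi * I * ρ * q - -(1 / 4) * D2 w w) := by
    have h1 := (hQ.hasCoef_opP (n := n) (r := r) hU hp hL).congr (G := op2 (scrInv L) I I
      (op2 (scrInv L) (-I) (-I) φ)) hU hp fun P hP => op2_op2_comm (hφ.analytic P hP) _ _ _ _ _ _
    have h2 := hR.hasCoef_opR (n := n) (r := r) hU hp hL
    have h3 : fcoef n r (wirtG I (emb w) (op2 (scrInv L) I (-I) φ)) p
        = fcoef n r (op2 (scrInv L) I (-I) (wirtG I (emb w) φ)) p :=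
      fcoef_congr hp fun P hP => wirtG_op2 (hφ.analytic P hP) _ _ _ _ _
    have h4 : fcoef n r (op2 (scrInv L) I I (op2 (scrInv L) I (-I) φ)) p
        = fcoef n r (op2 (scrInv L) I (-I) (op2 (scrInv L) I I φ)) p :=
      fcoef_congr hp fun P hP => op2_op2_comm (hφ.analytic P hP) _ _ _ _ _ _
    rw [← hw] at h1 h2
    have h5 := ((hA w).hasCoef_opR (n := n) (r := r) hU hp hL).2
    have h6 := (hQ.hasCoef_opR (n := n) (r := r) hU hp hL).2
    rw [← hw] at h5 h6
    rw [h3, h4, h5, h6, c2, hAQ] at h2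
    rw [hAQ, ← hq, ← hρ] at h1
    have h7 := h1.sub hp h2
    convert h7 using 1
    ring
  have hZU : ∀ {K : JacobiSpace N → ℂ}, PeriodicOn U K → HasCoef U n r p (opZU L K)
      (2 * Real.pi * I * ρ * fcoef n r K p - fcoef n r (wirtG I (emb w) K) p) := by
    intro K hK
    have h1 := (hK.hasCoef_opP (n := n) (r := r) hU hp hL).add hp (hK.hasCoef_opR' hU hp hL)
    rw [← hw] at h1
    have h2 : 2 * Real.pi * I * ρ * fcoef n r K p - fcoef n r (wirtG I (emb w) K) p
      = (2 * Real.pi * I * ρ * fcoef n r K p - 2 * fcoef n r (wirtG I (emb w) K) p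
        + fcoef n r (op2 (scrInv L) I I K) p) + (fcoef n r (wirtG I (emb w) K) p
        - fcoef n r (op2 (scrInv L) I I K) p) := by ring
    rw [h2]
    refine h1.congr hU hp fun P hP => ?_
    simp only [opZU, op2, ← Finset.sum_add_distrib, ← mul_add, dZ_eq, dU_eq]
    refine Finset.sum_congr rfl fun i _ => Finset.sum_congr rfl fun j _ => ?_
    congr 1
    exact wirtG_add (analyticAt_wirtG (hK.analytic P hP) _ _).differentiableAt
      (analyticAt_wirtG (hK.analytic P hP) _ _).differentiableAt
  have t6 : HasCoef U n r p (fun P => ∑ j, vNdC L P j * dZBar (stdVec j) (opZU L φ) P)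
      (2 * Real.pi * I * ρ * (I / 2 * D1 vv) - -(1 / 4) * D2 w vv) := by
    have h := HasCoef.sum hp Finset.univ fun j => (hZU (hA (0, stdVec j))).vNdC_mul (L := L) j
    simp only [c1, c2] at h
    have h2 : ∑ j, ((projNd L *ᵥ p.2) j : ℂ) * (2 * Real.pi * I * ρ * (I / 2 * D1 (0, stdVec j))
        - -(1 / 4) * D2 w (0, stdVec j))
        = 2 * Real.pi * I * ρ * (I / 2 * D1 vv) - -(1 / 4) * D2 w vv := by
      rw [hv, ← sum_coord_apply D1, ← sum_coord_apply (D2 w)]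
      simp only [Finset.mul_sum, ← Finset.sum_sub_distrib]
      exact Finset.sum_congr rfl fun j _ => by ring
    rw [h2] at h
    refine h.congr hU hp fun P hP => ?_
    refine Finset.sum_congr rfl fun j _ => ?_
    congr 1
    have hP' := hφ.analytic P hP
    have hfun : opZU L φ = fun Q => ∑ i, ∑ l, scrInv L i l *
        wirtG (-I) (dirZ (stdVec i)) (dU l φ) Q := by
      funext Q; simp only [opZU, dZ_eq]
    simp only [hfun, dZBar_eq, dirZ_eq_emb]
    simp only [opZU, dZ_eq, ← dirZ_eq_emb]
    rw [wirtG_sum fun i _ => (Finset.analyticAt_fun_sum _ fun l _ => analyticAt_const.fun_mul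
      (analyticAt_wirtG (analyticAt_dU hP' l) _ _)).differentiableAt]
    refine Finset.sum_congr rfl fun i _ => ?_
    rw [wirtG_sum fun l _ => (analyticAt_const.fun_mul
      (analyticAt_wirtG (analyticAt_dU hP' l) _ _)).differentiableAt]
    refine Finset.sum_congr rfl fun l _ => ?_
    rw [wirtG_const_mul _ (analyticAt_wirtG (analyticAt_dU hP' l) _ _).differentiableAt,
      wirtG_comm (analyticAt_dU hP' l)]
    congr 1
    refine wirtG_congr ?_ _ _
    filter_upwards [hP'.eventually_analyticAt] with Q hQ
    simp only [dU_eq]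
    rw [wirtG_add (analyticAt_wirtG hQ _ _).differentiableAt
      (analyticAt_wirtG hQ _ _).differentiableAt, wirtG_comm hQ I (-I),
      wirtG_comm hQ I I (dirZ (stdVec j)) (dirZ (stdVec l))]
  have t7 : HasCoef U n r p (opZBarU L φ) (I / 2 * D1 w) := by
    have h1 := (hφ.hasCoef_opR (n := n) (r := r) hU hp hL).add hp hQ.hasCoef
    rw [sub_add_cancel, ← hw, c1] at h1
    refine h1.congr hU hp fun P hP => ?_
    simp only [opZBarU, op2, ← Finset.sum_add_distrib, ← mul_add, dZBar_eq, dU_eq]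
    refine Finset.sum_congr rfl fun i _ => Finset.sum_congr rfl fun j _ => ?_
    congr 1
    exact wirtG_add (analyticAt_wirtG (hφ.analytic P hP) _ _).differentiableAt
      (analyticAt_wirtG (hφ.analytic P hP) _ _).differentiableAt
  have t8 : HasCoef U n r p (fun P => ∑ i, ∑ j, vNdC L P i * vNdC L P j *
      dZBar (stdVec i) (dZBar (stdVec j) φ) P) (-(1 / 4) * D2 vv vv) := by
    have h := HasCoef.sum hp Finset.univ fun i => HasCoef.sum hp Finset.univ fun j =>
      ((hcc (0, stdVec i) (0, stdVec j)).vNdC_mul (L := L) j).vNdC_mul (L := L) i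
    have h2 : ∑ i, ∑ j, ((projNd L *ᵥ p.2) i : ℂ) * (((projNd L *ᵥ p.2) j : ℂ) *
        (-(1 / 4) * D2 (0, stdVec i) (0, stdVec j))) = -(1 / 4) * D2 vv vv := by
      have h3 : ∀ i, ∑ j, ((projNd L *ᵥ p.2) i : ℂ) * (((projNd L *ᵥ p.2) j : ℂ) *
          (-(1 / 4) * D2 (0, stdVec i) (0, stdVec j)))
          = -(1 / 4) * (((projNd L *ᵥ p.2) i : ℂ) * D2 vv (0, stdVec i)) := by
        intro i
        rw [hsymm vv, hv, ← sum_coord_apply (D2 (0, stdVec i))]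
        simp only [Finset.mul_sum]
        exact Finset.sum_congr rfl fun j _ => by ring
      simp only [h3]
      rw [← Finset.mul_sum, sum_coord_apply, ← hv]
    rw [h2] at h
    simpa only [dZBar_eq, dirZ_eq_emb, mul_assoc] using h
  have t9 : HasCoef U n r p (fun P => ∑ j, vNdC L P j * dZBar (stdVec j) φ P) (I / 2 * D1 vv) := by
    have h := HasCoef.sum hp Finset.univ fun j => (hc (0, stdVec j)).vNdC_mul (L := L) j
    have h2 : ∑ j, ((projNd L *ᵥ p.2) j : ℂ) * (I / 2 * D1 (0, stdVec j)) = I / 2 * D1 vv := by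
      rw [hv, ← sum_coord_apply D1, Finset.mul_sum]
      exact Finset.sum_congr rfl fun j _ => by ring
    rw [h2] at h
    simpa only [dZBar_eq, dirZ_eq_emb] using h
  have total := ((((((((((t1.im_mul.im_mul.const_mul 4).sub hp
    (t1'.im_mul.const_mul (2 * kappa k N * I))).const_mul (-2)).add hp
    ((t2.add hp t3).im_mul.im_mul.const_mul 2)).sub hp (t4.im_mul.const_mul 8)).sub hp
    (t5.im_mul.im_mul.const_mul (1 / 2))).add hp (t6.im_mul.const_mul 2)).sub hp
    (t7.im_mul.const_mul ((1 / 2) * (2 * (k : ℂ) - (N : ℂ) + 1) * I))).add hp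
    (t8.const_mul 2))).add hp (t9.const_mul ((2 * (k : ℂ) - (N : ℂ) - 1) * I))
  have h0 := total.eq_zero hp fun P hP => by
    rw [← hcas P hP, casimir_eq_casD, casD, opP_eq, opQ_eq, opR_eq]
    ring
  have hkap : ((kappa k N : ℝ) : ℂ) = k - N / 2 := by simp [kappa]
  have hD : ((normDisc L n r : ℝ) : ℂ) = 4 * n - ρ := by simp [normDisc, hρ]
  have hqq : 2 * Real.pi * I * q = -(1 / 4) *
      ∑ i, ∑ j, (pinv L i j : ℂ) * D2 (0, stdVec i) (0, stdVec j) := by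
    rw [hq1, ← mul_assoc, mul_inv_cancel₀ two_pi_I_ne_zero, one_mul]
  set S := ∑ i, ∑ j, (pinv L i j : ℂ) * D2 (0, stdVec i) (0, stdVec j) with hS
  have e1 : D1 θ = 2 * p.1 * D1 (1, 0) + D1 vv - p.1 / 2 * D1 w := by
    rw [hθ, map_sub, map_add, map_smul, map_smul, Complex.real_smul, Complex.real_smul]
    push_cast; ring
  have e2 : D2 θ θ = 4 * p.1 ^ 2 * D2 (1, 0) (1, 0) + D2 vv vv + p.1 ^ 2 / 4 * D2 w w
      + 4 * p.1 * D2 (1, 0) vv - 2 * p.1 ^ 2 * D2 w (1, 0) - p.1 * D2 w vv := by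
    have h1 := hsymm vv (1, 0)
    have h2 := hsymm (1, 0) w
    have h3 := hsymm vv w
    simp only [hθ, map_sub, map_add, map_smul, sub_apply, add_apply, smul_apply,
      Complex.real_smul]
    push_cast
    linear_combination (2 * p.1) * h1 - (p.1 : ℂ) ^ 2 * h2 - (p.1 / 2 : ℂ) * h3
  rw [e1, e2, hD, hkap]
  rw [hkap] at h0
  have hI := Complex.I_mul_I
  linear_combination h0 - ((4 * n - ρ) * (p.1 : ℂ) ^ 2 / 2) * hqq
    - (-8 * Real.pi * n * (p.1 : ℂ) ^ 2 * D1 (1, 0) + 2 * (k - N / 2) * p.1 * D1 (1, 0)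
      + 2 * Real.pi * ρ * (p.1 : ℂ) ^ 2 * D1 (1, 0) - 8 * Real.pi * n * p.1 * D1 vv
      + 2 * Real.pi * ρ * p.1 * D1 vv - (2 * k - N + 1) / 4 * p.1 * D1 w
      + (2 * k - N - 1) / 2 * D1 vv) * hI

theorem fderiv_fcoef_eq_zero (hU : IsOpen U) (hφ : PeriodicOn U φ) (hp : p ∈ U) {x : Fin N → ℝ}
    (hx : ∀ P ∈ imPart ⁻¹' U, wirtG I (dirZ x) φ P = 0) : fderiv ℝ (fcoef n r φ) p (0, x) = 0 := by
  have h := fcoef_wirtBar (n := n) (r := r) hU hφ hp (0, x)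
  rw [← dirZ_eq_emb, fcoef_congr hp hx, fcoef_zero] at h
  simpa using h.symm

theorem fderiv_fderiv_fcoef_eq_zero (hU : IsOpen U) (hφ : PeriodicOn U φ) (hp : p ∈ U)
    {x : Fin N → ℝ} (hx : ∀ P ∈ imPart ⁻¹' U, wirtG I (dirZ x) φ P = 0) (d : ℝ × (Fin N → ℝ)) :
    fderiv ℝ (fderiv ℝ (fcoef n r φ)) p d (0, x) = 0 := by
  rw [← fderiv_fderiv_apply (contDiffAt_fcoef hU hφ hp)]
  have : (fun q => fderiv ℝ (fcoef n r φ) q (0, x)) =ᶠ[𝓝 p] fun _ => 0 :=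
    Filter.eventuallyEq_of_mem (hU.mem_nhds hp) fun q hq => fderiv_fcoef_eq_zero hU hφ hq hx
  rw [this.fderiv_eq]
  simp

/-- The equation for Fourier coefficients that results from a Heisenberg Laplace operator. -/
theorem heis_mode (hU : IsOpen U) (hφ : PeriodicOn U φ) (hp : p ∈ U) (hL : L.IsSymm)
    {e : Fin N → ℝ} (hH : ∀ P ∈ imPart ⁻¹' U, heisLaplace L e φ P = 0) :
    p.1 * fderiv ℝ (fderiv ℝ (fcoef n r φ)) p (0, e) (0, e)
      = 4 * Real.pi * (p.1 * pairing r e + 2 * (e ⬝ᵥ (L *ᵥ p.2) : ℝ))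
        * fderiv ℝ (fcoef n r φ) p (0, e) := by
  have hA := hφ.wirtG hU I (emb (0, e))
  have h1 := (hA.hasCoef_wirt (n := n) (r := r) hU hp (0, e)).im_mul
  have h2 := ((hA.hasCoef (n := n) (r := r) (p := p)).imFun_mul (sndL (L *ᵥ e))).const_mul
    (4 * Real.pi * I)
  rw [fcoef_wirtBar_wirtBar hU hφ hp, fcoef_wirtBar hU hφ hp] at h1
  rw [fcoef_wirtBar hU hφ hp] at h2
  have h3 := (h1.add hp h2).eq_zero hp fun P hP => by
    rw [← hH P hP, heisLaplace_eq hL, dirZ_eq_emb, imFun, sndL_apply, dotProduct_comm (L *ᵥ e)]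
    ring
  have h4 : chiDir n r ((0 : ℝ), e) = 2 * Real.pi * I * pairing r e := by
    simp [chiDir, pairing]
  have h5 : (L *ᵥ e) ⬝ᵥ p.2 = e ⬝ᵥ (L *ᵥ p.2) := by
    rw [Matrix.dotProduct_mulVec, ← Matrix.mulVec_transpose, hL]
  rw [h4, sndL_apply, h5] at h3
  linear_combination 4 * h3 - (4 * Real.pi * fderiv ℝ (fcoef n r φ) p (0, e) *
    (p.1 * pairing r e + 2 * (e ⬝ᵥ (L *ᵥ p.2) : ℝ))) * Complex.I_mul_I

/-- The equation for Fourier coefficients that results from the linear part of the translated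
Casimir operator. -/
theorem casLin_mode (hU : IsOpen U) (hφ : PeriodicOn U φ) (hp : p ∈ U) (hpos : 0 < p.1)
    {lam : Fin N → ℝ} (hlam : ∀ P ∈ imPart ⁻¹' U, wirtG I (dirZ lam) φ P = 0)
    (hr : pairing r lam ≠ 0) (hcas : ∀ P ∈ imPart ⁻¹' U, casLin k L lam φ P = 0)
    (D1 : (ℝ × (Fin N → ℝ)) →L[ℝ] ℂ)
    (D2 : (ℝ × (Fin N → ℝ)) →L[ℝ] (ℝ × (Fin N → ℝ)) →L[ℝ] ℂ) (hD1 : D1 = fderiv ℝ (fcoef n r φ) p)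
    (hD2 : D2 = fderiv ℝ (fderiv ℝ (fcoef n r φ)) p) :
    2 * p.1 * D1 (1, 0) + 2 * D1 (0, projNd L *ᵥ p.2)
      - p.1 / (8 * Real.pi) * ∑ i, ∑ j, (pinv L i j : ℂ) * D2 (0, stdVec i) (0, stdVec j) = 0 := by
  have c1 : ∀ d, fcoef n r (wirtG I (emb d) φ) p = I / 2 * D1 d := by
    intro d; rw [hD1]; exact fcoef_wirtBar hU hφ hp d
  have hA := fun d => hφ.wirtG hU I (emb d)
  set q := fcoef n r (op2 (scrInv L) I I φ) p with hq
  have hq1 : q = (2 * Real.pi * I)⁻¹ * (-(1 / 4) *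
      ∑ i, ∑ j, (pinv L i j : ℂ) * D2 (0, stdVec i) (0, stdVec j)) := by
    have h := HasCoef.sum hp Finset.univ fun i => HasCoef.sum hp Finset.univ fun j =>
      ((((hφ.wirtG hU I (emb (0, stdVec j))).wirtG hU I (emb (0, stdVec i))).hasCoef (n := n)
        (r := r) (p := p))).const_mul (scrInv L i j)
    simp only [fcoef_wirtBar_wirtBar hU hφ hp] at h
    simp only [← dirZ_eq_emb, ← hD2] at h
    rw [show q = _ from h.2, Finset.mul_sum, Finset.mul_sum]
    refine Finset.sum_congr rfl fun i _ => ?_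
    rw [Finset.mul_sum, Finset.mul_sum]
    refine Finset.sum_congr rfl fun j _ => ?_
    rw [scrInv]; ring
  have hz : ∀ d, ∀ P ∈ imPart ⁻¹' U, wirtG I (dirZ lam) (wirtG I (emb d) φ) P = 0 := by
    intro d P hP
    rw [wirtG_comm (hφ.analytic P hP), wirtG_congr (Filter.eventuallyEq_of_mem
      ((isOpen_preimage_imPart hU).mem_nhds hP) hlam), wirtG_const]
  have hchi : chiDir n r ((0 : ℝ), lam) = 2 * Real.pi * I * pairing r lam := by
    simp [chiDir, pairing]
  have hop : ∀ a, ∀ P ∈ imPart ⁻¹' U, wirtG I (dirZ lam) (op2 (scrInv L) a a φ) P = 0 := by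
    intro a P hP
    rw [wirtG_op2 (hφ.analytic P hP), (op2_congr (Filter.eventuallyEq_of_mem
      ((isOpen_preimage_imPart hU).mem_nhds hP) hlam) _ _ _).eq_of_nhds]
    have h : ∀ a (d : JacobiSpace N), wirtG a d (fun _ : JacobiSpace N => (0 : ℂ)) = fun _ => 0 :=
      fun a d => funext fun Q => wirtG_const 0
    simp [op2, h]
  -- Because `∂̄_lam φ = 0`, the derivative `∂_lam` acts on the mode as multiplication by `2π i
  -- r_lam`. Every surviving term contains this nonzero factor, which is cancelled at the end.
  have hw : ∀ d, HasCoef U n r p (wirtG (-I) (dirZ lam) (wirtG I (emb d) φ))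
      (2 * Real.pi * I * pairing r lam * (I / 2 * D1 d)) := by
    intro d
    have h := (hA d).hasCoef_wirt (n := n) (r := r) hU hp (0, lam)
    rwa [hchi, c1, ← dirZ_eq_emb, fcoef_congr hp (hz d), fcoef_zero, sub_zero] at h
  have hQ : HasCoef U n r p (wirtG (-I) (dirZ lam) (op2 (scrInv L) I I φ))
      (2 * Real.pi * I * pairing r lam * q) := by
    have h := (hφ.op2 hU (scrInv L) I I).hasCoef_wirt (n := n) (r := r) hU hp (0, lam)
    rwa [hchi, ← dirZ_eq_emb, fcoef_congr hp (hop I), fcoef_zero, sub_zero, ← hq] at h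
  have h4 : HasCoef U n r p (fun P => ∑ j, vNdC L P j *
      wirtG (-I) (dirZ lam) (wirtG I (dirZ (stdVec j)) φ) P)
      (2 * Real.pi * I * pairing r lam * (I / 2 * D1 (0, projNd L *ᵥ p.2))) := by
    have h := HasCoef.sum hp Finset.univ fun j => (hw (0, stdVec j)).vNdC_mul (L := L) j
    have h2 : ∑ j, ((projNd L *ᵥ p.2) j : ℂ) *
        (2 * Real.pi * I * pairing r lam * (I / 2 * D1 (0, stdVec j)))
        = 2 * Real.pi * I * pairing r lam * (I / 2 * D1 (0, projNd L *ᵥ p.2)) := by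
      rw [← sum_coord_apply D1]
      simp only [Finset.mul_sum]
      exact Finset.sum_congr rfl fun j _ => by ring
    rw [h2] at h
    simpa only [dirZ_eq_emb] using h
  have total := (((hw (1, 0)).im_mul.im_mul.const_mul 8).sub hp (hQ.im_mul.im_mul.const_mul 2)).add
    hp (h4.im_mul.const_mul 8)
  have h0 := total.eq_zero hp fun P hP => by
    have h1 := hcas P hP
    have h2 : wirtG (-I) dirTau (wirtG I (dirZ lam) φ) P = 0 := by
      rw [wirtG_congr (Filter.eventuallyEq_of_mem ((isOpen_preimage_imPart hU).mem_nhds hP) hlam),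
        wirtG_const]
    rw [casLin, opP_eq, opQ_eq, hlam P hP, h2, hop _ P hP] at h1
    rw [← h1, dirTau_eq_emb]
    ring
  have hy : (p.1 : ℂ) ≠ 0 := by exact_mod_cast hpos.ne'
  have hr' : (pairing r lam : ℂ) ≠ 0 := by exact_mod_cast hr
  have hpi : (Real.pi : ℂ) ≠ 0 := by exact_mod_cast Real.pi_ne_zero
  set S := ∑ i, ∑ j, (pinv L i j : ℂ) * D2 (0, stdVec i) (0, stdVec j) with hS
  rw [hq1] at h0
  have h5 : 2 * (Real.pi : ℂ) * I * pairing r lam * (4 * p.1) * (I * (p.1 * D1 (1, 0)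
      + D1 (0, projNd L *ᵥ p.2)) + p.1 * (8 * Real.pi * I)⁻¹ / 2 * S) = 0 := by
    rw [← h0]; field_simp; ring
  have h6 := (mul_eq_zero.mp h5).resolve_left (by simp [hpi, hr', hy])
  have h7 : (8 * (Real.pi : ℂ) * I)⁻¹ = -I * (8 * (Real.pi : ℂ))⁻¹ := by
    rw [mul_inv, Complex.inv_I]; ring
  rw [h7] at h6
  rw [div_eq_mul_inv (p.1 : ℂ)]
  linear_combination (-2 * I) * h6 + (2 * (p.1 * D1 (1, 0) + D1 (0, projNd L *ᵥ p.2))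
    - p.1 * (8 * (Real.pi : ℂ))⁻¹ * S) * Complex.I_mul_I

end ModeEquations

section Periodicity

variable {k : ℤ} {L : Matrix (Fin N) (Fin N) ℝ} {s : Finset ((Fin N → ℝ) × ℝ × ℝ)}
  {φ : JacobiSpace N → ℂ} {U : Set (ℝ × (Fin N → ℝ))}

theorem preimage_imPart_subset (hpos : ∀ p ∈ U, 0 < p.1)
    (hreg : AnalyticOnNhd ℝ φ (imPart ⁻¹' U)) : imPart ⁻¹' U ⊆ analyticDomain φ :=
  fun P hP => ⟨hpos _ hP, hreg P hP⟩

/-- Invariance under the translations in the Jacobi group. -/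
theorem IsCasimirForm.periodicOn (h : IsCasimirForm k L s φ) (hpos : ∀ p ∈ U, 0 < p.1)
    (hreg : AnalyticOnNhd ℝ φ (imPart ⁻¹' U)) : PeriodicOn U φ := by
  refine ⟨hreg, fun P hP m mu => ?_⟩
  set t : JacobiSpace N := emb ((m : ℝ), fun j => (mu j : ℝ)) with ht
  rw [← sub_eq_zero]
  have hPt : P + t ∈ imPart ⁻¹' U := by
    rw [Set.mem_preimage, add_comm, imPart_emb_add]; exact hP
  have hcont : ContinuousAt (fun Q => φ (Q + t) - φ Q) P :=
    (ContinuousAt.comp (f := fun Q => Q + t) (hreg _ hPt).continuousAt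
      (by fun_prop)).sub (hreg _ hP).continuousAt
  refine eq_zero_of_generic h.sing.nonzero (F := fun Q => φ (Q + t) - φ Q) (hpos _ hP) hcont
    fun α hα β τ hτ => ?_
  let γ : Matrix.SpecialLinearGroup (Fin 2) ℤ := ⟨!![1, m; 0, 1], by simp⟩
  have h1 := sectionPt_mem_regularPoints hα β hτ
  have hact : jacobiAct γ 0 mu (sectionPt α β τ) = sectionPt α β τ + t := by
    refine Prod.ext ?_ ?_
    · simp [jacobiAct, denomJ, γ, ht, emb, sectionPt]
    · ext j
      simp [jacobiAct, denomJ, γ, ht, emb, sectionPt, shiftZ]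
  have hact2 : sectionPt α β τ + t
      = sectionPt α (fun j => β j - m * α j + mu j) (τ + m) := by
    refine Prod.ext ?_ ?_
    · simp [ht, emb, sectionPt]
    · ext j
      simp [ht, emb, sectionPt]
      ring
  have h2 : jacobiAct γ 0 mu (sectionPt α β τ) ∈ regularPoints s := by
    rw [hact, hact2]
    exact sectionPt_mem_regularPoints hα _ (by simpa using hτ)
  have h3 := h.inv γ 0 mu _ h1 h2
  rw [slash, hact] at h3
  have h4 : denomJ γ (sectionPt α β τ).1 = 1 := by simp [denomJ, γ]
  rw [h4] at h3
  simp [γ, qfC] at h3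
  rw [h3, sub_self]

end Periodicity

/-! ### Directions in which the form is holomorphic. -/

section Frame

variable {m : ℕ} {k : ℤ} {L : Matrix (Fin N) (Fin N) ℝ} {s : Finset ((Fin N → ℝ) × ℝ × ℝ)}
  {φ : JacobiSpace N → ℂ} {E : Fin m → Fin N → ℝ} {W : Submodule ℝ (Fin N → ℝ)}

open Classical in
/-- The negative frame vectors that are `L`-orthogonal to `W`. -/
def starFrame (L : Matrix (Fin N) (Fin N) ℝ) (E : Fin m → Fin N → ℝ)
    (W : Submodule ℝ (Fin N → ℝ)) : Finset (Fin m) :=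
  Finset.univ.filter fun i => qf L (E i) < 0 ∧ ∀ w ∈ W, w ⬝ᵥ (L *ᵥ E i) = 0

theorem mem_starFrame {i : Fin m} :
    i ∈ starFrame L E W ↔ qf L (E i) < 0 ∧ ∀ w ∈ W, w ⬝ᵥ (L *ᵥ E i) = 0 := by
  simp [starFrame]

/-- The coordinate along a non-isotropic frame vector, by means of `L`. -/
def coordL (L : Matrix (Fin N) (Fin N) ℝ) (E : Fin m → Fin N → ℝ) (i : Fin m) :
    (ℝ × (Fin N → ℝ)) →L[ℝ] ℝ := (qf L (E i))⁻¹ • sndL (L *ᵥ E i)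

theorem coordL_apply (i : Fin m) (p : ℝ × (Fin N → ℝ)) :
    coordL L E i p = (p.2 ⬝ᵥ (L *ᵥ E i)) / qf L (E i) := by
  rw [coordL, smul_apply, sndL_apply, smul_eq_mul, dotProduct_comm]
  ring

theorem exists_frame_decomp (hE : LinearIndependent ℝ E)
    (hW : IsCompl (Submodule.span ℝ (Set.range E)) W) (x : Fin N → ℝ) :
    ∃ w ∈ W, x = ∑ j, frameCoord hE hW x j • E j + w := by
  have hx : (Submodule.projectionOnto _ W hW x : Fin N → ℝ) = ∑ j, frameCoord hE hW x j • E j := by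
    have h := hE.linearCombination_repr (Submodule.projectionOnto _ W hW x)
    rw [← h, Finsupp.linearCombination_apply, Finsupp.sum_fintype _ _ (fun i => zero_smul ℝ (E i))]
    rfl
  refine ⟨x - Submodule.projectionOnto _ W hW x, ?_, by rw [hx]; abel⟩
  rw [← Submodule.projectionOnto_apply_eq_zero_iff hW, map_sub,
    Submodule.projectionOnto_apply_left, sub_self]

/-- A vector of `starFrame` is `L`-orthogonal to `W` and to the other frame vectors, so pairing with
`L e` extracts its coordinate. -/
theorem coordL_eq_frameCoord (hE : LinearIndependent ℝ E)
    (hEL : ∀ i j, i ≠ j → E i ⬝ᵥ (L *ᵥ E j) = 0)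
    (hW : IsCompl (Submodule.span ℝ (Set.range E)) W) {i : Fin m} (hi : i ∈ starFrame L E W)
    (p : ℝ × (Fin N → ℝ)) : coordL L E i p = frameCoord hE hW p.2 i := by
  obtain ⟨w, hw, hx⟩ := exists_frame_decomp hE hW p.2
  rw [mem_starFrame] at hi
  rw [coordL_apply, div_eq_iff hi.1.ne]
  conv_lhs => rw [hx]
  rw [add_dotProduct, hi.2 w hw, add_zero, sum_dotProduct, Finset.sum_eq_single i]
  · rw [smul_dotProduct, smul_eq_mul, qf]
  · intro j _ hj
    rw [smul_dotProduct, hEL j i hj, smul_zero]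
  · simp

theorem coordL_frame (hEL : ∀ i j, i ≠ j → E i ⬝ᵥ (L *ᵥ E j) = 0) {i : Fin m}
    (hi : i ∈ starFrame L E W) (j : Fin m) (y : ℝ) :
    coordL L E i (y, E j) = if j = i then 1 else 0 := by
  rw [coordL_apply]
  split_ifs with h
  · rw [h]; exact div_self (mem_starFrame.mp hi).1.ne
  · simp only [hEL j i h, zero_div]

theorem frame_sub_coordL (hEL : ∀ i j, i ≠ j → E i ⬝ᵥ (L *ᵥ E j) = 0) {i : Fin m}
    (hi : i ∈ starFrame L E W) (x : Fin N → ℝ) : coordL L E i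
      (0, x - ∑ j ∈ starFrame L E W, coordL L E j (0, x) • E j) = 0 := by
  have h : ((0 : ℝ), x - ∑ j ∈ starFrame L E W, coordL L E j (0, x) • E j)
      = (0, x) - ∑ j ∈ starFrame L E W, coordL L E j (0, x) • ((0 : ℝ), E j) := by
    refine Prod.ext ?_ ?_
    · simp [Prod.fst_sum]
    · simp [Prod.snd_sum]
  rw [h, map_sub, map_sum, sub_eq_zero, Finset.sum_eq_single i]
  · rw [map_smul, coordL_frame hEL hi, if_pos rfl, smul_eq_mul, mul_one]
  · intro j _ hj
    rw [map_smul, coordL_frame hEL hi, if_neg hj, smul_zero]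
  · exact fun h => absurd hi h

/-- Antiholomorphic derivatives vanish in all directions that are `L`-orthogonal to the relevant
frame vectors. -/
theorem IsCasimirForm.dZBar_of_coord (h : IsCasimirForm k L s φ) (hE : LinearIndependent ℝ E)
    (hEL : ∀ i j, i ≠ j → E i ⬝ᵥ (L *ᵥ E j) = 0)
    (hW : IsCompl (Submodule.span ℝ (Set.range E)) W)
    (hH : ∀ P ∈ regularPoints s, (∀ i, heisLaplace L (E i) φ P = 0) ∧ ∀ w ∈ W, dZBar w φ P = 0)
    {x : Fin N → ℝ} (hx : ∀ i ∈ starFrame L E W, coordL L E i (0, x) = 0) :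
    ∀ P ∈ analyticDomain φ, wirtG I (dirZ x) φ P = 0 := by
  have hL := h.index.symm
  have hHeis : ∀ i, ∀ P ∈ analyticDomain φ, heisLaplace L (E i) φ P = 0 := fun i =>
    h.eq_zero (fun P hP => analyticAt_heisLaplace hP.2 hL _) fun P hP => (hH P hP).1 i
  have hWz : ∀ w ∈ W, ∀ P ∈ analyticDomain φ, wirtG I (dirZ w) φ P = 0 := fun w hw =>
    h.eq_zero (fun P hP => analyticAt_wirtG hP.2 _ _) fun P hP => (hH P hP).2 w hw
  -- Every frame vector outside `starFrame` is positive, or isotropic and `L`-orthogonal to `W`, or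
  -- fails to be `L`-orthogonal to `W`; each case has its own mechanism.
  have hEz : ∀ i ∉ starFrame L E W, ∀ P ∈ analyticDomain φ, wirtG I (dirZ (E i)) φ P = 0 := by
    intro i hi
    by_cases hWi : ∀ w ∈ W, w ⬝ᵥ (L *ᵥ E i) = 0
    · rcases lt_trichotomy (qf L (E i)) 0 with h1 | h1 | h1
      · exact absurd (mem_starFrame.mpr ⟨h1, hWi⟩) hi
      -- An isotropic vector that is `L`-orthogonal to `W` and to the other frame vectors is
      -- `L`-orthogonal to the whole space, hence lies in the radical.
      · refine h.dZBar_ker (dotProduct_eq_zero _ fun v => ?_)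
        obtain ⟨w, hw, hv⟩ := exists_frame_decomp hE hW v
        rw [dotProduct_comm, hv, add_dotProduct, hWi w hw, add_zero, sum_dotProduct]
        refine Finset.sum_eq_zero fun j _ => ?_
        rw [smul_dotProduct]
        by_cases hj : j = i
        · subst hj; rw [← qf, h1, smul_zero]
        · rw [hEL j i hj, smul_zero]
      · exact h.dZBar_pos (fun P hP => (hH P hP).1 i) h1
    · push Not at hWi
      obtain ⟨w, hw, hwi⟩ := hWi
      exact dZBar_eq_zero_of_transverse hL (hHeis i) (hWz w hw) hwi
  intro P hP
  obtain ⟨w, hw, hx'⟩ := exists_frame_decomp hE hW x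
  rw [hx', dirZ_add, wirtG_dir_add, hWz w hw P hP, add_zero, dirZ_sum, wirtG_dir_sum]
  refine Finset.sum_eq_zero fun j _ => ?_
  rw [dirZ_smul, wirtG_dir_smul]
  by_cases hj : j ∈ starFrame L E W
  · have h1 := coordL_eq_frameCoord hE hEL hW hj (0, x)
    rw [hx j hj] at h1
    rw [← h1]; simp
  · rw [hEz j hj P hP, mul_zero]

end Frame

/-! ### The ordinary differential equation along the radial vector field. -/

section RadialField

variable {m : ℕ} {k : ℤ} {L : Matrix (Fin N) (Fin N) ℝ} {s : Finset ((Fin N → ℝ) × ℝ × ℝ)}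
  {φ : JacobiSpace N → ℂ} {E : Fin m → Fin N → ℝ} {W : Submodule ℝ (Fin N → ℝ)}
  {U : Set (ℝ × (Fin N → ℝ))} {n : ℤ} {r : Fin N → ℤ} {p : ℝ × (Fin N → ℝ)}

/-- The linear vector field along which Fourier coefficients satisfy an ordinary differential
equation. -/
def radialField (L : Matrix (Fin N) (Fin N) ℝ) (E : Fin m → Fin N → ℝ)
    (W : Submodule ℝ (Fin N → ℝ)) (r : Fin N → ℤ) :
    (ℝ × (Fin N → ℝ)) →L[ℝ] ℝ × (Fin N → ℝ) :=
  (2 • fstL).smulRight ((1 : ℝ), (0 : Fin N → ℝ))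
    + ∑ i ∈ starFrame L E W, (coordL L E i - (pairing r (E i) / (2 * qf L (E i))) • fstL).smulRight
      ((0 : ℝ), E i)

/-- The shift by `r_e y / (2 L_e)` is the one for which the argument `heisArg` of the Gauss integral
is constant along the field; see `fderiv_heisArg`. -/
theorem radialField_apply (p : ℝ × (Fin N → ℝ)) : radialField L E W r p
    = (2 * p.1) • ((1 : ℝ), (0 : Fin N → ℝ)) + ∑ i ∈ starFrame L E W,
      (coordL L E i p - pairing r (E i) / (2 * qf L (E i)) * p.1) • ((0 : ℝ), E i) := by
  simp [radialField, sum_apply]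

theorem coordL_smul_one (i : Fin m) (c : ℝ) :
    coordL L E i (c • ((1 : ℝ), (0 : Fin N → ℝ))) = 0 := by
  rw [coordL_apply]; simp

theorem coordL_radialField (hEL : ∀ i j, i ≠ j → E i ⬝ᵥ (L *ᵥ E j) = 0) {i : Fin m}
    (hi : i ∈ starFrame L E W) (p : ℝ × (Fin N → ℝ)) : coordL L E i (radialField L E W r p)
      = coordL L E i p - pairing r (E i) / (2 * qf L (E i)) * p.1 := by
  rw [radialField_apply, map_add, coordL_smul_one, zero_add, map_sum, Finset.sum_eq_single i]
  · rw [map_smul, coordL_frame hEL hi, if_pos rfl, smul_eq_mul, mul_one]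
  · intro j _ hj
    rw [map_smul, coordL_frame hEL hi, if_neg hj, smul_zero]
  · exact fun h => absurd hi h

theorem radialField_fst (p : ℝ × (Fin N → ℝ)) : (radialField L E W r p).1 = 2 * p.1 := by
  rw [radialField_apply]; simp [Prod.fst_sum]

theorem radialField_radialField (hEL : ∀ i j, i ≠ j → E i ⬝ᵥ (L *ᵥ E j) = 0)
    (p : ℝ × (Fin N → ℝ)) : radialField L E W r (radialField L E W r p)
      = (4 * p.1) • ((1 : ℝ), (0 : Fin N → ℝ)) + ∑ i ∈ starFrame L E W,
      (coordL L E i p - 3 * (pairing r (E i) / (2 * qf L (E i))) * p.1) • ((0 : ℝ), E i) := by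
  rw [radialField_apply (radialField L E W r p), radialField_fst]
  congr 1
  · congr 1; ring
  · refine Finset.sum_congr rfl fun i hi => ?_
    rw [coordL_radialField hEL hi]
    congr 1; ring

theorem coordL_projNd (hL : L.IsSymm) (i : Fin m) (y : ℝ) (v : Fin N → ℝ) :
    coordL L E i (y, projNd L *ᵥ v) = coordL L E i (y, v) := by
  have h : ∀ u : Fin N → ℝ, u ⬝ᵥ (L *ᵥ E i) = E i ⬝ᵥ (L *ᵥ u) := by
    intro u
    rw [Matrix.dotProduct_mulVec, ← Matrix.mulVec_transpose, hL, dotProduct_comm]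
  rw [coordL_apply, coordL_apply, h, h, mulVec_projNd_mulVec]

/-- A linear functional that vanishes on vectors without frame coordinates. -/
theorem apply_eq_sum_coordL (hEL : ∀ i j, i ≠ j → E i ⬝ᵥ (L *ᵥ E j) = 0)
    (T : (ℝ × (Fin N → ℝ)) →L[ℝ] ℂ)
    (hT : ∀ x, (∀ i ∈ starFrame L E W, coordL L E i (0, x) = 0) → T (0, x) = 0) (x : Fin N → ℝ) :
    T (0, x) = ∑ i ∈ starFrame L E W, (coordL L E i (0, x) : ℂ) * T (0, E i) := by
  have h := hT _ fun i hi => frame_sub_coordL hEL hi x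
  have h2 : ((0 : ℝ), x - ∑ j ∈ starFrame L E W, coordL L E j (0, x) • E j)
      = (0, x) - ∑ j ∈ starFrame L E W, coordL L E j (0, x) • ((0 : ℝ), E j) := by
    refine Prod.ext ?_ ?_
    · simp [Prod.fst_sum]
    · simp [Prod.snd_sum]
  rw [h2, map_sub, map_sum, sub_eq_zero] at h
  rw [h]
  exact Finset.sum_congr rfl fun i _ => by rw [map_smul, Complex.real_smul]

/-- The trace of a bilinear form against `L_nd⁻¹`, in terms of the frame. -/
theorem sum_pinv_eq (hL : L.IsSymm) (hEL : ∀ i j, i ≠ j → E i ⬝ᵥ (L *ᵥ E j) = 0)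
    (D2 : (ℝ × (Fin N → ℝ)) →L[ℝ] (ℝ × (Fin N → ℝ)) →L[ℝ] ℂ) (hsymm : ∀ a b, D2 a b = D2 b a)
    (hT : ∀ d x, (∀ i ∈ starFrame L E W, coordL L E i (0, x) = 0) → D2 d (0, x) = 0) :
    ∑ i, ∑ j, (pinv L i j : ℂ) * D2 (0, stdVec i) (0, stdVec j)
      = ∑ i ∈ starFrame L E W, ((qf L (E i))⁻¹ : ℂ) * D2 (0, E i) (0, E i) := by
  have h1 : ∀ i, ∑ j, (pinv L i j : ℂ) * D2 (0, stdVec i) (0, stdVec j)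
      = ∑ l ∈ starFrame L E W, (coordL L E l (0, stdVec i) : ℂ) *
        ∑ j, (pinv L i j : ℂ) * D2 (0, E l) (0, stdVec j) := by
    intro i
    simp only [Finset.mul_sum]
    rw [Finset.sum_comm]
    refine Finset.sum_congr rfl fun j _ => ?_
    rw [hsymm, apply_eq_sum_coordL hEL (D2 (0, stdVec j)) (hT _), Finset.mul_sum]
    refine Finset.sum_congr rfl fun l _ => ?_
    rw [hsymm (0, stdVec j)]; ring
  simp only [h1]
  rw [Finset.sum_comm]
  refine Finset.sum_congr rfl fun l hl => ?_
  have hl0 : qf L (E l) ≠ 0 := (mem_starFrame.mp hl).1.ne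
  have h2 : ∑ i, (coordL L E l (0, stdVec i) : ℂ) *
        ∑ j, (pinv L i j : ℂ) * D2 (0, E l) (0, stdVec j)
      = ∑ j, (((qf L (E l))⁻¹ * (projNd L *ᵥ E l) j : ℝ) : ℂ) * D2 (0, E l) (0, stdVec j) := by
    simp only [Finset.mul_sum]
    rw [Finset.sum_comm]
    refine Finset.sum_congr rfl fun j _ => ?_
    have h3 : (qf L (E l))⁻¹ * (projNd L *ᵥ E l) j
        = ∑ i, coordL L E l (0, stdVec i) * pinv L i j := by
      rw [← pinv_mul hL, ← Matrix.mulVec_mulVec, Matrix.mulVec, dotProduct, Finset.mul_sum]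
      refine Finset.sum_congr rfl fun i _ => ?_
      rw [coordL_apply, stdVec, single_dotProduct, pinv_comm hL]
      ring
    rw [h3]
    push_cast
    rw [Finset.sum_mul]
    exact Finset.sum_congr rfl fun i _ => by ring
  rw [h2, sum_coord_apply (D2 (0, E l)) fun j => (qf L (E l))⁻¹ * (projNd L *ᵥ E l) j]
  have h4 : ((0 : ℝ), fun j => (qf L (E l))⁻¹ * (projNd L *ᵥ E l) j)
      = (qf L (E l))⁻¹ • (0, E l) - (qf L (E l))⁻¹ • ((0 : ℝ), E l - projNd L *ᵥ E l) := by
    refine Prod.ext (by simp) ?_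
    ext j; simp; ring
  rw [h4, map_sub, map_smul, map_smul, hT _ (E l - projNd L *ᵥ E l), smul_zero, sub_zero,
    Complex.real_smul]
  · push_cast; rfl
  · intro i _
    have h5 : ((0 : ℝ), E l - projNd L *ᵥ E l) = (0, E l) - (0, projNd L *ᵥ E l) := by simp
    rw [h5, map_sub, coordL_projNd hL, sub_self]

/-- Second derivatives along a linear vector field. -/
theorem fderiv_linear_field {f : ℝ × (Fin N → ℝ) → ℂ} (hf : ContDiffAt ℝ 2 f p)
    (Y : (ℝ × (Fin N → ℝ)) →L[ℝ] ℝ × (Fin N → ℝ)) (d : ℝ × (Fin N → ℝ)) :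
    fderiv ℝ (fun q => fderiv ℝ f q (Y q)) p d
      = fderiv ℝ (fderiv ℝ f) p d (Y p) + fderiv ℝ f p (Y d) := by
  have hd : DifferentiableAt ℝ (fderiv ℝ f) p :=
    (hf.fderiv_right (m := 1) le_rfl).differentiableAt one_ne_zero
  rw [fderiv_clm_apply hd Y.differentiableAt]
  simp [add_comm]

theorem analyticAt_casD {F : JacobiSpace N → ℂ} {P : JacobiSpace N} (hF : AnalyticAt ℝ F P)
    (δ : JacobiSpace N) : AnalyticAt ℝ (casD k L δ F) P := by
  have hw := fun {G : JacobiSpace N → ℂ} (hG : AnalyticAt ℝ G P) a d => analyticAt_wirtG hG a d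
  have ho := fun {G : JacobiSpace N → ℂ} (hG : AnalyticAt ℝ G P) a b =>
    analyticAt_op2 hG (scrInv L) a b
  have hv := fun j => analyticAt_vNdC L j P
  have hy := analyticAt_im P
  have hc := fun c : ℂ => analyticAt_const (𝕜 := ℝ) (v := c) (x := P)
  unfold casD
  simp only [opP_eq, opQ_eq, opR_eq, dZBar_eq]
  refine AnalyticAt.fun_add (AnalyticAt.fun_add (AnalyticAt.fun_sub (AnalyticAt.fun_add
    (AnalyticAt.fun_sub (AnalyticAt.fun_sub (AnalyticAt.fun_add ?_ ?_) ?_) ?_) ?_) ?_) ?_) ?_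
  · exact (hc _).fun_mul ((((hc _).fun_mul (hy.fun_pow 2)).fun_mul (hw (hw hF _ _) _ _)).fun_sub
      (((hc _).fun_mul hy).fun_mul (hw hF _ _)))
  · exact ((hc _).fun_mul (hy.fun_pow 2)).fun_mul ((hw (ho hF _ _) _ _).fun_add (hw (ho hF _ _) _ _))
  · exact ((hc _).fun_mul hy).fun_mul (Finset.analyticAt_fun_sum _ fun j _ =>
      (hv j).fun_mul (hw (hw hF _ _) _ _))
  · exact ((hc _).fun_mul (hy.fun_pow 2)).fun_mul ((ho (ho hF _ _) _ _).fun_sub (ho (ho hF _ _) _ _))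
  · exact ((hc _).fun_mul hy).fun_mul (Finset.analyticAt_fun_sum _ fun j _ =>
      (hv j).fun_mul (hw (analyticAt_opZU hF L) _ _))
  · exact ((hc _).fun_mul hy).fun_mul (analyticAt_opZBarU hF L)
  · exact (hc _).fun_mul (Finset.analyticAt_fun_sum _ fun i _ => Finset.analyticAt_fun_sum _ fun j _ =>
      ((hv i).fun_mul (hv j)).fun_mul (hw (hw hF _ _) _ _))
  · exact (hc _).fun_mul (Finset.analyticAt_fun_sum _ fun j _ => (hv j).fun_mul (hw hF _ _))

/-- The ordinary differential equation along the radial vector field. -/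
theorem IsCasimirForm.radial_mode (h : IsCasimirForm k L s φ)
    (hE : LinearIndependent ℝ E) (hEL : ∀ i j, i ≠ j → E i ⬝ᵥ (L *ᵥ E j) = 0)
    (hW : IsCompl (Submodule.span ℝ (Set.range E)) W)
    (hH : ∀ P ∈ regularPoints s, (∀ i, heisLaplace L (E i) φ P = 0) ∧ ∀ w ∈ W, dZBar w φ P = 0)
    (hU : IsOpen U) (hpos : ∀ p ∈ U, 0 < p.1) (hreg : AnalyticOnNhd ℝ φ (imPart ⁻¹' U))
    (hp : p ∈ U) :
    fderiv ℝ (fun q => fderiv ℝ (fcoef n r φ) q (radialField L E W r q)) p (radialField L E W r p)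
      = (2 * (1 - kappa k N) + 2 * Real.pi * normDisc L n r * p.1)
        * fderiv ℝ (fcoef n r φ) p (radialField L E W r p) := by
  have hL := h.index.symm
  have hsub := preimage_imPart_subset hpos hreg
  have hφ := h.periodicOn hpos hreg
  have hker : ∀ x, (∀ i ∈ starFrame L E W, coordL L E i (0, x) = 0) →
      ∀ P ∈ imPart ⁻¹' U, wirtG I (dirZ x) φ P = 0 := fun x hx P hP =>
    h.dZBar_of_coord hE hEL hW hH hx P (hsub hP)
  have hHeis : ∀ i, ∀ P ∈ imPart ⁻¹' U, heisLaplace L (E i) φ P = 0 := fun i P hP =>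
    h.eq_zero (fun P hP => analyticAt_heisLaplace hP.2 hL _) (fun P hP => (hH P hP).1 i) P (hsub hP)
  set f := fcoef n r φ with hf
  set Y := radialField L E W r with hY
  -- the trace term
  have hXi : ∀ p ∈ U, 2 * p.1 * fderiv ℝ f p (1, 0) + 2 * fderiv ℝ f p (0, projNd L *ᵥ p.2)
      - p.1 / (8 * Real.pi) * ∑ i, ∑ j, (pinv L i j : ℂ) *
        fderiv ℝ (fderiv ℝ f) p (0, stdVec i) (0, stdVec j) = fderiv ℝ f p (Y p) := by
    intro p hp
    have hsymm : ∀ a b, fderiv ℝ (fderiv ℝ f) p a b = fderiv ℝ (fderiv ℝ f) p b a := fun a b =>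
      fderiv_fderiv_symm (contDiffAt_fcoef hU hφ hp) b a
    rw [sum_pinv_eq hL hEL _ hsymm fun d x hx => fderiv_fderiv_fcoef_eq_zero hU hφ hp (hker x hx) d,
      apply_eq_sum_coordL (E := E) (L := L) (W := W) hEL (fderiv ℝ f p)
        (fun x hx => fderiv_fcoef_eq_zero hU hφ hp (hker x hx)),
      hY, radialField_apply, map_add, map_sum, map_smul, Complex.real_smul]
    have hpi : (Real.pi : ℂ) ≠ 0 := by exact_mod_cast Real.pi_ne_zero
    have hsum : 2 * ∑ i ∈ starFrame L E W, (coordL L E i (0, projNd L *ᵥ p.2) : ℂ) *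
          fderiv ℝ f p (0, E i) - p.1 / (8 * Real.pi) * ∑ i ∈ starFrame L E W,
          ((qf L (E i))⁻¹ : ℂ) * fderiv ℝ (fderiv ℝ f) p (0, E i) (0, E i)
        = ∑ i ∈ starFrame L E W, fderiv ℝ f p ((coordL L E i p
          - pairing r (E i) / (2 * qf L (E i)) * p.1) • ((0 : ℝ), E i)) := by
      rw [Finset.mul_sum, Finset.mul_sum, ← Finset.sum_sub_distrib]
      refine Finset.sum_congr rfl fun i hi => ?_
      have hi0 : (qf L (E i) : ℂ) ≠ 0 := by exact_mod_cast (mem_starFrame.mp hi).1.ne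
      -- The Heisenberg equation converts the second derivative along `e` into a first order term.
      -- This changes the factor of `v_e` from `2` to `1` and produces the shift by `r_e y / (2
      -- L_e)`.
      have h1 := heis_mode (n := n) (r := r) hU hφ hp hL (hHeis i)
      have h2 : ((E i ⬝ᵥ (L *ᵥ p.2) : ℝ) : ℂ) = qf L (E i) * coordL L E i p := by
        rw [coordL_apply, Matrix.dotProduct_mulVec, ← Matrix.mulVec_transpose, hL, dotProduct_comm]
        push_cast
        field_simp
      rw [h2] at h1
      have h3 : coordL L E i (0, projNd L *ᵥ p.2) = coordL L E i p := by
        rw [coordL_projNd hL, coordL_apply, coordL_apply]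
      rw [h3, map_smul, Complex.real_smul]
      push_cast
      have h4 : (p.1 : ℂ) / (8 * Real.pi) * ((qf L (E i) : ℂ)⁻¹ *
          fderiv ℝ (fderiv ℝ f) p (0, E i) (0, E i))
          = 1 / (8 * Real.pi) * (qf L (E i) : ℂ)⁻¹ * (p.1 * fderiv ℝ (fderiv ℝ f) p (0, E i) (0, E i)) := by
        ring
      rw [h4, h1]
      field_simp
      ring
    push_cast
    linear_combination hsum
  have hc2 := contDiffAt_fcoef (n := n) (r := r) hU hφ hp
  -- If `r` annihilates the radical, the pairing of `r` with a frame vector only involves `π_nd` of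
  -- that vector, and the Casimir equation suffices. Otherwise a radical vector with `r_lam ≠ 0`
  -- gives a first order equation.
  by_cases hr : ∀ lam, L *ᵥ lam = 0 → pairing r lam = 0
  · have hsymm : ∀ a b, fderiv ℝ (fderiv ℝ f) p a b = fderiv ℝ (fderiv ℝ f) p b a := fun a b =>
      fderiv_fderiv_symm hc2 b a
    have hw : ∀ i ∈ starFrame L E W, coordL L E i (0, pinvVec L r) = pairing r (E i) / qf L (E i) := by
      intro i _
      rw [coordL_apply, pinvVec, dotProduct_comm, Matrix.dotProduct_mulVec, ← Matrix.mulVec_transpose,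
        pinv_isSymm hL, Matrix.mulVec_mulVec, pinv_mul hL]
      congr 1
      have h1 := hr _ (mulVec_sub_projNd L (E i))
      simp only [pairing, Pi.sub_apply, mul_sub, Finset.sum_sub_distrib] at h1
      rw [pairing, sub_eq_zero.mp h1, dotProduct]
      exact Finset.sum_congr rfl fun j _ => mul_comm _ _
    have hcas := casimir_mode (n := n) (r := r) hU hφ hp hL (fun P hP => by
      have hP' := hsub hP
      refine h.eq_zero (F := casimir k L φ) (fun Q hQ => ?_) h.cas P hP'
      rw [casimir_eq_casD]
      exact analyticAt_casD hQ.2 _) (fderiv ℝ f p)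
      (fderiv ℝ (fderiv ℝ f) p) rfl rfl _ _ _ rfl rfl rfl
    set θ := (2 * p.1) • ((1 : ℝ), (0 : Fin N → ℝ)) + (0, projNd L *ᵥ p.2)
      - (p.1 / 2) • (0, pinvVec L r) with hθ
    have hD1 := apply_eq_sum_coordL (E := E) (L := L) (W := W) hEL (fderiv ℝ f p)
        (fun x hx => fderiv_fcoef_eq_zero hU hφ hp (hker x hx))
    -- The vector `θ` of the Casimir equation and the radial field have the same `y` component and
    -- the same essential coordinates. They differ by a direction along which the coefficient is
    -- constant.
    have hdiff : ∃ x, (∀ i ∈ starFrame L E W, coordL L E i (0, x) = 0) ∧ θ = Y p + (0, x) := by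
      refine ⟨(θ - Y p).2, fun i hi => ?_, ?_⟩
      · have h1 : ((0 : ℝ), (θ - Y p).2) = θ - Y p := by
          refine Prod.ext ?_ rfl
          simp [hθ, hY, radialField_fst]
        rw [h1, map_sub, hY, coordL_radialField hEL hi, hθ, map_sub, map_add, coordL_smul_one,
          map_smul, hw i hi, coordL_projNd hL, coordL_apply, coordL_apply, smul_eq_mul]
        ring
      · refine Prod.ext ?_ ?_
        · simp [hθ, hY, radialField_fst]
        · simp
    obtain ⟨x, hx, hθx⟩ := hdiff
    have h1 : fderiv ℝ f p θ = fderiv ℝ f p (Y p) := by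
      rw [hθx, map_add, fderiv_fcoef_eq_zero hU hφ hp (hker x hx), add_zero]
    have h2 : fderiv ℝ (fderiv ℝ f) p θ θ = fderiv ℝ (fderiv ℝ f) p (Y p) (Y p) := by
      have h3 : ∀ d, fderiv ℝ (fderiv ℝ f) p d θ = fderiv ℝ (fderiv ℝ f) p d (Y p) := by
        intro d
        rw [hθx, map_add, fderiv_fderiv_fcoef_eq_zero hU hφ hp (hker x hx), add_zero]
      rw [h3, hsymm, h3]
    -- Iterating a linear field gives the second derivative plus the derivative along `Y (Y p)`. The
    -- latter absorbs the terms along `π_nd v` and `L_nd⁻¹ r` that remain in the Casimir equation.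
    have hYY : fderiv ℝ f p (Y (Y p)) = 2 * fderiv ℝ f p (Y p)
        - fderiv ℝ f p (0, projNd L *ᵥ p.2) - 1 / 2 * p.1 * fderiv ℝ f p (0, pinvVec L r) := by
      rw [hD1 (projNd L *ᵥ p.2), hD1 (pinvVec L r), hY, radialField_radialField hEL,
        radialField_apply]
      simp only [map_add, map_sum, map_smul, Complex.real_smul]
      have hs : ∑ i ∈ starFrame L E W, (((coordL L E i p
            - 3 * (pairing r (E i) / (2 * qf L (E i))) * p.1 : ℝ) : ℂ) * fderiv ℝ f p (0, E i))
          = 2 * ∑ i ∈ starFrame L E W, ((coordL L E i p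
            - pairing r (E i) / (2 * qf L (E i)) * p.1 : ℝ) : ℂ) * fderiv ℝ f p (0, E i)
          - ∑ i ∈ starFrame L E W, (coordL L E i (0, projNd L *ᵥ p.2) : ℂ) * fderiv ℝ f p (0, E i)
          - 1 / 2 * p.1 * ∑ i ∈ starFrame L E W, (coordL L E i (0, pinvVec L r) : ℂ) *
            fderiv ℝ f p (0, E i) := by
        rw [Finset.mul_sum, Finset.mul_sum, ← Finset.sum_sub_distrib, ← Finset.sum_sub_distrib]
        refine Finset.sum_congr rfl fun i hi => ?_
        have h3 : coordL L E i (0, projNd L *ᵥ p.2) = coordL L E i p := by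
          rw [coordL_projNd hL, coordL_apply, coordL_apply]
        have hi0 : (qf L (E i) : ℂ) ≠ 0 := by exact_mod_cast (mem_starFrame.mp hi).1.ne
        rw [h3, hw i hi]
        push_cast
        field_simp
        ring
      push_cast at hs ⊢
      linear_combination hs
    have hX := hXi p hp
    rw [fderiv_linear_field hc2, hYY]
    rw [h1, h2] at hcas
    have hpi : (Real.pi : ℂ) ≠ 0 := by exact_mod_cast Real.pi_ne_zero
    have h8 : (Real.pi : ℂ) * (p.1 / (8 * Real.pi)) = p.1 / 8 := by field_simp
    set S := ∑ i, ∑ j, (pinv L i j : ℂ) * fderiv ℝ (fderiv ℝ f) p (0, stdVec i) (0, stdVec j)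
    linear_combination (-2) * hcas + (2 * Real.pi * normDisc L n r * p.1) * hX
      + 2 * normDisc L n r * p.1 * S * h8
  · push Not at hr
    obtain ⟨lam, hlam, hr⟩ := hr
    -- Here already the first derivative along the field vanishes, by the linear part of the
    -- translated Casimir operator.
    have hz : ∀ q ∈ U, fderiv ℝ f q (Y q) = 0 := by
      intro q hq
      rw [← hXi q hq]
      exact casLin_mode hU hφ hq (hpos q hq)
        (fun P hP => h.dZBar_ker hlam P (hsub hP)) hr
        (fun P hP => h.casLin_eq_zero hlam P (hsub hP)) _ _ rfl rfl
    have hev : (fun q => fderiv ℝ f q (Y q)) =ᶠ[𝓝 p] fun _ => 0 :=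
      Filter.eventuallyEq_of_mem (hU.mem_nhds hp) hz
    rw [hev.fderiv_eq, hz p hp]
    simp

end RadialField

/-! ### Functions annihilated by squares of commuting derivations. -/

section Splitting

variable {V : Type*} [NormedAddCommGroup V] [NormedSpace ℝ V] {U : Set V}

/-- The derivative of a function along a vector field, divided by a function. -/
def lieDiv (X : V → V) (h f : V → ℂ) (p : V) : ℂ := fderiv ℝ f p (X p) / h p

variable {X Y : V → V} {h k f g : V → ℂ} {p : V}

theorem lieDiv_congr (hU : IsOpen U) (hfg : ∀ p ∈ U, f p = g p) : ∀ p ∈ U,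
    lieDiv X h f p = lieDiv X h g p := fun p hp => by
  rw [lieDiv, lieDiv, (Filter.eventuallyEq_of_mem (hU.mem_nhds hp) hfg).fderiv_eq]

theorem lieDiv_zero (hU : IsOpen U) (hf : ∀ p ∈ U, f p = 0) : ∀ p ∈ U, lieDiv X h f p = 0 :=
  fun p hp => by
    rw [lieDiv_congr (g := fun _ => 0) hU hf p hp, lieDiv]
    simp

theorem contDiffOn_lieDiv (hU : IsOpen U) (hf : ContDiffOn ℝ ∞ f U) (hX : ContDiffOn ℝ ∞ X U)
    (hh : ContDiffOn ℝ ∞ h U) (h0 : ∀ p ∈ U, h p ≠ 0) : ContDiffOn ℝ ∞ (lieDiv X h f) U :=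
  (((hf.fderiv_of_isOpen hU (by simp)).clm_apply hX).mul (hh.inv h0)).congr fun _ _ =>
    div_eq_mul_inv _ _

theorem ContDiffOn.contDiffAt_two (hU : IsOpen U) (hf : ContDiffOn ℝ ∞ f U) (hp : p ∈ U) :
    ContDiffAt ℝ 2 f p := by
  have h := (contDiffOn_infty.mp hf 2).contDiffAt (hU.mem_nhds hp)
  exact_mod_cast h

theorem ContDiffOn.differentiableAt_of_isOpen (hU : IsOpen U) (hf : ContDiffOn ℝ ∞ f U)
    (hp : p ∈ U) : DifferentiableAt ℝ f p :=
  (hf.contDiffAt (hU.mem_nhds hp)).differentiableAt (by simp)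

theorem lieDiv_sub_mul {H : V → ℂ} (hf : DifferentiableAt ℝ f p) (hH : DifferentiableAt ℝ H p)
    (hg : DifferentiableAt ℝ g p) : lieDiv X h (fun q => f q - H q * g q) p
      = lieDiv X h f p - (lieDiv X h H p * g p + H p * lieDiv X h g p) := by
  simp only [lieDiv]
  rw [fderiv_fun_sub hf (hH.fun_mul hg), fderiv_fun_mul hH hg]
  simp only [sub_apply, add_apply, smul_apply, smul_eq_mul]
  ring

theorem fderiv_apply_field {X : V → V} (hf : ContDiffAt ℝ 2 f p) (hX : DifferentiableAt ℝ X p)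
    (d : V) : fderiv ℝ (fun q => fderiv ℝ f q (X q)) p d
      = fderiv ℝ (fderiv ℝ f) p d (X p) + fderiv ℝ f p (fderiv ℝ X p d) := by
  have hd : DifferentiableAt ℝ (fderiv ℝ f) p :=
    (hf.fderiv_right (m := 1) le_rfl).differentiableAt one_ne_zero
  rw [fderiv_clm_apply hd hX]
  simp [add_comm]

theorem fderiv_div_apply {a b : V → ℂ} (ha : DifferentiableAt ℝ a p) (hb : DifferentiableAt ℝ b p)
    (h0 : b p ≠ 0) (d : V) : fderiv ℝ (fun q => a q / b q) p d
      = (fderiv ℝ a p d * b p - a p * fderiv ℝ b p d) / b p ^ 2 := by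
  have h1 : (fun q => a q) =ᶠ[𝓝 p] fun q => a q / b q * b q := by
    filter_upwards [hb.continuousAt.eventually_ne h0] with q hq
    rw [div_mul_cancel₀ _ hq]
  have h2 := congrArg (fun T : V →L[ℝ] ℂ => T d) h1.fderiv_eq
  have hab : DifferentiableAt ℝ (fun q => a q / b q) p := by
    simp only [div_eq_mul_inv]
    exact ha.fun_mul (hb.inv h0)
  rw [fderiv_fun_mul hab hb] at h2
  simp only [add_apply, smul_apply, smul_eq_mul] at h2
  rw [eq_div_iff (pow_ne_zero 2 h0)]
  rw [show fderiv ℝ a p d = _ from h2]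
  field_simp
  ring

theorem lieDiv_lieDiv (hf : ContDiffAt ℝ 2 f p) (hY : DifferentiableAt ℝ Y p)
    (hk : DifferentiableAt ℝ k p) (h0 : k p ≠ 0) : lieDiv X h (lieDiv Y k f) p
      = ((fderiv ℝ (fderiv ℝ f) p (X p) (Y p) + fderiv ℝ f p (fderiv ℝ Y p (X p))) * k p
        - fderiv ℝ f p (Y p) * fderiv ℝ k p (X p)) / (k p ^ 2 * h p) := by
  have hd : DifferentiableAt ℝ (fderiv ℝ f) p :=
    (hf.fderiv_right (m := 1) le_rfl).differentiableAt one_ne_zero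
  rw [lieDiv]
  change fderiv ℝ (fun q => fderiv ℝ f q (Y q) / k q) p (X p) / h p = _
  rw [fderiv_div_apply (hd.clm_apply hY) hk h0, fderiv_apply_field hf hY, div_div]

/-- The vector fields commute and each denominator is constant along the other field, so only the
symmetry of second derivatives remains. -/
theorem lieDiv_comm (hf : ContDiffAt ℝ 2 f p) (hX : DifferentiableAt ℝ X p)
    (hY : DifferentiableAt ℝ Y p) (hh : DifferentiableAt ℝ h p) (hk : DifferentiableAt ℝ k p)
    (h0 : h p ≠ 0) (k0 : k p ≠ 0) (hXY : fderiv ℝ Y p (X p) = fderiv ℝ X p (Y p))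
    (hXk : fderiv ℝ k p (X p) = 0) (hYh : fderiv ℝ h p (Y p) = 0) :
    lieDiv X h (lieDiv Y k f) p = lieDiv Y k (lieDiv X h f) p := by
  rw [lieDiv_lieDiv hf hY hk k0, lieDiv_lieDiv hf hX hh h0, hXY, hXk, hYh,
    (hf.isSymmSndFDerivAt (by simp)) (X p) (Y p)]
  field_simp
  ring

/-- The hypothesis says that `Y f` and `k` have the same logarithmic derivative along `Y`, so their
quotient is constant along `Y`. -/
theorem lieDiv_lieDiv_self (hf : ContDiffAt ℝ 2 f p) (hY : DifferentiableAt ℝ Y p)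
    (hk : DifferentiableAt ℝ k p) (h0 : k p ≠ 0)
    (hode : fderiv ℝ (fun q => fderiv ℝ f q (Y q)) p (Y p) * k p
      = fderiv ℝ f p (Y p) * fderiv ℝ k p (Y p)) : lieDiv Y k (lieDiv Y k f) p = 0 := by
  rw [fderiv_apply_field hf hY] at hode
  rw [lieDiv_lieDiv hf hY hk h0, hode, sub_self, zero_div]

/-- A function that is annihilated by squares of commuting derivations is a polynomial of degree
at most one in each of the corresponding coordinates. -/
theorem exists_multilinear {ι : Type*} [DecidableEq ι] (hU : IsOpen U) (hUc : IsPreconnected U)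
    {X : ι → V → V} {h H : ι → V → ℂ} (hX : ∀ i, ContDiffOn ℝ ∞ (X i) U)
    (hh : ∀ i, ContDiffOn ℝ ∞ (h i) U) (h0 : ∀ i, ∀ p ∈ U, h i p ≠ 0)
    (hbr : ∀ i j, ∀ p ∈ U, fderiv ℝ (X j) p (X i p) = fderiv ℝ (X i) p (X j p))
    (hXh : ∀ i j, i ≠ j → ∀ p ∈ U, fderiv ℝ (h j) p (X i p) = 0)
    (hspan : ∀ p ∈ U, ∀ T : V →L[ℝ] ℂ, (∀ i, T (X i p) = 0) → T = 0) (T : Finset ι)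
    (hH : ∀ i ∈ T, ContDiffOn ℝ ∞ (H i) U)
    (hXH : ∀ i ∈ T, ∀ j, ∀ p ∈ U, lieDiv (X j) (h j) (H i) p = if j = i then 1 else 0)
    {c : V → ℂ} (hc : ContDiffOn ℝ ∞ c U)
    (hc2 : ∀ i ∈ T, ∀ p ∈ U, lieDiv (X i) (h i) (lieDiv (X i) (h i) c) p = 0)
    (hc1 : ∀ i ∉ T, ∀ p ∈ U, lieDiv (X i) (h i) c p = 0) :
    ∃ a : Finset ι → ℂ, ∀ p ∈ U, c p = ∑ S ∈ T.powerset, a S * ∏ i ∈ S, H i p := by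
  have hsm : ∀ {f : V → ℂ}, ContDiffOn ℝ ∞ f U → ∀ i, ContDiffOn ℝ ∞ (lieDiv (X i) (h i) f) U :=
    fun hf i => contDiffOn_lieDiv hU hf (hX i) (hh i) (h0 i)
  have hdf : ∀ {f : V → ℂ}, ContDiffOn ℝ ∞ f U → ∀ p ∈ U, DifferentiableAt ℝ f p :=
    fun hf p hp => ContDiffOn.differentiableAt_of_isOpen hU hf hp
  have hcomm : ∀ {f : V → ℂ}, ContDiffOn ℝ ∞ f U → ∀ i j, ∀ p ∈ U,
      lieDiv (X i) (h i) (lieDiv (X j) (h j) f) p = lieDiv (X j) (h j) (lieDiv (X i) (h i) f) p := by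
    intro f hf i j p hp
    by_cases hij : i = j
    · rw [hij]
    · exact lieDiv_comm (ContDiffOn.contDiffAt_two hU hf hp)
        (((hX i).contDiffAt (hU.mem_nhds hp)).differentiableAt (by simp))
        (((hX j).contDiffAt (hU.mem_nhds hp)).differentiableAt (by simp)) (hdf (hh i) p hp)
        (hdf (hh j) p hp) (h0 i p hp) (h0 j p hp) (hbr i j p hp) (hXh i j hij p hp)
        (hXh j i (Ne.symm hij) p hp)
  induction T using Finset.induction_on generalizing c with
  | empty =>
    -- With no coordinates left, all fields annihilate `c`; they span, so the derivative vanishes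
    -- and `c` is constant on the preconnected set.
    have hz : Set.EqOn (fderiv ℝ c) 0 U := fun p hp => hspan p hp _ fun i => by
      have h1 := hc1 i (Finset.notMem_empty i) p hp
      rw [lieDiv, div_eq_zero_iff] at h1
      exact h1.resolve_right (h0 i p hp)
    obtain ⟨a, ha⟩ := hU.exists_is_const_of_fderiv_eq_zero hUc
      (fun p hp => (hdf hc p hp).differentiableWithinAt) hz
    exact ⟨fun _ => a, fun p hp => by simpa using ha p hp⟩
  | insert i T hi ih =>
    have hiT := Finset.mem_insert_self i T
    -- Division with remainder by the coordinate `H i`: with `D` the `i`-th derivation, `D c = b`,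
    -- `D b = 0` and `D (H i) = 1`. Hence both `b` and `c - H i * b` are killed by `D`, and the
    -- induction hypothesis applies to each.
    set b := lieDiv (X i) (h i) c with hb
    have hbs : ContDiffOn ℝ ∞ b U := hsm hc i
    have hHi := hH i hiT
    have has : ContDiffOn ℝ ∞ (fun p => c p - H i p * b p) U := hc.sub (hHi.mul hbs)
    have hja : ∀ {f g : V → ℂ}, ContDiffOn ℝ ∞ f U → ContDiffOn ℝ ∞ g U → ∀ j, ∀ p ∈ U,
        lieDiv (X j) (h j) (fun p => f p - H i p * g p) p = lieDiv (X j) (h j) f p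
          - ((if j = i then 1 else 0) * g p + H i p * lieDiv (X j) (h j) g p) := by
      intro f g hf hg j p hp
      rw [lieDiv_sub_mul (hdf hf p hp) (hdf hHi p hp) (hdf hg p hp), hXH i hiT j p hp]
    have hbi : ∀ p ∈ U, lieDiv (X i) (h i) b p = 0 := hc2 i hiT
    have hb1 : ∀ j ∉ T, ∀ p ∈ U, lieDiv (X j) (h j) b p = 0 := by
      intro j hj p hp
      by_cases hji : j = i
      · rw [hji]; exact hbi p hp
      · rw [hb, hcomm hc j i p hp]
        exact lieDiv_zero hU (hc1 j (by simp [hji, hj])) p hp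
    have hb2 : ∀ j ∈ T, ∀ p ∈ U, lieDiv (X j) (h j) (lieDiv (X j) (h j) b) p = 0 := by
      intro j hj p hp
      rw [lieDiv_congr hU (hcomm hc j i) p hp, hcomm (hsm hc j) j i p hp]
      exact lieDiv_zero hU (hc2 j (Finset.mem_insert_of_mem hj)) p hp
    have ha1 : ∀ j ∉ T, ∀ p ∈ U, lieDiv (X j) (h j) (fun p => c p - H i p * b p) p = 0 := by
      intro j hj p hp
      rw [hja hc hbs j p hp, hb1 j hj p hp]
      by_cases hji : j = i
      · rw [if_pos hji, hji]; simp [hb]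
      · rw [if_neg hji, hc1 j (by simp [hji, hj]) p hp]; simp
    have ha2 : ∀ j ∈ T, ∀ p ∈ U, lieDiv (X j) (h j) (lieDiv (X j) (h j)
        fun p => c p - H i p * b p) p = 0 := by
      intro j hj p hp
      have hji : j ≠ i := fun h => hi (h ▸ hj)
      have h1 : ∀ p ∈ U, lieDiv (X j) (h j) (fun p => c p - H i p * b p) p
          = lieDiv (X j) (h j) c p - H i p * lieDiv (X j) (h j) b p := by
        intro p hp
        rw [hja hc hbs j p hp, if_neg hji, zero_mul, zero_add]
      rw [lieDiv_congr hU h1 p hp, hja (hsm hc j) (hsm hbs j) j p hp, if_neg hji, hb2 j hj p hp,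
        hc2 j (Finset.mem_insert_of_mem hj) p hp]
      simp
    have hH' := fun j hj => hH j (Finset.mem_insert_of_mem hj)
    have hXH' := fun j hj => hXH j (Finset.mem_insert_of_mem hj)
    obtain ⟨α, hα⟩ := ih hH' hXH' has ha2 ha1
    obtain ⟨β, hβ⟩ := ih hH' hXH' hbs hb2 hb1
    -- Monomials that contain `i` take their coefficient from the expansion of `b`, the others from
    -- that of the remainder.
    refine ⟨fun S => if i ∈ S then β (S.erase i) else α S, fun p hp => ?_⟩
    rw [Finset.sum_powerset_insert hi]
    have h1 : c p = (c p - H i p * b p) + H i p * b p := by ring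
    rw [h1, hα p hp, hβ p hp, Finset.mul_sum]
    congr 1
    · refine Finset.sum_congr rfl fun S hS => ?_
      dsimp only
      rw [if_neg fun h => hi (Finset.mem_powerset.mp hS h)]
    · refine Finset.sum_congr rfl fun S hS => ?_
      have hiS : i ∉ S := fun h => hi (Finset.mem_powerset.mp hS h)
      dsimp only
      rw [if_pos (Finset.mem_insert_self i S), Finset.erase_insert hiS, Finset.prod_insert hiS]
      ring

theorem sum_powerset_map {ι κ : Type*} (g : ι ↪ κ) (F : Finset ι) (a : Finset κ → ℂ) :
    ∑ S ∈ (F.map g).powerset, a S = ∑ S ∈ F.powerset, a (S.map g) := by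
  refine (Finset.sum_nbij (fun S : Finset ι => S.map g) ?_ ?_ ?_ fun _ _ => rfl).symm
  · intro S hS
    rw [Finset.mem_powerset] at hS ⊢
    exact Finset.map_subset_map.mpr hS
  · exact (Finset.map_injective g).injOn
  · intro S hS
    rw [Finset.mem_coe, Finset.mem_powerset, Finset.subset_map_iff] at hS
    obtain ⟨u, hu, rfl⟩ := hS
    exact ⟨u, by simpa using hu, rfl⟩

end Splitting

/-! ### The lower incomplete gamma function at `1/2` and the Gauss integral. -/

section Gauss

open MeasureTheory

/-- The integral of the Gauss function. -/
def gaussInt (x : ℝ) : ℝ := ∫ w in (0 : ℝ)..x, Real.exp (-w ^ 2)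

theorem hasDerivAt_gaussInt (x : ℝ) : HasDerivAt gaussInt (Real.exp (-x ^ 2)) x := by
  have hc : Continuous fun w : ℝ => Real.exp (-w ^ 2) := by fun_prop
  exact intervalIntegral.integral_hasDerivAt_right (hc.intervalIntegrable _ _)
    (hc.stronglyMeasurableAtFilter _ _) hc.continuousAt

theorem contDiff_gaussInt : ContDiff ℝ ∞ gaussInt := by
  rw [contDiff_infty_iff_deriv]
  refine ⟨fun x => (hasDerivAt_gaussInt x).differentiableAt, ?_⟩
  have : deriv gaussInt = fun x => Real.exp (-x ^ 2) := funext fun x => (hasDerivAt_gaussInt x).deriv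
  rw [this]
  fun_prop

theorem gaussInt_neg (x : ℝ) : gaussInt (-x) = -gaussInt x := by
  have h := intervalIntegral.integral_comp_neg (fun w : ℝ => Real.exp (-w ^ 2)) (a := 0) (b := x)
  simp only [neg_sq, neg_zero] at h
  rw [gaussInt, gaussInt, intervalIntegral.integral_symm, ← h]

/-- Substitution `t = w²`. The integrand `t^(-1/2) e^(-t)` is singular at zero, so the pointwise
identity is used only almost everywhere and integrability is taken from the Gamma integral. -/
theorem lowerGamma_half_sq {x : ℝ} (hx : 0 ≤ x) : lowerGamma (1 / 2) (x ^ 2) = 2 * gaussInt x := by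
  have hint : IntegrableOn (fun t : ℝ => t ^ ((1 / 2 : ℝ) - 1) * Real.exp (-t)) (Set.Ici 0) := by
    rw [integrableOn_Ici_iff_integrableOn_Ioi]
    refine (Real.GammaIntegral_convergent (s := 1 / 2) (by norm_num)).congr_fun (fun t _ => ?_)
      measurableSet_Ioi
    exact mul_comm _ _
  have hint2 : IntegrableOn (fun w : ℝ => 2 * Real.exp (-w ^ 2)) (Set.uIcc 0 x) :=
    (by fun_prop : Continuous fun w : ℝ => 2 * Real.exp (-w ^ 2)).continuousOn.integrableOn_compact
      isCompact_uIcc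
  have hpt : ∀ w ∈ Set.Ioo (0 : ℝ) x, ((fun t : ℝ => t ^ ((1 / 2 : ℝ) - 1) * Real.exp (-t)) ∘
      fun w : ℝ => w ^ 2) w * (2 * w) = 2 * Real.exp (-w ^ 2) := by
    intro w hw
    have h1 : (w ^ 2) ^ ((1 / 2 : ℝ) - 1) = w⁻¹ := by
      rw [← Real.rpow_natCast, ← Real.rpow_mul hw.1.le]
      norm_num
      rw [Real.rpow_neg_one]
    simp only [Function.comp_apply, h1]
    field_simp [hw.1.ne']
  have hae : ∀ᵐ w : ℝ, w ∈ Set.uIoc 0 x → ((fun t : ℝ => t ^ ((1 / 2 : ℝ) - 1) * Real.exp (-t)) ∘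
      fun w : ℝ => w ^ 2) w * (2 * w) = 2 * Real.exp (-w ^ 2) := by
    have : ∀ᵐ w : ℝ, w ≠ x := by simp [ae_iff]
    filter_upwards [this] with w hw hw2
    rw [Set.uIoc_of_le hx] at hw2
    exact hpt w ⟨hw2.1, lt_of_le_of_ne hw2.2 hw⟩
  have h := intervalIntegral.integral_comp_mul_deriv''' (a := 0) (b := x) (f := fun w : ℝ => w ^ 2)
    (f' := fun w => 2 * w) (g := fun t : ℝ => t ^ ((1 / 2 : ℝ) - 1) * Real.exp (-t))
    (by fun_prop) (fun w _ => by
      have := (hasDerivAt_pow 2 w).hasDerivWithinAt (s := Set.Ioi w)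
      simpa using this) ?_ ?_ ?_
  · rw [intervalIntegral.integral_congr_ae hae] at h
    rw [lowerGamma, gaussInt, ← intervalIntegral.integral_const_mul, h]
    norm_num
  · refine ContinuousOn.mul (ContinuousOn.rpow_const continuousOn_id ?_) (by fun_prop)
    rintro _ ⟨w, hw, rfl⟩
    rw [min_eq_left hx] at hw
    exact Or.inl (pow_ne_zero 2 hw.1.ne')
  · refine hint.mono_set ?_
    rintro _ ⟨w, _, rfl⟩
    exact sq_nonneg w
  · refine hint2.congr_fun_ae ((ae_restrict_iff' measurableSet_uIcc).mpr ?_)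
    have h1 : ∀ᵐ w : ℝ, w ≠ x := by simp [ae_iff]
    have h2 : ∀ᵐ w : ℝ, w ≠ 0 := by simp [ae_iff]
    filter_upwards [h1, h2] with w hw hw0 hw2
    rw [Set.uIcc_of_le hx] at hw2
    exact (hpt w ⟨lt_of_le_of_ne hw2.1 (Ne.symm hw0), lt_of_le_of_ne hw2.2 hw⟩).symm

end Gauss

/-! ### The derivative of the upper incomplete gamma function. -/

section UpperGamma

open MeasureTheory

/-- A ray in the upper half plane. -/
def rayPt (a u : ℝ) : ℂ := (a : ℂ) + (1 + I) * u

variable {a : ℝ}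

theorem rayPt_im (u : ℝ) : (rayPt a u).im = u := by simp [rayPt]

theorem rayPt_re (u : ℝ) : (rayPt a u).re = a + u := by simp [rayPt]

theorem rayPt_ne_zero (ha : a ≠ 0) (u : ℝ) : rayPt a u ≠ 0 := by
  intro h
  have h1 := congrArg Complex.im h
  have h2 := congrArg Complex.re h
  rw [rayPt_im] at h1
  rw [rayPt_re] at h2
  simp at h1 h2
  exact ha (by linarith)

theorem rayPt_mem_slitPlane {u : ℝ} (hu : 0 < u) : rayPt a u ∈ Complex.slitPlane :=
  Or.inr (by rw [rayPt_im]; exact hu.ne')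

theorem continuous_rayPt : Continuous (rayPt a) := by unfold rayPt; fun_prop

theorem hasDerivAt_rayPt (u : ℝ) : HasDerivAt (rayPt a) (1 + I) u := by
  have h := ((Complex.ofRealCLM.hasDerivAt (x := u)).const_mul (1 + I)).const_add (a : ℂ)
  exact h.congr_deriv (by simp)

theorem norm_rayPt_le (u : ℝ) (hu : 0 ≤ u) : ‖rayPt a u‖ ≤ |a| + 2 * u := by
  have h := Complex.norm_le_abs_re_add_abs_im (rayPt a u)
  rw [rayPt_re, rayPt_im, abs_of_nonneg hu] at h
  have := abs_add_le a u
  rw [abs_of_nonneg hu] at this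
  linarith

theorem tendsto_norm_rayPt : Tendsto (fun u => ‖rayPt a u‖) atTop atTop :=
  tendsto_atTop_mono (fun u => by
    have := Complex.abs_im_le_norm (rayPt a u)
    rw [rayPt_im] at this
    exact (le_abs_self u).trans this) tendsto_id

theorem isBigO_rayPt (b : ℝ) {c : ℝ} (hc : 0 < c) :
    (fun u => ‖rayPt a u‖ ^ b * Real.exp (-c * u)) =O[atTop] fun u => Real.exp (-(c / 2) * u) := by
  have h1 : (fun u => ‖rayPt a u‖ ^ b) =O[atTop] fun u => Real.exp (c / 4 * ‖rayPt a u‖) :=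
    ((isLittleO_rpow_exp_pos_mul_atTop b (by positivity : 0 < c / 4)).comp_tendsto
      tendsto_norm_rayPt).isBigO
  have h2 : (fun u => Real.exp (c / 4 * ‖rayPt a u‖)) =O[atTop] fun u => Real.exp (c / 2 * u) := by
    refine Asymptotics.IsBigO.of_bound (Real.exp (c / 4 * |a|)) ?_
    filter_upwards [eventually_ge_atTop 0] with u hu
    rw [Real.norm_of_nonneg (Real.exp_pos _).le, Real.norm_of_nonneg (Real.exp_pos _).le,
      ← Real.exp_add]
    refine Real.exp_le_exp.mpr ?_
    have := norm_rayPt_le (a := a) u hu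
    nlinarith
  refine ((h1.trans h2).mul (Asymptotics.isBigO_refl (fun u => Real.exp (-c * u)) _)).congr_right
    fun u => ?_
  rw [← Real.exp_add]
  congr 1; ring

theorem integrableOn_rayPt (ha : a ≠ 0) (b : ℝ) {c : ℝ} (hc : 0 < c) :
    IntegrableOn (fun u => ‖rayPt a u‖ ^ b * Real.exp (-c * u)) (Set.Ioi 0) := by
  refine integrable_of_isBigO_exp_neg (b := c / 2) (by positivity) ?_ (isBigO_rayPt b hc)
  exact (ContinuousOn.rpow_const continuous_rayPt.norm.continuousOn fun u _ =>
    Or.inl (norm_ne_zero_iff.mpr (rayPt_ne_zero ha u))).mul (by fun_prop)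

/-- The integrand of the incomplete Gamma function, after rescaling. -/
def rayFun (a b y u : ℝ) : ℂ := Complex.exp (-(y * rayPt a u)) * rayPt a u ^ (b : ℂ)

theorem norm_rayFun (b y u : ℝ) :
    ‖rayFun a b y u‖ = Real.exp (-(y * a)) * (‖rayPt a u‖ ^ b * Real.exp (-y * u)) := by
  rw [rayFun, norm_mul, Complex.norm_exp, Complex.norm_cpow_real]
  have : (-((y : ℂ) * rayPt a u)).re = -(y * a) + -y * u := by
    rw [Complex.neg_re, Complex.re_ofReal_mul, rayPt_re]; ring
  rw [this, Real.exp_add]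
  ring

theorem continuousOn_rayFun (b y : ℝ) : ContinuousOn (rayFun a b y) (Set.Ioi 0) := by
  unfold rayFun
  refine ContinuousOn.mul (Continuous.continuousOn (by have := continuous_rayPt (a := a); fun_prop)) ?_
  exact continuous_rayPt.continuousOn.cpow continuousOn_const fun u hu => rayPt_mem_slitPlane hu

theorem integrableOn_rayFun (ha : a ≠ 0) (b : ℝ) {y : ℝ} (hy : 0 < y) :
    IntegrableOn (rayFun a b y) (Set.Ioi 0) := by
  refine ((integrableOn_rayPt ha b hy).const_mul (Real.exp (-(y * a)))).mono'
    ((continuousOn_rayFun b y).aestronglyMeasurable measurableSet_Ioi) ?_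
  exact Eventually.of_forall fun u => (norm_rayFun b y u).le

theorem rayPt_mul_rayFun (ha : a ≠ 0) (b y u : ℝ) :
    rayPt a u * rayFun a b y u = rayFun a (b + 1) y u := by
  rw [rayFun, rayFun, Complex.ofReal_add, Complex.cpow_add _ _ (rayPt_ne_zero ha u),
    Complex.ofReal_one, Complex.cpow_one]
  ring

/-- Along the ray the real part tends to infinity, so the integrand decays exponentially. A common
dominating function exists for parameters in the interval from `y/2` to `2y`. -/
theorem hasDerivAt_integral_rayFun (ha : a ≠ 0) (b : ℝ) {y : ℝ} (hy : 0 < y) :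
    HasDerivAt (fun y => ∫ u in Set.Ioi (0 : ℝ), rayFun a b y u)
      (∫ u in Set.Ioi (0 : ℝ), -rayFun a (b + 1) y u) y := by
  refine (hasDerivAt_integral_of_dominated_loc_of_deriv_le (μ := volume.restrict (Set.Ioi 0))
    (F := fun y u => rayFun a b y u) (F' := fun y u => -rayFun a (b + 1) y u)
    (s := Set.Ioo (y / 2) (2 * y))
    (bound := fun u => Real.exp (2 * y * |a|) * (‖rayPt a u‖ ^ (b + 1) * Real.exp (-(y / 2) * u)))
    (Ioo_mem_nhds (by linarith) (by linarith)) ?_ ?_ ?_ ?_ ?_ ?_).2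
  · exact Eventually.of_forall fun y => (continuousOn_rayFun b y).aestronglyMeasurable measurableSet_Ioi
  · exact integrableOn_rayFun ha b hy
  · exact ((continuousOn_rayFun (b + 1) y).aestronglyMeasurable measurableSet_Ioi).neg
  · refine (ae_restrict_iff' measurableSet_Ioi).mpr (Eventually.of_forall fun u hu x hx => ?_)
    have hu' : (0 : ℝ) < u := hu
    rw [norm_neg, norm_rayFun]
    refine mul_le_mul (Real.exp_le_exp.mpr ?_) (mul_le_mul_of_nonneg_left (Real.exp_le_exp.mpr ?_)
      (Real.rpow_nonneg (norm_nonneg _) _)) (by positivity) (Real.exp_pos _).le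
    · have h1 : -(x * a) ≤ x * |a| := by
        have := neg_abs_le a
        nlinarith [hx.1, hx.2]
      exact h1.trans (mul_le_mul_of_nonneg_right hx.2.le (abs_nonneg a))
    · nlinarith [hx.1]
  · exact (integrableOn_rayPt ha (b + 1) (by positivity)).const_mul _
  · refine Eventually.of_forall fun u x _ => ?_
    have h1 : HasDerivAt (fun x : ℝ => -((x : ℂ) * rayPt a u)) (-(1 * rayPt a u)) x :=
      ((Complex.ofRealCLM.hasDerivAt (x := x)).mul_const (rayPt a u)).neg
    have h2 := h1.cexp.mul_const (rayPt a u ^ (b : ℂ))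
    refine h2.congr_deriv ?_
    rw [← rayPt_mul_rayFun ha, rayFun]
    ring

/-- For `a < 0` the ray starts on the branch cut. The principal logarithm is continuous there from
the closed upper half plane, the side on which the ray lies. -/
theorem continuousWithinAt_rayFun (ha : a ≠ 0) (b y : ℝ) :
    ContinuousWithinAt (rayFun a b y) (Set.Ici 0) 0 := by
  have h0 : rayPt a 0 = a := by simp [rayPt]
  have hlog : ContinuousWithinAt (fun u => Complex.log (rayPt a u)) (Set.Ici 0) 0 := by
    rcases lt_or_gt_of_ne ha with h | h
    · have h1 := Complex.continuousWithinAt_log_of_re_neg_of_im_zero (z := rayPt a 0)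
        (by rw [h0]; exact h) (by rw [h0]; simp)
      refine ContinuousWithinAt.comp (f := rayPt a) (s := Set.Ici 0) h1
        continuous_rayPt.continuousWithinAt fun u hu => ?_
      rw [Set.mem_ofPred_eq, rayPt_im]; exact hu
    · refine (ContinuousAt.clog continuous_rayPt.continuousAt ?_).continuousWithinAt
      rw [h0]; exact Or.inl h
  have h2 : rayFun a b y = fun u => Complex.exp (-(y * rayPt a u)) *
      Complex.exp (Complex.log (rayPt a u) * b) := by
    funext u
    rw [rayFun, Complex.cpow_def_of_ne_zero (rayPt_ne_zero ha u)]
  rw [h2]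
  refine ContinuousWithinAt.mul ?_ (hlog.mul continuousWithinAt_const).cexp
  have := continuous_rayPt (a := a)
  exact Continuous.continuousWithinAt (by fun_prop)

theorem tendsto_rayFun (b : ℝ) {y : ℝ} (hy : 0 < y) : Tendsto (rayFun a b y) atTop (𝓝 0) := by
  rw [tendsto_zero_iff_norm_tendsto_zero]
  simp only [norm_rayFun]
  rw [← mul_zero (Real.exp (-(y * a)))]
  refine Tendsto.const_mul _ ((isBigO_rayPt b hy).trans_tendsto ?_)
  exact Real.tendsto_exp_atBot.comp (tendsto_id.const_mul_atTop_of_neg (by linarith))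

/-- The integrand on the left is the total derivative of `e^(-y z) z^s` along the ray, so only the
value at the initial point `z = a` contributes. -/
theorem integral_rayFun_by_parts (ha : a ≠ 0) (s : ℝ) {y : ℝ} (hy : 0 < y) :
    (1 + I) * (s * (∫ u in Set.Ioi (0 : ℝ), rayFun a (s - 1) y u)
      + y * ∫ u in Set.Ioi (0 : ℝ), -rayFun a s y u)
      = -(Complex.exp (-(y * a)) * (a : ℂ) ^ (s : ℂ)) := by
  have hint := ((integrableOn_rayFun ha (s - 1) hy).const_mul (s : ℂ)).fun_add
    ((integrableOn_rayFun ha s hy).fun_neg.const_mul (y : ℂ))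
  have h := integral_Ioi_of_hasDerivAt_of_tendsto (f := rayFun a s y)
    (f' := fun u => (1 + I) * (s * rayFun a (s - 1) y u + y * -rayFun a s y u))
    (continuousWithinAt_rayFun ha s y) (fun u hu => ?_) (hint.const_mul (1 + I))
    (tendsto_rayFun s hy)
  · have h0 : rayPt a 0 = a := by simp [rayPt]
    rw [integral_const_mul, integral_add ((integrableOn_rayFun ha (s - 1) hy).const_mul (s : ℂ))
      ((integrableOn_rayFun ha s hy).fun_neg.const_mul (y : ℂ)), integral_const_mul,
      integral_const_mul, zero_sub] at h
    rw [h, rayFun, h0]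
  · have h1 := (((hasDerivAt_rayPt (a := a) u).const_mul (y : ℂ)).neg.cexp).mul
      (((hasDerivAt_id (rayPt a u)).cpow_const (c := (s : ℂ)) (rayPt_mem_slitPlane hu)).comp u
        (hasDerivAt_rayPt (a := a) u))
    refine h1.congr_deriv ?_
    simp only [rayFun, Function.comp_apply, id, Pi.neg_apply]
    push_cast
    ring

theorem real_mul_cpow {y : ℝ} (hy : 0 < y) {z : ℂ} (hz : z ≠ 0) (b : ℝ) :
    ((y : ℂ) * z) ^ (b : ℂ) = ((y ^ b : ℝ) : ℂ) * z ^ (b : ℂ) := by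
  have hy' : (y : ℂ) ≠ 0 := by exact_mod_cast hy.ne'
  rw [Complex.cpow_def_of_ne_zero (mul_ne_zero hy' hz), Complex.cpow_def_of_ne_zero hz,
    Complex.log_ofReal_mul hy hz, Real.rpow_def_of_pos hy, add_mul, Complex.exp_add]
  push_cast
  rfl

/-- The substitution `t = y u` scales the ray issuing from `a y` to the one issuing from `a`. After
it `y` is only a parameter of the integrand. -/
theorem upperGamma_mul (ha : a ≠ 0) (s : ℝ) {y : ℝ} (hy : 0 < y) :
    upperGamma s (a * y) = (y ^ s : ℝ) * ((1 + I) * ∫ u in Set.Ioi (0 : ℝ), rayFun a (s - 1) y u) := by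
  have h := integral_comp_mul_left_Ioi (fun t : ℝ => (1 + I) *
    Complex.exp (-(((a * y : ℝ) : ℂ) + (1 + I) * t)) * (((a * y : ℝ) : ℂ) + (1 + I) * t) ^ ((s : ℂ) - 1))
    0 hy
  rw [mul_zero] at h
  have h2 : upperGamma s (a * y) = y * (y⁻¹ • upperGamma s (a * y)) := by
    rw [Complex.real_smul, ← mul_assoc]
    push_cast
    rw [mul_inv_cancel₀ (by exact_mod_cast hy.ne'), one_mul]
  rw [h2, upperGamma, ← h, ← integral_const_mul, ← integral_const_mul, ← integral_const_mul]
  refine setIntegral_congr_fun measurableSet_Ioi fun u _ => ?_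
  have h3 : ((a * y : ℝ) : ℂ) + (1 + I) * ((y * u : ℝ) : ℂ) = y * rayPt a u := by
    rw [rayPt]; push_cast; ring
  have h4 : ((s : ℂ) - 1) = ((s - 1 : ℝ) : ℂ) := by push_cast; rfl
  have h5 : (y : ℂ) * ((y ^ (s - 1) : ℝ) : ℂ) = ((y ^ s : ℝ) : ℂ) := by
    rw [← Complex.ofReal_mul, Real.rpow_sub_one hy.ne']
    congr 1
    field_simp
  simp only [h3, h4]
  rw [real_mul_cpow hy (rayPt_ne_zero ha u), ← h5, rayFun]
  ring

theorem hasDerivAt_upperGamma (ha : a ≠ 0) (s : ℝ) {y : ℝ} (hy : 0 < y) :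
    HasDerivAt (fun y => upperGamma s (a * y))
      (-(a : ℂ) ^ (s : ℂ) * ((y ^ (s - 1) : ℝ) * Real.exp (-(a * y)))) y := by
  have h1 := ((Real.hasDerivAt_rpow_const (p := s) (Or.inl hy.ne')).ofReal_comp).mul
    ((hasDerivAt_integral_rayFun ha (s - 1) hy).const_mul (1 + I))
  rw [sub_add_cancel] at h1
  have h2 : (fun y => upperGamma s (a * y)) =ᶠ[𝓝 y] fun y => (y ^ s : ℝ) * ((1 + I) *
      ∫ u in Set.Ioi (0 : ℝ), rayFun a (s - 1) y u) := by
    filter_upwards [Ioi_mem_nhds hy] with x hx using upperGamma_mul ha s hx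
  refine (h1.congr_of_eventuallyEq h2).congr_deriv ?_
  have h3 := integral_rayFun_by_parts ha s hy
  have h5 : (y : ℂ) * ((y ^ (s - 1) : ℝ) : ℂ) = ((y ^ s : ℝ) : ℂ) := by
    rw [← Complex.ofReal_mul, Real.rpow_sub_one hy.ne']
    congr 1
    field_simp
  rw [← h5]
  have h6 : Complex.exp (-(y * a)) = ((Real.exp (-(a * y)) : ℝ) : ℂ) := by
    push_cast; rw [mul_comm]
  rw [h6] at h3
  push_cast at h3 ⊢
  linear_combination ((y ^ (s - 1) : ℝ) : ℂ) * h3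

end UpperGamma

section HFun

/-- The function `H(y; D)` satisfies a first order differential equation. -/
theorem exists_hasDerivAt_HFun (κ D' : ℝ) : ∃ C : ℂ, C ≠ 0 ∧ ∀ y : ℝ, 0 < y →
    HasDerivAt (HFun κ D') (C * ((y ^ (-κ) * Real.exp (Real.pi * D' * y) : ℝ) : ℂ)) y := by
  by_cases hD : D' = 0
  · subst hD
    by_cases hκ : κ = 1
    · refine ⟨1, one_ne_zero, fun y hy => ?_⟩
      have h1 : HFun κ 0 = fun y => ((Real.log y : ℝ) : ℂ) := by funext y; simp [HFun, hκ]
      rw [h1]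
      refine (Real.hasDerivAt_log hy.ne').ofReal_comp.congr_deriv ?_
      rw [hκ, Real.rpow_neg_one]; simp
    · refine ⟨((1 - κ : ℝ) : ℂ), by exact_mod_cast sub_ne_zero.mpr (Ne.symm hκ), fun y hy => ?_⟩
      have h1 : HFun κ 0 = fun y => ((y ^ (1 - κ) : ℝ) : ℂ) := by funext y; simp [HFun, hκ]
      rw [h1]
      refine (Real.hasDerivAt_rpow_const (p := 1 - κ) (Or.inl hy.ne')).ofReal_comp.congr_deriv ?_
      have : 1 - κ - 1 = -κ := by ring
      rw [this]; simp
  · have ha : -(Real.pi * D') ≠ 0 := neg_ne_zero.mpr (mul_ne_zero Real.pi_ne_zero hD)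
    refine ⟨-((-(Real.pi * D') : ℝ) : ℂ) ^ ((1 - κ : ℝ) : ℂ), ?_, fun y hy => ?_⟩
    · refine neg_ne_zero.mpr ?_
      rw [Complex.cpow_def_of_ne_zero (by exact_mod_cast ha)]
      exact Complex.exp_ne_zero _
    · have h1 : HFun κ D' = fun y => upperGamma (1 - κ) (-(Real.pi * D') * y) := by
        funext y; rw [HFun, if_pos hD, neg_mul]
      rw [h1]
      refine (hasDerivAt_upperGamma ha (1 - κ) hy).congr_deriv ?_
      have h2 : 1 - κ - 1 = -κ := by ring
      have h3 : -(-(Real.pi * D') * y) = Real.pi * D' * y := by ring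
      rw [h2, h3]
      push_cast
      ring

end HFun

section HeisFun

variable {L : Matrix (Fin N) (Fin N) ℝ} {m : ℕ} {E : Fin m → Fin N → ℝ} {r : Fin N → ℤ}
  {p : ℝ × (Fin N → ℝ)}

/-- The argument of the Gauss integral that is attached to a negative frame vector. -/
def heisArg (L : Matrix (Fin N) (Fin N) ℝ) (E : Fin m → Fin N → ℝ) (r : Fin N → ℤ) (i : Fin m)
    (p : ℝ × (Fin N → ℝ)) : ℝ := √(Real.pi / -qf L (E i)) *
  (√p.1 * pairing r (E i) + 2 * qf L (E i) * (coordL L E i p * (√p.1)⁻¹))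

/-- The Gauss integral is odd, which absorbs the sign factor. Thus the building block is smooth,
also where its argument changes sign. -/
theorem HHeis_eq {i : Fin m} (hi : qf L (E i) < 0) (hp : 0 < p.1) :
    HHeis (qf L (E i)) (pairing r (E i)) p.1 (coordL L E i p) = 2 * gaussInt (heisArg L E r i p) := by
  set t := pairing r (E i) + 2 * qf L (E i) * (coordL L E i p / p.1) with ht
  set c := √(Real.pi / -qf L (E i)) * √p.1 with hc
  have hc0 : 0 ≤ c := by positivity
  have hs : √p.1 ≠ 0 := (Real.sqrt_pos.mpr hp).ne'
  have hsq : √p.1 * √p.1 = p.1 := Real.mul_self_sqrt hp.le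
  have h1 : heisArg L E r i p = c * t := by
    rw [heisArg, hc, ht]
    have h3 : coordL L E i p / p.1 = coordL L E i p * (√p.1)⁻¹ * (√p.1)⁻¹ := by
      rw [mul_assoc, ← mul_inv, hsq]; rfl
    rw [h3]
    field_simp
  have h2 : -(p.1 * Real.pi) / qf L (E i) * t ^ 2 = (c * |t|) ^ 2 := by
    rw [mul_pow, sq_abs, hc, mul_pow, Real.sq_sqrt (div_nonneg Real.pi_pos.le (by linarith)),
      Real.sq_sqrt hp.le]
    have : qf L (E i) ≠ 0 := hi.ne
    field_simp
  rw [HHeis, ← ht, h2, lowerGamma_half_sq (by positivity), h1]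
  rcases lt_trichotomy t 0 with h | h | h
  · rw [Real.sign_of_neg h, abs_of_neg h, mul_neg, gaussInt_neg]; ring
  · rw [h]; simp [gaussInt]
  · rw [Real.sign_of_pos h, abs_of_pos h, one_mul]

theorem fstL_hasFDerivAt_sqrt (hp : 0 < p.1) : HasFDerivAt (fun q : ℝ × (Fin N → ℝ) => √q.1)
    ((1 / (2 * √p.1)) • (fstL : (ℝ × (Fin N → ℝ)) →L[ℝ] ℝ)) p :=
  (fstL : (ℝ × (Fin N → ℝ)) →L[ℝ] ℝ).hasFDerivAt.sqrt hp.ne'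

theorem hasFDerivAt_heisArg (i : Fin m) (hp : 0 < p.1) :
    ∃ T : (ℝ × (Fin N → ℝ)) →L[ℝ] ℝ, HasFDerivAt (heisArg L E r i) T p ∧
      ∀ d, T d = √(Real.pi / -qf L (E i)) * (√p.1)⁻¹ * (d.1 / 2 * pairing r (E i)
        + 2 * qf L (E i) * (coordL L E i d - coordL L E i p * d.1 / (2 * p.1))) := by
  have hs := fstL_hasFDerivAt_sqrt (N := N) hp
  have hs0 : √p.1 ≠ 0 := (Real.sqrt_pos.mpr hp).ne'
  have hinv := (hasDerivAt_inv hs0).comp_hasFDerivAt p hs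
  have h := ((hs.mul_const (pairing r (E i))).add (((coordL L E i).hasFDerivAt.mul hinv).const_mul
    (2 * qf L (E i)))).const_mul √(Real.pi / -qf L (E i))
  refine ⟨_, h, fun d => ?_⟩
  have hsq : p.1 = √p.1 * √p.1 := (Real.mul_self_sqrt hp.le).symm
  simp only [smul_apply, add_apply, smul_eq_mul, ContinuousLinearMap.coe_fst', Function.comp_apply]
  have h3 : coordL L E i p * d.1 / (2 * p.1)
      = coordL L E i p * d.1 / (2 * (√p.1 * √p.1)) := by rw [← hsq]
  rw [h3]
  field_simp
  ring

theorem contDiffOn_heisArg (i : Fin m) {U : Set (ℝ × (Fin N → ℝ))} (hpos : ∀ p ∈ U, 0 < p.1) :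
    ContDiffOn ℝ ∞ (heisArg L E r i) U := by
  have hs : ContDiffOn ℝ ∞ (fun q : ℝ × (Fin N → ℝ) => √q.1) U :=
    contDiff_fst.contDiffOn.sqrt fun p hp => (hpos p hp).ne'
  have hinv := hs.inv fun p hp => (Real.sqrt_pos.mpr (hpos p hp)).ne'
  exact contDiffOn_const.mul ((hs.mul contDiffOn_const).add (contDiffOn_const.mul
    ((coordL L E i).contDiff.contDiffOn.mul hinv)))

theorem fderiv_comp_real {g : ℝ → ℂ} {g' : ℂ} {σ : ℝ × (Fin N → ℝ) → ℝ}
    {T : (ℝ × (Fin N → ℝ)) →L[ℝ] ℝ} (hg : HasDerivAt g g' (σ p)) (hσ : HasFDerivAt σ T p)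
    (d : ℝ × (Fin N → ℝ)) : fderiv ℝ (fun q => g (σ q)) p d = T d * g' := by
  have h : HasFDerivAt (fun q => g (σ q)) _ p := hg.hasFDerivAt.comp p hσ
  rw [h.fderiv]
  simp

end HeisFun

/-! ### The commuting frame of vector fields and its dual functions. -/

section Application

variable {m : ℕ} {k : ℤ} {L : Matrix (Fin N) (Fin N) ℝ} {s : Finset ((Fin N → ℝ) × ℝ × ℝ)}
  {φ : JacobiSpace N → ℂ} {E : Fin m → Fin N → ℝ} {W : Submodule ℝ (Fin N → ℝ)}
  {U : Set (ℝ × (Fin N → ℝ))} {n : ℤ} {r : Fin N → ℤ} {p : ℝ × (Fin N → ℝ)} {C : ℂ} {κ D' : ℝ}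

/-- Indices for a commuting frame of vector fields. -/
abbrev FieldIdx (L : Matrix (Fin N) (Fin N) ℝ) (E : Fin m → Fin N → ℝ)
    (W : Submodule ℝ (Fin N → ℝ)) : Type :=
  Option {i // i ∈ starFrame L E W} ⊕ {x : Fin N → ℝ // ∀ i ∈ starFrame L E W, coordL L E i (0, x) = 0}

/-- A commuting frame of vector fields. -/
def frameField (L : Matrix (Fin N) (Fin N) ℝ) (E : Fin m → Fin N → ℝ)
    (W : Submodule ℝ (Fin N → ℝ)) (r : Fin N → ℤ) :
    FieldIdx L E W → ℝ × (Fin N → ℝ) → ℝ × (Fin N → ℝ)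
  | .inl none => radialField L E W r
  | .inl (some i) => fun p => √p.1 • ((0 : ℝ), E i)
  | .inr x => fun _ => ((0 : ℝ), (x : Fin N → ℝ))

/-- Functions that are dual to the frame of vector fields. -/
def frameFun (L : Matrix (Fin N) (Fin N) ℝ) (E : Fin m → Fin N → ℝ)
    (W : Submodule ℝ (Fin N → ℝ)) (r : Fin N → ℤ) (κ D' : ℝ) :
    FieldIdx L E W → ℝ × (Fin N → ℝ) → ℂ
  | .inl none => fun p => HFun κ D' p.1
  | .inl (some i) => fun p => ((2 * gaussInt (heisArg L E r i p) : ℝ) : ℂ)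
  | .inr _ => fun _ => 0

/-- The derivatives of the dual functions along the vector fields. -/
def frameDen (L : Matrix (Fin N) (Fin N) ℝ) (E : Fin m → Fin N → ℝ)
    (W : Submodule ℝ (Fin N → ℝ)) (r : Fin N → ℤ) (C : ℂ) (κ D' : ℝ) :
    FieldIdx L E W → ℝ × (Fin N → ℝ) → ℂ
  | .inl none => fun p => 2 * C * ((p.1 ^ (1 - κ) * Real.exp (Real.pi * D' * p.1) : ℝ) : ℂ)
  | .inl (some i) => fun p => ((4 * √(Real.pi / -qf L (E i)) * qf L (E i) *
      Real.exp (-heisArg L E r i p ^ 2) : ℝ) : ℂ)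
  | .inr _ => fun _ => 1

theorem contDiffOn_frameField (hpos : ∀ p ∈ U, 0 < p.1) (a : FieldIdx L E W) :
    ContDiffOn ℝ ∞ (frameField L E W r a) U := by
  rcases a with (_ | i) | x
  · exact (radialField L E W r).contDiff.contDiffOn
  · exact (contDiff_fst.contDiffOn.sqrt fun p hp => (hpos p hp).ne').smul contDiffOn_const
  · exact contDiffOn_const

theorem contDiffOn_frameDen (hpos : ∀ p ∈ U, 0 < p.1) (a : FieldIdx L E W) :
    ContDiffOn ℝ ∞ (frameDen L E W r C κ D' a) U := by
  rcases a with (_ | i) | x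
  · have h : ContDiffOn ℝ ∞ (fun p : ℝ × (Fin N → ℝ) =>
        p.1 ^ (1 - κ) * Real.exp (Real.pi * D' * p.1)) U :=
      (contDiff_fst.contDiffOn.rpow_const_of_ne fun p hp => (hpos p hp).ne').mul
        (contDiffOn_const.mul contDiff_fst.contDiffOn).exp
    exact contDiffOn_const.mul (Complex.ofRealCLM.contDiff.comp_contDiffOn h)
  · have h0 : ContDiffOn ℝ ∞ (heisArg L E r (i : Fin m)) U := contDiffOn_heisArg (i : Fin m) hpos
    have h : ContDiffOn ℝ ∞ (fun p : ℝ × (Fin N → ℝ) => 4 * √(Real.pi / -qf L (E i)) *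
        qf L (E i) * Real.exp (-heisArg L E r i p ^ 2)) U :=
      contDiffOn_const.mul (h0.pow 2).neg.exp
    exact Complex.ofRealCLM.contDiff.comp_contDiffOn h
  · exact contDiffOn_const

theorem contDiffOn_HFun (hC : ∀ y : ℝ, 0 < y →
    HasDerivAt (HFun κ D') (C * ((y ^ (-κ) * Real.exp (Real.pi * D' * y) : ℝ) : ℂ)) y) :
    ContDiffOn ℝ ∞ (HFun κ D') (Set.Ioi 0) := by
  rw [contDiffOn_infty_iff_deriv_of_isOpen isOpen_Ioi]
  refine ⟨fun y hy => (hC y hy).differentiableAt.differentiableWithinAt, ?_⟩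
  refine ContDiffOn.congr (f := fun y : ℝ => C * ((y ^ (-κ) * Real.exp (Real.pi * D' * y) : ℝ) : ℂ))
    ?_ fun y hy => (hC y hy).deriv
  refine contDiffOn_const.mul (Complex.ofRealCLM.contDiff.comp_contDiffOn (ContDiffOn.mul ?_ ?_))
  · exact contDiffOn_id.rpow_const_of_ne fun y hy => (Set.mem_Ioi.mp hy).ne'
  · exact (contDiffOn_const.mul contDiffOn_id).exp

theorem contDiffOn_frameFun (hpos : ∀ p ∈ U, 0 < p.1) (hC : ∀ y : ℝ, 0 < y →
    HasDerivAt (HFun κ D') (C * ((y ^ (-κ) * Real.exp (Real.pi * D' * y) : ℝ) : ℂ)) y)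
    (a : FieldIdx L E W) : ContDiffOn ℝ ∞ (frameFun L E W r κ D' a) U := by
  rcases a with (_ | i) | x
  · exact (contDiffOn_HFun hC).comp contDiff_fst.contDiffOn hpos
  · have h0 : ContDiffOn ℝ ∞ (heisArg L E r (i : Fin m)) U := contDiffOn_heisArg (i : Fin m) hpos
    have h : ContDiffOn ℝ ∞ (fun p : ℝ × (Fin N → ℝ) => 2 * gaussInt (heisArg L E r i p)) U :=
      contDiffOn_const.mul (contDiff_gaussInt.comp_contDiffOn h0)
    exact Complex.ofRealCLM.contDiff.comp_contDiffOn h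
  · exact contDiffOn_const

theorem frameDen_ne_zero (hpos : ∀ p ∈ U, 0 < p.1) (hC0 : C ≠ 0) (a : FieldIdx L E W) :
    ∀ p ∈ U, frameDen L E W r C κ D' a p ≠ 0 := by
  intro p hp
  rcases a with (_ | i) | x
  · have h1 : p.1 ^ (1 - κ) * Real.exp (Real.pi * D' * p.1) ≠ 0 :=
      (mul_pos (Real.rpow_pos_of_pos (hpos p hp) _) (Real.exp_pos _)).ne'
    have h2 : ((p.1 ^ (1 - κ) * Real.exp (Real.pi * D' * p.1) : ℝ) : ℂ) ≠ 0 := by exact_mod_cast h1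
    exact mul_ne_zero (mul_ne_zero two_ne_zero hC0) h2
  · have hi := (mem_starFrame.mp i.2).1
    have h1 : 0 < √(Real.pi / -qf L (E i)) :=
      Real.sqrt_pos.mpr (div_pos Real.pi_pos (by linarith))
    have h2 : 4 * √(Real.pi / -qf L (E i)) * qf L (E i) * Real.exp (-heisArg L E r i p ^ 2) ≠ 0 :=
      mul_ne_zero (mul_ne_zero (by positivity) hi.ne) (Real.exp_pos _).ne'
    simp only [frameDen]
    exact_mod_cast h2
  · exact one_ne_zero

theorem radialField_frame (hEL : ∀ i j, i ≠ j → E i ⬝ᵥ (L *ᵥ E j) = 0) {j : Fin m}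
    (hj : j ∈ starFrame L E W) : radialField L E W r (0, E j) = (0, E j) := by
  rw [radialField_apply, Finset.sum_eq_single j]
  · rw [coordL_frame hEL hj, if_pos rfl]; simp
  · intro i hi hij
    rw [coordL_frame hEL hi, if_neg (Ne.symm hij)]; simp
  · exact fun h => absurd hj h

theorem radialField_ker {x : Fin N → ℝ} (hx : ∀ i ∈ starFrame L E W, coordL L E i (0, x) = 0) :
    radialField L E W r (0, x) = 0 := by
  rw [radialField_apply, Finset.sum_eq_zero]
  · simp
  · intro i hi
    rw [hx i hi]; simp

theorem fderiv_sqrt_field (hp : 0 < p.1) (v d : ℝ × (Fin N → ℝ)) :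
    fderiv ℝ (fun q : ℝ × (Fin N → ℝ) => √q.1 • v) p d = (d.1 / (2 * √p.1)) • v := by
  rw [((fstL_hasFDerivAt_sqrt hp).smul_const v).fderiv]
  simp [div_eq_mul_inv, mul_comm]

/-- The commutator of the radial field with `∂_e` is `-∂_e`, and the radial field multiplies `√y` by
one; the factor `√y` compensates. -/
theorem frameField_bracket (hEL : ∀ i j, i ≠ j → E i ⬝ᵥ (L *ᵥ E j) = 0) (hp : 0 < p.1)
    (a b : FieldIdx L E W) : fderiv ℝ (frameField L E W r b) p (frameField L E W r a p)
      = fderiv ℝ (frameField L E W r a) p (frameField L E W r b p) := by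
  have hs : √p.1 ≠ 0 := (Real.sqrt_pos.mpr hp).ne'
  have key : ∀ i : {i // i ∈ starFrame L E W},
      (2 * p.1 / (2 * √p.1)) • ((0 : ℝ), E i) = radialField L E W r (√p.1 • ((0 : ℝ), E i)) := by
    intro i
    rw [map_smul, radialField_frame hEL i.2]
    congr 1
    rw [div_eq_iff (by positivity)]
    linear_combination (-2) * Real.mul_self_sqrt hp.le
  rcases a with (_ | i) | x <;> rcases b with (_ | j) | y <;>
    simp only [frameField, fderiv_sqrt_field hp, fderiv_fun_const, ContinuousLinearMap.fderiv,
      radialField_fst, Pi.zero_apply, zero_apply, Prod.smul_fst, smul_zero, zero_div, zero_smul]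
  · exact key j
  · exact (radialField_ker y.2).symm
  · exact (key i).symm
  · exact radialField_ker x.2

theorem frameField_span (hEL : ∀ i j, i ≠ j → E i ⬝ᵥ (L *ᵥ E j) = 0) (hp : 0 < p.1)
    (T : (ℝ × (Fin N → ℝ)) →L[ℝ] ℂ) (hT : ∀ a, T (frameField L E W r a p) = 0) : T = 0 := by
  have hE : ∀ i ∈ starFrame L E W, T (0, E i) = 0 := by
    intro i hi
    have h := hT (.inl (some ⟨i, hi⟩))
    rw [frameField, map_smul] at h
    exact (smul_eq_zero.mp h).resolve_left (Real.sqrt_pos.mpr hp).ne'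
  have h2 : ∀ x, T (0, x) = 0 := by
    intro x
    rw [apply_eq_sum_coordL (W := W) hEL T (fun x hx => hT (.inr ⟨x, hx⟩))]
    exact Finset.sum_eq_zero fun i hi => by rw [hE i hi, mul_zero]
  have h1 : T (1, 0) = 0 := by
    have h := hT (.inl none)
    rw [frameField, radialField_apply, map_add, map_sum, Finset.sum_eq_zero, add_zero, map_smul] at h
    · exact (smul_eq_zero.mp h).resolve_left (by positivity)
    · intro i hi
      rw [map_smul, hE i hi, smul_zero]
  refine ContinuousLinearMap.ext fun d => ?_
  have h3 : d = d.1 • ((1 : ℝ), (0 : Fin N → ℝ)) + (0, d.2) := by ext <;> simp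
  rw [h3, map_add, map_smul, h1, h2]; simp

/-- The derivatives of the arguments of the Gauss integrals. -/
theorem fderiv_heisArg (hEL : ∀ i j, i ≠ j → E i ⬝ᵥ (L *ᵥ E j) = 0) (hp : 0 < p.1)
    (i : {i // i ∈ starFrame L E W}) : ∃ T : (ℝ × (Fin N → ℝ)) →L[ℝ] ℝ,
      HasFDerivAt (heisArg L E r i) T p ∧
      T (frameField L E W r (.inl (some i)) p) = 2 * √(Real.pi / -qf L (E i)) * qf L (E i) ∧
      ∀ a, a ≠ .inl (some i) → T (frameField L E W r a p) = 0 := by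
  obtain ⟨T, hT, hTd⟩ := hasFDerivAt_heisArg (L := L) (E := E) (r := r) (i : Fin m) hp
  have hs : √p.1 ≠ 0 := (Real.sqrt_pos.mpr hp).ne'
  have hi : qf L (E i) ≠ 0 := (mem_starFrame.mp i.2).1.ne
  refine ⟨T, hT, ?_, ?_⟩
  · rw [frameField, map_smul, hTd, coordL_frame hEL i.2, if_pos rfl, smul_eq_mul]
    simp only [mul_zero, zero_div, sub_zero, zero_mul, zero_add, mul_one]
    field_simp
  · rintro ((_ | j) | x) ha
    · rw [frameField, hTd, coordL_radialField hEL i.2, radialField_fst]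
      have : p.1 ≠ 0 := hp.ne'
      field_simp
      ring
    · have hji : (j : Fin m) ≠ i := fun h => ha (by rw [Subtype.ext h])
      rw [frameField, map_smul, hTd, coordL_frame hEL i.2, if_neg hji]
      simp
    · rw [frameField, hTd, x.2 i i.2]
      simp

theorem frameField_fst {a : FieldIdx L E W} (ha : a ≠ .inl none) :
    (frameField L E W r a p).1 = 0 := by
  rcases a with (_ | i) | x
  · exact absurd rfl ha
  · simp [frameField]
  · rfl

theorem hasDerivAt_exp_neg_sq (c x : ℝ) : HasDerivAt (fun t : ℝ => ((c * Real.exp (-t ^ 2) : ℝ) : ℂ))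
    ((-2 * x * (c * Real.exp (-x ^ 2)) : ℝ) : ℂ) x := by
  refine (((hasDerivAt_pow 2 x).neg.exp).const_mul c).ofReal_comp.congr_deriv ?_
  congr 1
  push_cast
  simp
  ring

theorem hasDerivAt_den (C : ℂ) (κ D' : ℝ) {y : ℝ} (hy : 0 < y) :
    HasDerivAt (fun y : ℝ => 2 * C * ((y ^ (1 - κ) * Real.exp (Real.pi * D' * y) : ℝ) : ℂ))
      (((1 - κ) / y + Real.pi * D') * (2 * C * ((y ^ (1 - κ) * Real.exp (Real.pi * D' * y) : ℝ) : ℂ)))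
      y := by
  have h1 := (Real.hasDerivAt_rpow_const (p := 1 - κ) (Or.inl hy.ne')).mul
    (((hasDerivAt_id y).const_mul (Real.pi * D')).exp)
  refine (h1.ofReal_comp.const_mul (2 * C)).congr_deriv ?_
  rw [Real.rpow_sub_one hy.ne']
  have hy' : (y : ℂ) ≠ 0 := by exact_mod_cast hy.ne'
  push_cast
  simp only [id]
  field_simp

/-- One denominator depends on `y` alone, the others on their own `heisArg`, and each of these
quantities is constant along all fields but its own. -/
theorem fderiv_frameDen_of_ne (hEL : ∀ i j, i ≠ j → E i ⬝ᵥ (L *ᵥ E j) = 0) (hp : 0 < p.1)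
    (a b : FieldIdx L E W) (hab : a ≠ b) :
    fderiv ℝ (frameDen L E W r C κ D' b) p (frameField L E W r a p) = 0 := by
  rcases b with (_ | i) | x
  · have h := fderiv_comp_real (σ := Prod.fst) (hasDerivAt_den C κ D' hp)
      ((fstL : (ℝ × (Fin N → ℝ)) →L[ℝ] ℝ).hasFDerivAt) (frameField L E W r a p)
    refine h.trans ?_
    rw [ContinuousLinearMap.coe_fst', frameField_fst hab]; simp
  · obtain ⟨T, hT, _, hT2⟩ := fderiv_heisArg (r := r) hEL hp i
    have h := fderiv_comp_real (hasDerivAt_exp_neg_sq (4 * √(Real.pi / -qf L (E i)) * qf L (E i)) _)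
      hT (frameField L E W r a p)
    refine h.trans ?_
    rw [hT2 a hab]; simp
  · simp [frameDen]

open Classical in
theorem lieDiv_frameFun (hEL : ∀ i j, i ≠ j → E i ⬝ᵥ (L *ᵥ E j) = 0) (hp : 0 < p.1) (hC0 : C ≠ 0)
    (hC : ∀ y : ℝ, 0 < y →
      HasDerivAt (HFun κ D') (C * ((y ^ (-κ) * Real.exp (Real.pi * D' * y) : ℝ) : ℂ)) y)
    (a : Option {i // i ∈ starFrame L E W}) (b : FieldIdx L E W) :
    lieDiv (frameField L E W r b) (frameDen L E W r C κ D' b) (frameFun L E W r κ D' (.inl a)) p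
      = if b = .inl a then 1 else 0 := by
  have hne := frameDen_ne_zero (L := L) (E := E) (W := W) (r := r) (κ := κ) (D' := D')
    (U := {p}) (by simpa using hp) hC0 b p rfl
  rcases a with _ | i
  · have h := fderiv_comp_real (σ := Prod.fst) (hC p.1 hp)
      ((fstL : (ℝ × (Fin N → ℝ)) →L[ℝ] ℝ).hasFDerivAt) (frameField L E W r b p)
    rw [lieDiv, show fderiv ℝ (frameFun L E W r κ D' (.inl none)) p _ = _ from h,
      ContinuousLinearMap.coe_fst']
    split_ifs with hb
    · subst hb
      rw [div_eq_one_iff_eq hne, frameField, radialField_fst]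
      simp only [frameDen]
      have h2 : p.1 ^ (1 - κ) = p.1 * p.1 ^ (-κ) := by
        rw [sub_eq_add_neg, Real.rpow_add hp, Real.rpow_one]
      rw [h2]; push_cast; ring
    · rw [frameField_fst hb]; simp
  · obtain ⟨T, hT, hT1, hT2⟩ := fderiv_heisArg (r := r) hEL hp i
    have h := fderiv_comp_real (((hasDerivAt_gaussInt _).const_mul 2).ofReal_comp)
      hT (frameField L E W r b p)
    rw [lieDiv, show fderiv ℝ (frameFun L E W r κ D' (.inl (some i))) p _ = _ from h]
    split_ifs with hb
    · subst hb
      rw [div_eq_one_iff_eq hne, hT1]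
      simp only [frameDen]
      push_cast; ring
    · rw [hT2 b hb]; simp

end Application

/-! ### Expansion of the Fourier coefficients in the building blocks. -/

section Conclusion

variable {m : ℕ} {k : ℤ} {L : Matrix (Fin N) (Fin N) ℝ} {s : Finset ((Fin N → ℝ) × ℝ × ℝ)}
  {φ : JacobiSpace N → ℂ} {E : Fin m → Fin N → ℝ} {W : Submodule ℝ (Fin N → ℝ)}
  {U : Set (ℝ × (Fin N → ℝ))} {n : ℤ} {r : Fin N → ℤ} {p : ℝ × (Fin N → ℝ)} {C : ℂ} {κ D' : ℝ}

theorem fderiv_heis_field {f : ℝ × (Fin N → ℝ) → ℂ} (hf : ContDiffAt ℝ 2 f p) (hp : 0 < p.1)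
    (e : Fin N → ℝ) :
    fderiv ℝ (fun q : ℝ × (Fin N → ℝ) => fderiv ℝ f q (√q.1 • ((0 : ℝ), e))) p
        (√p.1 • ((0 : ℝ), e))
      = p.1 * fderiv ℝ (fderiv ℝ f) p (0, e) (0, e) := by
  have hX : DifferentiableAt ℝ (fun q : ℝ × (Fin N → ℝ) => √q.1 • ((0 : ℝ), e)) p :=
    ((fstL_hasFDerivAt_sqrt hp).smul_const _).differentiableAt
  rw [fderiv_apply_field hf hX, fderiv_sqrt_field hp]
  have hsq : ((√p.1 : ℝ) : ℂ) * ((√p.1 : ℝ) : ℂ) = (p.1 : ℂ) := by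
    exact_mod_cast Real.mul_self_sqrt hp.le
  simp only [Prod.smul_mk, smul_zero, zero_div, zero_smul, map_zero, add_zero]
  rw [← hsq, ← Prod.smul_zero_mk, map_smul, map_smul, smul_apply]
  simp only [Complex.real_smul]
  ring

/-- Along the radial field the logarithmic derivative of `y^(1-κ) exp(π D' y)` is `2(1-κ) + 2π D'
y`, the factor in `radial_mode`. -/
theorem IsCasimirForm.lieDiv_lieDiv_none (h : IsCasimirForm k L s φ) (hE : LinearIndependent ℝ E)
    (hEL : ∀ i j, i ≠ j → E i ⬝ᵥ (L *ᵥ E j) = 0)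
    (hW : IsCompl (Submodule.span ℝ (Set.range E)) W)
    (hH : ∀ P ∈ regularPoints s, (∀ i, heisLaplace L (E i) φ P = 0) ∧ ∀ w ∈ W, dZBar w φ P = 0)
    (hU : IsOpen U) (hpos : ∀ p ∈ U, 0 < p.1) (hreg : AnalyticOnNhd ℝ φ (imPart ⁻¹' U))
    (hC0 : C ≠ 0) (hp : p ∈ U) :
    lieDiv (frameField L E W r (.inl none)) (frameDen L E W r C (kappa k N) (normDisc L n r)
        (.inl none))
      (lieDiv (frameField L E W r (.inl none)) (frameDen L E W r C (kappa k N) (normDisc L n r)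
        (.inl none)) (fcoef n r φ)) p = 0 := by
  refine lieDiv_lieDiv_self (contDiffAt_fcoef hU (h.periodicOn hpos hreg) hp)
    (((contDiffOn_frameField hpos _).contDiffAt (hU.mem_nhds hp)).differentiableAt (by simp))
    (ContDiffOn.differentiableAt_of_isOpen hU (contDiffOn_frameDen hpos _) hp)
    (frameDen_ne_zero hpos hC0 _ p hp) ?_
  have h1 := h.radial_mode (n := n) (r := r) hE hEL hW hH hU hpos hreg hp
  have h2 := fderiv_comp_real (σ := Prod.fst)
    (hasDerivAt_den C (kappa k N) (normDisc L n r) (hpos p hp))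
    ((fstL : (ℝ × (Fin N → ℝ)) →L[ℝ] ℝ).hasFDerivAt) (radialField L E W r p)
  rw [ContinuousLinearMap.coe_fst', radialField_fst] at h2
  have h3 : fderiv ℝ (frameDen L E W r C (kappa k N) (normDisc L n r) (.inl none)) p
      (frameField L E W r (.inl none) p) = _ := h2
  rw [h3]
  simp only [frameField, frameDen] at h1 ⊢
  rw [h1]
  have hy : (p.1 : ℂ) ≠ 0 := by exact_mod_cast (hpos p hp).ne'
  push_cast
  field_simp

theorem IsCasimirForm.lieDiv_lieDiv_some (h : IsCasimirForm k L s φ)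
    (hEL : ∀ i j, i ≠ j → E i ⬝ᵥ (L *ᵥ E j) = 0)
    (hH : ∀ P ∈ regularPoints s, ∀ i, heisLaplace L (E i) φ P = 0)
    (hU : IsOpen U) (hpos : ∀ p ∈ U, 0 < p.1) (hreg : AnalyticOnNhd ℝ φ (imPart ⁻¹' U))
    (hC0 : C ≠ 0) (hp : p ∈ U) (i : {i // i ∈ starFrame L E W}) :
    lieDiv (frameField L E W r (.inl (some i))) (frameDen L E W r C κ D' (.inl (some i)))
      (lieDiv (frameField L E W r (.inl (some i))) (frameDen L E W r C κ D' (.inl (some i)))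
        (fcoef n r φ)) p = 0 := by
  have hφ := h.periodicOn hpos hreg
  have hf := contDiffAt_fcoef (n := n) (r := r) hU hφ hp
  have hy := hpos p hp
  refine lieDiv_lieDiv_self hf
    (((contDiffOn_frameField hpos _).contDiffAt (hU.mem_nhds hp)).differentiableAt (by simp))
    (ContDiffOn.differentiableAt_of_isOpen hU (contDiffOn_frameDen hpos _) hp)
    (frameDen_ne_zero hpos hC0 _ p hp) ?_
  have hi := (mem_starFrame.mp i.2).1
  have h1 := heis_mode (n := n) (r := r) hU hφ hp h.index.symm (e := E i)
    fun P hP => h.eq_zero (fun P hP => analyticAt_heisLaplace hP.2 h.index.symm _)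
      (fun P hP => hH P hP i) P (preimage_imPart_subset hpos hreg hP)
  obtain ⟨T, hT, hT1, _⟩ := fderiv_heisArg (r := r) hEL hy i
  have h2 := fderiv_comp_real (hasDerivAt_exp_neg_sq (4 * √(Real.pi / -qf L (E i)) * qf L (E i)) _)
    hT (frameField L E W r (.inl (some i)) p)
  rw [hT1] at h2
  have h3 : fderiv ℝ (frameDen L E W r C κ D' (.inl (some i))) p
      (frameField L E W r (.inl (some i)) p) = _ := h2
  have h4 : fderiv ℝ (fun q => fderiv ℝ (fcoef n r φ) q (frameField L E W r (.inl (some i)) q)) p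
      (frameField L E W r (.inl (some i)) p) = _ := fderiv_heis_field hf hy (E i)
  rw [h3, h4, h1]
  have h5 : E i ⬝ᵥ (L *ᵥ p.2) = qf L (E i) * coordL L E i p := by
    rw [coordL_apply, mul_div_cancel₀ _ hi.ne, Matrix.dotProduct_mulVec, ← Matrix.mulVec_transpose,
      h.index.symm.eq, dotProduct_comm]
  have hs0 : √p.1 ≠ 0 := (Real.sqrt_pos.mpr hy).ne'
  -- This identifies the logarithmic derivative of the Gaussian denominator with the coefficient in
  -- `heis_mode`; the constant `√(π / -L_e)` in `heisArg` is fixed by this identity.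
  have h6 : √p.1 * (2 * √(Real.pi / -qf L (E i)) * qf L (E i) * (-2 * heisArg L E r i p))
      = 4 * Real.pi * (p.1 * pairing r (E i) + 2 * (qf L (E i) * coordL L E i p)) := by
    have h7 : √(Real.pi / -qf L (E i)) * √(Real.pi / -qf L (E i)) * qf L (E i) = -Real.pi := by
      rw [Real.mul_self_sqrt (div_nonneg Real.pi_pos.le (by linarith))]
      have := hi.ne
      field_simp
    have h8 : √p.1 * (√p.1)⁻¹ = 1 := mul_inv_cancel₀ hs0
    have h9 : √p.1 * √p.1 = p.1 := Real.mul_self_sqrt hy.le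
    rw [heisArg]
    linear_combination (-4) * (√p.1 * √p.1 * pairing r (E i)
      + 2 * qf L (E i) * coordL L E i p * (√p.1 * (√p.1)⁻¹)) * h7
      + 4 * Real.pi * pairing r (E i) * h9
      + 8 * Real.pi * qf L (E i) * coordL L E i p * h8
  have h10 : fderiv ℝ (fcoef n r φ) p (frameField L E W r (.inl (some i)) p)
      = √p.1 * fderiv ℝ (fcoef n r φ) p (0, E i) := by
    rw [frameField, map_smul, Complex.real_smul]
  have h11 := congrArg (fun x : ℝ => (x : ℂ)) h6
  rw [h5, h10]
  simp only [frameDen]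
  push_cast at h11 ⊢
  linear_combination (-fderiv ℝ (fcoef n r φ) p (0, E i) * (4 * (√(Real.pi / -qf L (E i)) : ℝ)
    * qf L (E i) * Complex.exp (-heisArg L E r i p ^ 2))) * h11

/-- The Fourier coefficients are multilinear in the functions of the frame. -/
theorem IsCasimirForm.exists_fcoef_eq (h : IsCasimirForm k L s φ) (hE : LinearIndependent ℝ E)
    (hEL : ∀ i j, i ≠ j → E i ⬝ᵥ (L *ᵥ E j) = 0)
    (hW : IsCompl (Submodule.span ℝ (Set.range E)) W)
    (hH : ∀ P ∈ regularPoints s, (∀ i, heisLaplace L (E i) φ P = 0) ∧ ∀ w ∈ W, dZBar w φ P = 0)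
    (hU : IsOpen U) (hUc : IsPreconnected U) (hpos : ∀ p ∈ U, 0 < p.1)
    (hreg : AnalyticOnNhd ℝ φ (imPart ⁻¹' U)) :
    ∃ a : Finset (Option {i // i ∈ starFrame L E W}) → ℂ, ∀ p ∈ U, fcoef n r φ p
      = ∑ S ∈ (Finset.univ : Finset (Option {i // i ∈ starFrame L E W})).powerset,
        a S * ∏ i ∈ S, frameFun L E W r (kappa k N) (normDisc L n r) (.inl i) p := by
  classical
  obtain ⟨C, hC0, hC⟩ := exists_hasDerivAt_HFun (kappa k N) (normDisc L n r)
  have hφ := h.periodicOn hpos hreg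
  have hmem : ∀ b : FieldIdx L E W, b ∈ Finset.univ.map ⟨Sum.inl, Sum.inl_injective⟩ →
      ∃ a, b = .inl a := by
    intro b hb
    obtain ⟨a, _, ha⟩ := Finset.mem_map.mp hb
    exact ⟨a, ha.symm⟩
  obtain ⟨a, ha⟩ := exists_multilinear hU hUc (X := frameField L E W r)
    (h := frameDen L E W r C (kappa k N) (normDisc L n r))
    (H := frameFun L E W r (kappa k N) (normDisc L n r)) (contDiffOn_frameField hpos)
    (contDiffOn_frameDen hpos) (frameDen_ne_zero hpos hC0)
    (fun i j p hp => frameField_bracket hEL (hpos p hp) i j)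
    (fun i j hij p hp => fderiv_frameDen_of_ne hEL (hpos p hp) i j hij)
    (fun p hp => frameField_span hEL (hpos p hp))
    (Finset.univ.map ⟨Sum.inl, Sum.inl_injective⟩)
    (fun i _ => contDiffOn_frameFun hpos hC i) (c := fcoef n r φ)
    (by
      intro i hi j p hp
      obtain ⟨b, rfl⟩ := hmem i hi
      rw [lieDiv_frameFun hEL (hpos p hp) hC0 hC b j])
    (contDiffOn_fcoef hU hφ)
    (by
      intro i hi p hp
      obtain ⟨_ | b, rfl⟩ := hmem i hi
      · exact h.lieDiv_lieDiv_none hE hEL hW hH hU hpos hreg hC0 hp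
      · exact h.lieDiv_lieDiv_some hEL (fun P hP => (hH P hP).1) hU hpos hreg hC0 hp b)
    (by
      rintro (i | x) hi p hp
      · exact absurd (Finset.mem_map_of_mem _ (Finset.mem_univ i)) hi
      · rw [lieDiv, frameField, fderiv_fcoef_eq_zero hU hφ hp fun P hP =>
          h.dZBar_of_coord hE hEL hW hH x.2 P (preimage_imPart_subset hpos hreg hP), zero_div])
  refine ⟨fun S => a (S.map ⟨Sum.inl, Sum.inl_injective⟩), fun p hp => ?_⟩
  rw [ha p hp, sum_powerset_map]
  refine Finset.sum_congr rfl fun S _ => ?_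
  rw [Finset.prod_map]
  rfl

open Classical in
theorem block_of_subset_starFrame (hE : LinearIndependent ℝ E)
    (hEL : ∀ i j, i ≠ j → E i ⬝ᵥ (L *ᵥ E j) = 0)
    (hW : IsCompl (Submodule.span ℝ (Set.range E)) W) {S : Finset (Fin m)}
    (hS : S ⊆ starFrame L E W) (hp : 0 < p.1) :
    block L hE hW S r p.1 p.2 = ∏ i ∈ S, 2 * gaussInt (heisArg L E r i p) := by
  have hneg : ∀ i ∈ S, qf L (E i) < 0 := fun i hi => (mem_starFrame.mp (hS hi)).1
  rw [block, Finset.filter_false_of_mem fun i hi => (hneg i hi).ne, Finset.prod_empty, one_mul,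
    Finset.filter_true_of_mem hneg]
  refine Finset.prod_congr rfl fun i hi => ?_
  rw [← coordL_eq_frameCoord hE hEL hW (hS hi) p, HHeis_eq (hneg i hi) hp]

theorem starFrame_subset_nonposFrame : starFrame L E W ⊆ nonposFrame L E := fun i hi => by
  rw [nonposFrame, Finset.mem_filter]
  exact ⟨Finset.mem_univ i, (mem_starFrame.mp hi).1.le⟩

/-- The index `none` stands for the factor `H(y; D)`. Pairing the subsets with and without it
produces the two families of coefficients. -/
theorem sum_powerset_univ_option {ι : Type*} [Fintype ι] (f : Finset (Option ι) → ℂ) :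
    ∑ S ∈ (Finset.univ : Finset (Option ι)).powerset, f S
      = ∑ S ∈ (Finset.univ : Finset ι).powerset, (f (S.map .some) + f S.insertNone) := by
  classical
  have h1 : ∀ S : Finset ι, S.insertNone = insert none (S.map .some) := fun S => by
    ext (_ | x) <;> simp
  rw [univ_option, h1, Finset.sum_powerset_insert (by simp), sum_powerset_map,
    sum_powerset_map .some _ fun S => f (insert none S), ← Finset.sum_add_distrib]
  simp only [h1]

theorem sum_powerset_subtype {ι : Type*} (T : Finset ι) (f : Finset ι → ℂ) :
    ∑ S ∈ T.powerset, f S = ∑ S ∈ (Finset.univ : Finset {i // i ∈ T}).powerset,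
      f (S.map (Function.Embedding.subtype _)) := by
  have hmap : (Finset.univ : Finset {i // i ∈ T}).map (Function.Embedding.subtype _) = T :=
    Finset.attach_map_val
  rw [← sum_powerset_map, hmap]

theorem IsCasimirForm.exists_fcoef_eq_block (h : IsCasimirForm k L s φ)
    (hE : LinearIndependent ℝ E) (hEL : ∀ i j, i ≠ j → E i ⬝ᵥ (L *ᵥ E j) = 0)
    (hW : IsCompl (Submodule.span ℝ (Set.range E)) W)
    (hH : ∀ P ∈ regularPoints s, (∀ i, heisLaplace L (E i) φ P = 0) ∧ ∀ w ∈ W, dZBar w φ P = 0)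
    (hU : IsOpen U) (hUc : IsPreconnected U) (hpos : ∀ p ∈ U, 0 < p.1)
    (hreg : AnalyticOnNhd ℝ φ (imPart ⁻¹' U)) :
    ∃ a b : Finset (Fin m) → ℂ, ∀ p ∈ U, fcoef n r φ p
      = ∑ S ∈ (starFrame L E W).powerset,
        (a S + b S * HFun (kappa k N) (normDisc L n r) p.1) * (block L hE hW S r p.1 p.2 : ℂ) := by
  classical
  obtain ⟨a, ha⟩ := h.exists_fcoef_eq (n := n) (r := r) hE hEL hW hH hU hUc hpos hreg
  refine ⟨fun S => a ((S.subtype (· ∈ starFrame L E W)).map .some),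
    fun S => a (S.subtype (· ∈ starFrame L E W)).insertNone, fun p hp => ?_⟩
  rw [ha p hp, sum_powerset_univ_option, sum_powerset_subtype (starFrame L E W)]
  refine Finset.sum_congr rfl fun S _ => ?_
  have hS : S.map (Function.Embedding.subtype _) ⊆ starFrame L E W := by
    intro i hi
    obtain ⟨j, _, rfl⟩ := Finset.mem_map.mp hi
    exact j.2
  have hsub : (S.map (Function.Embedding.subtype _)).subtype (· ∈ starFrame L E W) = S := by
    ext x; simp
  have hins : S.insertNone = insert none (S.map .some) := by ext (_ | x) <;> simp
  dsimp only
  rw [hsub, block_of_subset_starFrame hE hEL hW hS (hpos p hp)]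
  rw [hins, Finset.prod_insert (by simp)]
  simp only [Finset.prod_map, Complex.ofReal_prod]
  simp only [frameFun, Function.Embedding.some_apply, Function.Embedding.subtype_apply]
  ring

end Conclusion

end MaassJacobi

end

theorem mainTheorem5 {N m : ℕ} (k : ℤ) (L : Matrix (Fin N) (Fin N) ℝ)
    (hL : MaassJacobi.IsJacobiIndex L)
    (E : Fin m → Fin N → ℝ) (hE : LinearIndependent ℝ E)
    (hEL : ∀ i j, i ≠ j → E i ⬝ᵥ (L *ᵥ E j) = 0)
    (W : Submodule ℝ (Fin N → ℝ)) (hW : IsCompl (Submodule.span ℝ (Set.range E)) W)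
    (φ : MaassJacobi.JacobiSpace N → ℂ) (hφ : MaassJacobi.IsHHarmonic k L E W φ)
    (U : Set (ℝ × (Fin N → ℝ))) (hUopen : IsOpen U) (hUconn : IsPreconnected U)
    (hUpos : ∀ p ∈ U, 0 < p.1)
    (hUreg : AnalyticOnNhd ℝ φ (MaassJacobi.imPart ⁻¹' U))
    (n : ℤ) (r : Fin N → ℤ) :
    ∃ cδ cΔ : Finset (Fin m) → ℂ, ∀ p ∈ U,
      MaassJacobi.fourierCoeff φ n r p.1 p.2
        = (∑ E' ∈ (MaassJacobi.nonposFrame L E).powerset,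
            cδ E' * (MaassJacobi.block L hE hW E' r p.1 p.2 : ℂ))
        + ∑ E' ∈ (MaassJacobi.nonposFrame L E).powerset,
            cΔ E' * MaassJacobi.HFun (MaassJacobi.kappa k N) (MaassJacobi.normDisc L n r) p.1
              * (MaassJacobi.block L hE hW E' r p.1 p.2 : ℂ) := by
  obtain ⟨s, hsing, hinv, hcas, hH, -⟩ := hφ
  have h : MaassJacobi.IsCasimirForm k L s φ := ⟨hL, hsing, hinv, hcas⟩
  obtain ⟨a, b, hab⟩ := h.exists_fcoef_eq_block (n := n) (r := r) hE hEL hW hH hUopen hUconn hUpos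
    hUreg
  classical
  -- Only subsets of `starFrame` contribute. All blocks with an isotropic vector, or with a negative
  -- vector that is not `L`-orthogonal to `W`, receive the coefficient zero.
  refine ⟨fun S => if S ⊆ MaassJacobi.starFrame L E W then a S else 0,
    fun S => if S ⊆ MaassJacobi.starFrame L E W then b S else 0, fun p hp => ?_⟩
  rw [MaassJacobi.fourierCoeff_eq_fcoef, hab p hp, ← Finset.sum_add_distrib]
  refine (Finset.sum_congr rfl fun S hS => ?_).trans (Finset.sum_subset
    (Finset.powerset_mono.mpr MaassJacobi.starFrame_subset_nonposFrame) fun S _ hS => ?_)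
  · dsimp only
    rw [if_pos (Finset.mem_powerset.mp hS), if_pos (Finset.mem_powerset.mp hS)]
    ring
  · rw [Finset.mem_powerset] at hS
    dsimp only
    rw [if_neg hS, if_neg hS]
    ring
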